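/- Let $n,N\ge 1$ and let $\Omega\subset\mathbb{R}^n$ be a simply connected, bounded Lipschitz domain. Let $f\in C^2([0,\infty))$ (with one-sided derivatives at $0$) be strictly convex with $f(0)=f'(0)=0$, and suppose that there are constants $0<\nu\le L<\infty$ such that $$\nu t-L\le f(t)\le L(t+1)\qquad\text{and}\qquad f''(t)\le L(1+t)^{-1}\qquad\text{for all } t\ge 0 .$$ Put $f^\infty(1)=\lim_{t\to\infty} f(t)/t$, and let $T_0\in W^{2,\infty}(\Omega;\mathbb{R}^{N\times n})$ satisfy $\|T_0\|_{L^\infty(\Omega;\mathbb{R}^{N\times n})}<f^\infty(1)$, where $|\cdot|$ and $\cdot$ denote the Euclidean (Frobenius) norm and inner product on $\mathbb{R}^{N\times n}$. Call $u\in W^{1,1}(\Omega;\mathbb{R}^N)$ a weak solution of the Neumann problem $$\operatorname{div}\Big(\frac{f'(|\nabla u|)\nabla u}{|\nabla u|}\Big)=\operatorname{div}T_0\ \text{ in }\Omega,\qquad \frac{f'(|\nabla u|)\nabla u}{|\nabla u|}\,\nu_{\partial\Omega}=T_0\,\nu_{\partial\Omega}\ \text{ on }\partial\Omega,$$ where $\nu_{\partial\Omega}$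 is the outward unit normal, if $$\int_\Omega \frac{f'(|\nabla u|)\nabla u}{|\nabla u|}\cdot\nabla\varphi\,dx=\int_\Omega T_0\cdot\nabla\varphi\,dx\qquad\text{for all }\varphi\in W^{1,1}(\Omega;\mathbb{R}^N),$$ with $f'(|z|)z/|z|$ read as $0$ at $z=0$. Then: 1. a map $u\in W^{1,1}(\Omega;\mathbb{R}^N)$ is a weak solution if and only if it minimises $w\mapsto\int_\Omega \big[f(|\nabla w|)-T_0\cdot\nabla w\big]\,dx$ among all $w\in W^{1,1}(\Omega;\mathbb{R}^N)$; 2. there is a weak solution $u\in W^{1,1}(\Omega;\mathbb{R}^N)$ with zero mean, $\frac{1}{|\Omega|}\int_\Omega u\,dx=0$, and it is the only weak solution with zero mean (up to equality almost everywhere in $\Omega$). -/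

import Mathlib

open MeasureTheory Filter Topology
open scoped ENNReal NNReal ContDiff RealInnerProductSpace

noncomputable section

/-- The space `ℝᵈ` with the Euclidean norm. -/
abbrev RVec (d : ℕ) : Type := EuclideanSpace ℝ (Fin d)

/-- The space `ℝ^{N × n}` with the Euclidean (Frobenius) inner product and norm. -/
abbrev RMat (N n : ℕ) : Type := EuclideanSpace ℝ (Fin N × Fin n)

/-- The boundary of `Ω` is Lipschitz: near each boundary point there are a direction `e` ("up") and
a Lipschitz function `γ` on the hyperplane orthogonal to `e` such that `Ω` is, locally, the set of
points lying strictly above the graph of `γ`. -/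
def HasLipschitzBoundary {n : ℕ} (Ω : Set (RVec n)) : Prop :=
  ∀ x₀ ∈ frontier Ω, ∃ e : RVec n, ‖e‖ = 1 ∧
    ∃ (K : ℝ≥0) (γ : (ℝ ∙ e)ᗮ → ℝ), LipschitzWith K γ ∧
      ∃ U ∈ 𝓝 x₀, ∀ x ∈ U, x ∈ Ω ↔ γ ((ℝ ∙ e)ᗮ.orthogonalProjectionOnto x) < ⟪e, x⟫

/-- A bounded Lipschitz domain: a nonempty, connected, bounded open set with Lipschitz boundary. -/
structure IsBoundedLipschitzDomain {n : ℕ} (Ω : Set (RVec n)) : Prop where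
  isOpen : IsOpen Ω
  isConnected : IsConnected Ω
  isBounded : Bornology.IsBounded Ω
  hasLipschitzBoundary : HasLipschitzBoundary Ω

/-- `g` is the weak `i`-th partial derivative of the scalar function `u` in the open set `Ω`. Only
the values of `u` and `g` in `Ω` matter. -/
def HasWeakPartial {n : ℕ} (Ω : Set (RVec n)) (i : Fin n) (u g : RVec n → ℝ) : Prop :=
  LocallyIntegrableOn u Ω ∧ LocallyIntegrableOn g Ω ∧
    ∀ φ : RVec n → ℝ, ContDiff ℝ ∞ φ → HasCompactSupport φ → tsupport φ ⊆ Ω →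
      ∫ x in Ω, u x * fderiv ℝ φ x (EuclideanSpace.single i 1) = - ∫ x in Ω, g x * φ x

/-- The scalar Sobolev space `W^{k,p}(Ω)`: all weak derivatives of order at most `k` exist and
belong to `L^p(Ω)`. -/
def MemSobolevScalar {n : ℕ} (Ω : Set (RVec n)) (p : ℝ≥0∞) : ℕ → (RVec n → ℝ) → Prop
  | 0, u => MemLp u p (volume.restrict Ω)
  | k + 1, u => MemLp u p (volume.restrict Ω) ∧
      ∀ i : Fin n, ∃ g : RVec n → ℝ, HasWeakPartial Ω i u g ∧ MemSobolevScalar Ω p k g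

/-- The Sobolev space `W^{k,p}(Ω; ℝ^ι)` of maps all of whose components are in `W^{k,p}(Ω)`. -/
def MemSobolev {n : ℕ} {ι : Type} (Ω : Set (RVec n)) (k : ℕ) (p : ℝ≥0∞)
    (u : RVec n → EuclideanSpace ℝ ι) : Prop :=
  ∀ c : ι, MemSobolevScalar Ω p k (fun x => u x c)

/-- `G` is a weak gradient of `u : Ω → ℝᴺ`, i.e. `G_{α i}` is the weak derivative `∂ᵢ u^α`. -/
def HasWeakGrad {n N : ℕ} (Ω : Set (RVec n)) (u : RVec n → RVec N) (G : RVec n → RMat N n) : Prop :=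
  ∀ (α : Fin N) (i : Fin n), HasWeakPartial Ω i (fun x => u x α) (fun x => G x (α, i))

open Classical in
/-- The weak gradient `∇u` of `u : Ω → ℝᴺ` (unique up to a null subset of `Ω`), with the dummy value
`0` if `u` is not weakly differentiable in `Ω`. -/
def weakGrad {n N : ℕ} (Ω : Set (RVec n)) (u : RVec n → RVec N) : RVec n → RMat N n :=
  if h : ∃ G, HasWeakGrad Ω u G then h.choose else 0

/-- A map in `W^{k+1,p}` has a weak gradient, and `weakGrad` is one. -/
theorem MemSobolev.hasWeakGrad {n N : ℕ} {Ω : Set (RVec n)} {k : ℕ} {p : ℝ≥0∞}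
    {u : RVec n → RVec N} (hu : MemSobolev Ω (k + 1) p u) : HasWeakGrad Ω u (weakGrad Ω u) := by
  have h : ∃ G, HasWeakGrad Ω u G := by
    choose g hg using fun (α : Fin N) (i : Fin n) => (hu α).2 i
    exact ⟨fun x => WithLp.toLp 2 fun c => g c.1 c.2 x, fun α i => (hg α i).1⟩
  rw [weakGrad, dif_pos h]
  exact h.choose_spec

/-- The first derivative of `f : [0,∞) → ℝ` (one-sided at `0`). -/
def derivHalfLine (f : ℝ → ℝ) : ℝ → ℝ := derivWithin f (Set.Ici 0)

/-- The second derivative of `f : [0,∞) → ℝ` (one-sided at `0`). -/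
def derivHalfLine₂ (f : ℝ → ℝ) : ℝ → ℝ := derivWithin (derivHalfLine f) (Set.Ici 0)

/-- `f^∞(1) = lim_{t → ∞} f(t) / t`. -/
def recessionSlope (f : ℝ → ℝ) : ℝ := limUnder atTop (fun t : ℝ => f t / t)

/-- The tensor function `z ↦ f'(|z|) z / |z|`, with value `0` at `z = 0`. -/
def stressTensor {N n : ℕ} (f : ℝ → ℝ) (z : RMat N n) : RMat N n :=
  (derivHalfLine f ‖z‖ / ‖z‖) • z

/-- Weak solutions in `W^{1,1}(Ω; ℝᴺ)` of `div (f'(|∇u|) ∇u / |∇u|) = div T₀` in `Ω` under the Neumann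
condition `(f'(|∇u|) ∇u / |∇u|) ν = T₀ ν` on `∂Ω`. -/
def IsWeakSolution {n N : ℕ} (Ω : Set (RVec n)) (f : ℝ → ℝ) (T₀ : RVec n → RMat N n)
    (u : RVec n → RVec N) : Prop :=
  MemSobolev Ω 1 1 u ∧ ∀ φ : RVec n → RVec N, MemSobolev Ω 1 1 φ →
    ∫ x in Ω, ⟪stressTensor f (weakGrad Ω u x), weakGrad Ω φ x⟫ =
      ∫ x in Ω, ⟪T₀ x, weakGrad Ω φ x⟫

/-- The functional `∫_Ω f(|∇w|) - T₀ · ∇w dx`. -/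
def energy {n N : ℕ} (Ω : Set (RVec n)) (f : ℝ → ℝ) (T₀ : RVec n → RMat N n)
    (w : RVec n → RVec N) : ℝ :=
  ∫ x in Ω, (f ‖weakGrad Ω w x‖ - ⟪T₀ x, weakGrad Ω w x⟫)

/-- Minimisers of the functional among all maps in `W^{1,1}(Ω; ℝᴺ)`. -/
def IsEnergyMinimiser {n N : ℕ} (Ω : Set (RVec n)) (f : ℝ → ℝ) (T₀ : RVec n → RMat N n)
    (u : RVec n → RVec N) : Prop :=
  MemSobolev Ω 1 1 u ∧ ∀ w : RVec n → RVec N, MemSobolev Ω 1 1 w →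
    energy Ω f T₀ u ≤ energy Ω f T₀ w

end

/-! ### Energy densities of linear growth on the half line -/

/-! Write σ for `stress f`, the gradient of the convex function z ↦ f(|z|). The equivalence and the
uniqueness are convexity. The energy gap between two fields is a nonnegative Bregman distance plus a
first variation (`fieldEnergy_sub_eq`), so the Euler equation characterises minimisers. Since σ is
injective and |σ(w) − σ(z)|² ≤ L⟨σ(w) − σ(z), w − z⟩, two weak solutions have the same gradient,
hence differ by a constant on the connected set Ω.

Existence is the difficulty: with linear growth, minimising sequences are bounded only in W^{1,1}
and their gradients may concentrate. The argument works with fields G instead of maps. In the L²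
closure of the gradients of functions smooth up to the boundary, εG is added to σ(G) and a strongly
monotone equation is solved (`exists_regularised_solution`). The condition ‖T₀‖ < f^∞(1) gives L¹
bounds uniform in ε. The solutions form a minimising sequence, so the Bregman distances vanish and
the stresses converge in L². Because σ is a homeomorphism onto its image, the fields converge almost
everywhere to some g in L¹, which satisfies the limit equation
(`exists_limit_of_regularised_solutions`).

This convergence is too weak to pass the gradient structure to g directly; the heart of the proof is
that g is still curl-free. Differentiating the regularised equation bounds ∫ η²⟨Dσ(G) ∂ₛG, ∂ₛG⟩
uniformly in ε (`IsLinearGrowthDensity.integral_mul_inner_stressDeriv_le`): the bound f''(t) ≤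
L/(1+t) makes the cutoff terms linear in |G|, and the two bounded derivatives of T₀ make the
right-hand side linear in |G|. As f'' has no lower bound, only the part of ∂ₛG orthogonal to G is
controlled. This suffices: in the curl of the truncated field χ(δ log(1+|G|²)) G the radial parts
cancel, since G itself is curl-free, and what remains is of order δ
(`IsCutoffProfile.abs_fderiv_truncate_sub_le`). For fixed δ the truncated fields are bounded, so ε →
0 is harmless, and then δ → 0 (`isWeaklyCurlFree_of_truncate`).

Simple connectedness now yields a potential of g (`exists_potential`). The interior cones of the
Lipschitz domain make it integrable up to the boundary and, through mollification with shifted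
kernels, extend the equation from smooth test maps to all of W^{1,1}
(`IsBoundedLipschitzDomain.sum_integral_mul_weak_partial_eq_zero`). -/

/-- The properties of the energy density `f` on `[0, ∞)` used below. -/
structure IsLinearGrowthDensity (f : ℝ → ℝ) (L : ℝ) : Prop where
  pos : 0 < L
  hasDeriv : ∀ t, 0 ≤ t → HasDerivWithinAt f (derivHalfLine f t) (Set.Ici 0) t
  hasDeriv₂ : ∀ t, 0 ≤ t → HasDerivWithinAt (derivHalfLine f) (derivHalfLine₂ f t) (Set.Ici 0) t
  continuousOn₂ : ContinuousOn (derivHalfLine₂ f) (Set.Ici 0)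
  strictMonoOn : StrictMonoOn (derivHalfLine f) (Set.Ici 0)
  deriv_zero : derivHalfLine f 0 = 0
  deriv_le : ∀ t, 0 ≤ t → derivHalfLine f t ≤ L
  deriv₂_nonneg : ∀ t, 0 ≤ t → 0 ≤ derivHalfLine₂ f t
  deriv₂_le : ∀ t, 0 ≤ t → derivHalfLine₂ f t ≤ L * (1 + t)⁻¹
  add_mul_le : ∀ s, 0 ≤ s → ∀ t, 0 ≤ t → f s + derivHalfLine f s * (t - s) ≤ f t

theorem ConvexOn.add_derivWithin_mul_le {f : ℝ → ℝ} {S : Set ℝ} (hf : ConvexOn ℝ S f) {s t d : ℝ}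
    (hs : s ∈ S) (ht : t ∈ S) (hd : HasDerivWithinAt f d S s) : f s + d * (t - s) ≤ f t := by
  rcases lt_trichotomy s t with h | h | h
  · have := hf.le_slope_of_hasDerivWithinAt hs ht h hd
    rw [slope_def_field, le_div_iff₀ (by linarith)] at this
    linarith
  · subst h; simp
  · have := hf.slope_le_of_hasDerivWithinAt ht hs h hd
    rw [slope_def_field, div_le_iff₀ (by linarith)] at this
    linarith

theorem isLinearGrowthDensity {f : ℝ → ℝ} (hfC2 : ContDiffOn ℝ 2 f (Set.Ici 0))
    (hfconv : StrictConvexOn ℝ (Set.Ici 0) f) (hf'0 : derivHalfLine f 0 = 0)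
    {ν L : ℝ} (hν : 0 < ν) (hνL : ν ≤ L)
    (hgrowth : ∀ t : ℝ, 0 ≤ t → ν * t - L ≤ f t ∧ f t ≤ L * (t + 1))
    (hf'' : ∀ t : ℝ, 0 ≤ t → derivHalfLine₂ f t ≤ L * (1 + t)⁻¹) :
    IsLinearGrowthDensity f L := by
  have hu : UniqueDiffOn ℝ (Set.Ici (0 : ℝ)) := uniqueDiffOn_Ici 0
  have h1 : ∀ t, 0 ≤ t → HasDerivWithinAt f (derivHalfLine f t) (Set.Ici 0) t := fun t ht =>
    ((hfC2.differentiableOn (by norm_num)) t ht).hasDerivWithinAt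
  have hC1 : ContDiffOn ℝ 1 (derivHalfLine f) (Set.Ici 0) :=
    hfC2.derivWithin hu (by norm_num)
  have h2 : ∀ t, 0 ≤ t →
      HasDerivWithinAt (derivHalfLine f) (derivHalfLine₂ f t) (Set.Ici 0) t := fun t ht =>
    ((hC1.differentiableOn (by norm_num)) t ht).hasDerivWithinAt
  have hc2 : ContinuousOn (derivHalfLine₂ f) (Set.Ici 0) :=
    (hC1.derivWithin (m := 0) hu (by norm_num)).continuousOn
  have htan : ∀ s, 0 ≤ s → ∀ t, 0 ≤ t → f s + derivHalfLine f s * (t - s) ≤ f t :=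
    fun s hs t ht => hfconv.convexOn.add_derivWithin_mul_le hs ht (h1 s hs)
  have hmono : StrictMonoOn (derivHalfLine f) (Set.Ici 0) := by
    have hm : MonotoneOn (derivHalfLine f) (Set.Ici 0) := by
      intro s hs t ht hst
      rcases hst.eq_or_lt with h | h
      · rw [h]
      have a1 := htan s hs t ht
      have a2 := htan t ht s hs
      nlinarith
    intro s hs t ht hst
    -- Equal slopes at `s` and `t` would make `f` affine in between, contradicting strict convexity
    -- at the midpoint.
    refine lt_of_le_of_ne (hm hs ht hst.le) fun heq => ?_
    have hs' : (0 : ℝ) ≤ s := hs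
    have ht' : (0 : ℝ) ≤ t := ht
    have a1 := htan s hs ((s + t) / 2) (by linarith)
    have a2 := htan t ht s hs
    have := hfconv.2 hs ht hst.ne (show (0 : ℝ) < 1/2 by norm_num) (show (0 : ℝ) < 1/2 by norm_num)
      (by norm_num)
    simp only [smul_eq_mul] at this
    rw [show (1/2 * s + 1/2 * t) = (s + t) / 2 by ring] at this
    rw [← heq] at a2
    nlinarith
  refine ⟨hν.trans_le hνL, h1, h2, hc2, hmono, hf'0, fun s hs => ?_, fun t ht => ?_, hf'', htan⟩
  -- A tangent of slope larger than `L` eventually overtakes the bound `L * (t + 1)`; `t` is taken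
  -- beyond the crossing point.
  · by_contra! hlt
    have hd : 0 < derivHalfLine f s - L := by linarith
    obtain ⟨t, ht⟩ := exists_gt (max s ((L - f s + derivHalfLine f s * s) / (derivHalfLine f s - L)))
    have ht1 := (le_max_left _ _).trans_lt ht
    have ht2 := (le_max_right _ _).trans_lt ht
    rw [div_lt_iff₀ hd] at ht2
    have := htan s hs t (hs.trans ht1.le)
    have := (hgrowth t (hs.trans ht1.le)).2
    nlinarith
  · exact hmono.monotoneOn.derivWithin_nonneg

/-- The coercivity of the problem comes from here. By convexity and f(0) = 0, f(t)/t increases to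
the recession slope and stays below f'(t), so f' eventually exceeds every smaller number by a fixed
margin. -/
theorem exists_lt_derivHalfLine {f : ℝ → ℝ} {L : ℝ} (hf : IsLinearGrowthDensity f L)
    (hf0 : f 0 = 0) {τ : ℝ} (hτ : τ < recessionSlope f) :
    ∃ δ > 0, ∃ R, 0 ≤ R ∧ ∀ t, R ≤ t → τ + δ ≤ derivHalfLine f t := by
  have key : ∀ t, 0 < t → f t / t ≤ derivHalfLine f t := fun t ht => by
    have := hf.add_mul_le t ht.le 0 le_rfl
    rw [div_le_iff₀ ht]; rw [hf0] at this; linarith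
  have hmono : MonotoneOn (fun t => f t / t) (Set.Ioi 0) := by
    refine monotoneOn_of_deriv_nonneg (convex_Ioi 0) ?_ ?_ ?_
    · intro t ht
      have ht' : (0 : ℝ) < t := ht
      exact (((hf.hasDeriv t ht'.le).hasDerivAt (Ici_mem_nhds ht')).continuousAt.div
        continuousAt_id ht'.ne').continuousWithinAt
    · rw [interior_Ioi]; intro t ht
      have ht' : (0 : ℝ) < t := ht
      exact (((hf.hasDeriv t ht'.le).hasDerivAt (Ici_mem_nhds ht')).div
        (hasDerivAt_id t) ht'.ne').differentiableAt.differentiableWithinAt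
    · rw [interior_Ioi]; intro t ht
      have ht' : (0 : ℝ) < t := ht
      have hd := (((hf.hasDeriv t ht'.le).hasDerivAt (Ici_mem_nhds ht')).div
        (hasDerivAt_id t) ht'.ne')
      have : deriv (fun t => f t / t) t = (derivHalfLine f t * id t - f t * 1) / id t ^ 2 :=
        hd.deriv
      rw [this]
      have := key t ht'
      rw [div_le_iff₀ ht'] at this
      simp only [id]
      apply div_nonneg _ (by positivity)
      linarith
  have hbdd : ∀ t, 0 < t → f t / t ≤ L := fun t ht => (key t ht).trans (hf.deriv_le t ht.le)
  have hlim : Tendsto (fun t => f t / t) atTop (𝓝 (⨆ t : Set.Ioi (0 : ℝ), f t / t)) := by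
    have h0 : Tendsto (fun t : Set.Ioi (0 : ℝ) => f t / t) atTop
        (𝓝 (⨆ t : Set.Ioi (0 : ℝ), f t / t)) :=
      tendsto_atTop_ciSup (fun s t hst => hmono s.2 t.2 hst)
        ⟨L, by rintro _ ⟨t, rfl⟩; exact hbdd t t.2⟩
    rwa [← tendsto_comp_val_Ioi_atTop (a := (0 : ℝ))]
  have hrec : recessionSlope f = ⨆ t : Set.Ioi (0 : ℝ), f t / t := hlim.limUnder_eq
  obtain ⟨δ, hδ, hδ'⟩ : ∃ δ > 0, τ + δ < recessionSlope f :=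
    ⟨(recessionSlope f - τ) / 2, by linarith, by linarith⟩
  rw [hrec] at hδ'
  obtain ⟨R, hR⟩ := (eventually_atTop.1 (hlim.eventually (lt_mem_nhds hδ')))
  refine ⟨δ, hδ, max R 1, by positivity, fun t ht => ?_⟩
  have h1 : 0 < t := lt_of_lt_of_le one_pos ((le_max_right _ _).trans ht)
  exact (hR t ((le_max_left _ _).trans ht)).le.trans (key t h1)

/-! ### The stress tensor -/

section Stress

variable {V : Type*} [NormedAddCommGroup V] [InnerProductSpace ℝ V] {f : ℝ → ℝ} {L : ℝ}

/-- The continuous extension of `t ↦ f'(t) / t` to `[0, ∞)`. -/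
noncomputable def secantCoeff (f : ℝ → ℝ) (t : ℝ) : ℝ :=
  if t = 0 then derivHalfLine₂ f 0 else derivHalfLine f t / t

/-- The map `z ↦ f'(|z|) z / |z|` on an inner product space. -/
noncomputable def stress (f : ℝ → ℝ) (z : V) : V := (derivHalfLine f ‖z‖ / ‖z‖) • z

/-- The derivative of `stress f`. -/
noncomputable def stressDeriv (f : ℝ → ℝ) (z : V) : V →L[ℝ] V :=
  secantCoeff f ‖z‖ • ContinuousLinearMap.id ℝ V +
    ((derivHalfLine₂ f ‖z‖ - secantCoeff f ‖z‖) / ‖z‖ ^ 2) • (innerSL ℝ z).smulRight z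

theorem stress_eq_secantCoeff_smul (z : V) : stress f z = secantCoeff f ‖z‖ • z := by
  by_cases hz : z = 0
  · simp [stress, hz]
  · simp [stress, secantCoeff, hz]

@[simp] theorem stress_zero : stress f (0 : V) = 0 := by simp [stress]

namespace IsLinearGrowthDensity

theorem deriv_nonneg (hf : IsLinearGrowthDensity f L) {t : ℝ} (ht : 0 ≤ t) :
    0 ≤ derivHalfLine f t := by
  rw [← hf.deriv_zero]; exact hf.strictMonoOn.monotoneOn Set.self_mem_Ici ht ht

theorem deriv_pos (hf : IsLinearGrowthDensity f L) {t : ℝ} (ht : 0 < t) :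
    0 < derivHalfLine f t := by
  rw [← hf.deriv_zero]; exact hf.strictMonoOn Set.self_mem_Ici ht.le ht

theorem continuousOn_deriv (hf : IsLinearGrowthDensity f L) :
    ContinuousOn (derivHalfLine f) (Set.Ici 0) :=
  fun t ht => (hf.hasDeriv₂ t ht).continuousWithinAt

theorem deriv_le_mul (hf : IsLinearGrowthDensity f L) {t : ℝ} (ht : 0 ≤ t) :
    derivHalfLine f t ≤ L * t := by
  have h : AntitoneOn (fun t => derivHalfLine f t - L * t) (Set.Ici 0) := by
    refine antitoneOn_of_deriv_nonpos (convex_Ici 0)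
      (hf.continuousOn_deriv.sub (by fun_prop)) ?_ ?_ <;> rw [interior_Ici] <;> intro t ht
    · exact (((hf.hasDeriv₂ t (le_of_lt ht)).hasDerivAt (Ici_mem_nhds ht)).sub
        ((hasDerivAt_id t).const_mul L)).differentiableAt.differentiableWithinAt
    · have ht' : (0 : ℝ) < t := ht
      have hd : HasDerivAt (fun t => derivHalfLine f t - L * t) (derivHalfLine₂ f t - L * 1) t :=
        ((hf.hasDeriv₂ t ht'.le).hasDerivAt (Ici_mem_nhds ht)).sub ((hasDerivAt_id t).const_mul L)
      rw [hd.deriv]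
      have h1 := hf.deriv₂_le t ht'.le
      have h2 : (1 + t)⁻¹ ≤ 1 := inv_le_one_of_one_le₀ (by linarith)
      have := hf.pos
      nlinarith
  have := h Set.self_mem_Ici ht ht
  simp only [hf.deriv_zero] at this
  linarith

theorem secantCoeff_nonneg (hf : IsLinearGrowthDensity f L) {t : ℝ} (ht : 0 ≤ t) :
    0 ≤ secantCoeff f t := by
  unfold secantCoeff
  split_ifs
  · exact hf.deriv₂_nonneg 0 le_rfl
  · exact div_nonneg (hf.deriv_nonneg ht) ht

/-- The bounds f'(t) ≤ Lt and f'(t) ≤ L add up to (1 + t) f'(t) ≤ 2Lt. -/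
theorem secantCoeff_le (hf : IsLinearGrowthDensity f L) {t : ℝ} (ht : 0 ≤ t) :
    secantCoeff f t ≤ 2 * L * (1 + t)⁻¹ := by
  unfold secantCoeff
  have hL := hf.pos
  split_ifs with h
  · subst h
    have := hf.deriv₂_le 0 le_rfl
    norm_num at this ⊢
    linarith
  · have ht' : 0 < t := lt_of_le_of_ne ht (Ne.symm h)
    rw [← div_eq_mul_inv, div_le_div_iff₀ ht' (by linarith)]
    have := hf.deriv_le_mul ht
    have := hf.deriv_le t ht
    nlinarith

theorem secantCoeff_le_const (hf : IsLinearGrowthDensity f L) {t : ℝ} (ht : 0 ≤ t) :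
    secantCoeff f t ≤ L := by
  unfold secantCoeff
  split_ifs with h
  · simpa using hf.deriv₂_le 0 le_rfl
  · have ht' : 0 < t := lt_of_le_of_ne ht (Ne.symm h)
    rw [div_le_iff₀ ht']
    exact hf.deriv_le_mul ht

theorem deriv₂_le_const (hf : IsLinearGrowthDensity f L) {t : ℝ} (ht : 0 ≤ t) :
    derivHalfLine₂ f t ≤ L := by
  have h2 : (1 + t)⁻¹ ≤ 1 := inv_le_one_of_one_le₀ (by linarith)
  exact (hf.deriv₂_le t ht).trans (mul_le_of_le_one_right hf.pos.le h2)

theorem continuousOn_secantCoeff (hf : IsLinearGrowthDensity f L) :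
    ContinuousOn (secantCoeff f) (Set.Ici 0) := by
  intro t ht
  by_cases h0 : t = 0
  · subst h0
    -- Since f'(0) = 0, the quotient f'(t)/t is the difference quotient of f' at the origin.
    have h := (hasDerivWithinAt_iff_tendsto_slope.1 (hf.hasDeriv₂ 0 le_rfl))
    rw [← continuousWithinAt_update_same] at h
    convert h using 1
    ext s
    by_cases hs : s = 0
    · subst hs; simp [secantCoeff]
    · simp [secantCoeff, hs, slope_def_field, hf.deriv_zero]
  · have ht' : (0 : ℝ) < t := lt_of_le_of_ne ht (Ne.symm h0)
    have : ContinuousAt (fun t => derivHalfLine f t / t) t :=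
      ((hf.continuousOn_deriv t ht).continuousAt (Ici_mem_nhds ht')).div continuousAt_id h0
    refine (this.congr ?_).continuousWithinAt
    filter_upwards [lt_mem_nhds ht'] with s hs
    simp [secantCoeff, (show (0:ℝ) < s from hs).ne']

theorem norm_stress (hf : IsLinearGrowthDensity f L) (z : V) :
    ‖stress f z‖ = derivHalfLine f ‖z‖ := by
  by_cases hz : z = 0
  · simp [stress, hz, hf.deriv_zero]
  · have : 0 < ‖z‖ := norm_pos_iff.2 hz
    rw [stress, norm_smul, Real.norm_of_nonneg (div_nonneg (hf.deriv_nonneg this.le) this.le),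
      div_mul_cancel₀ _ this.ne']

theorem norm_stress_le (hf : IsLinearGrowthDensity f L) (z : V) : ‖stress f z‖ ≤ L := by
  rw [hf.norm_stress]; exact hf.deriv_le _ (norm_nonneg z)

theorem inner_stress_self (z : V) :
    ⟪stress f z, z⟫ = derivHalfLine f ‖z‖ * ‖z‖ := by
  by_cases hz : z = 0
  · simp [stress, hz]
  · have : 0 < ‖z‖ := norm_pos_iff.2 hz
    rw [stress, real_inner_smul_left, real_inner_self_eq_norm_sq]
    field_simp

theorem hasFDerivAt_stress (hf : IsLinearGrowthDensity f L) (z : V) :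
    HasFDerivAt (stress f) (stressDeriv f z) z := by
  by_cases hz : z = 0
  · subst hz
    -- At the origin the stress is a continuous scalar coefficient times `z`, so its derivative is
    -- the value of the coefficient.
    have hc : Tendsto (fun z : V => secantCoeff f ‖z‖) (𝓝 0) (𝓝 (secantCoeff f 0)) := by
      have := (hf.continuousOn_secantCoeff 0 Set.self_mem_Ici).tendsto
      refine this.comp (tendsto_nhdsWithin_iff.2 ⟨?_, .of_forall fun z => norm_nonneg z⟩)
      simpa using (continuous_norm (E := V)).tendsto 0
    rw [hasFDerivAt_iff_isLittleO_nhds_zero]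
    have h1 : (fun z : V => secantCoeff f ‖z‖ - secantCoeff f 0) =o[𝓝 0] (fun _ => (1 : ℝ)) := by
      rw [Asymptotics.isLittleO_one_iff]
      simpa using hc.sub_const (secantCoeff f 0)
    have h2 := h1.smul_isBigO (Asymptotics.isBigO_refl (fun z : V => z) (𝓝 0))
    refine (h2.congr_right (by simp)).congr_left fun z => ?_
    simp [stress_eq_secantCoeff_smul, stressDeriv, sub_smul]
  · have hr : 0 < ‖z‖ := norm_pos_iff.2 hz
    have hn : HasFDerivAt (fun z : V => ‖z‖) (‖z‖⁻¹ • innerSL ℝ z) z := by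
      have h := ((hasStrictFDerivAt_norm_sq z).hasFDerivAt).sqrt (by positivity)
      simp only [Real.sqrt_sq (norm_nonneg _)] at h
      convert h using 1
      ext w; simp; field_simp
    have h1 := ((hf.hasDeriv₂ _ hr.le).hasDerivAt (Ici_mem_nhds hr)).div (hasDerivAt_id ‖z‖) hr.ne'
    have h2 := (h1.comp_hasFDerivAt z hn).smul (hasFDerivAt_id z)
    refine (h2.congr_fderiv ?_).congr_of_eventuallyEq (.of_forall fun w => ?_)
    · ext w
      simp [stressDeriv, secantCoeff, hr.ne', smul_smul, hz]
      field_simp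
      simp
    · simp [stress]

theorem continuous_stress (hf : IsLinearGrowthDensity f L) : Continuous (stress f : V → V) :=
  continuous_iff_continuousAt.2 fun z => (hf.hasFDerivAt_stress z).continuousAt

theorem continuous_stressDeriv (hf : IsLinearGrowthDensity f L) :
    Continuous (stressDeriv f : V → V →L[ℝ] V) := by
  have hs : Continuous (fun z : V => secantCoeff f ‖z‖) :=
    hf.continuousOn_secantCoeff.comp_continuous continuous_norm fun z => norm_nonneg z
  have h2 : Continuous (fun z : V => derivHalfLine₂ f ‖z‖) :=
    hf.continuousOn₂.comp_continuous continuous_norm fun z => norm_nonneg z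
  refine (hs.smul continuous_const).add (continuous_iff_continuousAt.2 fun z => ?_)
  have hrank : Continuous fun z : V => (innerSL ℝ z).smulRight z := by
    have : (fun z : V => (innerSL ℝ z).smulRight z) = fun z : V =>
      ContinuousLinearMap.smulRightL ℝ V V (innerSL ℝ z) z := by ext; simp
    rw [this]; fun_prop
  by_cases hz : z = 0
  · subst hz
    -- The operator norm of the rank-one part is |f''(t) − f'(t)/t| at t = |z|, which tends to zero
    -- at the origin, where both terms have the limit f''(0).
    have h0 : Tendsto (fun z : V => |derivHalfLine₂ f ‖z‖ - secantCoeff f ‖z‖|) (𝓝 0) (𝓝 0) := by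
      have := (h2.sub hs).abs.tendsto 0
      simpa [secantCoeff] using this
    rw [ContinuousAt]
    simp only [norm_zero, map_zero, ContinuousLinearMap.zero_smulRight, smul_zero]
    refine squeeze_zero_norm (fun z => ?_) h0
    rw [norm_smul, ContinuousLinearMap.norm_smulRight_apply, innerSL_apply_norm, norm_div,
      norm_pow, norm_norm, Real.norm_eq_abs]
    by_cases hz : z = 0
    · simp [hz]
    · have : 0 < ‖z‖ := norm_pos_iff.2 hz
      apply le_of_eq; field_simp
  · refine ContinuousAt.smul (ContinuousAt.div (h2.sub hs).continuousAt (by fun_prop) ?_)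
      hrank.continuousAt
    simpa using hz

theorem stressDeriv_apply (z ξ : V) : stressDeriv f z ξ = secantCoeff f ‖z‖ • ξ +
    ((derivHalfLine₂ f ‖z‖ - secantCoeff f ‖z‖) / ‖z‖ ^ 2 * ⟪z, ξ⟫) • z := by
  simp [stressDeriv, smul_smul]

theorem inner_stressDeriv_comm (z ξ ζ : V) :
    ⟪stressDeriv f z ξ, ζ⟫ = ⟪ξ, stressDeriv f z ζ⟫ := by
  simp only [stressDeriv_apply, inner_add_left, inner_add_right, real_inner_smul_left,
    real_inner_smul_right, real_inner_comm z ξ]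
  ring

/-- The derivative acts as f'(|z|)/|z| on the complement of `z` and as f''(|z|) on the line of `z`.
At z = 0 the radial quotient is read as zero and the formula still holds. -/
theorem inner_stressDeriv_self (z ξ : V) : ⟪stressDeriv f z ξ, ξ⟫ =
    secantCoeff f ‖z‖ * (‖ξ‖ ^ 2 - ⟪z, ξ⟫ ^ 2 / ‖z‖ ^ 2) +
      derivHalfLine₂ f ‖z‖ * (⟪z, ξ⟫ ^ 2 / ‖z‖ ^ 2) := by
  simp only [stressDeriv_apply, inner_add_left, real_inner_smul_left, real_inner_self_eq_norm_sq]
  ring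

theorem sq_inner_div_le (z ξ : V) : ⟪z, ξ⟫ ^ 2 / ‖z‖ ^ 2 ≤ ‖ξ‖ ^ 2 := by
  apply div_le_of_le_mul₀ (by positivity) (by positivity)
  have := abs_real_inner_le_norm z ξ
  rw [← sq_abs]
  calc |⟪z, ξ⟫| ^ 2 ≤ (‖z‖ * ‖ξ‖) ^ 2 := by gcongr
    _ = _ := by ring

/-- The radial term is given up, because f'' may decay arbitrarily fast; the later curl estimate
needs only this tangential ellipticity. -/
theorem secantCoeff_mul_le_inner (hf : IsLinearGrowthDensity f L) (z ξ : V) :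
    secantCoeff f ‖z‖ * (‖ξ‖ ^ 2 - ⟪z, ξ⟫ ^ 2 / ‖z‖ ^ 2) ≤ ⟪stressDeriv f z ξ, ξ⟫ := by
  rw [inner_stressDeriv_self]
  have := mul_nonneg (hf.deriv₂_nonneg _ (norm_nonneg z))
    (show 0 ≤ ⟪z, ξ⟫ ^ 2 / ‖z‖ ^ 2 by positivity)
  linarith

theorem inner_stressDeriv_nonneg (hf : IsLinearGrowthDensity f L) (z ξ : V) :
    0 ≤ ⟪stressDeriv f z ξ, ξ⟫ :=
  (mul_nonneg (hf.secantCoeff_nonneg (norm_nonneg z))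
    (sub_nonneg.2 (sq_inner_div_le z ξ))).trans (hf.secantCoeff_mul_le_inner z ξ)

theorem inner_stressDeriv_le (hf : IsLinearGrowthDensity f L) (z ξ : V) :
    ⟪stressDeriv f z ξ, ξ⟫ ≤ 2 * L * (1 + ‖z‖)⁻¹ * ‖ξ‖ ^ 2 := by
  rw [inner_stressDeriv_self]
  have h1 := mul_le_mul_of_nonneg_right (hf.secantCoeff_le (norm_nonneg z))
    (sub_nonneg.2 (sq_inner_div_le z ξ))
  have h2 : derivHalfLine₂ f ‖z‖ ≤ 2 * L * (1 + ‖z‖)⁻¹ := by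
    have := hf.deriv₂_le _ (norm_nonneg z)
    have : 0 ≤ L * (1 + ‖z‖)⁻¹ := mul_nonneg hf.pos.le (by positivity)
    linarith
  have h3 := mul_le_mul_of_nonneg_right h2 (show 0 ≤ ⟪z, ξ⟫ ^ 2 / ‖z‖ ^ 2 by positivity)
  linarith

theorem norm_stressDeriv_apply_le (hf : IsLinearGrowthDensity f L) (z ξ : V) :
    ‖stressDeriv f z ξ‖ ≤ L * ‖ξ‖ := by
  have hL := hf.pos
  refine le_of_sq_le_sq ?_ (by positivity)
  -- Pythagoras for the tangential and radial parts.
  have hsq : ‖stressDeriv f z ξ‖ ^ 2 =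
      secantCoeff f ‖z‖ ^ 2 * (‖ξ‖ ^ 2 - ⟪z, ξ⟫ ^ 2 / ‖z‖ ^ 2) +
      derivHalfLine₂ f ‖z‖ ^ 2 * (⟪z, ξ⟫ ^ 2 / ‖z‖ ^ 2) := by
    by_cases hz : z = 0
    · subst hz; simp [stressDeriv_apply, norm_smul, mul_pow]
    have hr : ‖z‖ ≠ 0 := norm_ne_zero_iff.2 hz
    rw [stressDeriv_apply, norm_add_sq_real, norm_smul, norm_smul, real_inner_smul_left,
      real_inner_smul_right, mul_pow, mul_pow, real_inner_comm z ξ, Real.norm_eq_abs,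
      Real.norm_eq_abs, sq_abs, sq_abs]
    field_simp
    ring
  have h1 : secantCoeff f ‖z‖ ^ 2 ≤ L ^ 2 :=
    pow_le_pow_left₀ (hf.secantCoeff_nonneg (norm_nonneg z))
      (hf.secantCoeff_le_const (norm_nonneg z)) 2
  have h2 : derivHalfLine₂ f ‖z‖ ^ 2 ≤ L ^ 2 :=
    pow_le_pow_left₀ (hf.deriv₂_nonneg _ (norm_nonneg z)) (hf.deriv₂_le_const (norm_nonneg z)) 2
  have h3 := mul_le_mul_of_nonneg_right h1 (sub_nonneg.2 (sq_inner_div_le z ξ))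
  have h4 := mul_le_mul_of_nonneg_right h2 (show 0 ≤ ⟪z, ξ⟫ ^ 2 / ‖z‖ ^ 2 by positivity)
  rw [hsq, mul_pow]
  linarith

theorem lipschitzWith_stress (hf : IsLinearGrowthDensity f L) :
    LipschitzWith L.toNNReal (stress f : V → V) := by
  refine lipschitzWith_of_nnnorm_fderiv_le (𝕜 := ℝ)
    (fun z => (hf.hasFDerivAt_stress z).differentiableAt) fun z => ?_
  rw [(hf.hasFDerivAt_stress z).fderiv]
  exact NNReal.coe_le_coe.1 <| by
    rw [Real.coe_toNNReal _ hf.pos.le]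
    exact ContinuousLinearMap.opNorm_le_bound _ hf.pos.le (hf.norm_stressDeriv_apply_le z)

theorem hasFDerivAt_comp_norm (hf : IsLinearGrowthDensity f L) (z : V) :
    HasFDerivAt (fun z : V => f ‖z‖) (innerSL ℝ (stress f z)) z := by
  by_cases hz : z = 0
  · subst hz
    have h := hf.hasDeriv 0 le_rfl
    rw [hf.deriv_zero] at h
    have ht : Tendsto (fun z : V => ‖z‖) (𝓝 0) (𝓝[Set.Ici 0] 0) :=
      tendsto_nhdsWithin_iff.2 ⟨by simpa using (continuous_norm (E := V)).tendsto 0,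
        .of_forall fun z => norm_nonneg z⟩
    have h' := (hasDerivWithinAt_iff_isLittleO.1 h).comp_tendsto ht
    rw [hasFDerivAt_iff_isLittleO_nhds_zero]
    simp only [Function.comp_def, sub_zero, smul_zero] at h'
    simpa using h'.trans_isBigO (Asymptotics.isBigO_refl _ _).norm_left
  · have hr : 0 < ‖z‖ := norm_pos_iff.2 hz
    have hn : HasFDerivAt (fun z : V => ‖z‖) (‖z‖⁻¹ • innerSL ℝ z) z := by
      have h := ((hasStrictFDerivAt_norm_sq z).hasFDerivAt).sqrt (by positivity)
      simp only [Real.sqrt_sq (norm_nonneg _)] at h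
      convert h using 1
      ext w; simp; field_simp
    have h1 := ((hf.hasDeriv _ hr.le).hasDerivAt (Ici_mem_nhds hr)).comp_hasFDerivAt z hn
    refine h1.congr_fderiv ?_
    ext w
    simp [stress, div_eq_mul_inv, mul_assoc]

theorem continuous_comp_norm (hf : IsLinearGrowthDensity f L) : Continuous (fun z : V => f ‖z‖) :=
  continuous_iff_continuousAt.2 fun z => (hf.hasFDerivAt_comp_norm z).continuousAt

theorem add_inner_stress_le (hf : IsLinearGrowthDensity f L) (z w : V) :
    f ‖z‖ + ⟪stress f z, w - z⟫ ≤ f ‖w‖ := by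
  have h1 := hf.add_mul_le ‖z‖ (norm_nonneg _) ‖w‖ (norm_nonneg _)
  have h2 := real_inner_le_norm (stress f z) w
  rw [inner_sub_right, inner_stress_self]
  rw [hf.norm_stress] at h2
  linarith

theorem le_add_inner_stress (hf : IsLinearGrowthDensity f L) (z w : V) :
    f ‖w‖ ≤ f ‖z‖ + ⟪stress f z, w - z⟫ + L / 2 * ‖w - z‖ ^ 2 := by
  set v := w - z with hv
  -- The first-order remainder along the segment minus its quadratic bound; the Lipschitz constant
  -- `L` of the stress makes it nonincreasing.
  let g : ℝ → ℝ := fun t => f ‖z + t • v‖ - t * ⟪stress f z, v⟫ - L / 2 * t ^ 2 * ‖v‖ ^ 2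
  have hd : ∀ t, HasDerivAt g (⟪stress f (z + t • v), v⟫ - ⟪stress f z, v⟫ - L * t * ‖v‖ ^ 2) t := by
    intro t
    have h1 : HasDerivAt (fun t : ℝ => z + t • v) v t := by
      simpa using ((hasDerivAt_id t).smul_const v).const_add z
    have h2 := (hf.hasFDerivAt_comp_norm (z + t • v)).comp_hasDerivAt t h1
    have h3 : HasDerivAt (fun t : ℝ => t * ⟪stress f z, v⟫) ⟪stress f z, v⟫ t := by
      simpa using (hasDerivAt_id t).mul_const ⟪stress f z, v⟫
    have h4 : HasDerivAt (fun t : ℝ => L / 2 * t ^ 2 * ‖v‖ ^ 2) (L * t * ‖v‖ ^ 2) t := by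
      have := (((hasDerivAt_id t).pow 2).const_mul (L / 2)).mul_const (‖v‖ ^ 2)
      exact this.congr_deriv (by simp only [Nat.cast_ofNat, id]; ring)
    exact (h2.sub h3).sub h4
  have hanti : AntitoneOn g (Set.Ici 0) := by
    refine antitoneOn_of_deriv_nonpos (convex_Ici 0)
      (fun t _ => (hd t).continuousAt.continuousWithinAt)
      (fun t _ => (hd t).differentiableAt.differentiableWithinAt) fun t ht => ?_
    rw [interior_Ici] at ht
    rw [(hd t).deriv, ← inner_sub_left]
    have h1 := real_inner_le_norm (stress f (z + t • v) - stress f z) v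
    have h2 := hf.lipschitzWith_stress.norm_sub_le (z + t • v) z
    rw [Real.coe_toNNReal _ hf.pos.le, add_sub_cancel_left, norm_smul,
      Real.norm_of_nonneg (le_of_lt ht)] at h2
    nlinarith [norm_nonneg v]
  have := hanti Set.self_mem_Ici (Set.mem_Ici.2 zero_le_one) zero_le_one
  simp only [g] at this
  norm_num at this
  rw [show z + v = w by rw [hv, add_sub_cancel]] at this
  linarith

/-- A convex function with `L`-Lipschitz gradient controls the gradient difference by its Bregman
distance. One compares convexity at `z` with the quadratic upper bound at `w` in the point `y` that
minimises this upper bound after subtracting the linear function ⟨stress f z, ·⟩. -/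
theorem norm_stress_sub_sq_le (hf : IsLinearGrowthDensity f L) (z w : V) :
    ‖stress f w - stress f z‖ ^ 2 ≤ 2 * L * (f ‖w‖ - f ‖z‖ - ⟪stress f z, w - z⟫) := by
  have hL := hf.pos
  set p := stress f w - stress f z with hp
  set y := w - L⁻¹ • p with hy
  have h1 := hf.add_inner_stress_le z y
  have h2 := hf.le_add_inner_stress w y
  have e1 : y - w = -(L⁻¹ • p) := by simp [hy]
  have e2 : y - z = (w - z) - L⁻¹ • p := by rw [hy]; abel
  rw [e1, norm_neg, norm_smul, inner_neg_right, real_inner_smul_right, Real.norm_of_nonneg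
    (by positivity), mul_pow] at h2
  rw [e2, inner_sub_right, real_inner_smul_right] at h1
  have e3 : ⟪stress f w, p⟫ - ⟪stress f z, p⟫ = ‖p‖ ^ 2 := by
    rw [← inner_sub_left, ← hp, real_inner_self_eq_norm_sq]
  have h3 : L⁻¹ * ‖p‖ ^ 2 - L / 2 * (L⁻¹ ^ 2 * ‖p‖ ^ 2) ≤
      f ‖w‖ - f ‖z‖ - ⟪stress f z, w - z⟫ := by
    rw [← e3]; rw [e3]; linarith [congrArg (L⁻¹ * ·) e3]
  have h4 : L⁻¹ * ‖p‖ ^ 2 - L / 2 * (L⁻¹ ^ 2 * ‖p‖ ^ 2) = ‖p‖ ^ 2 / (2 * L) := by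
    field_simp; ring
  rw [h4, div_le_iff₀ (by positivity)] at h3
  linarith

theorem inner_stress_sub_nonneg (hf : IsLinearGrowthDensity f L) (z w : V) :
    0 ≤ ⟪stress f w - stress f z, w - z⟫ := by
  have h1 := hf.add_inner_stress_le z w
  have h2 := hf.add_inner_stress_le w z
  rw [inner_sub_left]
  rw [← neg_sub w z, inner_neg_right] at h2
  linarith

theorem norm_stress_sub_sq_le_inner (hf : IsLinearGrowthDensity f L) (z w : V) :
    ‖stress f w - stress f z‖ ^ 2 ≤ L * ⟪stress f w - stress f z, w - z⟫ := by
  have h1 := hf.norm_stress_sub_sq_le z w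
  have h2 := hf.norm_stress_sub_sq_le w z
  rw [norm_sub_rev, ← neg_sub w z, inner_neg_right] at h2
  rw [inner_sub_left]
  linarith

theorem stress_injective (hf : IsLinearGrowthDensity f L) :
    Function.Injective (stress f : V → V) := by
  intro z w h
  have hn : ‖z‖ = ‖w‖ := by
    refine hf.strictMonoOn.injOn (norm_nonneg z) (norm_nonneg w) ?_
    rw [← hf.norm_stress, ← hf.norm_stress, h]
  by_cases hz : z = 0
  · rw [hz, norm_zero] at hn; rw [hz, norm_eq_zero.1 hn.symm]
  · have hr : 0 < ‖z‖ := norm_pos_iff.2 hz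
    rw [stress, stress, ← hn] at h
    exact smul_right_injective V (div_pos (hf.deriv_pos hr) hr).ne' h

/-- The inverse of the stress is continuous on its image. As |stress| is f' of the norm and f' is
strictly increasing, the norms of `u` are eventually at most ‖z‖ + 1; by injectivity `z` is then the
only cluster point. -/
theorem tendsto_of_tendsto_stress [FiniteDimensional ℝ V] (hf : IsLinearGrowthDensity f L)
    {ι : Type*} {l : Filter ι} {u : ι → V} {z : V}
    (h : Tendsto (fun k => stress f (u k)) l (𝓝 (stress f z))) : Tendsto u l (𝓝 z) := by
  have : ProperSpace V := FiniteDimensional.proper ℝ V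
  have hlt : ‖stress f z‖ < derivHalfLine f (‖z‖ + 1) := by
    rw [hf.norm_stress]
    exact hf.strictMonoOn (norm_nonneg z) (Set.mem_Ici.2 (by positivity)) (by linarith)
  have hb : ∀ᶠ k in l, u k ∈ Metric.closedBall (0 : V) (‖z‖ + 1) := by
    filter_upwards [h.norm.eventually (gt_mem_nhds hlt)] with k hk
    rw [hf.norm_stress] at hk
    rw [mem_closedBall_zero_iff]
    exact ((hf.strictMonoOn.lt_iff_lt (norm_nonneg _) (Set.mem_Ici.2 (by positivity))).1 hk).le
  refine (isCompact_closedBall (0 : V) (‖z‖ + 1)).tendsto_nhds_of_unique_mapClusterPt hb ?_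
  intro y _ hy
  have h1 : MapClusterPt (stress f y) l (fun k => stress f (u k)) :=
    hy.continuousAt_comp hf.continuous_stress.continuousAt
  exact hf.stress_injective (eq_of_nhds_neBot (ClusterPt.mono h1 h))

end IsLinearGrowthDensity

end Stress

/-! ### Regularised problems in a closed subspace of `L²` and their limit -/

section Hilbert

/-- Zarantonello's theorem for strongly monotone Lipschitz operators, in variational form on a
complete subspace. -/
theorem Submodule.exists_forall_inner_eq_zero_of_stronglyMonotone {X : Type*}
    [NormedAddCommGroup X] [InnerProductSpace ℝ X] (K : Submodule ℝ X) [CompleteSpace K]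
    {A : X → X} {m M : ℝ} (hm : 0 < m) (hmM : m ≤ M)
    (hmono : ∀ x y, m * ‖x - y‖ ^ 2 ≤ ⟪A x - A y, x - y⟫)
    (hlip : ∀ x y, ‖A x - A y‖ ≤ M * ‖x - y‖) :
    ∃ x ∈ K, ∀ y ∈ K, ⟪A x, y⟫ = 0 := by
  have hM : 0 < M := hm.trans_le hmM
  -- This step size minimises the factor 1 − 2ρm + ρ²M² by which x ↦ x − ρ P(A x) contracts squared
  -- distances.
  set ρ : ℝ := m / M ^ 2 with hρ
  have hρ0 : 0 < ρ := by positivity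
  let Ψ : K → K := fun x => x - ρ • K.orthogonalProjectionOnto (A x)
  set c : ℝ := 1 - m ^ 2 / M ^ 2 with hc
  have hc0 : 0 ≤ c := by
    rw [hc, sub_nonneg, div_le_one (by positivity)]; gcongr
  have hc1 : c < 1 := by rw [hc]; have : 0 < m ^ 2 / M ^ 2 := by positivity
                         linarith
  have hΨ : ContractingWith (Real.sqrt c).toNNReal Ψ := by
    refine ⟨?_, LipschitzWith.of_dist_le_mul fun x y => ?_⟩
    · rw [← NNReal.coe_lt_coe, Real.coe_toNNReal _ (Real.sqrt_nonneg _)]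
      exact (Real.sqrt_lt' one_pos).2 (by simpa using hc1)
    · rw [Real.coe_toNNReal _ (Real.sqrt_nonneg _), dist_eq_norm, dist_eq_norm]
      refine le_of_sq_le_sq ?_ (by positivity)
      rw [mul_pow, Real.sq_sqrt hc0]
      have e : Ψ x - Ψ y = (x - y) - ρ • K.orthogonalProjectionOnto (A x - A y) := by
        simp only [Ψ, map_sub, smul_sub]; abel
      rw [e, norm_sub_sq_real, real_inner_smul_right, norm_smul, Real.norm_of_nonneg hρ0.le]
      have h1 : ⟪x - y, K.orthogonalProjectionOnto (A x - A y)⟫ =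
          ⟪A x - A y, (x : X) - y⟫ := by
        rw [real_inner_comm, Submodule.inner_orthogonalProjectionOnto_eq_of_mem_right]; rfl
      have h2 : ‖K.orthogonalProjectionOnto (A x - A y)‖ ≤ M * ‖x - y‖ :=
        (K.norm_orthogonalProjectionOnto_apply_le _).trans (hlip x y)
      have h3 := hmono x y
      have h4 : (ρ * ‖K.orthogonalProjectionOnto (A x - A y)‖) ^ 2 ≤
          (ρ * (M * ‖x - y‖)) ^ 2 := by gcongr
      have h5 : ‖(x : X) - y‖ = ‖x - y‖ := rfl
      rw [h5] at h3
      have h6 : (ρ * (M * ‖x - y‖)) ^ 2 = m ^ 2 / M ^ 2 * ‖x - y‖ ^ 2 := by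
        rw [hρ]; field_simp
      have h7 : ρ * (m * ‖x - y‖ ^ 2) = m ^ 2 / M ^ 2 * ‖x - y‖ ^ 2 := by rw [hρ]; field_simp
      have h8 := mul_le_mul_of_nonneg_left h3 hρ0.le
      rw [h1, hc]
      nlinarith
  obtain ⟨x, hx, -⟩ := hΨ.exists_fixedPoint (0 : K) (edist_ne_top _ _)
  refine ⟨x, x.2, fun y hy => ?_⟩
  have hx' : ρ • K.orthogonalProjectionOnto (A x) = 0 := by
    have : x - ρ • K.orthogonalProjectionOnto (A x) = x := hx
    simpa using this
  have h0 : K.orthogonalProjectionOnto (A x) = 0 := (smul_eq_zero.1 hx').resolve_left hρ0.ne'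
  have := K.inner_orthogonalProjectionOnto_eq_of_mem_right ⟨y, hy⟩ (A x)
  rw [h0] at this
  simpa using this.symm

end Hilbert

section Limit

variable {α : Type*} [MeasurableSpace α] {μ : Measure α}
  {V : Type*} [NormedAddCommGroup V] [InnerProductSpace ℝ V]
  {f : ℝ → ℝ} {L : ℝ}

namespace IsLinearGrowthDensity

theorem nonneg (hf : IsLinearGrowthDensity f L) (hf0 : f 0 = 0) {t : ℝ} (ht : 0 ≤ t) :
    0 ≤ f t := by
  have := hf.add_mul_le 0 le_rfl t ht
  rw [hf0, hf.deriv_zero] at this; linarith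

theorem le_mul (hf : IsLinearGrowthDensity f L) (hf0 : f 0 = 0) {t : ℝ} (ht : 0 ≤ t) :
    f t ≤ L * t := by
  have h1 := hf.add_mul_le t ht 0 le_rfl
  have h2 := mul_le_mul_of_nonneg_right (hf.deriv_le t ht) ht
  rw [hf0] at h1; linarith

theorem integrable_comp_norm (hf : IsLinearGrowthDensity f L) (hf0 : f 0 = 0) {G : α → V}
    (hG : Integrable G μ) : Integrable (fun x => f ‖G x‖) μ := by
  refine (hG.norm.const_mul L).mono'
    (hf.continuous_comp_norm.comp_aestronglyMeasurable hG.aestronglyMeasurable) ?_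
  refine .of_forall fun x => ?_
  rw [Real.norm_of_nonneg (hf.nonneg hf0 (norm_nonneg _))]
  exact hf.le_mul hf0 (norm_nonneg _)

theorem integrable_inner_stress (hf : IsLinearGrowthDensity f L) {G Φ : α → V}
    (hG : AEStronglyMeasurable G μ) (hΦ : Integrable Φ μ) :
    Integrable (fun x => ⟪stress f (G x), Φ x⟫) μ := by
  refine (hΦ.norm.const_mul L).mono'
    ((hf.continuous_stress.comp_aestronglyMeasurable hG).inner hΦ.aestronglyMeasurable) ?_
  refine .of_forall fun x => (norm_inner_le_norm _ _).trans ?_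
  exact mul_le_mul_of_nonneg_right (hf.norm_stress_le _) (norm_nonneg _)

end IsLinearGrowthDensity

theorem integrable_inner_of_ae_norm_le {T₀ Φ : α → V} {τ : ℝ} (hT₀ : AEStronglyMeasurable T₀ μ)
    (hτ : ∀ᵐ x ∂μ, ‖T₀ x‖ ≤ τ) (hΦ : Integrable Φ μ) :
    Integrable (fun x => ⟪T₀ x, Φ x⟫) μ := by
  refine (hΦ.norm.const_mul τ).mono' (hT₀.inner hΦ.aestronglyMeasurable) ?_
  filter_upwards [hτ] with x hx
  exact (norm_inner_le_norm _ _).trans (mul_le_mul_of_nonneg_right hx (norm_nonneg _))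

/-- The stress is only monotone; the term `ε • G` adds strong monotonicity with constant `ε`, and
the sum has Lipschitz constant `L + ε`. -/
theorem exists_regularised_solution (hf : IsLinearGrowthDensity f L) {T₀ : α → V}
    (hT₀ : MemLp T₀ 2 μ) (H : Submodule ℝ (Lp V 2 μ)) [CompleteSpace H] {ε : ℝ} (hε : 0 < ε) :
    ∃ G ∈ H, ∀ Φ ∈ H,
      ⟪hf.lipschitzWith_stress.compLp stress_zero G + ε • G - hT₀.toLp T₀, Φ⟫ = 0 := by
  refine H.exists_forall_inner_eq_zero_of_stronglyMonotone hε
    (M := L + ε) (by linarith [hf.pos]) (fun G G' => ?_) (fun G G' => ?_)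
  · have e : hf.lipschitzWith_stress.compLp stress_zero G + ε • G - hT₀.toLp T₀ -
      (hf.lipschitzWith_stress.compLp stress_zero G' + ε • G' - hT₀.toLp T₀) =
      (hf.lipschitzWith_stress.compLp stress_zero G -
        hf.lipschitzWith_stress.compLp stress_zero G') + ε • (G - G') := by
      rw [smul_sub]; abel
    rw [e, inner_add_left, real_inner_smul_left, real_inner_self_eq_norm_sq]
    suffices 0 ≤ ⟪hf.lipschitzWith_stress.compLp stress_zero G -
        hf.lipschitzWith_stress.compLp stress_zero G', G - G'⟫ by linarith
    rw [L2.inner_def]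
    refine integral_nonneg_of_ae ?_
    filter_upwards [Lp.coeFn_sub G G', Lp.coeFn_sub (hf.lipschitzWith_stress.compLp stress_zero G)
      (hf.lipschitzWith_stress.compLp stress_zero G'),
      hf.lipschitzWith_stress.coeFn_compLp stress_zero G,
      hf.lipschitzWith_stress.coeFn_compLp stress_zero G'] with x h1 h2 h3 h4
    rw [h1, h2, Pi.sub_apply, Pi.sub_apply, h3, h4]
    exact hf.inner_stress_sub_nonneg _ _
  · have e : hf.lipschitzWith_stress.compLp stress_zero G + ε • G - hT₀.toLp T₀ -
      (hf.lipschitzWith_stress.compLp stress_zero G' + ε • G' - hT₀.toLp T₀) =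
      (hf.lipschitzWith_stress.compLp stress_zero G -
        hf.lipschitzWith_stress.compLp stress_zero G') + ε • (G - G') := by
      rw [smul_sub]; abel
    rw [e, add_mul]
    refine (norm_add_le _ _).trans (add_le_add ?_ ?_)
    · have := hf.lipschitzWith_stress.norm_compLp_sub_le stress_zero G G'
      rwa [Real.coe_toNNReal _ hf.pos.le] at this
    · rw [norm_smul, Real.norm_of_nonneg hε.le]

end Limit

/-! ### Convergence of the regularised solutions -/

section Limit

variable {α : Type*} [MeasurableSpace α] {μ : Measure α}
  {V : Type*} [NormedAddCommGroup V] [InnerProductSpace ℝ V]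
  {f : ℝ → ℝ} {L : ℝ}

/-- The functional `∫ f(|G|) - T₀ · G dμ` on arbitrary fields. -/
noncomputable def fieldEnergy (μ : Measure α) (f : ℝ → ℝ) (T₀ G : α → V) : ℝ :=
  ∫ x, (f ‖G x‖ - ⟪T₀ x, G x⟫) ∂μ

/-- The first integral is a Bregman distance, hence nonnegative and a bound for the squared L²
distance of the stresses; the second is the first variation, which vanishes for solutions and is
small for regularised ones. -/
theorem fieldEnergy_sub_eq (hf : IsLinearGrowthDensity f L) (hf0 : f 0 = 0) {T₀ G Φ : α → V}
    {τ : ℝ} (hT₀ : AEStronglyMeasurable T₀ μ) (hτ : ∀ᵐ x ∂μ, ‖T₀ x‖ ≤ τ)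
    (hG : Integrable G μ) (hΦ : Integrable Φ μ) :
    fieldEnergy μ f T₀ Φ - fieldEnergy μ f T₀ G =
      (∫ x, (f ‖Φ x‖ - f ‖G x‖ - ⟪stress f (G x), Φ x - G x⟫) ∂μ) +
      ∫ x, (⟪stress f (G x), Φ x - G x⟫ - ⟪T₀ x, Φ x - G x⟫) ∂μ := by
  have i1 := hf.integrable_comp_norm hf0 hG
  have i2 := hf.integrable_comp_norm hf0 hΦ
  have i3 := integrable_inner_of_ae_norm_le hT₀ hτ hG
  have i4 := integrable_inner_of_ae_norm_le hT₀ hτ hΦ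
  have i5 := hf.integrable_inner_stress hG.aestronglyMeasurable (hΦ.sub hG)
  have i6 := integrable_inner_of_ae_norm_le hT₀ hτ (hΦ.sub hG)
  simp only [Pi.sub_apply] at i5 i6
  have e1 : ∫ x, (f ‖Φ x‖ - ⟪T₀ x, Φ x⟫ - (f ‖G x‖ - ⟪T₀ x, G x⟫)) ∂μ =
    fieldEnergy μ f T₀ Φ - fieldEnergy μ f T₀ G := integral_sub (i2.sub i4) (i1.sub i3)
  have e2 : ∫ x, (f ‖Φ x‖ - f ‖G x‖ - ⟪stress f (G x), Φ x - G x⟫ +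
      (⟪stress f (G x), Φ x - G x⟫ - ⟪T₀ x, Φ x - G x⟫)) ∂μ = _ :=
    integral_add ((i2.sub i1).sub i5) (i5.sub i6)
  rw [← e1, ← e2]
  refine integral_congr_ae (.of_forall fun x => ?_)
  simp only [inner_sub_right]
  ring

theorem le_fieldEnergy_sub (hf : IsLinearGrowthDensity f L) (hf0 : f 0 = 0) {T₀ G Φ : α → V}
    {τ : ℝ} (hT₀ : AEStronglyMeasurable T₀ μ) (hτ : ∀ᵐ x ∂μ, ‖T₀ x‖ ≤ τ)
    (hG : Integrable G μ) (hΦ : Integrable Φ μ) :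
    ∫ x, (⟪stress f (G x), Φ x - G x⟫ - ⟪T₀ x, Φ x - G x⟫) ∂μ ≤
      fieldEnergy μ f T₀ Φ - fieldEnergy μ f T₀ G := by
  rw [fieldEnergy_sub_eq hf hf0 hT₀ hτ hG hΦ]
  refine le_add_of_nonneg_left (integral_nonneg fun x => ?_)
  have := hf.add_inner_stress_le (G x) (Φ x)
  simp only [Pi.zero_apply]
  linarith

/-- The tangent of `f` at `R` has slope at least `τ`, so it absorbs the linear term up to a
constant. -/
theorem neg_le_fieldEnergy [IsFiniteMeasure μ] (hf : IsLinearGrowthDensity f L) (hf0 : f 0 = 0)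
    {T₀ G : α → V} {τ R : ℝ} (hT₀ : AEStronglyMeasurable T₀ μ)
    (hτ : ∀ᵐ x ∂μ, ‖T₀ x‖ ≤ τ) (hR : 0 ≤ R) (hτR : τ ≤ derivHalfLine f R) (hG : Integrable G μ) :
    -(L * R * μ.real Set.univ) ≤ fieldEnergy μ f T₀ G := by
  have h0 : ∫ _, -(L * R) ∂μ = -(L * R * μ.real Set.univ) := by
    rw [integral_const, smul_eq_mul]; ring
  rw [← h0]
  refine integral_mono_ae (integrable_const _)
    ((hf.integrable_comp_norm hf0 hG).sub (integrable_inner_of_ae_norm_le hT₀ hτ hG)) ?_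
  filter_upwards [hτ] with x hx
  have h1 := hf.add_mul_le R hR ‖G x‖ (norm_nonneg _)
  have h2 := (real_inner_le_norm (T₀ x) (G x)).trans
    (mul_le_mul_of_nonneg_right (hx.trans hτR) (norm_nonneg _))
  have h3 := hf.nonneg hf0 hR
  have h4 := mul_le_mul_of_nonneg_right (hf.deriv_le R hR) hR
  linarith

/-- The regularised solutions converge almost everywhere, along a sequence of regularisation
parameters, to an integrable field which satisfies the limit equation. -/
theorem exists_limit_of_regularised_solutions [FiniteDimensional ℝ V] [IsFiniteMeasure μ]
    (hf : IsLinearGrowthDensity f L) (hf0 : f 0 = 0) {T₀ : α → V} {τ : ℝ}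
    (hT₀ : AEStronglyMeasurable T₀ μ) (hτ : ∀ᵐ x ∂μ, ‖T₀ x‖ ≤ τ) (hτf : τ < recessionSlope f)
    (H : Submodule ℝ (Lp V 2 μ)) [CompleteSpace H] :
    ∃ (ε : ℕ → ℝ) (G : ℕ → Lp V 2 μ) (C : ℝ) (g : α → V),
      (∀ k, 0 < ε k ∧ ε k ≤ 1) ∧ (∀ k, G k ∈ H) ∧
      (∀ k, ∀ Φ ∈ H, ∫ x, ⟪stress f (G k x) + ε k • G k x - T₀ x, Φ x⟫ ∂μ = 0) ∧
      (∀ k, ∫ x, ‖G k x‖ ∂μ ≤ C) ∧ (∀ k, ε k * ∫ x, ‖G k x‖ ^ 2 ∂μ ≤ C) ∧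
      Integrable g μ ∧ (∀ᵐ x ∂μ, Tendsto (fun k => G k x) atTop (𝓝 (g x))) ∧
      ∀ Φ ∈ H, ∫ x, (⟪stress f (g x), Φ x⟫ - ⟪T₀ x, Φ x⟫) ∂μ = 0 := by
  have hT₀2 : MemLp T₀ 2 μ := MemLp.of_bound hT₀ τ hτ
  let S : Lp V 2 μ → Lp V 2 μ := hf.lipschitzWith_stress.compLp stress_zero
  have hS : ∀ G, S G =ᵐ[μ] fun x => stress f (G x) := fun G =>
    hf.lipschitzWith_stress.coeFn_compLp stress_zero G
  set e : ℕ → ℝ := fun k => 1 / ((k : ℝ) + 1) with he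
  have he0 : ∀ k, 0 < e k := fun k => by positivity
  have he1 : ∀ k, e k ≤ 1 := fun k => by
    rw [he]; exact (div_le_one (by positivity)).2 (by linarith [(Nat.cast_nonneg k : (0:ℝ) ≤ k)])
  have helim : Tendsto e atTop (𝓝 0) := tendsto_one_div_add_atTop_nhds_zero_nat
  have heanti : Antitone e := fun i j hij => by
    simp only [he]; gcongr
  choose G hGH hG using fun k => exists_regularised_solution hf hT₀2 H (he0 k)
  have hint : ∀ Φ : Lp V 2 μ, Integrable Φ μ := fun Φ => (Lp.memLp Φ).integrable (by norm_num)
  have hsplit : ∀ k Φ, ⟪S (G k) + e k • G k - hT₀2.toLp T₀, Φ⟫ =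
      (∫ x, (⟪stress f (G k x), Φ x⟫ - ⟪T₀ x, Φ x⟫) ∂μ) + e k * ⟪G k, Φ⟫ := by
    intro k Φ
    have h1 : ⟪S (G k), Φ⟫ = ∫ x, ⟪stress f (G k x), Φ x⟫ ∂μ := by
      rw [L2.inner_def]
      refine integral_congr_ae ?_
      filter_upwards [hS (G k)] with x hx
      rw [hx]
    have h2 : ⟪hT₀2.toLp T₀, Φ⟫ = ∫ x, ⟪T₀ x, Φ x⟫ ∂μ := by
      rw [L2.inner_def]
      refine integral_congr_ae ?_
      filter_upwards [hT₀2.coeFn_toLp] with x hx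
      rw [hx]
    rw [inner_sub_left, inner_add_left, real_inner_smul_left, h1, h2, integral_sub
      (hf.integrable_inner_stress (hint _).aestronglyMeasurable (hint _))
      (integrable_inner_of_ae_norm_le hT₀ hτ (hint _))]
    ring
  have hEL : ∀ k, ∀ Φ ∈ H,
      (∫ x, (⟪stress f (G k x), Φ x⟫ - ⟪T₀ x, Φ x⟫) ∂μ) = -(e k * ⟪G k, Φ⟫) := by
    intro k Φ hΦ
    have := hG k Φ hΦ
    rw [hsplit] at this
    linarith
  obtain ⟨δ, hδ, R, hR, hδR⟩ := exists_lt_derivHalfLine hf hf0 hτf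
  -- the uniform bounds
  have hbound : ∀ k, δ * (∫ x, ‖G k x‖ ∂μ) + e k * ‖G k‖ ^ 2 ≤ (|τ| + δ) * R * μ.real Set.univ := by
    intro k
    have h1 := hEL k (G k) (hGH k)
    rw [real_inner_self_eq_norm_sq] at h1
    have h2 : ∫ x, (δ * ‖G k x‖ - (|τ| + δ) * R) ∂μ ≤
        ∫ x, (⟪stress f (G k x), G k x⟫ - ⟪T₀ x, G k x⟫) ∂μ := by
      refine integral_mono_ae (((hint _).norm.const_mul δ).sub (integrable_const _))
        ((hf.integrable_inner_stress (hint _).aestronglyMeasurable (hint _)).sub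
        (integrable_inner_of_ae_norm_le hT₀ hτ (hint _))) ?_
      filter_upwards [hτ] with x hx
      rw [IsLinearGrowthDensity.inner_stress_self]
      have h3 := (real_inner_le_norm (T₀ x) (G k x)).trans
        (mul_le_mul_of_nonneg_right hx (norm_nonneg _))
      -- Large values profit from the margin `δ` in the slope of `f`; for small ones every term is
      -- bounded by (|τ| + δ)R.
      rcases le_total R ‖G k x‖ with h | h
      · have h4 := mul_le_mul_of_nonneg_right (hδR _ h) (norm_nonneg (G k x))
        have : 0 ≤ (|τ| + δ) * R := by positivity
        linarith
      · have h4 := mul_nonneg (hf.deriv_nonneg (norm_nonneg (G k x))) (norm_nonneg (G k x))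
        have h5 : (|τ| + δ) * ‖G k x‖ ≤ (|τ| + δ) * R := by gcongr
        have h6 : τ * ‖G k x‖ ≤ |τ| * ‖G k x‖ :=
          mul_le_mul_of_nonneg_right (le_abs_self τ) (norm_nonneg _)
        linarith
    rw [integral_sub ((hint _).norm.const_mul δ) (integrable_const _), integral_const_mul,
      integral_const, smul_eq_mul, h1] at h2
    linarith
  -- the regularised solutions are a minimising sequence
  let I : Lp V 2 μ → ℝ := fun Φ => fieldEnergy μ f T₀ Φ
  -- By convexity the regularised solution minimises the energy penalised by the quadratic term that
  -- its equation contains.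
  have hImin : ∀ k, ∀ Φ ∈ H, I (G k) + e k / 2 * ‖G k‖ ^ 2 ≤ I Φ + e k / 2 * ‖Φ‖ ^ 2 := by
    intro k Φ hΦ
    have h1 := le_fieldEnergy_sub hf hf0 hT₀ hτ (hint (G k)) (hint Φ)
    have h2 := hEL k (Φ - G k) (H.sub_mem hΦ (hGH k))
    have h3 : ∫ x, (⟪stress f (G k x), (Φ - G k) x⟫ - ⟪T₀ x, (Φ - G k) x⟫) ∂μ =
        ∫ x, (⟪stress f (G k x), Φ x - G k x⟫ - ⟪T₀ x, Φ x - G k x⟫) ∂μ := by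
      refine integral_congr_ae ?_
      filter_upwards [Lp.coeFn_sub Φ (G k)] with x hx
      rw [hx, Pi.sub_apply]
    rw [h3, inner_sub_right, real_inner_self_eq_norm_sq] at h2
    rw [h2] at h1
    have h4 : ⟪G k, Φ⟫ ≤ (‖G k‖ ^ 2 + ‖Φ‖ ^ 2) / 2 := by
      have := real_inner_le_norm (G k) Φ
      nlinarith [sq_nonneg (‖G k‖ - ‖Φ‖)]
    have h5 := mul_le_mul_of_nonneg_left h4 (he0 k).le
    have h6 : -(e k * (⟪G k, Φ⟫ - ‖G k‖ ^ 2)) ≤ I Φ - I (G k) := h1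
    linarith
  have hτR : τ ≤ derivHalfLine f R := by linarith [hδR R le_rfl]
  have hIbdd : BddBelow (I '' H) := ⟨-(L * R * μ.real Set.univ), by
    rintro _ ⟨Φ, -, rfl⟩
    exact neg_le_fieldEnergy hf hf0 hT₀ hτ hR hτR (hint Φ)⟩
  set m := sInf (I '' H) with hm
  have hmle : ∀ k, m ≤ I (G k) := fun k => csInf_le hIbdd ⟨_, hGH k, rfl⟩
  have hlim1 : Tendsto (fun k => I (G k) + e k / 2 * ‖G k‖ ^ 2) atTop (𝓝 m) := by
    refine tendsto_order.2 ⟨fun a ha => .of_forall fun k => ha.trans_le ?_, fun a ha => ?_⟩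
    · have := he0 k
      have := hmle k
      have : 0 ≤ e k / 2 * ‖G k‖ ^ 2 := by positivity
      linarith
    · obtain ⟨_, ⟨Φ, hΦ, rfl⟩, hΦa⟩ := exists_lt_of_csInf_lt
        (Set.image_nonempty.2 ⟨0, H.zero_mem⟩) ha
      have : Tendsto (fun k => I Φ + e k / 2 * ‖Φ‖ ^ 2) atTop (𝓝 (I Φ + 0 / 2 * ‖Φ‖ ^ 2)) :=
        ((helim.div_const 2).mul_const _).const_add _
      rw [zero_div, zero_mul, add_zero] at this
      filter_upwards [this.eventually (gt_mem_nhds hΦa)] with k hk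
      exact (hImin k Φ hΦ).trans_lt hk
  -- The penalty is at most twice the excess of the penalised energy over the infimum `m`.
  have ha : Tendsto (fun k => e k * ‖G k‖ ^ 2) atTop (𝓝 0) := by
    have h := (hlim1.sub_const m).const_mul 2
    rw [sub_self, mul_zero] at h
    refine squeeze_zero (fun k => mul_nonneg (he0 k).le (by positivity)) (fun k => ?_) h
    have := hmle k
    linarith
  have hIlim : Tendsto (fun k => I (G k)) atTop (𝓝 m) := by
    have h := hlim1.sub (ha.div_const 2)
    rw [zero_div, sub_zero] at h
    refine h.congr fun k => ?_
    ring
  -- the stresses form a Cauchy sequence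
  set b : ℕ → ℝ := fun k => 2 * L * ((I (G k) - m) + e k * ‖G k‖ ^ 2) with hb
  have hb0 : Tendsto b atTop (𝓝 0) := by
    have := ((hIlim.sub_const m).add ha).const_mul (2 * L)
    simpa using this
  -- The Bregman distance of `G k` from `G l` equals the energy gap plus e_l⟨G l, G k − G l⟩. As `e`
  -- is antitone, e_l‖G k‖² ≤ e_k‖G k‖², so the mixed term is also controlled by the vanishing
  -- penalties.
  have hpair : ∀ k l, k ≤ l → ‖S (G k) - S (G l)‖ ^ 2 ≤ b k + b l := by
    intro k l hkl
    have hL := hf.pos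
    have h1 := fieldEnergy_sub_eq hf hf0 hT₀ hτ (hint (G l)) (hint (G k))
    have h2 := hEL l (G k - G l) (H.sub_mem (hGH k) (hGH l))
    have h3 : ∫ x, (⟪stress f (G l x), (G k - G l) x⟫ - ⟪T₀ x, (G k - G l) x⟫) ∂μ =
        ∫ x, (⟪stress f (G l x), G k x - G l x⟫ - ⟪T₀ x, G k x - G l x⟫) ∂μ := by
      refine integral_congr_ae ?_
      filter_upwards [Lp.coeFn_sub (G k) (G l)] with x hx
      rw [hx, Pi.sub_apply]
    rw [h3] at h2
    rw [h2, inner_sub_right, real_inner_self_eq_norm_sq] at h1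
    have h4 : ‖S (G k) - S (G l)‖ ^ 2 ≤ 2 * L *
        ∫ x, (f ‖G k x‖ - f ‖G l x‖ - ⟪stress f (G l x), G k x - G l x⟫) ∂μ := by
      rw [← real_inner_self_eq_norm_sq, L2.inner_def, ← integral_const_mul]
      have i5 := hf.integrable_inner_stress (hint (G l)).aestronglyMeasurable
        ((hint (G k)).sub (hint (G l)))
      refine integral_mono_ae (L2.integrable_inner _ _) ((((hf.integrable_comp_norm hf0
        (hint (G k))).sub (hf.integrable_comp_norm hf0 (hint (G l)))).sub i5).const_mul _) ?_
      filter_upwards [Lp.coeFn_sub (S (G k)) (S (G l)), hS (G k), hS (G l)] with x hx hk hl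
      rw [hx, Pi.sub_apply, hk, hl, real_inner_self_eq_norm_sq]
      exact hf.norm_stress_sub_sq_le _ _
    have h5 : e l * ⟪G l, G k⟫ ≤ e l * ‖G l‖ ^ 2 + e k * ‖G k‖ ^ 2 := by
      have h51 : ⟪G l, G k⟫ ≤ (‖G l‖ ^ 2 + ‖G k‖ ^ 2) / 2 := by
        have := real_inner_le_norm (G l) (G k)
        nlinarith [sq_nonneg (‖G l‖ - ‖G k‖)]
      have h52 := mul_le_mul_of_nonneg_left h51 (he0 l).le
      have h53 := mul_le_mul_of_nonneg_right (heanti hkl) (sq_nonneg ‖G k‖)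
      have h54 := mul_nonneg (he0 l).le (sq_nonneg ‖G l‖)
      have h55 := mul_nonneg (he0 k).le (sq_nonneg ‖G k‖)
      linarith
    refine h4.trans ?_
    rw [hb]
    simp only
    rw [← mul_add]
    refine mul_le_mul_of_nonneg_left ?_ (by positivity)
    have h6 := hmle l
    have h7 := mul_nonneg (he0 l).le (sq_nonneg ‖G l‖)
    have h8 : I (G k) = fieldEnergy μ f T₀ (G k) := rfl
    have h9 : I (G l) = fieldEnergy μ f T₀ (G l) := rfl
    linarith
  have hcauchy : CauchySeq fun k => S (G k) := by
    refine Metric.cauchySeq_iff'.2 fun r hr => ?_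
    have hev : ∀ᶠ k in atTop, b k < r ^ 2 / 2 :=
      hb0.eventually (gt_mem_nhds (by positivity))
    obtain ⟨N, hN⟩ := eventually_atTop.1 hev
    refine ⟨N, fun k hk => ?_⟩
    rw [dist_comm, dist_eq_norm]
    refine lt_of_pow_lt_pow_left₀ 2 hr.le ((hpair N k hk).trans_lt ?_)
    linarith [hN N le_rfl, hN k hk]
  obtain ⟨σ, hσ⟩ := cauchySeq_tendsto_of_complete hcauchy
  obtain ⟨φ, hφ, hφae⟩ := (tendstoInMeasure_of_tendsto_Lp hσ).exists_seq_tendsto_ae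
  -- almost everywhere convergence
  set C : ℝ := (|τ| + δ) * R * μ.real Set.univ with hC
  have hC0 : 0 ≤ C := by positivity
  have hL1 : ∀ k, ∫ x, ‖G k x‖ ∂μ ≤ C / δ := fun k => by
    rw [le_div_iff₀ hδ]
    have := mul_nonneg (he0 k).le (sq_nonneg ‖G k‖)
    linarith [hbound k]
  have hlint : ∀ k, ∫⁻ x, ‖G k x‖ₑ ∂μ ≤ ENNReal.ofReal (C / δ) := fun k => by
    rw [← ofReal_integral_norm_eq_lintegral_enorm (hint _)]
    exact ENNReal.ofReal_le_ofReal (hL1 k)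
  -- The L¹ bound excludes divergence to infinity at almost every point.
  have hFatou : ∫⁻ x, liminf (fun k => ‖G (φ k) x‖ₑ) atTop ∂μ ≤ ENNReal.ofReal (C / δ) := by
    refine (lintegral_liminf_le' fun k => (hint _).aestronglyMeasurable.enorm).trans ?_
    exact liminf_le_of_frequently_le' (.of_forall fun k => hlint (φ k))
  have hfin : ∀ᵐ x ∂μ, liminf (fun k => ‖G (φ k) x‖ₑ) atTop < (⊤ : ℝ≥0∞) := by
    refine ae_lt_top ?_ (hFatou.trans_lt ENNReal.ofReal_lt_top).ne
    exact .liminf fun k => (Lp.stronglyMeasurable _).enorm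
  have : ProperSpace V := FiniteDimensional.proper ℝ V
  have hSall : ∀ᵐ x ∂μ, ∀ k, S (G (φ k)) x = stress f (G (φ k) x) :=
    ae_all_iff.2 fun k => hS (G (φ k))
  -- Boundedness along a subsequence depending on `x` gives a cluster point `z`, whose stress must
  -- be `σ x`. Convergence of the stresses to `stress f z` then forces convergence of the whole
  -- sequence to `z`.
  have hex : ∀ᵐ x ∂μ, ∃ z, Tendsto (fun k => G (φ k) x) atTop (𝓝 z) ∧ stress f z = σ x := by
    filter_upwards [hφae, hfin, hSall] with x hx hxf hxS
    obtain ⟨r, hr⟩ := ENNReal.lt_iff_exists_nnreal_btwn.1 hxf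
    have hfreq : ∃ᶠ k in atTop, G (φ k) x ∈ Metric.closedBall (0 : V) r := by
      refine (frequently_lt_of_liminf_lt (by isBoundedDefault) hr.1).mono fun k hk => ?_
      rw [mem_closedBall_zero_iff]
      have := (enorm_le_coe (r := r)).1 hk.le
      exact_mod_cast this
    obtain ⟨z, -, hz⟩ := (isCompact_closedBall (0 : V) r).exists_mapClusterPt_of_frequently hfreq
    have h1 : Tendsto (fun k => stress f (G (φ k) x)) atTop (𝓝 (σ x)) :=
      hx.congr hxS
    have h2 : MapClusterPt (stress f z) atTop (fun k => stress f (G (φ k) x)) :=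
      hz.continuousAt_comp hf.continuous_stress.continuousAt
    have h3 : stress f z = σ x := eq_of_nhds_neBot (ClusterPt.mono h2 h1)
    exact ⟨z, hf.tendsto_of_tendsto_stress (by rwa [h3]), h3⟩
  obtain ⟨g, hgm, hg⟩ := exists_stronglyMeasurable_limit_of_tendsto_ae
    (fun k => (hint (G (φ k))).aestronglyMeasurable) (hex.mono fun x ⟨z, hz, _⟩ => ⟨z, hz⟩)
  have hgσ : ∀ᵐ x ∂μ, stress f (g x) = σ x := by
    filter_upwards [hex, hg] with x ⟨z, hz, hzσ⟩ hgx
    rw [tendsto_nhds_unique hgx hz, hzσ]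
  have hgint : Integrable g μ := by
    refine ⟨hgm.aestronglyMeasurable, ?_⟩
    refine lt_of_le_of_lt (le_trans (lintegral_mono_ae ?_) hFatou) ENNReal.ofReal_lt_top
    filter_upwards [hg] with x hx
    exact hx.enorm.liminf_eq.ge
  refine ⟨e ∘ φ, G ∘ φ, max (C / δ) C, g, fun k => ⟨he0 _, he1 _⟩, fun k => hGH _, ?_, ?_, ?_,
    hgint, hg, ?_⟩
  · intro k Φ hΦ
    have h := hG (φ k) Φ hΦ
    rw [L2.inner_def] at h
    rw [← h]
    refine integral_congr_ae ?_
    filter_upwards [Lp.coeFn_sub (S (G (φ k)) + e (φ k) • G (φ k)) (hT₀2.toLp T₀),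
      Lp.coeFn_add (S (G (φ k))) (e (φ k) • G (φ k)), Lp.coeFn_smul (e (φ k)) (G (φ k)),
      hS (G (φ k)), hT₀2.coeFn_toLp] with x h1 h2 h3 h4 h5
    change _ = ⟪(S (G (φ k)) + e (φ k) • G (φ k) - hT₀2.toLp T₀) x, Φ x⟫
    rw [h1, Pi.sub_apply, h2, Pi.add_apply, h3, Pi.smul_apply, h4, h5]
    rfl
  · exact fun k => (hL1 _).trans (le_max_left _ _)
  · intro k
    refine le_trans ?_ (le_max_right _ _)
    have h1 : ∫ x, ‖G (φ k) x‖ ^ 2 ∂μ = ‖G (φ k)‖ ^ 2 := by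
      rw [← real_inner_self_eq_norm_sq, L2.inner_def]
      simp only [real_inner_self_eq_norm_sq]
    have h2 := hbound (φ k)
    have h3 : 0 ≤ δ * ∫ x, ‖G (φ k) x‖ ∂μ :=
      mul_nonneg hδ.le (integral_nonneg fun x => norm_nonneg _)
    simp only [Function.comp_apply]
    rw [h1]
    linarith
  · intro Φ hΦ
    have h1 : Tendsto (fun k => ⟪S (G k) - hT₀2.toLp T₀, Φ⟫) atTop
        (𝓝 ⟪σ - hT₀2.toLp T₀, Φ⟫) := (hσ.sub_const _).inner tendsto_const_nhds
    -- The regularising term disappears in the limit because (e_k‖G k‖)² = (e_k‖G k‖²) e_k.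
    have h2 : Tendsto (fun k => -(e k * ⟪G k, Φ⟫)) atTop (𝓝 0) := by
      have h21 : Tendsto (fun k => (e k * ‖G k‖ ^ 2) * e k) atTop (𝓝 (0 * 0)) := ha.mul helim
      have h22 := (h21.sqrt).mul_const ‖Φ‖
      rw [mul_zero, Real.sqrt_zero, zero_mul] at h22
      refine squeeze_zero_norm (fun k => ?_) h22
      rw [norm_neg, norm_mul, Real.norm_of_nonneg (he0 k).le]
      have : (e k * ‖G k‖ ^ 2) * e k = (e k * ‖G k‖) ^ 2 := by ring
      rw [this, Real.sqrt_sq (mul_nonneg (he0 k).le (norm_nonneg _)), mul_assoc]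
      exact mul_le_mul_of_nonneg_left (norm_inner_le_norm _ _) (he0 k).le
    have h3 : ∀ k, ⟪S (G k) - hT₀2.toLp T₀, Φ⟫ = -(e k * ⟪G k, Φ⟫) := by
      intro k
      have : ⟪S (G k) + e k • G k - hT₀2.toLp T₀, Φ⟫ = 0 := hG k Φ hΦ
      rw [inner_sub_left, inner_add_left, real_inner_smul_left] at this
      rw [inner_sub_left]
      linarith
    have h4 : ⟪σ - hT₀2.toLp T₀, Φ⟫ = 0 :=
      tendsto_nhds_unique h1 (h2.congr fun k => (h3 k).symm)
    rw [← h4, L2.inner_def]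
    refine integral_congr_ae ?_
    filter_upwards [Lp.coeFn_sub σ (hT₀2.toLp T₀), hgσ, hT₀2.coeFn_toLp] with x h5 h6 h7
    rw [h5, Pi.sub_apply, h6, h7, inner_sub_left]

end Limit

/-! ### Averages of translates -/

section Averages

variable {n : ℕ} {F : Type*} [NormedAddCommGroup F] {P : Type*} [MeasurableSpace P]
  {ρ : Measure P} {q : ℝ≥0∞}

theorem measurePreserving_add_right_volume (v : RVec n) :
    MeasurePreserving (fun x : RVec n => x + v) volume volume :=
  measurePreserving_add_right volume v

theorem tendsto_eLpNorm_translate_sub [Fact (1 ≤ q)] (hq : q ≠ ⊤) {U : RVec n → F}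
    (hU : MemLp U q) :
    Tendsto (fun v => eLpNorm (fun x => U (x + v) - U x) q volume) (𝓝 0) (𝓝 0) := by
  let g : C(RVec n, C(RVec n, RVec n)) :=
    ContinuousMap.curry ⟨fun p : RVec n × RVec n => p.2 + p.1, by fun_prop⟩
  have hg : ∀ v, MeasurePreserving (g v) volume volume := measurePreserving_add_right_volume
  have h := (continuous_const (y := hU.toLp U)).compMeasurePreservingLp g.continuous hg hq
  have h0 := (tendsto_iff_edist_tendsto_0.1 (h.tendsto 0))
  refine h0.congr fun v => ?_
  rw [Lp.edist_def]
  refine eLpNorm_congr_ae ?_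
  have e : ∀ v, ⇑(Lp.compMeasurePreserving (g v) (hg v) (hU.toLp U)) =ᵐ[volume]
      fun x => U (x + v) := fun v =>
    (Lp.coeFn_compMeasurePreserving _ (hg v)).trans
      ((hg v).quasiMeasurePreserving.ae_eq_comp hU.coeFn_toLp)
  filter_upwards [e v, e 0] with x h1 h2
  rw [Pi.sub_apply, h1, h2, add_zero]

/-- The shear (p, x) ↦ (p, x + s p) preserves the product measure. -/
theorem AEStronglyMeasurable.comp_add_prod [SFinite ρ] {U : RVec n → F}
    (hU : AEStronglyMeasurable U volume) {s : P → RVec n} (hs : Measurable s) :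
    AEStronglyMeasurable (fun z : RVec n × P => U (z.1 + s z.2)) (volume.prod ρ) := by
  have h : MeasurePreserving (fun z : P × RVec n => (z.1, z.2 + s z.1)) (ρ.prod volume)
      (ρ.prod volume) :=
    (MeasurePreserving.id ρ).skew_product (g := fun p x => x + s p)
      (by simp only [Function.uncurry_def]; fun_prop)
      (.of_forall fun p => (measurePreserving_add_right_volume (s p)).map_eq)
  have h2 : AEStronglyMeasurable (fun z : P × RVec n => U (z.2 + s z.1)) (ρ.prod volume) :=
    (hU.comp_snd (μ := ρ)).comp_measurePreserving h
  exact h2.prod_swap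

/-- On a probability space the L¹ norm is at most the L^q norm; Tonelli does the rest. This one
bound serves segment averages and mollifications alike, both being averages of translates. -/
theorem eLpNorm_integral_le_of_forall_eLpNorm_le [NormedSpace ℝ F] [IsProbabilityMeasure ρ]
    (hq1 : 1 ≤ q) (hq : q ≠ ⊤) {D : RVec n × P → F}
    (hD : AEStronglyMeasurable D (volume.prod ρ)) {c : ℝ≥0∞}
    (hc : ∀ᵐ p ∂ρ, eLpNorm (fun x => D (x, p)) q volume ≤ c) :
    eLpNorm (fun x => ∫ p, D (x, p) ∂ρ) q volume ≤ c := by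
  have hq0 : q ≠ 0 := (one_pos.trans_le hq1).ne'
  have hr : 0 < q.toReal := ENNReal.toReal_pos hq0 hq
  have hpow : ∫⁻ x, ‖∫ p, D (x, p) ∂ρ‖ₑ ^ q.toReal ≤ c ^ q.toReal := by
    calc ∫⁻ x, ‖∫ p, D (x, p) ∂ρ‖ₑ ^ q.toReal
        ≤ ∫⁻ x, ∫⁻ p, ‖D (x, p)‖ₑ ^ q.toReal ∂ρ := by
          refine lintegral_mono_ae ?_
          filter_upwards [hD.prodMk_left] with x hx
          have h1 : ‖∫ p, D (x, p) ∂ρ‖ₑ ≤ eLpNorm (fun p => D (x, p)) q ρ := by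
            refine (enorm_integral_le_lintegral_enorm _).trans ?_
            rw [← eLpNorm_one_eq_lintegral_enorm]
            exact eLpNorm_le_eLpNorm_of_exponent_le hq1 hx
          refine (ENNReal.rpow_le_rpow h1 hr.le).trans ?_
          rw [eLpNorm_eq_lintegral_rpow_enorm_toReal hq0 hq, ← ENNReal.rpow_mul,
            one_div_mul_cancel hr.ne', ENNReal.rpow_one]
      _ = ∫⁻ p, (∫⁻ x, ‖D (x, p)‖ₑ ^ q.toReal) ∂ρ := by
          rw [lintegral_lintegral_swap]
          exact hD.enorm.pow_const _
      _ ≤ ∫⁻ _, c ^ q.toReal ∂ρ := by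
          refine lintegral_mono_ae ?_
          filter_upwards [hc] with p hp
          refine le_trans (le_of_eq ?_) (ENNReal.rpow_le_rpow hp hr.le)
          rw [eLpNorm_eq_lintegral_rpow_enorm_toReal hq0 hq, ← ENNReal.rpow_mul,
            one_div_mul_cancel hr.ne', ENNReal.rpow_one]
      _ = c ^ q.toReal := by simp
  rw [eLpNorm_eq_lintegral_rpow_enorm_toReal hq0 hq]
  refine (ENNReal.rpow_le_rpow hpow (by positivity)).trans ?_
  rw [← ENNReal.rpow_mul, mul_one_div_cancel hr.ne', ENNReal.rpow_one]

theorem eLpNorm_translate (U : RVec n → F) (hU : AEStronglyMeasurable U volume) (v : RVec n) :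
    eLpNorm (fun x => U (x + v)) q volume = eLpNorm U q volume :=
  eLpNorm_comp_measurePreserving hU (measurePreserving_add_right_volume v)

theorem ae_integrable_comp_add [IsProbabilityMeasure ρ] (hq1 : 1 ≤ q) (hq : q ≠ ⊤)
    {U : RVec n → F} (hU : MemLp U q) {s : P → RVec n} (hs : Measurable s) :
    ∀ᵐ x, Integrable (fun p => U (x + s p)) ρ := by
  have hq0 : q ≠ 0 := (one_pos.trans_le hq1).ne'
  have hr : 0 < q.toReal := ENNReal.toReal_pos hq0 hq
  have hm := AEStronglyMeasurable.comp_add_prod (ρ := ρ) hU.1 hs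
  have h1 : ∫⁻ x, ∫⁻ p, ‖U (x + s p)‖ₑ ^ q.toReal ∂ρ < ⊤ := by
    rw [lintegral_lintegral_swap (hm.enorm.pow_const _)]
    have : ∀ p, ∫⁻ x, ‖U (x + s p)‖ₑ ^ q.toReal = eLpNorm U q volume ^ q.toReal := fun p => by
      rw [← eLpNorm_translate U hU.1 (s p), eLpNorm_eq_lintegral_rpow_enorm_toReal hq0 hq,
        ← ENNReal.rpow_mul, one_div_mul_cancel hr.ne', ENNReal.rpow_one]
    simp only [this, lintegral_const, measure_univ, mul_one]
    exact ENNReal.rpow_lt_top_of_nonneg hr.le hU.2.ne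
  filter_upwards [ae_lt_top' (hm.enorm.pow_const _).lintegral_prod_right' h1.ne,
    hm.prodMk_left] with x hx hxm
  have : MemLp (fun p => U (x + s p)) q ρ := by
    refine ⟨hxm, ?_⟩
    rw [eLpNorm_eq_lintegral_rpow_enorm_toReal hq0 hq]
    exact ENNReal.rpow_lt_top_of_nonneg (by positivity) hx.ne
  exact this.integrable hq1

variable [NormedSpace ℝ F]

/-- The average of the translates of `U` by `s p`, `p` distributed according to `ρ`. -/
noncomputable def translateAverage (ρ : Measure P) (s : P → RVec n) (U : RVec n → F)
    (x : RVec n) : F := ∫ p, U (x + s p) ∂ρ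

theorem aestronglyMeasurable_translateAverage [SFinite ρ] {U : RVec n → F}
    (hU : AEStronglyMeasurable U volume) {s : P → RVec n} (hs : Measurable s) :
    AEStronglyMeasurable (translateAverage ρ s U) volume :=
  (AEStronglyMeasurable.comp_add_prod hU hs).integral_prod_right'

theorem eLpNorm_translateAverage_le [IsProbabilityMeasure ρ] (hq1 : 1 ≤ q) (hq : q ≠ ⊤)
    {U : RVec n → F} (hU : AEStronglyMeasurable U volume) {s : P → RVec n} (hs : Measurable s) :
    eLpNorm (translateAverage ρ s U) q volume ≤ eLpNorm U q volume :=
  eLpNorm_integral_le_of_forall_eLpNorm_le hq1 hq (AEStronglyMeasurable.comp_add_prod hU hs)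
    (.of_forall fun p => (eLpNorm_translate U hU (s p)).le)

theorem memLp_translateAverage [IsProbabilityMeasure ρ] (hq1 : 1 ≤ q) (hq : q ≠ ⊤)
    {U : RVec n → F} (hU : MemLp U q) {s : P → RVec n} (hs : Measurable s) :
    MemLp (translateAverage ρ s U) q volume :=
  ⟨aestronglyMeasurable_translateAverage hU.1 hs,
    (eLpNorm_translateAverage_le hq1 hq hU.1 hs).trans_lt hU.2⟩

theorem eLpNorm_translateAverage_sub_le [CompleteSpace F] [IsProbabilityMeasure ρ] (hq1 : 1 ≤ q)
    (hq : q ≠ ⊤) {U : RVec n → F} (hU : MemLp U q) {s : P → RVec n} (hs : Measurable s) {c : ℝ≥0∞}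
    (hc : ∀ᵐ p ∂ρ, eLpNorm (fun x => U (x + s p) - U x) q volume ≤ c) :
    eLpNorm (fun x => translateAverage ρ s U x - U x) q volume ≤ c := by
  have h := eLpNorm_integral_le_of_forall_eLpNorm_le (ρ := ρ) hq1 hq
    (D := fun z => U (z.1 + s z.2) - U z.1)
    ((AEStronglyMeasurable.comp_add_prod hU.1 hs).sub hU.1.comp_fst) hc
  refine le_trans (le_of_eq (eLpNorm_congr_ae ?_)) h
  filter_upwards [ae_integrable_comp_add (ρ := ρ) hq1 hq hU hs] with x hx
  rw [integral_sub hx (integrable_const _), integral_const]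
  simp [translateAverage]

/-- If the measures `ρ k` are probability measures concentrated on translations that tend to zero,
then the averages of translates converge in `L^q`. -/
theorem tendsto_eLpNorm_translateAverage_sub [CompleteSpace F] [Fact (1 ≤ q)] (hq : q ≠ ⊤)
    {ι : Type*} {l : Filter ι} {ρ : ι → Measure P} [∀ k, IsProbabilityMeasure (ρ k)]
    {s : ι → P → RVec n} (hs : ∀ k, Measurable (s k)) {r : ι → ℝ} (hr : Tendsto r l (𝓝 0))
    (hsr : ∀ k, ∀ᵐ p ∂(ρ k), ‖s k p‖ ≤ r k) {U : RVec n → F} (hU : MemLp U q) :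
    Tendsto (fun k => eLpNorm (fun x => translateAverage (ρ k) (s k) U x - U x) q volume)
      l (𝓝 0) := by
  refine ENNReal.tendsto_nhds_zero.2 fun c hc => ?_
  obtain ⟨δ, hδ, hδc⟩ := Metric.eventually_nhds_iff.1
    (ENNReal.tendsto_nhds_zero.1 (tendsto_eLpNorm_translate_sub hq hU) c hc)
  filter_upwards [hr.eventually (gt_mem_nhds hδ)] with k hk
  refine eLpNorm_translateAverage_sub_le Fact.out hq hU (hs k) ?_
  filter_upwards [hsr k] with p hp
  exact hδc (by rw [dist_zero_right]; exact hp.trans_lt hk)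

end Averages

/-! ### Weak derivatives: test functions, segments, mollification -/

section WeakDerivatives

variable {n : ℕ}

/-- Smooth functions with compact support in `Ω`. -/
structure IsTestFunction (Ω : Set (RVec n)) (φ : RVec n → ℝ) : Prop where
  contDiff : ContDiff ℝ ∞ φ
  hasCompactSupport : HasCompactSupport φ
  tsupport_subset : tsupport φ ⊆ Ω

theorem IsTestFunction.mono {Ω Ω' : Set (RVec n)} {φ : RVec n → ℝ} (h : IsTestFunction Ω φ)
    (hΩ : Ω ⊆ Ω') : IsTestFunction Ω' φ :=
  ⟨h.1, h.2, h.3.trans hΩ⟩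

theorem IsTestFunction.fderiv_apply {Ω : Set (RVec n)} {φ : RVec n → ℝ} (h : IsTestFunction Ω φ)
    (v : RVec n) : IsTestFunction Ω (fun x => fderiv ℝ φ x v) := by
  refine ⟨(h.1.fderiv_right (m := ∞) (by simp)).clm_apply contDiff_const,
    h.2.fderiv_apply (𝕜 := ℝ) v, ?_⟩
  exact (tsupport_fderiv_apply_subset ℝ v).trans h.3

theorem IsTestFunction.comp_add_right {Ω : Set (RVec n)} {φ : RVec n → ℝ}
    {V : Set (RVec n)} (h : IsTestFunction V φ) {v : RVec n} (hV : ∀ x ∈ tsupport φ, x - v ∈ Ω) :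
    IsTestFunction Ω (fun x => φ (x + v)) := by
  refine ⟨h.1.comp (contDiff_id.add contDiff_const),
    h.2.comp_homeomorph (Homeomorph.addRight v), fun x hx => ?_⟩
  have hx' : x + v ∈ tsupport φ :=
    tsupport_comp_subset_preimage φ (Homeomorph.addRight v).continuous hx
  simpa using hV _ hx'

theorem HasCompactSupport.integrable_mul_of_locallyIntegrableOn {Ω : Set (RVec n)}
    {u ψ : RVec n → ℝ} (hu : LocallyIntegrableOn u Ω) (hψc : Continuous ψ)
    (hψ : HasCompactSupport ψ) (hψΩ : tsupport ψ ⊆ Ω) : Integrable (fun x => u x * ψ x) := by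
  have hK : IntegrableOn u (tsupport ψ) := hu.integrableOn_compact_subset hψΩ hψ
  refine (integrableOn_iff_integrable_of_support_subset (s := tsupport ψ) fun x hx => ?_).1
    (hK.mul_continuousOn hψc.continuousOn hψ)
  exact subset_tsupport _ (right_ne_zero_of_mul hx)

theorem IsTestFunction.integrable_mul {Ω : Set (RVec n)} {u φ : RVec n → ℝ}
    (hφ : IsTestFunction Ω φ) (hu : LocallyIntegrableOn u Ω) : Integrable (fun x => u x * φ x) :=
  hφ.2.integrable_mul_of_locallyIntegrableOn hu hφ.1.continuous hφ.3

theorem setIntegral_mul_eq_integral {Ω : Set (RVec n)} {u φ : RVec n → ℝ}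
    (hφ : tsupport φ ⊆ Ω) : ∫ x in Ω, u x * φ x = ∫ x, u x * φ x :=
  setIntegral_eq_integral_of_forall_compl_eq_zero fun x hx => by
    rw [image_eq_zero_of_notMem_tsupport fun h => hx (hφ h), mul_zero]

theorem HasWeakPartial.integral_mul_fderiv {Ω : Set (RVec n)} {i : Fin n} {u g : RVec n → ℝ}
    (h : HasWeakPartial Ω i u g) {φ : RVec n → ℝ} (hφ : IsTestFunction Ω φ) :
    ∫ x, u x * fderiv ℝ φ x (EuclideanSpace.single i 1) = -∫ x, g x * φ x := by
  have := h.2.2 φ hφ.1 hφ.2 hφ.3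
  rwa [setIntegral_mul_eq_integral hφ.3, setIntegral_mul_eq_integral
    (hφ.fderiv_apply _).3] at this

theorem hasWeakPartial_of_integral_eq {Ω : Set (RVec n)} {i : Fin n} {u g : RVec n → ℝ}
    (hu : LocallyIntegrableOn u Ω) (hg : LocallyIntegrableOn g Ω)
    (h : ∀ φ, IsTestFunction Ω φ →
      ∫ x, u x * fderiv ℝ φ x (EuclideanSpace.single i 1) = -∫ x, g x * φ x) :
    HasWeakPartial Ω i u g := by
  refine ⟨hu, hg, fun φ h1 h2 h3 => ?_⟩
  have hφ : IsTestFunction Ω φ := ⟨h1, h2, h3⟩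
  rw [setIntegral_mul_eq_integral h3, setIntegral_mul_eq_integral (hφ.fderiv_apply _).3, h φ hφ]

theorem ae_eq_of_forall_integral_test_eq {Ω : Set (RVec n)} (hΩ : IsOpen Ω) {u w : RVec n → ℝ}
    (hu : LocallyIntegrableOn u Ω) (hw : LocallyIntegrableOn w Ω)
    (h : ∀ φ, IsTestFunction Ω φ → ∫ x, u x * φ x = ∫ x, w x * φ x) :
    u =ᵐ[volume.restrict Ω] w := by
  have := hΩ.ae_eq_zero_of_integral_contDiff_smul_eq_zero (hu.sub hw) fun φ h1 h2 h3 => by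
    have hφ : IsTestFunction Ω φ := ⟨h1, h2, h3⟩
    have e : ∀ x, φ x • (u - w) x = u x * φ x - w x * φ x := fun x => by
      rw [smul_eq_mul, Pi.sub_apply]; ring
    simp only [e]
    rw [integral_sub (hφ.integrable_mul hu) (hφ.integrable_mul hw), h φ hφ, sub_self]
  rw [EventuallyEq, ae_restrict_iff' hΩ.measurableSet]
  filter_upwards [this] with x hx hxΩ
  exact sub_eq_zero.1 (hx hxΩ)

theorem HasWeakPartial.ae_eq {Ω : Set (RVec n)} (hΩ : IsOpen Ω) {i : Fin n} {u g g' : RVec n → ℝ}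
    (h : HasWeakPartial Ω i u g) (h' : HasWeakPartial Ω i u g') : g =ᵐ[volume.restrict Ω] g' :=
  ae_eq_of_forall_integral_test_eq hΩ h.2.1 h'.2.1 fun φ hφ => by
    have h1 := h.integral_mul_fderiv hφ
    have h2 := h'.integral_mul_fderiv hφ
    linarith

theorem HasWeakPartial.mono {Ω V : Set (RVec n)} {i : Fin n} {u g : RVec n → ℝ}
    (h : HasWeakPartial Ω i u g) (hV : V ⊆ Ω) : HasWeakPartial V i u g :=
  hasWeakPartial_of_integral_eq (h.1.mono_set hV) (h.2.1.mono_set hV) fun _ hφ =>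
    h.integral_mul_fderiv (hφ.mono hV)

theorem HasWeakPartial.congr_ae {Ω : Set (RVec n)} {i : Fin n} {u u' g g' : RVec n → ℝ}
    (h : HasWeakPartial Ω i u g) (hu : u =ᵐ[volume.restrict Ω] u')
    (hg : g =ᵐ[volume.restrict Ω] g') : HasWeakPartial Ω i u' g' := by
  refine ⟨fun x hx => ?_, fun x hx => ?_, fun φ h1 h2 h3 => ?_⟩
  · obtain ⟨s, hs, hi⟩ := h.1 x hx
    exact ⟨s ∩ Ω, inter_mem hs self_mem_nhdsWithin, (hi.mono_set Set.inter_subset_left).congr_fun_ae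
      (hu.filter_mono (ae_mono (Measure.restrict_mono Set.inter_subset_right le_rfl)))⟩
  · obtain ⟨s, hs, hi⟩ := h.2.1 x hx
    exact ⟨s ∩ Ω, inter_mem hs self_mem_nhdsWithin, (hi.mono_set Set.inter_subset_left).congr_fun_ae
      (hg.filter_mono (ae_mono (Measure.restrict_mono Set.inter_subset_right le_rfl)))⟩
  · have e1 := h.2.2 φ h1 h2 h3
    have e2 : ∫ x in Ω, u' x * fderiv ℝ φ x (EuclideanSpace.single i 1) =
        ∫ x in Ω, u x * fderiv ℝ φ x (EuclideanSpace.single i 1) :=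
      integral_congr_ae (by filter_upwards [hu] with x hx; rw [hx])
    have e3 : ∫ x in Ω, g' x * φ x = ∫ x in Ω, g x * φ x :=
      integral_congr_ae (by filter_upwards [hg] with x hx; rw [hx])
    rw [e2, e3, e1]

theorem HasWeakPartial.add {Ω : Set (RVec n)} {i : Fin n} {u g u' g' : RVec n → ℝ}
    (h : HasWeakPartial Ω i u g) (h' : HasWeakPartial Ω i u' g') :
    HasWeakPartial Ω i (fun x => u x + u' x) (fun x => g x + g' x) := by
  refine hasWeakPartial_of_integral_eq (h.1.add h'.1) (h.2.1.add h'.2.1) fun φ hφ => ?_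
  simp only [add_mul]
  rw [integral_add ((hφ.fderiv_apply _).integrable_mul h.1)
    ((hφ.fderiv_apply _).integrable_mul h'.1), integral_add (hφ.integrable_mul h.2.1)
    (hφ.integrable_mul h'.2.1), h.integral_mul_fderiv hφ, h'.integral_mul_fderiv hφ]
  ring

theorem HasWeakPartial.const_mul {Ω : Set (RVec n)} {i : Fin n} {u g : RVec n → ℝ}
    (h : HasWeakPartial Ω i u g) (c : ℝ) :
    HasWeakPartial Ω i (fun x => c * u x) (fun x => c * g x) := by
  refine hasWeakPartial_of_integral_eq (h.1.smul c) (h.2.1.smul c) fun φ hφ => ?_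
  simp only [mul_assoc]
  rw [integral_const_mul, integral_const_mul, h.integral_mul_fderiv hφ]
  ring

theorem ContDiff.hasWeakPartial {ψ : RVec n → ℝ} (hψ : ContDiff ℝ 1 ψ) (Ω : Set (RVec n))
    (i : Fin n) : HasWeakPartial Ω i ψ (fun x => fderiv ℝ ψ x (EuclideanSpace.single i 1)) := by
  have hc : Continuous fun x => fderiv ℝ ψ x (EuclideanSpace.single i 1) :=
    (hψ.continuous_fderiv (by simp)).clm_apply continuous_const
  have h1 : LocallyIntegrableOn ψ Ω := hψ.continuous.locallyIntegrable.locallyIntegrableOn Ω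
  have h2 : LocallyIntegrableOn (fun x => fderiv ℝ ψ x (EuclideanSpace.single i 1)) Ω :=
    hc.locallyIntegrable.locallyIntegrableOn Ω
  refine hasWeakPartial_of_integral_eq h1 h2 fun φ hφ => ?_
  exact integral_mul_fderiv_eq_neg_fderiv_mul_of_integrable (hφ.integrable_mul h2)
    ((hφ.fderiv_apply _).integrable_mul h1) (hφ.integrable_mul h1)
    (fun x _ => hψ.differentiable (by simp) x) (fun x _ => hφ.1.differentiable (by simp) x)

theorem hasWeakPartial_const (Ω : Set (RVec n)) (i : Fin n) (c : ℝ) :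
    HasWeakPartial Ω i (fun _ => c) (fun _ => 0) := by
  simpa using (contDiff_const (c := c)).hasWeakPartial Ω i

theorem RVec.eq_sum_smul_single (v : RVec n) :
    v = ∑ i, v i • EuclideanSpace.single i (1 : ℝ) := by
  simpa using ((EuclideanSpace.basisFun (Fin n) ℝ).sum_repr v).symm

theorem integral_mul_fderiv_of_hasWeakPartial {Ω : Set (RVec n)} {u : RVec n → ℝ}
    {g : Fin n → RVec n → ℝ} (h : ∀ i, HasWeakPartial Ω i u (g i)) (hu : LocallyIntegrableOn u Ω)
    {φ : RVec n → ℝ} (hφ : IsTestFunction Ω φ) (v : RVec n) :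
    ∫ x, u x * fderiv ℝ φ x v = -∫ x, (∑ i, v i * g i x) * φ x := by
  have e1 : ∀ x, u x * fderiv ℝ φ x v =
      ∑ i, v i * (u x * fderiv ℝ φ x (EuclideanSpace.single i 1)) := fun x => by
    conv_lhs => rw [RVec.eq_sum_smul_single v]
    rw [map_sum, Finset.mul_sum]
    refine Finset.sum_congr rfl fun i _ => ?_
    rw [map_smul, smul_eq_mul]; ring
  have e2 : ∀ x, (∑ i, v i * g i x) * φ x = ∑ i, v i * (g i x * φ x) := fun x => by
    rw [Finset.sum_mul]; simp only [mul_assoc]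
  simp only [e1, e2]
  rw [integral_finsetSum _ fun i _ => ((hφ.fderiv_apply _).integrable_mul hu).const_mul _,
    integral_finsetSum _ fun i _ => (hφ.integrable_mul (h i).2.1).const_mul _,
    ← Finset.sum_neg_distrib]
  refine Finset.sum_congr rfl fun i _ => ?_
  rw [integral_const_mul, integral_const_mul, (h i).integral_mul_fderiv hφ, mul_neg]

end WeakDerivatives

/-! ### Averages over segments and the fundamental theorem of calculus -/

section Segments

variable {n : ℕ} {F : Type*} [NormedAddCommGroup F] [NormedSpace ℝ F]

instance isProbabilityMeasure_restrict_Ioc_zero_one :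
    IsProbabilityMeasure ((volume : Measure ℝ).restrict (Set.Ioc 0 1)) := ⟨by simp⟩

/-- The average of `U` over the segment from `x` to `x + v`. -/
noncomputable def segmentAverage (v : RVec n) (U : RVec n → F) : RVec n → F :=
  translateAverage ((volume : Measure ℝ).restrict (Set.Ioc 0 1)) (fun t => t • v) U

theorem segmentAverage_eq (v : RVec n) (U : RVec n → F) (x : RVec n) :
    segmentAverage v U x = ∫ t in Set.Ioc (0 : ℝ) 1, U (x + t • v) := rfl

theorem measurable_smul_const_RVec (v : RVec n) : Measurable fun t : ℝ => t • v := by fun_prop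

theorem memLp_segmentAverage {q : ℝ≥0∞} (hq1 : 1 ≤ q) (hq : q ≠ ⊤) {U : RVec n → F}
    (hU : MemLp U q) (v : RVec n) : MemLp (segmentAverage v U) q :=
  memLp_translateAverage hq1 hq hU (measurable_smul_const_RVec v)

theorem tendsto_eLpNorm_segmentAverage_sub [CompleteSpace F] {q : ℝ≥0∞} [Fact (1 ≤ q)]
    (hq : q ≠ ⊤) {ι : Type*} {l : Filter ι} {v : ι → RVec n} (hv : Tendsto v l (𝓝 0))
    {U : RVec n → F} (hU : MemLp U q) :
    Tendsto (fun k => eLpNorm (fun x => segmentAverage (v k) U x - U x) q volume) l (𝓝 0) := by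
  refine tendsto_eLpNorm_translateAverage_sub hq (fun k => measurable_smul_const_RVec (v k))
    (r := fun k => ‖v k‖) (by simpa using hv.norm) (fun k => ?_) hU
  filter_upwards [ae_restrict_mem measurableSet_Ioc] with t ht
  rw [norm_smul, Real.norm_of_nonneg ht.1.le]
  exact mul_le_of_le_one_left (norm_nonneg _) ht.2

/-- The compact set swept out by the translates of `K` along the segment from `0` to `v`. -/
def sweep (K : Set (RVec n)) (v : RVec n) : Set (RVec n) :=
  (fun z : RVec n × ℝ => z.1 + z.2 • v) '' (K ×ˢ Set.Icc 0 1)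

theorem isCompact_sweep {K : Set (RVec n)} (hK : IsCompact K) (v : RVec n) :
    IsCompact (sweep K v) :=
  (hK.prod isCompact_Icc).image (by fun_prop)

theorem add_smul_mem_sweep {K : Set (RVec n)} {x : RVec n} (hx : x ∈ K) (v : RVec n) {t : ℝ}
    (ht : t ∈ Set.Icc (0 : ℝ) 1) : x + t • v ∈ sweep K v := ⟨(x, t), ⟨hx, ht⟩, rfl⟩

theorem sweep_subset {K Ω : Set (RVec n)} {v : RVec n}
    (h : ∀ x ∈ K, ∀ t ∈ Set.Icc (0 : ℝ) 1, x + t • v ∈ Ω) : sweep K v ⊆ Ω := by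
  rintro _ ⟨⟨x, t⟩, ⟨hx, ht⟩, rfl⟩; exact h x hx t ht

theorem subset_sweep {K : Set (RVec n)} {v : RVec n} : K ⊆ sweep K v := fun x hx =>
  ⟨(x, 0), ⟨hx, by simp⟩, by simp⟩

theorem locallyIntegrableOn_segmentAverage {Ω V : Set (RVec n)} {g : RVec n → ℝ} {v : RVec n}
    (hV : IsOpen V) (hVΩ : ∀ x ∈ V, ∀ t ∈ Set.Icc (0 : ℝ) 1, x + t • v ∈ Ω)
    (hg : LocallyIntegrableOn g Ω) : LocallyIntegrableOn (segmentAverage v g) V := by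
  rw [locallyIntegrableOn_iff hV.isLocallyClosed]
  intro K hKV hK
  have hK1 := isCompact_sweep hK v
  have hi : Integrable ((sweep K v).indicator g) := (integrable_indicator_iff
    hK1.measurableSet).2 (hg.integrableOn_compact_subset
      (sweep_subset fun x hx => hVΩ x (hKV hx)) hK1)
  have h1 : Integrable (segmentAverage v ((sweep K v).indicator g)) :=
    memLp_one_iff_integrable.1 (memLp_segmentAverage le_rfl (by simp)
      (memLp_one_iff_integrable.2 hi) v)
  refine h1.integrableOn.congr_fun (fun x hx => ?_) hK.measurableSet
  refine setIntegral_congr_fun measurableSet_Ioc fun t ht => ?_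
  exact Set.indicator_of_mem (add_smul_mem_sweep hx v ⟨ht.1.le, ht.2⟩) g

theorem locallyIntegrableOn_comp_add {Ω V : Set (RVec n)} {u : RVec n → ℝ} {v : RVec n}
    (hV : IsOpen V) (hVΩ : ∀ x ∈ V, x + v ∈ Ω) (hu : LocallyIntegrableOn u Ω) :
    LocallyIntegrableOn (fun x => u (x + v)) V := by
  rw [locallyIntegrableOn_iff hV.isLocallyClosed]
  intro K hKV hK
  have hK1 : IsCompact ((fun x => x + v) '' K) := hK.image (by fun_prop)
  have hi : Integrable (((fun x => x + v) '' K).indicator u) := (integrable_indicator_iff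
    hK1.measurableSet).2 (hu.integrableOn_compact_subset
      (by rintro _ ⟨x, hx, rfl⟩; exact hVΩ x (hKV hx)) hK1)
  refine (hi.comp_add_right v).integrableOn.congr_fun (fun x hx => ?_) hK.measurableSet
  exact Set.indicator_of_mem (Set.mem_image_of_mem _ hx) u

theorem MeasureTheory.Integrable.comp_add_smul_prod {W : RVec n → ℝ} (hW : Integrable W)
    (ρ : Measure ℝ) [IsFiniteMeasure ρ] (v : RVec n) :
    Integrable (fun z : RVec n × ℝ => W (z.1 + z.2 • v)) (volume.prod ρ) := by
  have hm := AEStronglyMeasurable.comp_add_prod (ρ := ρ) hW.1 (measurable_smul_const_RVec v)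
  refine (integrable_prod_iff' hm).2 ⟨.of_forall fun t => hW.comp_add_right (t • v), ?_⟩
  have : ∀ t : ℝ, ∫ x, ‖W (x + t • v)‖ = ∫ x, ‖W x‖ := fun t =>
    integral_add_right_eq_self (fun x => ‖W x‖) (t • v)
  simp only [this]
  exact integrable_const _

/-- The fundamental theorem of calculus along segments for weakly differentiable functions. -/
theorem ae_sub_eq_segmentAverage {Ω V : Set (RVec n)} {u g : RVec n → ℝ} {v : RVec n}
    (hV : IsOpen V) (hVΩ : ∀ x ∈ V, ∀ t ∈ Set.Icc (0 : ℝ) 1, x + t • v ∈ Ω)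
    (hu : LocallyIntegrableOn u Ω) (hg : LocallyIntegrableOn g Ω)
    (h : ∀ φ, IsTestFunction Ω φ → ∫ x, u x * fderiv ℝ φ x v = -∫ x, g x * φ x) :
    (fun x => u (x + v) - u x) =ᵐ[volume.restrict V] segmentAverage v g := by
  have hVΩ1 : ∀ x ∈ V, x + v ∈ Ω := fun x hx => by simpa using hVΩ x hx 1 (by simp)
  have hVΩ0 : V ⊆ Ω := fun x hx => by simpa using hVΩ x hx 0 (by simp)
  have hl1 := locallyIntegrableOn_comp_add hV hVΩ1 hu
  have hl2 := hu.mono_set hVΩ0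
  refine ae_eq_of_forall_integral_test_eq hV (hl1.sub hl2)
    (locallyIntegrableOn_segmentAverage hV hVΩ hg) fun φ hφ => ?_
  set K := tsupport φ with hKdef
  have hK : IsCompact K := hφ.2
  have hS := isCompact_sweep hK v
  have hSΩ : sweep K v ⊆ Ω := sweep_subset fun x hx => hVΩ x (hφ.3 hx)
  -- Only values in the swept compact set matter. Cutting off outside it gives globally integrable
  -- functions, to which Fubini and translation invariance apply.
  set U := (sweep K v).indicator u with hUdef
  set W := (sweep K v).indicator g with hWdef
  have hU : Integrable U := (integrable_indicator_iff hS.measurableSet).2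
    (hu.integrableOn_compact_subset hSΩ hS)
  have hW : Integrable W := (integrable_indicator_iff hS.measurableSet).2
    (hg.integrableOn_compact_subset hSΩ hS)
  have htest : ∀ t ∈ Set.Icc (0 : ℝ) 1, IsTestFunction (sweep K v) (fun x => φ (x + -(t • v))) :=
    fun t ht => hφ.comp_add_right fun x hx => by
      rw [sub_neg_eq_add]; exact add_smul_mem_sweep hx v ht
  -- both sides are equal to an iterated integral
  have hlhs : ∫ x, (u (x + v) - u x) * φ x = ∫ x, U x * (φ (x - v) - φ x) := by
    have e1 : ∀ x, (u (x + v) - u x) * φ x = U (x + v) * φ x - U x * φ x := fun x => by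
      by_cases hx : x ∈ K
      · have h1 : x + v ∈ sweep K v := by simpa using add_smul_mem_sweep hx v (t := 1) (by simp)
        rw [hUdef, Set.indicator_of_mem h1, Set.indicator_of_mem (subset_sweep hx)]; ring
      · rw [image_eq_zero_of_notMem_tsupport hx]; simp
    have hφb : ∃ C, ∀ x, ‖φ x‖ ≤ C := hφ.1.continuous.bounded_above_of_compact_support hφ.2
    obtain ⟨C, hC⟩ := hφb
    have i1 : Integrable fun x => U (x + v) * φ x :=
      (hU.comp_add_right v).mul_bdd (c := C) hφ.1.continuous.aestronglyMeasurable (.of_forall hC)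
    have i2 : Integrable fun x => U x * φ x :=
      hU.mul_bdd (c := C) hφ.1.continuous.aestronglyMeasurable (.of_forall hC)
    have i3 : Integrable fun x => U x * φ (x - v) :=
      hU.mul_bdd (c := C) (hφ.1.continuous.comp (continuous_sub_right v)).aestronglyMeasurable
        (.of_forall fun x => hC (x - v))
    simp only [e1, mul_sub]
    rw [integral_sub i1 i2, integral_sub i3 i2]
    congr 1
    rw [← integral_add_right_eq_self (fun x => U x * φ (x - v)) v]
    simp
  -- The fundamental theorem is used for the test function, where it is classical.
  have hftc : ∀ x, φ (x - v) - φ x = ∫ t in Set.Ioc (0 : ℝ) 1, -fderiv ℝ φ (x + -(t • v)) v := by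
    intro x
    rw [← intervalIntegral.integral_of_le zero_le_one]
    have hd : ∀ t : ℝ, HasDerivAt (fun t : ℝ => φ (x + -(t • v)))
        (-fderiv ℝ φ (x + -(t • v)) v) t := fun t => by
      have h1 : HasDerivAt (fun t : ℝ => x + -(t • v)) (-v) t := by
        simpa using (((hasDerivAt_id t).smul_const v).neg).const_add x
      have h2 := ((hφ.1.differentiable (by simp)) (x + -(t • v))).hasFDerivAt.comp_hasDerivAt t h1
      rwa [map_neg] at h2
    rw [intervalIntegral.integral_eq_sub_of_hasDerivAt (fun t _ => hd t)]
    · simp [sub_eq_add_neg]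
    · refine Continuous.intervalIntegrable ?_ _ _
      have := (hφ.1.continuous_fderiv (by simp))
      fun_prop
  set ρ := (volume : Measure ℝ).restrict (Set.Ioc 0 1) with hρ
  have hcf := hφ.1.continuous_fderiv (by simp)
  obtain ⟨C, hC⟩ : ∃ C, ∀ x, ‖fderiv ℝ φ x v‖ ≤ C :=
    (hφ.fderiv_apply v).1.continuous.bounded_above_of_compact_support (hφ.fderiv_apply v).2
  obtain ⟨C', hC'⟩ : ∃ C, ∀ x, ‖φ x‖ ≤ C :=
    hφ.1.continuous.bounded_above_of_compact_support hφ.2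
  have hint1 : Integrable (fun z : RVec n × ℝ => U z.1 * -fderiv ℝ φ (z.1 + -(z.2 • v)) v)
      (volume.prod ρ) := by
    have h1 : Integrable (fun z : RVec n × ℝ => U z.1) (volume.prod ρ) := hU.comp_fst ρ
    refine h1.mul_bdd (c := C) ?_ (.of_forall fun z => by rw [norm_neg]; exact hC _)
    exact Continuous.aestronglyMeasurable (by fun_prop)
  have hint2 : Integrable (fun z : RVec n × ℝ => W (z.1 + z.2 • v) * φ z.1) (volume.prod ρ) := by
    exact (hW.comp_add_smul_prod ρ v).mul_bdd (c := C') (hφ.1.continuous.comp continuous_fst).aestronglyMeasurable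
      (.of_forall fun z => hC' _)
  have hrhs : ∫ x, segmentAverage v g x * φ x =
      ∫ x, ∫ t, W (x + t • v) * φ x ∂ρ := by
    refine integral_congr_ae (.of_forall fun x => ?_)
    simp only
    rw [integral_mul_const]
    by_cases hx : x ∈ K
    · congr 1
      refine setIntegral_congr_fun measurableSet_Ioc fun t ht => ?_
      exact (Set.indicator_of_mem (add_smul_mem_sweep hx v ⟨ht.1.le, ht.2⟩) g).symm
    · rw [image_eq_zero_of_notMem_tsupport hx]; simp
  rw [hlhs, hrhs, integral_integral_swap hint2]
  have e3 : ∀ x, U x * (φ (x - v) - φ x) = ∫ t, U x * -fderiv ℝ φ (x + -(t • v)) v ∂ρ :=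
    fun x => by rw [hftc x, integral_const_mul]
  simp only [e3]
  rw [integral_integral_swap hint1]
  -- For each `t` the weak equation is tested with the translate φ(· − t v), which is still
  -- supported in Ω.
  refine setIntegral_congr_fun measurableSet_Ioc fun t ht => ?_
  have ht' : t ∈ Set.Icc (0 : ℝ) 1 := ⟨ht.1.le, ht.2⟩
  have hφt := htest t ht'
  have h4 := h _ (hφt.mono hSΩ)
  have e5 : ∀ x, fderiv ℝ (fun x => φ (x + -(t • v))) x = fderiv ℝ φ (x + -(t • v)) := fun x =>
    fderiv_comp_add_right _
  simp only [e5] at h4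
  have e6 : ∫ x, U x * -fderiv ℝ φ (x + -(t • v)) v = -∫ x, u x * fderiv ℝ φ (x + -(t • v)) v := by
    rw [← integral_neg]
    refine integral_congr_ae (.of_forall fun x => ?_)
    simp only
    by_cases hx : x ∈ sweep K v
    · rw [hUdef, Set.indicator_of_mem hx]; ring
    · have : fderiv ℝ φ (x + -(t • v)) v = 0 := by
        have := image_eq_zero_of_notMem_tsupport (f := fun x => fderiv ℝ (fun x =>
          φ (x + -(t • v))) x v) (x := x) fun hx' => hx ((hφt.fderiv_apply v).3 hx')
        simpa only [e5] using this
      rw [this]; ring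
  have e7 : ∫ x, W (x + t • v) * φ x = ∫ x, g x * φ (x + -(t • v)) := by
    rw [← integral_add_right_eq_self (fun x => g x * φ (x + -(t • v))) (t • v)]
    refine integral_congr_ae (.of_forall fun x => ?_)
    simp only [add_neg_cancel_right]
    by_cases hx : x ∈ K
    · rw [hWdef, Set.indicator_of_mem (add_smul_mem_sweep hx v ht')]
    · rw [image_eq_zero_of_notMem_tsupport hx]; simp
  rw [e6, e7, h4, neg_neg]

end Segments

/-! ### Mollification -/

section Mollify

variable {n : ℕ} {c : RVec n}

/-- The convolution of `U` with a normalised bump function, whose support need not be centred. -/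
noncomputable def mollify (b : ContDiffBump c) (U : RVec n → ℝ) : RVec n → ℝ :=
  convolution (b.normed volume) U (ContinuousLinearMap.lsmul ℝ ℝ) volume

/-- The probability measure with density a normalised bump function. -/
noncomputable def bumpMeasure (b : ContDiffBump c) : Measure (RVec n) :=
  volume.withDensity fun t => ((b.normed volume t).toNNReal : ℝ≥0∞)

theorem measurable_bump_toNNReal (b : ContDiffBump c) :
    Measurable fun t => (b.normed volume t).toNNReal :=
  (b.contDiff_normed (n := 0)).continuous.measurable.real_toNNReal

instance (b : ContDiffBump c) : IsProbabilityMeasure (bumpMeasure b) := by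
  refine ⟨?_⟩
  rw [bumpMeasure, withDensity_apply _ MeasurableSet.univ, Measure.restrict_univ]
  have h := ofReal_integral_eq_lintegral_ofReal b.integrable_normed
    (.of_forall fun x => b.nonneg_normed (μ := volume) x)
  rw [b.integral_normed, ENNReal.ofReal_one] at h
  exact h.symm

theorem mollify_apply (b : ContDiffBump c) (U : RVec n → ℝ) (x : RVec n) :
    mollify b U x = ∫ t, b.normed volume t * U (x - t) := rfl

theorem mollify_eq_translateAverage (b : ContDiffBump c) (U : RVec n → ℝ) :
    mollify b U = translateAverage (bumpMeasure b) (fun t => -t) U := by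
  ext x
  rw [mollify_apply, translateAverage, bumpMeasure,
    integral_withDensity_eq_integral_smul (measurable_bump_toNNReal b)]
  refine integral_congr_ae (.of_forall fun t => ?_)
  simp only [NNReal.smul_def, smul_eq_mul, Real.coe_toNNReal _ (b.nonneg_normed (μ := volume) t),
    sub_eq_add_neg]

theorem ae_bumpMeasure (b : ContDiffBump c) : ∀ᵐ t ∂(bumpMeasure b), ‖-t‖ ≤ ‖c‖ + b.rOut := by
  rw [bumpMeasure, ae_withDensity_iff (measurable_bump_toNNReal b).coe_nnreal_ennreal]
  refine .of_forall fun t ht => ?_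
  have h1 : b.normed volume t ≠ 0 := fun h => ht (by simp [h])
  have h2 : t ∈ Function.support (b.normed volume) := h1
  rw [b.support_normed_eq, mem_ball_iff_norm] at h2
  rw [norm_neg]
  calc ‖t‖ = ‖c + (t - c)‖ := by simp
    _ ≤ ‖c‖ + ‖t - c‖ := norm_add_le _ _
    _ ≤ _ := by linarith

theorem tendsto_eLpNorm_mollify_sub {ι : Type*} {l : Filter ι} {c : ι → RVec n}
    (b : ∀ k, ContDiffBump (c k)) (hb : Tendsto (fun k => ‖c k‖ + (b k).rOut) l (𝓝 0))
    {U : RVec n → ℝ} (hU : Integrable U) :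
    Tendsto (fun k => eLpNorm (fun x => mollify (b k) U x - U x) 1 volume) l (𝓝 0) := by
  simp only [mollify_eq_translateAverage]
  exact tendsto_eLpNorm_translateAverage_sub (by simp) (fun _ => measurable_neg) hb
    (fun k => ae_bumpMeasure (b k)) (memLp_one_iff_integrable.2 hU)

theorem integrable_mollify (b : ContDiffBump c) {U : RVec n → ℝ} (hU : Integrable U) :
    Integrable (mollify b U) := by
  rw [mollify_eq_translateAverage, ← memLp_one_iff_integrable]
  exact memLp_translateAverage le_rfl (by simp) (memLp_one_iff_integrable.2 hU) measurable_neg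

theorem contDiff_mollify (b : ContDiffBump c) {U : RVec n → ℝ} (hU : Integrable U) :
    ContDiff ℝ ∞ (mollify b U) :=
  b.hasCompactSupport_normed.contDiff_convolution_left _ b.contDiff_normed hU.locallyIntegrable

theorem hasCompactSupport_mollify (b : ContDiffBump c) {U : RVec n → ℝ}
    (hU : HasCompactSupport U) : HasCompactSupport (mollify b U) :=
  b.hasCompactSupport_normed.convolution _ hU

theorem isTestFunction_bump_sub (b : ContDiffBump c) {V : Set (RVec n)} {x : RVec n}
    (hx : ∀ y ∈ Metric.closedBall c b.rOut, x - y ∈ V) :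
    IsTestFunction V fun y => b.normed volume (x - y) := by
  refine ⟨b.contDiff_normed.comp (contDiff_const.sub contDiff_id), ?_, fun y hy => ?_⟩
  · exact b.hasCompactSupport_normed.comp_homeomorph (Homeomorph.subLeft x)
  · have hy' : x - y ∈ tsupport (b.normed volume) :=
      tsupport_comp_subset_preimage _ (Homeomorph.subLeft x).continuous hy
    rw [b.tsupport_normed_eq] at hy'
    simpa using hx _ hy'

theorem mollify_eq_integral_bump_sub (b : ContDiffBump c) (U : RVec n → ℝ) (x : RVec n) :
    mollify b U x = ∫ y, U y * b.normed volume (x - y) := by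
  rw [mollify_apply, ← integral_sub_left_eq_self _ _ x]
  simp only [sub_sub_cancel, mul_comm]

theorem fderiv_mollify_eq_integral (b : ContDiffBump c) {U : RVec n → ℝ} (hU : Integrable U)
    (x v : RVec n) : fderiv ℝ (mollify b U) x v =
      -∫ y, U y * fderiv ℝ (fun y => b.normed volume (x - y)) y v := by
  have hd := b.hasCompactSupport_normed.hasFDerivAt_convolution_left
    (ContinuousLinearMap.lsmul ℝ ℝ) (b.contDiff_normed (μ := volume) (n := 1))
    hU.locallyIntegrable x
  have h2 : ∀ y, fderiv ℝ (fun y => b.normed volume (x - y)) y v =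
      -fderiv ℝ (b.normed volume) (x - y) v := fun y => by
    have h3 := ((b.contDiff_normed (μ := volume) (n := 1)).differentiable (by simp)
      (x - y)).hasFDerivAt.comp y ((hasFDerivAt_id y).const_sub x)
    have h4 : fderiv ℝ (fun y => b.normed volume (x - y)) y = _ := h3.fderiv
    rw [h4]; simp
  simp only [h2, mul_neg, integral_neg, neg_neg]
  rw [show fderiv ℝ (mollify b U) x = _ from hd.fderiv, convolution_def,
    ContinuousLinearMap.integral_apply]
  · rw [← integral_sub_left_eq_self _ _ x]
    simp only [sub_sub_cancel]
    refine integral_congr_ae (.of_forall fun y => ?_)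
    simp [ContinuousLinearMap.precompL, mul_comm]
  · exact (b.hasCompactSupport_normed.fderiv (𝕜 := ℝ)).convolutionExists_left _
      ((b.contDiff_normed (μ := volume) (n := 1)).continuous_fderiv (by simp))
      hU.locallyIntegrable x

/-- Differentiation commutes with mollification at `x` as soon as all sampled points x − y lie in
`V`, since the reflected kernel is then a test function in `V`. The point `x` itself need not lie in
`V`, which is what off-centre kernels exploit. -/
theorem fderiv_mollify (b : ContDiffBump c) {U G : RVec n → ℝ} (hU : Integrable U)
    {V : Set (RVec n)} {v : RVec n}
    (h : ∀ φ, IsTestFunction V φ → ∫ x, U x * fderiv ℝ φ x v = -∫ x, G x * φ x)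
    {x : RVec n} (hx : ∀ y ∈ Metric.closedBall c b.rOut, x - y ∈ V) :
    fderiv ℝ (mollify b U) x v = mollify b G x := by
  rw [fderiv_mollify_eq_integral b hU, h _ (isTestFunction_bump_sub b hx), neg_neg,
    mollify_eq_integral_bump_sub]

/-- A bump function of outer radius at most `r`. -/
noncomputable def smallBump (c : RVec n) {r : ℝ} (hr : 0 < r) : ContDiffBump c :=
  ⟨r / 2, r, by positivity, by linarith⟩

end Mollify

/-! ### Functions with vanishing weak gradient -/

section Constant

variable {n : ℕ}

theorem ae_restrict_of_locally {Ω : Set (RVec n)} (hΩ : IsOpen Ω) {p : RVec n → Prop}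
    (h : ∀ x ∈ Ω, ∃ r > 0, ∀ᵐ y ∂(volume.restrict (Metric.ball x r)), p y) :
    ∀ᵐ y ∂(volume.restrict Ω), p y := by
  rw [ae_restrict_iff' hΩ.measurableSet, ae_iff]
  refine measure_null_of_locally_null _ fun x hx => ?_
  simp only [Set.mem_ofPred_eq, Classical.not_imp] at hx
  obtain ⟨r, hr, hp⟩ := h x hx.1
  rw [ae_restrict_iff' measurableSet_ball, ae_iff] at hp
  refine ⟨_, inter_mem_nhdsWithin _ (Metric.ball_mem_nhds x hr), measure_mono_null ?_ hp⟩
  rintro y ⟨hy1, hy2⟩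
  simp only [Set.mem_ofPred_eq, Classical.not_imp] at hy1 ⊢
  exact ⟨hy2, hy1.2⟩

/-- Mollifications of `u` have zero derivative on the smaller ball, hence are constant there, and a
subsequence converges to `u` almost everywhere. -/
theorem ae_eq_const_on_ball {u : RVec n → ℝ} {x₀ : RVec n} {r : ℝ} (hr : 0 < r)
    (h : ∀ i, HasWeakPartial (Metric.ball x₀ (2 * r)) i u fun _ => 0) :
    ∃ a, u =ᵐ[volume.restrict (Metric.ball x₀ r)] fun _ => a := by
  -- In dimension zero no index supplies the integrability of `u`, but the space is a point.
  rcases Nat.eq_zero_or_pos n with hn | hn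
  · subst hn
    exact ⟨u 0, .of_forall fun x => by rw [Subsingleton.elim x 0]⟩
  have hK : IsCompact (Metric.closedBall x₀ (3 * r / 2)) := isCompact_closedBall _ _
  have hKΩ : Metric.closedBall x₀ (3 * r / 2) ⊆ Metric.ball x₀ (2 * r) :=
    Metric.closedBall_subset_ball (by linarith)
  set U := (Metric.closedBall x₀ (3 * r / 2)).indicator u with hU
  have hu := (h ⟨0, hn⟩).1
  have hUi : Integrable U := (integrable_indicator_iff hK.measurableSet).2
    (hu.integrableOn_compact_subset hKΩ hK)
  let ρ : ℕ → ℝ := fun k => (r / 2) * (1 / ((k : ℝ) + 1))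
  have hρ : ∀ k, 0 < ρ k := fun k => by positivity
  have hρr : ∀ k, ρ k ≤ r / 2 := fun k => by
    have : 1 / ((k : ℝ) + 1) ≤ 1 := (div_le_one (by positivity)).2 (by
      have := Nat.cast_nonneg (α := ℝ) k; linarith)
    exact mul_le_of_le_one_right (by positivity) this
  have hρ0 : Tendsto ρ atTop (𝓝 0) := by
    have := (tendsto_one_div_add_atTop_nhds_zero_nat (𝕜 := ℝ)).const_mul (r / 2)
    rwa [mul_zero] at this
  let b : ℕ → ContDiffBump (0 : RVec n) := fun k => smallBump 0 (hρ k)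
  have hlim := tendsto_eLpNorm_mollify_sub b (by simpa [b, smallBump] using hρ0) hUi
  have hm : TendstoInMeasure volume (fun k => mollify (b k) U) atTop U :=
    tendstoInMeasure_of_tendsto_eLpNorm one_ne_zero
      (fun k => (integrable_mollify _ hUi).aestronglyMeasurable) hUi.aestronglyMeasurable hlim
  obtain ⟨φ, -, hφ⟩ := hm.exists_seq_tendsto_ae
  have hconst : ∀ k, ∀ x ∈ Metric.ball x₀ r, ∀ y ∈ Metric.ball x₀ r,
      mollify (b k) U x = mollify (b k) U y := by
    intro k x hx y hy
    refine (Metric.isOpen_ball.is_const_of_fderiv_eq_zero (𝕜 := ℝ)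
      (convex_ball x₀ r).isPreconnected
      ((contDiff_mollify (b k) hUi).differentiable (by simp)).differentiableOn
      (fun z hz => ?_) hx hy)
    ext v
    rw [fderiv_mollify (b k) (G := fun _ => 0) hUi (V := Metric.ball x₀ (3 * r / 2))]
    · simp [mollify_apply]
    · intro ψ hψ
      have h1 := integral_mul_fderiv_of_hasWeakPartial h hu (hψ.mono
        (Metric.ball_subset_ball (by linarith : 3 * r / 2 ≤ 2 * r))) v
      simp only [mul_zero, Finset.sum_const_zero, zero_mul, integral_zero, neg_zero] at h1 ⊢
      rw [← h1]
      refine integral_congr_ae (.of_forall fun x => ?_)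
      simp only
      by_cases hx : x ∈ Metric.closedBall x₀ (3 * r / 2)
      · rw [hU, Set.indicator_of_mem hx]
      · have h0 : fderiv ℝ ψ x v = 0 := image_eq_zero_of_notMem_tsupport
          (f := fun x => fderiv ℝ ψ x v) fun hx' => hx (Metric.ball_subset_closedBall
            ((hψ.fderiv_apply v).3 hx'))
        rw [h0, mul_zero, mul_zero]
    · intro w hw
      rw [mem_closedBall_zero_iff] at hw
      rw [Metric.mem_ball] at hz ⊢
      have h1 : dist (z - w) x₀ ≤ dist z x₀ + ‖w‖ := by
        rw [dist_eq_norm, dist_eq_norm, show z - w - x₀ = (z - x₀) - w by abel]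
        exact norm_sub_le _ _
      have h2 : (b k).rOut ≤ r / 2 := hρr k
      linarith
  have hφ' : ∀ᵐ x ∂(volume.restrict (Metric.ball x₀ r)),
      Tendsto (fun k => mollify (b (φ k)) U x) atTop (𝓝 (U x)) := ae_restrict_of_ae hφ
  have hne : (ae (volume.restrict (Metric.ball x₀ r))).NeBot := by
    rw [ae_restrict_neBot]
    exact (Metric.measure_ball_pos _ _ hr).ne'
  obtain ⟨x₁, hx₁, hx₁b⟩ := (hφ'.and (ae_restrict_mem measurableSet_ball)).exists
  refine ⟨U x₁, ?_⟩
  filter_upwards [hφ', ae_restrict_mem measurableSet_ball] with x hx hxb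
  have h1 : U x = u x := Set.indicator_of_mem
    (Metric.ball_subset_closedBall (Metric.ball_subset_ball (by linarith) hxb)) u
  rw [← h1]
  exact tendsto_nhds_unique hx (hx₁.congr fun k => hconst _ _ hx₁b _ hxb)

/-- A function with zero weak gradient on a connected open set is constant almost everywhere. -/
theorem exists_ae_eq_const_of_hasWeakPartial_zero {Ω : Set (RVec n)} (hΩ : IsOpen Ω)
    (hc : IsPreconnected Ω) {u : RVec n → ℝ} (h : ∀ i, HasWeakPartial Ω i u fun _ => 0) :
    ∃ a, u =ᵐ[volume.restrict Ω] fun _ => a := by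
  rcases Ω.eq_empty_or_nonempty with rfl | ⟨x₀, hx₀⟩
  · exact ⟨0, by rw [Measure.restrict_empty, ae_zero]; exact eventually_bot⟩
  have hloc : ∀ x : RVec n, ∃ a r, x ∈ Ω → 0 < r ∧
      u =ᵐ[volume.restrict (Metric.ball x r)] fun _ => a := by
    intro x
    by_cases hx : x ∈ Ω
    · obtain ⟨r, hr, hrΩ⟩ := Metric.isOpen_iff.1 hΩ x hx
      obtain ⟨a, ha⟩ := ae_eq_const_on_ball (x₀ := x) (half_pos hr)
        fun i => (h i).mono (by rwa [mul_div_cancel₀ _ two_ne_zero])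
      exact ⟨a, r / 2, fun _ => ⟨half_pos hr, ha⟩⟩
    · exact ⟨0, 0, fun h => absurd h hx⟩
  choose a r har using hloc
  -- Overlapping balls meet in a set of positive measure, so nearby local constants agree;
  -- connectedness spreads this over Ω.
  have heq : ∀ x ∈ Ω, ∀ y ∈ Ω, a x = a y := by
    refine fun x hx y hy => hc.induction₂ (fun x y => a x = a y) (fun x hx => ?_)
      (fun x y z _ _ _ => Eq.trans) (fun x y _ _ => Eq.symm) hx hy
    filter_upwards [mem_nhdsWithin_of_mem_nhds (Metric.ball_mem_nhds x (har x hx).1),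
      self_mem_nhdsWithin] with y hy hyΩ
    have hopen : IsOpen (Metric.ball x (r x) ∩ Metric.ball y (r y)) :=
      Metric.isOpen_ball.inter Metric.isOpen_ball
    have hne : (ae (volume.restrict (Metric.ball x (r x) ∩ Metric.ball y (r y)))).NeBot := by
      rw [ae_restrict_neBot]
      exact (hopen.measure_pos volume ⟨y, hy, Metric.mem_ball_self (har y hyΩ).1⟩).ne'
    have h1 := ae_restrict_of_ae_restrict_of_subset
      (s := Metric.ball x (r x) ∩ Metric.ball y (r y)) Set.inter_subset_left (har x hx).2
    have h2 := ae_restrict_of_ae_restrict_of_subset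
      (s := Metric.ball x (r x) ∩ Metric.ball y (r y)) Set.inter_subset_right (har y hyΩ).2
    obtain ⟨z, hz1, hz2⟩ := (Filter.Eventually.and h1 h2).exists
    exact hz1.symm.trans hz2
  refine ⟨a x₀, ae_restrict_of_locally hΩ fun x hx => ⟨r x, (har x hx).1, ?_⟩⟩
  filter_upwards [(har x hx).2] with y hy
  rw [hy, heq x hx x₀ hx₀]

end Constant

/-! ### The Poincaré inequality on balls and local potentials -/

section Poincare

variable {n : ℕ}

/-- The Jacobian t^{-n} of the dilation is at most 2^n. -/
theorem lintegral_comp_add_smul_le {h : RVec n → ℝ≥0∞} (hh : Measurable h) (c : RVec n) {t : ℝ}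
    (ht : 1 / 2 ≤ t) : ∫⁻ x, h (c + t • x) ≤ 2 ^ n * ∫⁻ x, h x := by
  have ht0 : 0 < t := by linarith
  have h1 : ∫⁻ x, h (c + t • x) = ∫⁻ x, h (c + x) ∂(Measure.map (t • ·) volume) := by
    have hm : Measurable fun x => h (c + x) := hh.comp (measurable_const_add c)
    rw [lintegral_map hm (measurable_const_smul t)]
  rw [h1, Measure.map_addHaar_smul _ ht0.ne', lintegral_smul_measure,
    lintegral_add_left_eq_self (fun x => h x) c, smul_eq_mul, finrank_euclideanSpace_fin]
  gcongr
  rw [abs_of_pos (by positivity), ← inv_pow, ENNReal.ofReal_pow (by positivity)]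
  gcongr
  rw [← ENNReal.ofReal_ofNat]
  exact ENNReal.ofReal_le_ofReal (by rw [inv_le_comm₀ ht0 two_pos]; linarith)

/-- One of `t` and `1 - t` is at least 1/2. Changing variables in the corresponding endpoint avoids
the degenerate Jacobian. -/
theorem lintegral_lintegral_segment_le (s : Set (RVec n)) {h : RVec n → ℝ≥0∞} (hh : Measurable h)
    {t : ℝ} : ∫⁻ x in s, ∫⁻ y in s, h (y + t • (x - y)) ≤ volume s * (2 ^ n * ∫⁻ x, h x) := by
  have key : ∀ {t : ℝ}, 1 / 2 ≤ t → ∫⁻ y in s, ∫⁻ x in s, h (y + t • (x - y)) ≤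
      volume s * (2 ^ n * ∫⁻ x, h x) := by
    intro t ht
    calc ∫⁻ y in s, ∫⁻ x in s, h (y + t • (x - y))
        ≤ ∫⁻ _ in s, 2 ^ n * ∫⁻ x, h x := by
          refine lintegral_mono fun y => ?_
          refine (setLIntegral_le_lintegral _ _).trans ?_
          have e : ∀ x, y + t • (x - y) = (y - t • y) + t • x := fun x => by
            rw [smul_sub]; abel
          simp only [e]
          exact lintegral_comp_add_smul_le hh _ ht
      _ = _ := by rw [setLIntegral_const, mul_comm]
  rcases le_total (1 / 2) t with ht | ht
  · rw [lintegral_lintegral_swap]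
    · exact key ht
    · exact (hh.comp (by fun_prop)).aemeasurable
  · have e : ∀ x y : RVec n, y + t • (x - y) = x + (1 - t) • (y - x) := fun x y => by
      simp only [smul_sub, sub_smul, one_smul]; abel
    simp only [e]
    exact key (by linarith)

theorem enorm_sub_le_lintegral_segment {x₀ : RVec n} {r : ℝ} {w : RVec n → ℝ}
    {W : RVec n → RVec n →L[ℝ] ℝ} (hW : Continuous W)
    (hw : ∀ x ∈ Metric.ball x₀ r, HasFDerivAt w (W x) x) {x y : RVec n}
    (hx : x ∈ Metric.ball x₀ r) (hy : y ∈ Metric.ball x₀ r) :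
    ‖w x - w y‖ₑ ≤ ENNReal.ofReal (2 * r) * ∫⁻ t in Set.Ioc (0 : ℝ) 1,
      (Metric.ball x₀ r).indicator (fun x => ‖W x‖ₑ) (y + t • (x - y)) := by
  have hseg : ∀ t ∈ Set.Icc (0 : ℝ) 1, y + t • (x - y) ∈ Metric.ball x₀ r := fun t ht =>
    (convex_ball x₀ r).add_smul_sub_mem hy hx ht
  have hd : ∀ t ∈ Set.uIcc (0 : ℝ) 1, HasDerivAt (fun t : ℝ => w (y + t • (x - y)))
      (W (y + t • (x - y)) (x - y)) t := fun t ht => by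
    rw [Set.uIcc_of_le zero_le_one] at ht
    have h1 : HasDerivAt (fun t : ℝ => y + t • (x - y)) (x - y) t := by
      simpa using ((hasDerivAt_id t).smul_const (x - y)).const_add y
    exact (hw _ (hseg t ht)).comp_hasDerivAt t h1
  have hint := intervalIntegral.integral_eq_sub_of_hasDerivAt hd
    (Continuous.intervalIntegrable (by fun_prop) _ _)
  simp only [one_smul, zero_smul, add_zero, add_sub_cancel] at hint
  rw [← hint, intervalIntegral.integral_of_le zero_le_one]
  refine (enorm_integral_le_lintegral_enorm _).trans ?_
  rw [← lintegral_const_mul' _ _ ENNReal.ofReal_ne_top]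
  refine setLIntegral_mono' measurableSet_Ioc fun t ht => ?_
  rw [Set.indicator_of_mem (hseg t ⟨ht.1.le, ht.2⟩), mul_comm]
  refine (ContinuousLinearMap.le_opENorm _ _).trans ?_
  gcongr
  rw [← ofReal_norm]
  refine ENNReal.ofReal_le_ofReal ?_
  rw [Metric.mem_ball] at hx hy
  rw [← dist_eq_norm]
  linarith [dist_triangle_right x y x₀]

theorem lintegral_lintegral_lintegral_segment_le (s : Set (RVec n)) {h : RVec n → ℝ≥0∞}
    (hh : Measurable h) :
    ∫⁻ x in s, ∫⁻ y in s, ∫⁻ t in Set.Ioc (0 : ℝ) 1, h (y + t • (x - y)) ≤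
      volume s * (2 ^ n * ∫⁻ x, h x) := by
  have hswap : ∫⁻ x in s, ∫⁻ y in s, ∫⁻ t in Set.Ioc (0 : ℝ) 1, h (y + t • (x - y)) =
      ∫⁻ t in Set.Ioc (0 : ℝ) 1, ∫⁻ x in s, ∫⁻ y in s, h (y + t • (x - y)) := by
    have e1 : ∀ x, ∫⁻ y in s, ∫⁻ t in Set.Ioc (0 : ℝ) 1, h (y + t • (x - y)) =
        ∫⁻ t in Set.Ioc (0 : ℝ) 1, ∫⁻ y in s, h (y + t • (x - y)) := fun x => by
      have hm : Measurable fun z : RVec n × ℝ => h (z.1 + z.2 • (x - z.1)) :=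
        hh.comp (by fun_prop)
      exact lintegral_lintegral_swap hm.aemeasurable
    simp only [e1]
    have hm5 : Measurable fun z : (RVec n × ℝ) × RVec n => h (z.2 + z.1.2 • (z.1.1 - z.2)) :=
      hh.comp (by fun_prop)
    exact lintegral_lintegral_swap
      (hm5.lintegral_prod_right' (ν := volume.restrict s)).aemeasurable
  rw [hswap]
  refine (lintegral_mono fun t => lintegral_lintegral_segment_le s hh).trans ?_
  simp

/-- The Poincaré inequality in `L¹` on a ball. -/
theorem lintegral_sub_average_le {x₀ : RVec n} {r : ℝ} (hr : 0 < r) {w : RVec n → ℝ}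
    {W : RVec n → RVec n →L[ℝ] ℝ} (hW : Continuous W)
    (hw : ∀ x ∈ Metric.ball x₀ r, HasFDerivAt w (W x) x)
    (hwi : IntegrableOn w (Metric.ball x₀ r)) :
    ∫⁻ x in Metric.ball x₀ r, ‖w x - ⨍ y in Metric.ball x₀ r, w y‖ₑ ≤
      ENNReal.ofReal (2 * r) * (2 ^ n * ∫⁻ x in Metric.ball x₀ r, ‖W x‖ₑ) := by
  have hB0 : volume (Metric.ball x₀ r) ≠ 0 := (Metric.measure_ball_pos _ _ hr).ne'
  have hBt : volume (Metric.ball x₀ r) ≠ ⊤ := measure_ball_lt_top.ne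
  have hhm : Measurable ((Metric.ball x₀ r).indicator fun x => ‖W x‖ₑ) :=
    hW.enorm.measurable.indicator measurableSet_ball
  have hpt := fun x hx y hy => enorm_sub_le_lintegral_segment (x := x) (y := y) hW hw hx hy
  have htri := lintegral_lintegral_lintegral_segment_le (Metric.ball x₀ r) hhm
  rw [lintegral_indicator measurableSet_ball] at htri
  set h : RVec n → ℝ≥0∞ := (Metric.ball x₀ r).indicator fun x => ‖W x‖ₑ
  set B := Metric.ball x₀ r with hB
  have : IsFiniteMeasure (volume.restrict B) := ⟨by rwa [Measure.restrict_apply_univ,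
    lt_top_iff_ne_top]⟩
  -- The deviation from the mean is the mean of differences, each of which is an integral along a
  -- segment.
  have hw1 : ∀ x, w x - ⨍ y in B, w y = ⨍ y in B, (w x - w y) := fun x => by
    rw [average_eq, average_eq, integral_sub (integrable_const _) hwi, integral_const, smul_sub,
      smul_smul, inv_mul_cancel₀, one_smul]
    rw [measureReal_def, Measure.restrict_apply_univ]
    exact (ENNReal.toReal_pos hB0 hBt).ne'
  have hw2 : ∀ x ∈ B, ‖w x - ⨍ y in B, w y‖ₑ ≤ (volume B)⁻¹ * (ENNReal.ofReal (2 * r) *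
      ∫⁻ y in B, ∫⁻ t in Set.Ioc (0 : ℝ) 1, h (y + t • (x - y))) := fun x hx => by
    rw [hw1, average]
    refine (enorm_integral_le_lintegral_enorm _).trans ?_
    rw [lintegral_smul_measure, Measure.restrict_apply_univ, smul_eq_mul,
      ← lintegral_const_mul' _ _ ENNReal.ofReal_ne_top]
    gcongr 1
    exact setLIntegral_mono' measurableSet_ball fun y hy => hpt x hx y hy
  refine (setLIntegral_mono' measurableSet_ball hw2).trans ?_
  rw [lintegral_const_mul' _ _ (ENNReal.inv_ne_top.2 hB0),
    lintegral_const_mul' _ _ ENNReal.ofReal_ne_top]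
  calc (volume B)⁻¹ * (ENNReal.ofReal (2 * r) * _)
      ≤ (volume B)⁻¹ * (ENNReal.ofReal (2 * r) *
        (volume B * (2 ^ n * ∫⁻ x in B, ‖W x‖ₑ))) := by gcongr
    _ = ((volume B)⁻¹ * volume B) *
        (ENNReal.ofReal (2 * r) * (2 ^ n * ∫⁻ x in B, ‖W x‖ₑ)) := by ring
    _ = _ := by rw [ENNReal.inv_mul_cancel hB0 hBt, one_mul]

end Poincare

/-! ### Local potentials of weakly curl-free fields -/

section LocalPotential

variable {n : ℕ}

/-- The field `g` is curl-free in `Ω` in the sense of distributions. -/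
def IsWeaklyCurlFree (Ω : Set (RVec n)) (g : Fin n → RVec n → ℝ) : Prop :=
  ∀ i j φ, IsTestFunction Ω φ →
    ∫ x, g j x * fderiv ℝ φ x (EuclideanSpace.single i 1) =
      ∫ x, g i x * fderiv ℝ φ x (EuclideanSpace.single j 1)

/-- The one-form with the components `g`. -/
noncomputable def oneForm (g : Fin n → RVec n → ℝ) (x : RVec n) : RVec n →L[ℝ] ℝ :=
  ∑ i, g i x • EuclideanSpace.proj i

theorem oneForm_apply (g : Fin n → RVec n → ℝ) (x v : RVec n) :
    oneForm g x v = ∑ i, g i x * v i := by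
  simp [oneForm]

theorem oneForm_single (g : Fin n → RVec n → ℝ) (x : RVec n) (i : Fin n) :
    oneForm g x (EuclideanSpace.single i 1) = g i x := by
  simp [oneForm_apply]

theorem enorm_oneForm_le (g : Fin n → RVec n → ℝ) (x : RVec n) :
    ‖oneForm g x‖ₑ ≤ ∑ i, ‖g i x‖ₑ := by
  refine (enorm_sum_le Finset.univ
    fun i => g i x • (EuclideanSpace.proj i : RVec n →L[ℝ] ℝ)).trans
      (Finset.sum_le_sum fun i _ => ?_)
  rw [enorm_smul]
  refine mul_le_of_le_one_right (by simp) ?_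
  rw [← ofReal_norm, ← ENNReal.ofReal_one]
  refine ENNReal.ofReal_le_ofReal (ContinuousLinearMap.opNorm_le_bound _ zero_le_one fun v => ?_)
  rw [one_mul]
  exact PiLp.norm_apply_le v i

theorem contDiff_oneForm {g : Fin n → RVec n → ℝ} (hg : ∀ i, ContDiff ℝ ∞ (g i)) :
    ContDiff ℝ ∞ (oneForm g) :=
  ContDiff.sum fun i _ => (hg i).smul contDiff_const

theorem fderiv_oneForm_apply {g : Fin n → RVec n → ℝ} (hg : ∀ i, ContDiff ℝ ∞ (g i))
    (x v w : RVec n) : fderiv ℝ (oneForm g) x v w = ∑ i, fderiv ℝ (g i) x v * w i := by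
  have h : HasFDerivAt (oneForm g)
      (∑ i, (fderiv ℝ (g i) x).smulRight (EuclideanSpace.proj i : RVec n →L[ℝ] ℝ)) x := by
    refine HasFDerivAt.fun_sum fun i _ => ?_
    exact (((hg i).differentiable (by simp)) x).hasFDerivAt.smul_const
      (EuclideanSpace.proj i : RVec n →L[ℝ] ℝ)
  rw [h.fderiv]
  simp

theorem fderiv_oneForm_symm {g : Fin n → RVec n → ℝ} (hg : ∀ i, ContDiff ℝ ∞ (g i)) {x : RVec n}
    (hc : ∀ i j, fderiv ℝ (g j) x (EuclideanSpace.single i 1) =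
      fderiv ℝ (g i) x (EuclideanSpace.single j 1)) (v w : RVec n) :
    fderiv ℝ (oneForm g) x v w = fderiv ℝ (oneForm g) x w v := by
  have e : ∀ v w : RVec n, fderiv ℝ (oneForm g) x v w =
      ∑ i, ∑ j, v j * fderiv ℝ (g i) x (EuclideanSpace.single j 1) * w i := fun v w => by
    rw [fderiv_oneForm_apply hg]
    refine Finset.sum_congr rfl fun i _ => ?_
    conv_lhs => rw [RVec.eq_sum_smul_single v]
    simp [map_sum, Finset.sum_mul]
  rw [e, e, Finset.sum_comm]
  refine Finset.sum_congr rfl fun i _ => Finset.sum_congr rfl fun j _ => ?_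
  rw [hc i j]; ring

/-- A weakly curl-free field in a ball has a potential in the concentric ball of half the
radius. -/
theorem exists_local_potential {x₀ : RVec n} {r : ℝ} (hr : 0 < r) {g : Fin n → RVec n → ℝ}
    (hg : ∀ i, LocallyIntegrableOn (g i) (Metric.ball x₀ (2 * r)))
    (hc : IsWeaklyCurlFree (Metric.ball x₀ (2 * r)) g) :
    ∃ w, IntegrableOn w (Metric.ball x₀ r) ∧
      ∀ i, HasWeakPartial (Metric.ball x₀ r) i w (g i) := by
  -- With mollification radii at most r/4, the mollified fields in the ball of radius 3r/2 depend
  -- only on values in the ball of radius 7r/4, whose closure is compact in the given ball.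
  set K := Metric.closedBall x₀ (7 * r / 4) with hK
  have hKc : IsCompact K := isCompact_closedBall _ _
  have hKB : K ⊆ Metric.ball x₀ (2 * r) := Metric.closedBall_subset_ball (by linarith)
  set B := Metric.ball x₀ r with hB
  have hBK : B ⊆ K := Metric.ball_subset_closedBall.trans
    (Metric.closedBall_subset_closedBall (by linarith))
  let U : Fin n → RVec n → ℝ := fun i => K.indicator (g i)
  have hU : ∀ i, Integrable (U i) := fun i => (integrable_indicator_iff hKc.measurableSet).2
    ((hg i).integrableOn_compact_subset hKB hKc)
  let ρ : ℕ → ℝ := fun k => (r / 4) * (1 / ((k : ℝ) + 1))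
  have hρ : ∀ k, 0 < ρ k := fun k => by positivity
  have hρr : ∀ k, ρ k ≤ r / 4 := fun k => by
    have : 1 / ((k : ℝ) + 1) ≤ 1 := (div_le_one (by positivity)).2 (by
      have := Nat.cast_nonneg (α := ℝ) k; linarith)
    exact mul_le_of_le_one_right (by positivity) this
  have hρ0 : Tendsto ρ atTop (𝓝 0) := by
    have := (tendsto_one_div_add_atTop_nhds_zero_nat (𝕜 := ℝ)).const_mul (r / 4)
    rwa [mul_zero] at this
  let b : ℕ → ContDiffBump (0 : RVec n) := fun k => smallBump 0 (hρ k)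
  have hlim : ∀ i, Tendsto (fun k => eLpNorm (fun x => mollify (b k) (U i) x - U i x) 1 volume)
      atTop (𝓝 0) := fun i =>
    tendsto_eLpNorm_mollify_sub b (by simpa [b, smallBump] using hρ0) (hU i)
  let γ : ℕ → Fin n → RVec n → ℝ := fun k i => mollify (b k) (U i)
  have hγ : ∀ k i, ContDiff ℝ ∞ (γ k i) := fun k i => contDiff_mollify _ (hU i)
  -- potentials of the mollified fields
  have hpot : ∀ k, ∃ w : RVec n → ℝ, ∀ x ∈ Metric.ball x₀ (3 * r / 2),
      HasFDerivAt w (oneForm (γ k) x) x := by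
    intro k
    -- The classical Poincaré lemma on a convex set. The mollified form is closed, as seen by
    -- testing the weak curl condition with a reflected kernel.
    refine (convex_ball x₀ (3 * r / 2)).exists_forall_hasFDerivAt_of_fderiv_symmetric
      Metric.isOpen_ball ((contDiff_oneForm (hγ k)).differentiable (by simp)).differentiableOn ?_
    intro x hx
    refine fderiv_oneForm_symm (hγ k) fun i j => ?_
    have hφ : IsTestFunction (Metric.ball x₀ (7 * r / 4))
        fun y => (b k).normed volume (x - y) := by
      refine isTestFunction_bump_sub _ fun y hy => ?_
      rw [mem_closedBall_zero_iff] at hy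
      rw [Metric.mem_ball] at hx ⊢
      have h1 : dist (x - y) x₀ ≤ dist x x₀ + ‖y‖ := by
        rw [dist_eq_norm, dist_eq_norm, show x - y - x₀ = (x - x₀) - y by abel]
        exact norm_sub_le _ _
      have h2 : (b k).rOut ≤ r / 4 := hρr k
      linarith
    have hind : ∀ i j, ∫ y, U j y * fderiv ℝ (fun y => (b k).normed volume (x - y)) y
        (EuclideanSpace.single i 1) = ∫ y, g j y * fderiv ℝ (fun y =>
          (b k).normed volume (x - y)) y (EuclideanSpace.single i 1) := fun i j => by
      refine integral_congr_ae (.of_forall fun y => ?_)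
      simp only
      by_cases hy : y ∈ K
      · simp only [U, Set.indicator_of_mem hy]
      · have := image_eq_zero_of_notMem_tsupport (f := fun y => fderiv ℝ (fun y =>
          (b k).normed volume (x - y)) y (EuclideanSpace.single i 1)) (x := y) fun hy' =>
            hy (Metric.ball_subset_closedBall ((hφ.fderiv_apply _).3 hy'))
        simp only at this
        rw [this, mul_zero, mul_zero]
    simp only [γ]
    rw [fderiv_mollify_eq_integral _ (hU j), fderiv_mollify_eq_integral _ (hU i), hind, hind,
      hc i j _ (hφ.mono (Metric.ball_subset_ball (by linarith)))]
  choose w hw using hpot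
  have hBw : B ⊆ Metric.ball x₀ (3 * r / 2) := Metric.ball_subset_ball (by linarith)
  have hwi : ∀ k, IntegrableOn (w k) B := fun k => by
    have hc : ContinuousOn (w k) (Metric.closedBall x₀ r) := fun x hx =>
      (hw k x (Metric.closedBall_subset_ball (by linarith) hx)).continuousAt.continuousWithinAt
    exact (hc.integrableOn_compact (isCompact_closedBall _ _)).mono_set Metric.ball_subset_closedBall
  have hBt : volume B ≠ ⊤ := measure_ball_lt_top.ne
  have : IsFiniteMeasure (volume.restrict B) := ⟨by rwa [Measure.restrict_apply_univ,
    lt_top_iff_ne_top]⟩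
  -- Subtracting the mean fixes the free constant, so that the Poincaré inequality makes the
  -- potentials Cauchy in L¹ together with the mollified fields.
  let v : ℕ → RVec n → ℝ := fun k x => w k x - ⨍ y in B, w k y
  have hvi : ∀ k, Integrable (v k) (volume.restrict B) := fun k =>
    (hwi k).sub (integrable_const _)
  have hvd : ∀ k, ∀ x ∈ B, HasFDerivAt (v k) (oneForm (γ k) x) x := fun k x hx =>
    (hw k x (hBw hx)).sub_const _
  set a : ℕ → ℝ≥0∞ := fun k => ∑ i, eLpNorm (fun x => γ k i x - U i x) 1 volume with ha
  have ha0 : Tendsto a atTop (𝓝 0) := by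
    simpa using tendsto_finsetSum Finset.univ fun i _ => hlim i
  set C : ℝ≥0∞ := ENNReal.ofReal (2 * r) * 2 ^ n with hC
  have hCt : C ≠ ⊤ := ENNReal.mul_ne_top ENNReal.ofReal_ne_top (by simp)
  have hdist : ∀ k l, eLpNorm (v k - v l) 1 (volume.restrict B) ≤ C * (a k + a l) := by
    intro k l
    have h1 := lintegral_sub_average_le hr (w := fun x => w k x - w l x)
      (W := fun x => oneForm (γ k) x - oneForm (γ l) x)
      ((contDiff_oneForm (hγ k)).continuous.sub (contDiff_oneForm (hγ l)).continuous)
      (fun x hx => (hw k x (hBw hx)).sub (hw l x (hBw hx))) ((hwi k).sub (hwi l))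
    rw [eLpNorm_one_eq_lintegral_enorm]
    have e : ∀ x, (v k - v l) x = w k x - w l x - ⨍ y in B, (w k y - w l y) := fun x => by
      simp only [v, Pi.sub_apply, average_eq]
      rw [integral_sub (hwi k) (hwi l), smul_sub]; ring
    simp only [e]
    refine h1.trans ?_
    rw [hC, mul_assoc]
    gcongr
    calc ∫⁻ x in B, ‖oneForm (γ k) x - oneForm (γ l) x‖ₑ
        ≤ ∫⁻ x in B, ∑ i, (‖γ k i x - U i x‖ₑ + ‖γ l i x - U i x‖ₑ) := by
          refine lintegral_mono fun x => ?_
          have e2 : oneForm (γ k) x - oneForm (γ l) x =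
              oneForm (fun i x => γ k i x - γ l i x) x := by
            ext y; simp [oneForm_apply, sub_mul]
          rw [e2]
          refine (enorm_oneForm_le _ _).trans (Finset.sum_le_sum fun i _ => ?_)
          calc ‖γ k i x - γ l i x‖ₑ = ‖(γ k i x - U i x) - (γ l i x - U i x)‖ₑ := by
                congr 1; ring
            _ ≤ _ := enorm_sub_le
      _ ≤ ∫⁻ x, ∑ i, (‖γ k i x - U i x‖ₑ + ‖γ l i x - U i x‖ₑ) :=
          setLIntegral_le_lintegral _ _
      _ = a k + a l := by
          have hm : ∀ k i, AEMeasurable (fun x => ‖γ k i x - U i x‖ₑ) volume := fun k i =>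
            ((hγ k i).continuous.aestronglyMeasurable.sub (hU i).aestronglyMeasurable).enorm
          have hm2 : ∀ i, AEMeasurable (fun x => ‖γ k i x - U i x‖ₑ + ‖γ l i x - U i x‖ₑ) volume :=
            fun i => (hm k i).add (hm l i)
          rw [lintegral_finsetSum' _ fun i _ => hm2 i, ha]
          simp only
          rw [← Finset.sum_add_distrib]
          refine Finset.sum_congr rfl fun i _ => ?_
          rw [lintegral_add_left' (hm k i), eLpNorm_one_eq_lintegral_enorm,
            eLpNorm_one_eq_lintegral_enorm]
  have hvL : ∀ k, MemLp (v k) 1 (volume.restrict B) := fun k => memLp_one_iff_integrable.2 (hvi k)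
  have hcauchy : CauchySeq fun k => (hvL k).toLp (v k) := by
    refine EMetric.cauchySeq_iff.2 fun ε hε => ?_
    have h2 : Tendsto (fun p : ℕ × ℕ => C * (a p.1 + a p.2)) (atTop ×ˢ atTop) (𝓝 0) := by
      have := ENNReal.Tendsto.const_mul ((ha0.comp tendsto_fst).add (ha0.comp tendsto_snd))
        (Or.inr hCt) (a := C)
      simpa using this
    rw [prod_atTop_atTop_eq] at h2
    obtain ⟨N, hN⟩ := eventually_atTop.1 (h2.eventually (gt_mem_nhds hε))
    refine ⟨max N.1 N.2, fun k hk l hl => ?_⟩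
    rw [Lp.edist_toLp_toLp]
    exact (hdist k l).trans_lt (hN (k, l) ⟨(le_max_left _ _).trans hk, (le_max_right _ _).trans hl⟩)
  obtain ⟨w₀, hw₀⟩ := cauchySeq_tendsto_of_complete hcauchy
  have hw₀i : IntegrableOn w₀ B := memLp_one_iff_integrable.1 (Lp.memLp w₀)
  have hvlim : Tendsto (fun k => ∫⁻ x in B, ‖v k x - w₀ x‖ₑ) atTop (𝓝 0) := by
    have h3 := tendsto_iff_edist_tendsto_0.1 hw₀
    refine h3.congr fun k => ?_
    rw [Lp.edist_def, eLpNorm_one_eq_lintegral_enorm]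
    refine lintegral_congr_ae ?_
    filter_upwards [(hvL k).coeFn_toLp] with x hx
    rw [Pi.sub_apply, hx]
  refine ⟨w₀, hw₀i, fun i => hasWeakPartial_of_integral_eq hw₀i.locallyIntegrableOn
    ((hg i).mono_set (hBK.trans hKB)) fun φ hφ => ?_⟩
  -- passage to the limit in the integration by parts formula
  have hlimit : ∀ (ψ : RVec n → ℝ) (hψ : IsTestFunction B ψ) (F : ℕ → RVec n → ℝ) (F₀ : RVec n → ℝ),
      (∀ k, IntegrableOn (F k) B) → IntegrableOn F₀ B →
      Tendsto (fun k => ∫⁻ x in B, ‖F k x - F₀ x‖ₑ) atTop (𝓝 0) →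
      Tendsto (fun k => ∫ x, F k x * ψ x) atTop (𝓝 (∫ x, F₀ x * ψ x)) := by
    intro ψ hψ F F₀ hF hF₀ hFl
    obtain ⟨M, hM⟩ := hψ.1.continuous.bounded_above_of_compact_support hψ.2
    simp only [← setIntegral_mul_eq_integral hψ.3]
    refine tendsto_integral_of_L1 _ (hF₀.mul_bdd (c := M)
      hψ.1.continuous.aestronglyMeasurable (.of_forall hM)).aestronglyMeasurable
      (.of_forall fun k => (hF k).mul_bdd (c := M) hψ.1.continuous.aestronglyMeasurable
        (.of_forall hM)) ?_
    have h4 : Tendsto (fun k => (∫⁻ x in B, ‖F k x - F₀ x‖ₑ) * ENNReal.ofReal M) atTop (𝓝 0) := by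
      have := ENNReal.Tendsto.mul_const hFl (Or.inr (ENNReal.ofReal_ne_top (r := M)))
      simpa using this
    refine tendsto_of_tendsto_of_tendsto_of_le_of_le tendsto_const_nhds h4 (fun _ => zero_le)
      fun k => ?_
    simp only
    rw [← lintegral_mul_const' _ _ ENNReal.ofReal_ne_top]
    refine lintegral_mono fun x => ?_
    rw [← sub_mul, enorm_mul]
    gcongr
    rw [← ofReal_norm]
    exact ENNReal.ofReal_le_ofReal (hM x)
  have hleft := hlimit _ (hφ.fderiv_apply (EuclideanSpace.single i 1)) v w₀ hvi hw₀i hvlim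
  have hright := hlimit φ hφ (fun k => γ k i) (U i)
    (fun k => (integrable_mollify _ (hU i)).integrableOn) (hU i).integrableOn (by
      refine tendsto_of_tendsto_of_tendsto_of_le_of_le tendsto_const_nhds (hlim i)
        (fun _ => zero_le) fun k => ?_
      rw [eLpNorm_one_eq_lintegral_enorm]
      exact setLIntegral_le_lintegral _ _)
  have heq : ∀ k, ∫ x, v k x * fderiv ℝ φ x (EuclideanSpace.single i 1) =
      -∫ x, γ k i x * φ x := by
    intro k
    have hγi : LocallyIntegrableOn (γ k i) B :=
      (hγ k i).continuous.locallyIntegrable.locallyIntegrableOn B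
    have hfd : ∀ x, γ k i x * φ x = fderiv ℝ (v k) x (EuclideanSpace.single i 1) * φ x :=
      fun x => by
        by_cases hx : x ∈ tsupport φ
        · rw [(hvd k x (hφ.3 hx)).fderiv, oneForm_single]
        · rw [image_eq_zero_of_notMem_tsupport hx, mul_zero, mul_zero]
    simp only [hfd]
    refine integral_mul_fderiv_eq_neg_fderiv_mul_of_integrable ?_
      ((hφ.fderiv_apply _).integrable_mul (show IntegrableOn (v k) B volume from hvi k).locallyIntegrableOn)
      (hφ.integrable_mul (show IntegrableOn (v k) B volume from hvi k).locallyIntegrableOn)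
      (fun x hx => (hvd k x (hφ.3 hx)).differentiableAt)
      (fun x _ => hφ.1.differentiable (by simp) x)
    simp only [← hfd]
    exact hφ.integrable_mul hγi
  have h5 : ∫ x, U i x * φ x = ∫ x, g i x * φ x := by
    refine integral_congr_ae (.of_forall fun x => ?_)
    simp only
    by_cases hx : x ∈ tsupport φ
    · simp only [U, Set.indicator_of_mem (hBK (hφ.3 hx))]
    · rw [image_eq_zero_of_notMem_tsupport hx, mul_zero, mul_zero]
  rw [← h5]
  simp only [heq] at hleft
  exact tendsto_nhds_unique hleft hright.neg

end LocalPotential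

/-! ### Smooth partitions of unity and gluing of local potentials -/

section Gluing

variable {n : ℕ}

open scoped Manifold in
/-- Finite smooth partitions of unity on a compact set, subordinate to a family of balls. -/
theorem exists_smooth_partition {K : Set (RVec n)} (hK : IsCompact K) {r : RVec n → ℝ}
    (hr : ∀ x ∈ K, 0 < r x) :
    ∃ (t : Finset (RVec n)) (ζ : t → RVec n → ℝ), (∀ x ∈ t, x ∈ K) ∧
      (∀ x : t, IsTestFunction (Metric.ball (x : RVec n) (r x)) (ζ x)) ∧
      ∀ y ∈ K, ∑ x, ζ x y = 1 := by
  obtain ⟨t, htK, ht⟩ := hK.elim_nhds_subcover (fun x => Metric.ball x (r x))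
    fun x hx => Metric.ball_mem_nhds x (hr x hx)
  obtain ⟨f, hf⟩ := SmoothPartitionOfUnity.exists_isSubordinate 𝓘(ℝ, RVec n) hK.isClosed
    (fun x : t => Metric.ball (x : RVec n) (r x)) (fun _ => Metric.isOpen_ball)
    (by simpa [Set.iUnion_subtype] using ht)
  refine ⟨t, fun x => f x, htK, fun x => ⟨(f x).contMDiff.contDiff, ?_, hf x⟩, fun y hy => ?_⟩
  · exact Metric.isCompact_of_isClosed_isBounded (isClosed_tsupport _)
      (Metric.isBounded_ball.subset (hf x))
  · rw [← finsum_eq_sum_of_fintype]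
    exact f.sum_eq_one hy

theorem IsTestFunction.mul {Ω V : Set (RVec n)} {φ ζ : RVec n → ℝ} (hζ : IsTestFunction V ζ)
    (hφ : IsTestFunction Ω φ) : IsTestFunction (V ∩ Ω) fun x => ζ x * φ x := by
  refine ⟨hζ.1.mul hφ.1, hζ.2.mul_right, fun x hx => ⟨hζ.3 ?_, hφ.3 ?_⟩⟩
  · exact tsupport_mul_subset_left hx
  · exact tsupport_mul_subset_right hx

/-- Weak differentiability is a local property. -/
theorem hasWeakPartial_of_locally {Ω : Set (RVec n)} {i : Fin n} {u g : RVec n → ℝ}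
    (hu : LocallyIntegrableOn u Ω) (hg : LocallyIntegrableOn g Ω) {r : RVec n → ℝ}
    (hr : ∀ x ∈ Ω, 0 < r x) (h : ∀ x ∈ Ω, HasWeakPartial (Metric.ball x (r x)) i u g) :
    HasWeakPartial Ω i u g := by
  refine hasWeakPartial_of_integral_eq hu hg fun φ hφ => ?_
  obtain ⟨t, ζ, htK, hζ, hsum⟩ := exists_smooth_partition hφ.2 fun x hx => hr x (hφ.3 hx)
  have hφζ : φ = fun x => ∑ k, ζ k x * φ x := funext fun x => by
    rw [← Finset.sum_mul]
    by_cases hx : x ∈ tsupport φ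
    · rw [hsum x hx, one_mul]
    · rw [image_eq_zero_of_notMem_tsupport hx, mul_zero]
  have hd : ∀ x, fderiv ℝ φ x (EuclideanSpace.single i 1) =
      ∑ k, fderiv ℝ (fun x => ζ k x * φ x) x (EuclideanSpace.single i 1) := fun x => by
    conv_lhs => rw [hφζ]
    rw [fderiv_fun_sum fun k _ => ((hζ k).mul hφ).1.differentiable (by simp) x]
    simp
  have e1 : ∫ x, u x * fderiv ℝ φ x (EuclideanSpace.single i 1) =
      ∑ k, ∫ x, u x * fderiv ℝ (fun x => ζ k x * φ x) x (EuclideanSpace.single i 1) := by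
    simp only [hd, Finset.mul_sum]
    exact integral_finsetSum _ fun k _ => ((((hζ k).mul hφ).mono
      Set.inter_subset_right).fderiv_apply _).integrable_mul hu
  have e2 : ∫ x, g x * φ x = ∑ k, ∫ x, g x * (ζ k x * φ x) := by
    rw [← integral_finsetSum _ fun k _ => (((hζ k).mul hφ).mono
      Set.inter_subset_right).integrable_mul hg]
    refine integral_congr_ae (.of_forall fun x => ?_)
    simp only
    rw [← Finset.mul_sum, ← congrFun hφζ x]
  rw [e1, e2, ← Finset.sum_neg_distrib]
  refine Finset.sum_congr rfl fun k _ => ?_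
  exact (h k (hφ.3 (htK k k.2))).integral_mul_fderiv (((hζ k).mul hφ).mono Set.inter_subset_left)

/-- On a simply connected, locally path connected space, a locally constant one-cocycle on a cover
by connected open sets is a coboundary. -/
theorem exists_coboundary_of_cocycle {X : Type*} [TopologicalSpace X] [SimplyConnectedSpace X]
    [LocallyPathConnectedSpace X] {A : Type*} [AddCommGroup A] {B : X → Set X}
    (hB : ∀ x, IsOpen (B x)) (hxB : ∀ x, x ∈ B x) (hBc : ∀ x, IsPreconnected (B x)) {c : X → X → A}
    (hc : ∀ i j k, (B i ∩ B j ∩ B k).Nonempty → c i j + c j k = c i k) :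
    ∃ a : X → A, ∀ i j, (B i ∩ B j).Nonempty → a j = a i + c i j := by
  let _ : TopologicalSpace A := ⊥
  have : DiscreteTopology A := ⟨rfl⟩
  -- The cocycle glues the sets `B i × A`, with discrete fibre, into a covering space of `X`. Simple
  -- connectedness provides a global section, and its values in the charts form the coboundary.
  let Z : FiberBundleCore X X A :=
    { baseSet := B
      isOpen_baseSet := hB
      indexAt := id
      mem_baseSet_at := hxB
      coordChange := fun i j _ v => v + c i j
      coordChange_self := fun i x hx v => by
        have := hc i i i ⟨x, ⟨hx, hx⟩, hx⟩
        rw [add_eq_left.1 this, add_zero]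
      continuousOn_coordChange := fun i j =>
        ((continuous_of_discreteTopology (f := fun v : A => v + c i j)).comp
          continuous_snd).continuousOn
      coordChange_comp := fun i j k x hx v => by rw [add_assoc, hc i j k ⟨x, hx⟩] }
  have hcov : IsCoveringMap Z.proj :=
    IsFiberBundle.isCoveringMap fun x => ⟨Z.localTriv x, hxB x⟩
  have x₀ : X := Classical.arbitrary X
  obtain ⟨s, ⟨-, hs⟩, -⟩ := hcov.existsUnique_continuousMap_lifts (ContinuousMap.id X) x₀
    (⟨x₀, (0 : A)⟩ : Z.TotalSpace) rfl
  have hs' : ∀ x, Z.proj (s x) = x := fun x => congrFun hs x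
  let σ : X → X → A := fun i x => (Z.localTriv i (s x)).2
  -- In a chart the section is a continuous map from a preconnected set into a discrete group.
  have hσ : ∀ i x y, x ∈ B i → y ∈ B i → σ i x = σ i y := by
    intro i x y hx hy
    refine (hBc i).constant (f := σ i) ?_ hx hy
    refine continuous_snd.comp_continuousOn ((Z.localTriv i).continuousOn.comp
      s.continuous.continuousOn fun z hz => ?_)
    rw [FiberBundleCore.mem_localTriv_source]
    change Z.proj (s z) ∈ B i
    rwa [hs' z]
  have hσc : ∀ i j x, x ∈ B i → x ∈ B j → σ j x = σ i x + c i j := by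
    intro i j x hi hj
    simp only [σ, FiberBundleCore.localTriv_apply]
    have e : (s x).1 = x := hs' x
    have e2 : c (s x).1 i + c i j = c (s x).1 j :=
      hc _ i j ⟨x, ⟨by rw [e]; exact hxB x, hi⟩, hj⟩
    have e3 : ∀ y : A, y + c (s x).1 j = y + c (s x).1 i + c i j := fun y => by
      rw [add_assoc, e2]
    exact e3 (s x).2
  refine ⟨fun i => σ i i, fun i j ⟨x, hi, hj⟩ => ?_⟩
  simp only
  rw [hσ j j x (hxB j) hj, hσ i i x (hxB i) hi, hσc i j x hi hj]

/-- A weakly curl-free field in a simply connected domain has a potential. -/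
theorem exists_potential {Ω : Set (RVec n)} (hΩ : IsOpen Ω) (hsc : IsSimplyConnected Ω)
    {g : Fin n → RVec n → ℝ} (hg : ∀ i, LocallyIntegrableOn (g i) Ω) (hc : IsWeaklyCurlFree Ω g) :
    ∃ w, ∀ i, HasWeakPartial Ω i w (g i) := by
  have hloc : ∀ x : RVec n, ∃ r w, x ∈ Ω → 0 < r ∧ Metric.ball x r ⊆ Ω ∧
      IntegrableOn w (Metric.ball x r) ∧ ∀ i, HasWeakPartial (Metric.ball x r) i w (g i) := by
    intro x
    by_cases hx : x ∈ Ω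
    · obtain ⟨r, hr, hrΩ⟩ := Metric.isOpen_iff.1 hΩ x hx
      have h2 : 2 * (r / 2) = r := by ring
      obtain ⟨w, hw, hwg⟩ := exists_local_potential (x₀ := x) (half_pos hr)
        (fun i => (hg i).mono_set (by rwa [h2]))
        fun i j φ hφ => hc i j φ (hφ.mono (by rwa [h2]))
      exact ⟨r / 2, w, fun _ => ⟨half_pos hr,
        (Metric.ball_subset_ball (by linarith)).trans hrΩ, hw, hwg⟩⟩
    · exact ⟨0, 0, fun h => absurd h hx⟩
  choose r w hw using hloc
  have := hsc.simplyConnectedSpace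
  have : LocallyPathConnectedSpace Ω := hΩ.locallyPathConnectedSpace
  -- Intersections of balls are convex, hence connected, so two local potentials differ there by one
  -- constant. These constants form the cocycle.
  have hconst : ∀ x y : Ω, ∃ a : ℝ, w x =ᵐ[volume.restrict
      (Metric.ball (x : RVec n) (r x) ∩ Metric.ball (y : RVec n) (r y))] fun z => w y z + a := by
    intro x y
    obtain ⟨a, ha⟩ := exists_ae_eq_const_of_hasWeakPartial_zero
      (Ω := Metric.ball (x : RVec n) (r x) ∩ Metric.ball (y : RVec n) (r y))
      (Metric.isOpen_ball.inter Metric.isOpen_ball)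
      ((convex_ball _ _).inter (convex_ball _ _)).isPreconnected (u := fun z => w x z + -1 * w y z)
      fun i => by
        have h1 := (((hw x x.2).2.2.2 i).mono Set.inter_subset_left).add
          ((((hw y y.2).2.2.2 i).mono Set.inter_subset_right).const_mul (-1))
        refine h1.congr_ae (.of_forall fun _ => rfl) (.of_forall fun z => ?_)
        simp
    refine ⟨a, ha.mono fun z hz => ?_⟩
    simp only at hz ⊢
    linarith
  choose c hc' using hconst
  have hBo : ∀ x : Ω, IsOpen (Metric.ball (x : RVec n) (r x)) := fun _ => Metric.isOpen_ball
  obtain ⟨a, ha⟩ := exists_coboundary_of_cocycle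
    (B := fun x : Ω => Subtype.val ⁻¹' Metric.ball (x : RVec n) (r x)) (c := c)
    (fun x => (hBo x).preimage continuous_subtype_val)
    (fun x => Metric.mem_ball_self (hw x x.2).1)
    (fun x => by
      rw [← Topology.IsInducing.subtypeVal.isPreconnected_image, Subtype.image_preimage_coe,
        Set.inter_eq_right.2 (hw x x.2).2.1]
      exact (convex_ball _ _).isPreconnected)
    (fun i j k ⟨x, ⟨hi, hj⟩, hk⟩ => by
      have hne : volume (Metric.ball (i : RVec n) (r i) ∩ Metric.ball (j : RVec n) (r j) ∩
          Metric.ball (k : RVec n) (r k)) ≠ 0 :=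
        ((((hBo i).inter (hBo j)).inter (hBo k)).measure_pos volume ⟨x, ⟨hi, hj⟩, hk⟩).ne'
      have h1 := ae_restrict_of_ae_restrict_of_subset (s := Metric.ball (i : RVec n) (r i) ∩
        Metric.ball (j : RVec n) (r j) ∩ Metric.ball (k : RVec n) (r k)) (fun z hz => hz.1) (hc' i j)
      have h2 := ae_restrict_of_ae_restrict_of_subset (s := Metric.ball (i : RVec n) (r i) ∩
        Metric.ball (j : RVec n) (r j) ∩ Metric.ball (k : RVec n) (r k))
        (Set.inter_subset_inter_left _ Set.inter_subset_right) (hc' j k)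
      have h3 := ae_restrict_of_ae_restrict_of_subset (s := Metric.ball (i : RVec n) (r i) ∩
        Metric.ball (j : RVec n) (r j) ∩ Metric.ball (k : RVec n) (r k))
        (Set.inter_subset_inter_left _ Set.inter_subset_left) (hc' i k)
      have : (ae (volume.restrict (Metric.ball (i : RVec n) (r i) ∩
        Metric.ball (j : RVec n) (r j) ∩ Metric.ball (k : RVec n) (r k)))).NeBot :=
        ae_neBot.2 (by rwa [Ne, Measure.restrict_eq_zero])
      obtain ⟨z, hz1, hz2, hz3⟩ := (h1.and (h2.and h3)).exists
      simp only at hz1 hz2 hz3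
      linarith)
  -- Passing to countably many balls keeps the union of the exceptional null sets null; `W` then
  -- takes its value at each point from one ball of this subcover.
  obtain ⟨s, hsc', hs⟩ := TopologicalSpace.isOpen_iUnion_countable
    (fun x : Ω => Metric.ball (x : RVec n) (r x)) hBo
  have hcover : ∀ z : RVec n, ∃ x : Ω, z ∈ Ω → x ∈ s ∧ z ∈ Metric.ball (x : RVec n) (r x) := by
    intro z
    by_cases hz : z ∈ Ω
    · have : z ∈ ⋃ x ∈ s, Metric.ball (x : RVec n) (r x) := by
        rw [hs]
        exact Set.mem_iUnion.2 ⟨⟨z, hz⟩, Metric.mem_ball_self (hw z hz).1⟩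
      obtain ⟨x, hx, hzx⟩ := Set.mem_iUnion₂.1 this
      exact ⟨x, fun _ => ⟨hx, hzx⟩⟩
    · exact ⟨Classical.arbitrary Ω, fun h => absurd h hz⟩
  choose ι hι using hcover
  let W : RVec n → ℝ := fun z => w (ι z) z + a (ι z)
  have hW : ∀ x : Ω, W =ᵐ[volume.restrict (Metric.ball (x : RVec n) (r x))]
      fun z => w x z + a x := by
    intro x
    have h1 : ∀ᵐ z ∂(volume.restrict (Metric.ball (x : RVec n) (r x))), ∀ y ∈ s,
        z ∈ Metric.ball (y : RVec n) (r y) → w y z + a y = w x z + a x := by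
      refine (ae_ball_iff hsc').2 fun y _ => ?_
      have h2 := hc' x y
      rw [Set.inter_comm, ← Measure.restrict_restrict (hBo y).measurableSet] at h2
      rw [Filter.EventuallyEq, ae_restrict_iff' (hBo y).measurableSet] at h2
      filter_upwards [h2, ae_restrict_mem (hBo x).measurableSet] with z hz hzx hzy
      have h3 := ha x y ⟨⟨z, (hw x x.2).2.1 hzx⟩, hzx, hzy⟩
      rw [hz hzy, h3]; ring
    filter_upwards [h1, ae_restrict_mem (hBo x).measurableSet] with z hz hzx
    have hzΩ := (hw x x.2).2.1 hzx
    exact hz (ι z) (hι z hzΩ).1 (hι z hzΩ).2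
  have hWi : ∀ x : Ω, IntegrableOn W (Metric.ball (x : RVec n) (r x)) := fun x =>
    ((hw x x.2).2.2.1.add (integrableOn_const (measure_ball_lt_top.ne))).congr_fun_ae (hW x).symm
  refine ⟨W, fun i => hasWeakPartial_of_locally (fun x hx => ?_) (hg i) (fun x hx => (hw x hx).1)
    fun x hx => ?_⟩
  · exact ⟨_, mem_nhdsWithin_of_mem_nhds (Metric.ball_mem_nhds x (hw x hx).1), hWi ⟨x, hx⟩⟩
  · have h1 := ((hw x hx).2.2.2 i).add (hasWeakPartial_const (Metric.ball x (r x)) i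
      (a ⟨x, hx⟩))
    refine h1.congr_ae (hW ⟨x, hx⟩).symm (.of_forall fun z => ?_)
    simp

end Gluing

/-! ### Interior cones of Lipschitz domains and integrability up to the boundary -/

section Cones

variable {n : ℕ}

/-- Near a boundary point of a Lipschitz domain, the domain contains translated truncated cones. -/
theorem HasLipschitzBoundary.exists_interior_cone {Ω : Set (RVec n)} (h : HasLipschitzBoundary Ω)
    {x₀ : RVec n} (hx₀ : x₀ ∈ frontier Ω) :
    ∃ (e : RVec n) (K r : ℝ), ‖e‖ = 1 ∧ 0 ≤ K ∧ 0 < r ∧ ∀ x ∈ Ω ∩ Metric.ball x₀ r, ∀ s : ℝ, 0 ≤ s →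
      (K + 3) * s ≤ r → ∀ z : RVec n, ‖z‖ ≤ s → x + (((K + 2) * s) • e + z) ∈ Ω := by
  obtain ⟨e, he, K, γ, hγ, U, hU, hUΩ⟩ := h x₀ hx₀
  obtain ⟨r, hr, hrU⟩ := Metric.mem_nhds_iff.1 hU
  refine ⟨e, K, r / 2, he, K.2, half_pos hr, fun x ⟨hxΩ, hxb⟩ s hs hsr z hz => ?_⟩
  have hxb' : ‖x - x₀‖ < r / 2 := by rwa [← dist_eq_norm]
  have hn : ‖((K + 2) * s : ℝ) • e + z‖ ≤ (K + 3) * s := by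
    refine (norm_add_le _ _).trans ?_
    rw [norm_smul, he, Real.norm_of_nonneg (by positivity)]
    linarith
  have hxU : x ∈ U := hrU (by rw [Metric.mem_ball, dist_eq_norm]; linarith)
  have hyU : x + (((K + 2) * s : ℝ) • e + z) ∈ U := hrU (by
    rw [Metric.mem_ball, dist_eq_norm, add_sub_right_comm]
    have := norm_add_le (x - x₀) (((K + 2) * s : ℝ) • e + z)
    linarith)
  have hx := (hUΩ x hxU).1 hxΩ
  -- The displacement raises the height by at least (K + 1)s, while the graph of `γ` rises by at
  -- most Ks.
  refine (hUΩ _ hyU).2 ?_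
  set P := (ℝ ∙ e)ᗮ.orthogonalProjectionOnto with hP
  have hPe : P e = 0 := Submodule.orthogonalProjectionOnto_orthogonalComplement_singleton_eq_zero e
  have h1 : P (x + (((K + 2) * s : ℝ) • e + z)) - P x = P z := by
    rw [map_add, map_add, map_smul, hPe]; simp
  have h2 : ‖P z‖ ≤ s := ((ℝ ∙ e)ᗮ.norm_orthogonalProjectionOnto_apply_le z).trans hz
  have h3 : γ (P (x + (((K + 2) * s : ℝ) • e + z))) ≤ γ (P x) + K * s := by
    have h4 := hγ.dist_le_mul (P (x + (((K + 2) * s : ℝ) • e + z))) (P x)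
    rw [Real.dist_eq, dist_eq_norm, h1] at h4
    have h5 := le_abs_self (γ (P (x + (((K + 2) * s : ℝ) • e + z))) - γ (P x))
    have h6 := mul_le_mul_of_nonneg_left h2 K.2
    simp only [NNReal.val_eq_coe] at h6
    linarith
  have h7 : ⟪e, x + (((K + 2) * s : ℝ) • e + z)⟫ = ⟪e, x⟫ + ((K + 2) * s + ⟪e, z⟫) := by
    rw [inner_add_right, inner_add_right, inner_smul_right, real_inner_self_eq_norm_sq, he]
    ring
  have h8 : -s ≤ ⟪e, z⟫ := by
    have := abs_real_inner_le_norm e z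
    rw [he, one_mul] at this
    linarith [neg_abs_le ⟪e, z⟫]
  rw [h7]
  nlinarith [K.2]

/-- In a bounded Lipschitz domain, a weakly differentiable function with integrable weak gradient
is integrable. -/
theorem IsBoundedLipschitzDomain.integrableOn_of_hasWeakPartial {Ω : Set (RVec n)}
    (hΩ : IsBoundedLipschitzDomain Ω) {w : RVec n → ℝ} {g : Fin n → RVec n → ℝ}
    (hg : ∀ i, IntegrableOn (g i) Ω) (hw : ∀ i, HasWeakPartial Ω i w (g i))
    (hwl : LocallyIntegrableOn w Ω) : IntegrableOn w Ω := by
  have hΩm := hΩ.isOpen.measurableSet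
  rw [← integrable_indicator_iff hΩm]
  suffices hl : LocallyIntegrableOn (Ω.indicator w) (closure Ω) by
    have h1 := hl.integrableOn_isCompact
      (Metric.isCompact_of_isClosed_isBounded isClosed_closure hΩ.isBounded.closure)
    rw [integrable_indicator_iff hΩm]
    exact (h1.mono_set subset_closure).congr_fun (fun x hx => Set.indicator_of_mem hx w) hΩm
  intro x₀ hx₀
  by_cases hx : x₀ ∈ Ω
  · obtain ⟨s, hs, hi⟩ := hwl x₀ hx
    rw [hΩ.isOpen.nhdsWithin_eq hx] at hs
    exact ⟨s, mem_nhdsWithin_of_mem_nhds hs, hi.indicator hΩm⟩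
  have hfr : x₀ ∈ frontier Ω := by rw [hΩ.isOpen.frontier_eq]; exact ⟨hx₀, hx⟩
  obtain ⟨e, K, r, he, hK, hr, hcone⟩ := hΩ.hasLipschitzBoundary.exists_interior_cone hfr
  refine ⟨Metric.ball x₀ r, mem_nhdsWithin_of_mem_nhds (Metric.ball_mem_nhds _ hr), ?_⟩
  rw [IntegrableOn, integrable_indicator_iff hΩm, IntegrableOn, Measure.restrict_restrict hΩm]
  set V := Ω ∩ Metric.ball x₀ r with hV
  have hVo : IsOpen V := hΩ.isOpen.inter Metric.isOpen_ball
  set s : ℝ := r / (K + 3) with hs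
  have hs0 : 0 < s := by positivity
  have hsr : (K + 3) * s = r := by rw [hs]; field_simp
  -- Near the boundary `w` is recovered from its translate by `v`, which only uses values in a
  -- compact subset of Ω, and from the integral of its directional derivative along segments inside
  -- Ω.
  set v : RVec n := ((K + 2) * s) • e with hv
  have hball : ∀ x ∈ V, ∀ z, ‖z‖ ≤ s → x + (v + z) ∈ Ω := fun x hx z hz =>
    hcone x hx s hs0.le hsr.le z hz
  have hseg : ∀ x ∈ V, ∀ t ∈ Set.Icc (0 : ℝ) 1, x + t • v ∈ Ω := fun x hx t ht => by
    have h1 : (K + 3) * (t * s) ≤ r := by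
      rw [← hsr]
      exact mul_le_mul_of_nonneg_left (mul_le_of_le_one_left hs0.le ht.2) (by positivity)
    have h2 := hcone x hx (t * s) (mul_nonneg ht.1 hs0.le) h1 0 (by
      rw [norm_zero]; exact mul_nonneg ht.1 hs0.le)
    rwa [add_zero, show (K + 2) * (t * s) = t * ((K + 2) * s) by ring, mul_smul] at h2
  set C := closure ((fun x => x + v) '' V) with hC
  have hCc : IsCompact C := Metric.isCompact_of_isClosed_isBounded isClosed_closure
    ((hΩ.isBounded.subset (by
      rintro _ ⟨x, hx, rfl⟩
      simpa using hball x hx 0 (by simpa using hs0.le))).closure)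
  -- A limit of points x + v lies within `s` of one of them, and the cone contains the ball of
  -- radius `s` around x + v.
  have hCΩ : C ⊆ Ω := fun y hy => by
    obtain ⟨_, ⟨x, hx, rfl⟩, hxy⟩ := Metric.mem_closure_iff.1 hy s hs0
    have h1 := hball x hx (y - (x + v)) (by rw [← dist_eq_norm]; exact hxy.le)
    rwa [show x + (v + (y - (x + v))) = y by abel] at h1
  have h1 : IntegrableOn (fun x => w (x + v)) V := by
    have h2 : Integrable (C.indicator w) := (integrable_indicator_iff hCc.measurableSet).2
      (hwl.integrableOn_compact_subset hCΩ hCc)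
    refine (h2.comp_add_right v).integrableOn.congr_fun (fun x hx => ?_) hVo.measurableSet
    exact Set.indicator_of_mem (subset_closure (Set.mem_image_of_mem _ hx)) w
  set G : RVec n → ℝ := fun x => ∑ i, v i * g i x with hG
  have hGi : IntegrableOn G Ω := integrable_finsetSum _ fun i _ => (hg i).const_mul (v i)
  have h3 : IntegrableOn (segmentAverage v G) V := by
    have h4 : Integrable (segmentAverage v (Ω.indicator G)) := memLp_one_iff_integrable.1
      (memLp_segmentAverage le_rfl ENNReal.one_ne_top
        (memLp_one_iff_integrable.2 ((integrable_indicator_iff hΩm).2 hGi)) v)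
    refine h4.integrableOn.congr_fun (fun x hx => ?_) hVo.measurableSet
    rw [segmentAverage_eq, segmentAverage_eq]
    refine setIntegral_congr_fun measurableSet_Ioc fun t ht => ?_
    exact Set.indicator_of_mem (hseg x hx t ⟨ht.1.le, ht.2⟩) G
  have h5 := ae_sub_eq_segmentAverage hVo hseg hwl hGi.locallyIntegrableOn fun φ hφ =>
    integral_mul_fderiv_of_hasWeakPartial hw hwl hφ v
  refine (h1.sub h3).congr ?_
  filter_upwards [h5] with x hx
  rw [Pi.sub_apply, ← hx]; ring

end Cones

/-! ### Test functions that are smooth up to the boundary suffice -/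

section Density

variable {n : ℕ}

/-- Only the products ζφ must be test functions in `V`. For a cutoff ζ supported in `V`, this gives
weak derivatives of ζu on all of space. -/
theorem HasWeakPartial.smooth_mul_of_test {Ω V : Set (RVec n)} {i : Fin n} {u g ζ : RVec n → ℝ}
    (h : HasWeakPartial V i u g) (hζ : ContDiff ℝ ∞ ζ) (hΩ : IsOpen Ω)
    (hu : LocallyIntegrableOn u Ω) (hg : LocallyIntegrableOn g Ω)
    (ht : ∀ φ, IsTestFunction Ω φ → IsTestFunction V fun x => ζ x * φ x) :
    HasWeakPartial Ω i (fun x => ζ x * u x)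
      (fun x => ζ x * g x + fderiv ℝ ζ x (EuclideanSpace.single i 1) * u x) := by
  have hζ' : Continuous fun x => fderiv ℝ ζ x (EuclideanSpace.single i 1) :=
    (hζ.continuous_fderiv (by simp)).clm_apply continuous_const
  have h1 : LocallyIntegrableOn (fun x => ζ x * u x) Ω :=
    hu.continuousOn_mul hζ.continuous.continuousOn hΩ.isLocallyClosed
  have h2 : LocallyIntegrableOn (fun x => ζ x * g x) Ω :=
    hg.continuousOn_mul hζ.continuous.continuousOn hΩ.isLocallyClosed
  have h3 : LocallyIntegrableOn (fun x => fderiv ℝ ζ x (EuclideanSpace.single i 1) * u x) Ω :=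
    hu.continuousOn_mul hζ'.continuousOn hΩ.isLocallyClosed
  refine hasWeakPartial_of_integral_eq h1 (h2.add h3) fun φ hφ => ?_
  have hζφ := ht φ hφ
  have h4 := h.integral_mul_fderiv hζφ
  have h5 : ∀ x, u x * fderiv ℝ (fun x => ζ x * φ x) x (EuclideanSpace.single i 1) =
      ζ x * u x * fderiv ℝ φ x (EuclideanSpace.single i 1) +
        fderiv ℝ ζ x (EuclideanSpace.single i 1) * u x * φ x := fun x => by
    rw [fderiv_fun_mul (hζ.differentiable (by simp) x) (hφ.1.differentiable (by simp) x)]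
    simp only [add_apply, smul_apply, smul_eq_mul]
    ring
  simp only [h5] at h4
  have e1 : ∫ x, (ζ x * u x * fderiv ℝ φ x (EuclideanSpace.single i 1) +
      fderiv ℝ ζ x (EuclideanSpace.single i 1) * u x * φ x) =
      (∫ x, ζ x * u x * fderiv ℝ φ x (EuclideanSpace.single i 1)) +
        ∫ x, fderiv ℝ ζ x (EuclideanSpace.single i 1) * u x * φ x :=
    integral_add ((hφ.fderiv_apply _).integrable_mul h1) (hφ.integrable_mul h3)
  have e2 : ∫ x, (ζ x * g x + fderiv ℝ ζ x (EuclideanSpace.single i 1) * u x) * φ x =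
      (∫ x, g x * (ζ x * φ x)) + ∫ x, fderiv ℝ ζ x (EuclideanSpace.single i 1) * u x * φ x := by
    rw [← integral_add (hζφ.integrable_mul h.2.1) (hφ.integrable_mul h3)]
    refine integral_congr_ae (.of_forall fun x => ?_)
    simp only
    ring
  rw [e1] at h4
  rw [e2]
  linarith

theorem HasWeakPartial.smooth_mul {Ω : Set (RVec n)} {i : Fin n} {u g ζ : RVec n → ℝ}
    (h : HasWeakPartial Ω i u g) (hζ : ContDiff ℝ ∞ ζ) (hΩ : IsOpen Ω) :
    HasWeakPartial Ω i (fun x => ζ x * u x)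
      (fun x => ζ x * g x + fderiv ℝ ζ x (EuclideanSpace.single i 1) * u x) :=
  h.smooth_mul_of_test hζ hΩ h.1 h.2.1 fun _ hφ =>
    ⟨hζ.mul hφ.1, hφ.2.mul_left, (tsupport_mul_subset_right).trans hφ.3⟩

/-- At every point of the closure of a Lipschitz domain there are interior cones (which are balls
at interior points). -/
theorem IsBoundedLipschitzDomain.exists_cone {Ω : Set (RVec n)} (hΩ : IsBoundedLipschitzDomain Ω)
    {x₀ : RVec n} (hx₀ : x₀ ∈ closure Ω) :
    ∃ (e : RVec n) (K r : ℝ), ‖e‖ ≤ 1 ∧ 0 ≤ K ∧ 0 < r ∧ ∀ x ∈ Ω ∩ Metric.ball x₀ r, ∀ s : ℝ, 0 ≤ s →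
      (K + 3) * s ≤ r → ∀ z : RVec n, ‖z‖ ≤ s → x + (((K + 2) * s) • e + z) ∈ Ω := by
  by_cases hx : x₀ ∈ Ω
  · obtain ⟨r, hr, hrΩ⟩ := Metric.isOpen_iff.1 hΩ.isOpen x₀ hx
    refine ⟨0, 0, r / 2, by simp, le_rfl, half_pos hr, fun x hx s hs hsr z hz => hrΩ ?_⟩
    have h1 := hx.2
    rw [Metric.mem_ball, dist_eq_norm] at h1 ⊢
    rw [smul_zero, zero_add, add_sub_right_comm]
    have := norm_add_le (x - x₀) z
    linarith
  · obtain ⟨e, K, r, he, h⟩ := hΩ.hasLipschitzBoundary.exists_interior_cone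
      (by rw [hΩ.isOpen.frontier_eq]; exact ⟨hx₀, hx⟩)
    exact ⟨e, K, r, he.le, h⟩

theorem tendsto_setIntegral_mul_of_L1 {Ω : Set (RVec n)} {S : RVec n → ℝ} {C : ℝ}
    (hS : AEStronglyMeasurable S (volume.restrict Ω)) (hSC : ∀ᵐ x ∂volume.restrict Ω, ‖S x‖ ≤ C)
    {F : ℕ → RVec n → ℝ} {F₀ : RVec n → ℝ} (hF : ∀ k, Integrable (F k)) (hF₀ : Integrable F₀)
    (h : Tendsto (fun k => eLpNorm (fun x => F k x - F₀ x) 1 volume) atTop (𝓝 0)) :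
    Tendsto (fun k => ∫ x in Ω, S x * F k x) atTop (𝓝 (∫ x in Ω, S x * F₀ x)) := by
  refine tendsto_integral_of_L1 _ (hF₀.integrableOn.bdd_mul (c := C) hS hSC).aestronglyMeasurable
    (.of_forall fun k => (hF k).integrableOn.bdd_mul (c := C) hS hSC) ?_
  have h4 : Tendsto (fun k => ENNReal.ofReal C * eLpNorm (fun x => F k x - F₀ x) 1 volume) atTop
      (𝓝 0) := by
    have := ENNReal.Tendsto.const_mul h (Or.inr (ENNReal.ofReal_ne_top (r := C)))
    simpa using this
  refine tendsto_of_tendsto_of_tendsto_of_le_of_le tendsto_const_nhds h4 (fun _ => zero_le)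
    fun k => ?_
  simp only
  rw [eLpNorm_one_eq_lintegral_enorm, ← lintegral_const_mul' _ _ ENNReal.ofReal_ne_top]
  refine le_trans (lintegral_mono_ae ?_) (setLIntegral_le_lintegral Ω _)
  filter_upwards [hSC] with x hx
  rw [← mul_sub, enorm_mul]
  gcongr
  rw [← ofReal_norm]
  exact ENNReal.ofReal_le_ofReal hx

/-- The zero extension of ζu is mollified with kernels shifted along the interior cone. At every
point of Ω the kernel then samples either inside Ω or off the support of ζ, so the gradients of the
mollifications converge in L¹ up to the boundary and the bounded field can be paired with them. -/
theorem sum_integral_localised_eq_zero {Ω : Set (RVec n)} (hΩ : IsOpen Ω)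
    {S : Fin n → RVec n → ℝ} {C : ℝ} (hS : ∀ i, AEStronglyMeasurable (S i) (volume.restrict Ω))
    (hSC : ∀ i, ∀ᵐ x ∂volume.restrict Ω, ‖S i x‖ ≤ C)
    (h : ∀ φ, ContDiff ℝ ∞ φ → HasCompactSupport φ →
      ∑ i, ∫ x in Ω, S i x * fderiv ℝ φ x (EuclideanSpace.single i 1) = 0)
    {u : RVec n → ℝ} {g : Fin n → RVec n → ℝ} (hu : IntegrableOn u Ω)
    (hg : ∀ i, IntegrableOn (g i) Ω) (hug : ∀ i, HasWeakPartial Ω i u (g i))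
    {x₀ e : RVec n} {K r : ℝ} (he : ‖e‖ ≤ 1) (hK : 0 ≤ K) (hr : 0 < r)
    (hcone : ∀ x ∈ Ω ∩ Metric.ball x₀ r, ∀ s : ℝ, 0 ≤ s →
      (K + 3) * s ≤ r → ∀ z : RVec n, ‖z‖ ≤ s → x + (((K + 2) * s) • e + z) ∈ Ω)
    {ζ : RVec n → ℝ} (hζ : IsTestFunction (Metric.ball x₀ r) ζ) :
    ∑ i, ∫ x in Ω, S i x *
      (ζ x * g i x + fderiv ℝ ζ x (EuclideanSpace.single i 1) * u x) = 0 := by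
  have hΩm := hΩ.measurableSet
  obtain ⟨M, hM⟩ := hζ.1.continuous.bounded_above_of_compact_support hζ.2
  set U : RVec n → ℝ := Ω.indicator fun x => ζ x * u x with hU
  set G : Fin n → RVec n → ℝ := fun i => Ω.indicator fun x =>
    ζ x * g i x + fderiv ℝ ζ x (EuclideanSpace.single i 1) * u x with hG
  have hUi : Integrable U := (integrable_indicator_iff hΩm).2
    (hu.bdd_mul (c := M) hζ.1.continuous.aestronglyMeasurable (.of_forall hM))
  have hGi : ∀ i, Integrable (G i) := fun i => by
    have hζi := hζ.fderiv_apply (EuclideanSpace.single i 1)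
    obtain ⟨M', hM'⟩ := hζi.1.continuous.bounded_above_of_compact_support hζi.2
    exact (integrable_indicator_iff hΩm).2
      (((hg i).bdd_mul (c := M) hζ.1.continuous.aestronglyMeasurable (.of_forall hM)).add
      (hu.bdd_mul (c := M') hζi.1.continuous.aestronglyMeasurable (.of_forall hM')))
  have hζ0 : ∀ x ∉ tsupport ζ, ζ x = 0 := fun x hx => image_eq_zero_of_notMem_tsupport hx
  have hζ1 : ∀ x ∉ tsupport ζ, ∀ i, fderiv ℝ ζ x (EuclideanSpace.single i 1) = 0 := fun x hx i => by
    rw [image_eq_zero_of_notMem_tsupport fun h => hx (tsupport_fderiv_subset ℝ h)]; rfl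
  -- The extension may jump across the boundary of Ω within the support of ζ; `W` leaves out exactly
  -- the points where this can be seen.
  set W : Set (RVec n) := Ω ∪ (tsupport ζ)ᶜ with hW
  have hWo : IsOpen W := hΩ.union (isClosed_tsupport ζ).isOpen_compl
  have hUG : ∀ i, HasWeakPartial W i U (G i) := by
    intro i
    have hloc : ∀ x : RVec n, ∃ ρ, x ∈ W → 0 < ρ ∧ HasWeakPartial (Metric.ball x ρ) i U (G i) := by
      intro x
      by_cases hx : x ∈ Ω
      · obtain ⟨ρ, hρ, hρΩ⟩ := Metric.isOpen_iff.1 hΩ x hx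
        refine ⟨ρ, fun _ => ⟨hρ, (((hug i).smooth_mul hζ.1 hΩ).mono hρΩ).congr_ae ?_ ?_⟩⟩
        all_goals
          filter_upwards [ae_restrict_mem measurableSet_ball] with y hy
          simp only [hU, hG, Set.indicator_of_mem (hρΩ hy)]
      · by_cases hx' : x ∈ (tsupport ζ)ᶜ
        · obtain ⟨ρ, hρ, hρΩ⟩ := Metric.isOpen_iff.1 (isClosed_tsupport ζ).isOpen_compl x hx'
          refine ⟨ρ, fun _ => ⟨hρ, (hasWeakPartial_const _ i 0).congr_ae ?_ ?_⟩⟩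
          all_goals
            filter_upwards [ae_restrict_mem measurableSet_ball] with y hy
            have hy' := hρΩ hy
            by_cases hyΩ : y ∈ Ω <;> simp [hU, hG, hyΩ, hζ0 y hy', hζ1 y hy']
        · exact ⟨0, fun h => absurd h (by rintro (h | h) <;> contradiction)⟩
    choose ρ hρ using hloc
    exact hasWeakPartial_of_locally (hUi.locallyIntegrable.locallyIntegrableOn W)
      ((hGi i).locallyIntegrable.locallyIntegrableOn W) (fun x hx => (hρ x hx).1)
      fun x hx => (hρ x hx).2
  -- the shifted mollifications of `U`
  obtain ⟨ρ, hρ, hρζ⟩ := hζ.2.exists_thickening_subset_open Metric.isOpen_ball hζ.3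
  -- Dividing by K + 4 leaves the strict inequality (K + 3)s < min r ρ.
  set s₀ : ℝ := min r ρ / (K + 4) with hs₀
  have hs₀pos : 0 < s₀ := div_pos (lt_min hr hρ) (by positivity)
  set s : ℕ → ℝ := fun k => s₀ * (1 / ((k : ℝ) + 1)) with hs
  have hspos : ∀ k, 0 < s k := fun k => by positivity
  have hsle : ∀ k, (K + 3) * s k < min r ρ := fun k => by
    have h1 : 1 / ((k : ℝ) + 1) ≤ 1 := (div_le_one (by positivity)).2 (by
      have := Nat.cast_nonneg (α := ℝ) k; linarith)
    have h2 : s k ≤ s₀ := mul_le_of_le_one_right hs₀pos.le h1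
    have h3 : (K + 4) * s₀ = min r ρ := by rw [hs₀]; field_simp
    nlinarith
  have hs0 : Tendsto s atTop (𝓝 0) := by
    have := (tendsto_one_div_add_atTop_nhds_zero_nat (𝕜 := ℝ)).const_mul s₀
    rwa [mul_zero] at this
  -- Convolution samples at x − y, so the centre carries a minus sign to move the samples upwards
  -- into the cone.
  let c : ℕ → RVec n := fun k => -(((K + 2) * s k) • e)
  let b : ∀ k, ContDiffBump (c k) := fun k => smallBump (c k) (hspos k)
  have hb : Tendsto (fun k => ‖c k‖ + (b k).rOut) atTop (𝓝 0) := by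
    have h1 : Tendsto (fun k => (K + 3) * s k) atTop (𝓝 0) := by
      simpa using hs0.const_mul (K + 3)
    refine squeeze_zero (fun k => add_nonneg (norm_nonneg _) (b k).rOut_pos.le) (fun k => ?_) h1
    have h2 : ‖c k‖ ≤ (K + 2) * s k := by
      rw [norm_neg, norm_smul, Real.norm_of_nonneg (by have := hspos k; positivity)]
      exact mul_le_of_le_one_right (by have := hspos k; positivity) he
    have h3 : (b k).rOut = s k := rfl
    linarith
  have hderiv : ∀ k i, ∀ x ∈ Ω, fderiv ℝ (mollify (b k) U) x (EuclideanSpace.single i 1) =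
      mollify (b k) (G i) x := by
    intro k i x hx
    refine fderiv_mollify (b k) hUi (V := W) (fun φ hφ => (hUG i).integral_mul_fderiv hφ)
      fun y hy => ?_
    have hy' : ‖-(y - c k)‖ ≤ s k := by
      rw [norm_neg]; exact mem_closedBall_iff_norm.1 hy
    have e1 : x - y = x + (((K + 2) * s k) • e + -(y - c k)) := by simp only [c]; abel
    -- Outside the ball the cone condition is not available, but there the samples miss the support
    -- of ζ, which has distance at least `ρ` from the complement of the ball.
    by_cases hxb : x ∈ Metric.ball x₀ r
    · left
      rw [e1]
      exact hcone x ⟨hx, hxb⟩ (s k) (hspos k).le ((hsle k).le.trans (min_le_left _ _)) _ hy'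
    · right
      intro hmem
      refine hxb (hρζ (Metric.mem_thickening_iff.2 ⟨x - y, hmem, ?_⟩))
      rw [dist_eq_norm, sub_sub_cancel]
      have h2 : ‖c k‖ ≤ (K + 2) * s k := by
        rw [norm_neg, norm_smul, Real.norm_of_nonneg (by have := hspos k; positivity)]
        exact mul_le_of_le_one_right (by have := hspos k; positivity) he
      have h3 : ‖y‖ ≤ ‖y - c k‖ + ‖c k‖ := by simpa using norm_add_le (y - c k) (c k)
      rw [norm_neg] at hy'
      have h4 := (hsle k).trans_le (min_le_right _ _)
      linarith
  have hUc : HasCompactSupport U := by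
    refine hζ.2.mono' fun x hx => ?_
    by_contra h
    exact hx (by simp [hU, hζ0 x h])
  have hzero : ∀ k, ∑ i, ∫ x in Ω, S i x * mollify (b k) (G i) x = 0 := by
    intro k
    rw [← h _ (contDiff_mollify (b k) hUi) (hasCompactSupport_mollify (b k) hUc)]
    refine Finset.sum_congr rfl fun i _ => setIntegral_congr_fun hΩm fun x hx => ?_
    rw [hderiv k i x hx]
  have hlim : Tendsto (fun k => ∑ i, ∫ x in Ω, S i x * mollify (b k) (G i) x) atTop
      (𝓝 (∑ i, ∫ x in Ω, S i x * G i x)) :=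
    tendsto_finsetSum _ fun i _ => tendsto_setIntegral_mul_of_L1 (hS i) (hSC i)
      (fun k => integrable_mollify (b k) (hGi i)) (hGi i) (tendsto_eLpNorm_mollify_sub b hb (hGi i))
  simp only [hzero] at hlim
  rw [← tendsto_nhds_unique hlim tendsto_const_nhds]
  refine Finset.sum_congr rfl fun i _ => setIntegral_congr_fun hΩm fun x hx => ?_
  simp only [hG, Set.indicator_of_mem hx]

/-- In a bounded Lipschitz domain, a bounded field that is orthogonal to the gradients of all
functions which are smooth up to the boundary is orthogonal to all gradients of `W^{1,1}`
functions. -/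
theorem IsBoundedLipschitzDomain.sum_integral_mul_weak_partial_eq_zero {Ω : Set (RVec n)}
    (hΩ : IsBoundedLipschitzDomain Ω)
    {S : Fin n → RVec n → ℝ} {C : ℝ} (hS : ∀ i, AEStronglyMeasurable (S i) (volume.restrict Ω))
    (hSC : ∀ i, ∀ᵐ x ∂volume.restrict Ω, ‖S i x‖ ≤ C)
    (h : ∀ φ, ContDiff ℝ ∞ φ → HasCompactSupport φ →
      ∑ i, ∫ x in Ω, S i x * fderiv ℝ φ x (EuclideanSpace.single i 1) = 0)
    {u : RVec n → ℝ} {g : Fin n → RVec n → ℝ} (hu : IntegrableOn u Ω)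
    (hg : ∀ i, IntegrableOn (g i) Ω) (hug : ∀ i, HasWeakPartial Ω i u (g i)) :
    ∑ i, ∫ x in Ω, S i x * g i x = 0 := by
  have hΩm := hΩ.isOpen.measurableSet
  have hcone : ∀ x₀ : RVec n, ∃ (e : RVec n) (K r : ℝ), x₀ ∈ closure Ω → ‖e‖ ≤ 1 ∧ 0 ≤ K ∧ 0 < r ∧
      ∀ x ∈ Ω ∩ Metric.ball x₀ r, ∀ s : ℝ, 0 ≤ s →
      (K + 3) * s ≤ r → ∀ z : RVec n, ‖z‖ ≤ s → x + (((K + 2) * s) • e + z) ∈ Ω := by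
    intro x₀
    by_cases hx₀ : x₀ ∈ closure Ω
    · obtain ⟨e, K, r, h⟩ := hΩ.exists_cone hx₀
      exact ⟨e, K, r, fun _ => h⟩
    · exact ⟨0, 0, 0, fun h => absurd h hx₀⟩
  choose e K r hc using hcone
  obtain ⟨t, ζ, ht, hζ, hsum⟩ := exists_smooth_partition
    (Metric.isCompact_of_isClosed_isBounded isClosed_closure hΩ.isBounded.closure)
    fun x hx => (hc x hx).2.2.1
  have hterm : ∀ k : t, ∑ i, ∫ x in Ω, S i x *
      (ζ k x * g i x + fderiv ℝ (ζ k) x (EuclideanSpace.single i 1) * u x) = 0 := fun k =>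
    sum_integral_localised_eq_zero hΩ.isOpen hS hSC h hu hg hug (hc k (ht k k.2)).1
      (hc k (ht k k.2)).2.1 (hc k (ht k k.2)).2.2.1 (hc k (ht k k.2)).2.2.2 (hζ k)
  -- The partition sums to 1 near every point of Ω, so the derivatives of the cutoffs cancel.
  have hdec : ∀ i, ∀ x ∈ Ω, g i x =
      ∑ k, (ζ k x * g i x + fderiv ℝ (ζ k) x (EuclideanSpace.single i 1) * u x) := by
    intro i x hx
    rw [Finset.sum_add_distrib, ← Finset.sum_mul, ← Finset.sum_mul, hsum x (subset_closure hx)]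
    have h1 : (fun y => ∑ k, ζ k y) =ᶠ[𝓝 x] fun _ => 1 :=
      (hΩ.isOpen.eventually_mem hx).mono fun y hy => hsum y (subset_closure hy)
    have h2 := h1.fderiv_eq (𝕜 := ℝ)
    rw [fderiv_fun_sum fun k _ => (hζ k).1.differentiable (by simp) x] at h2
    have h3 := congrArg (fun A => A (EuclideanSpace.single i (1 : ℝ))) h2
    simp only [fderiv_fun_const] at h3
    have h4 : ∑ k, fderiv ℝ (ζ k) x (EuclideanSpace.single i 1) = 0 := by simpa using h3
    rw [h4]; ring
  have hint : ∀ i (k : t), IntegrableOn (fun x => S i x *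
      (ζ k x * g i x + fderiv ℝ (ζ k) x (EuclideanSpace.single i 1) * u x)) Ω := by
    intro i k
    have hζi := (hζ k).fderiv_apply (EuclideanSpace.single i 1)
    obtain ⟨M, hM⟩ := (hζ k).1.continuous.bounded_above_of_compact_support (hζ k).2
    obtain ⟨M', hM'⟩ := hζi.1.continuous.bounded_above_of_compact_support hζi.2
    exact (((hg i).bdd_mul (c := M) (hζ k).1.continuous.aestronglyMeasurable (.of_forall hM)).add
      (hu.bdd_mul (c := M') hζi.1.continuous.aestronglyMeasurable (.of_forall hM'))).bdd_mul
      (c := C) (hS i) (hSC i)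
  calc ∑ i, ∫ x in Ω, S i x * g i x
      = ∑ i, ∑ k, ∫ x in Ω, S i x *
          (ζ k x * g i x + fderiv ℝ (ζ k) x (EuclideanSpace.single i 1) * u x) := by
        refine Finset.sum_congr rfl fun i _ => ?_
        rw [← integral_finsetSum _ fun k _ => hint i k]
        refine setIntegral_congr_fun hΩm fun x hx => ?_
        rw [← Finset.mul_sum, ← hdec i x hx]
    _ = 0 := by
        rw [Finset.sum_comm]
        exact Finset.sum_eq_zero fun k _ => hterm k

end Density

/-! ### Pairings in `L²` -/

section Pairing

variable {α V : Type*} [MeasurableSpace α] {μ : Measure α} [NormedAddCommGroup V]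
  [InnerProductSpace ℝ V]

theorem integral_inner_eq_inner_toLp {f g : α → V} (hf : MemLp f 2 μ) (hg : MemLp g 2 μ) :
    ∫ x, ⟪f x, g x⟫ ∂μ = ⟪hf.toLp f, hg.toLp g⟫ := by
  rw [L2.inner_def]
  refine integral_congr_ae ?_
  filter_upwards [hf.coeFn_toLp, hg.coeFn_toLp] with x h1 h2
  rw [h1, h2]

theorem MeasureTheory.MemLp.integrable_inner₂ {f g : α → V} (hf : MemLp f 2 μ) (hg : MemLp g 2 μ) :
    Integrable (fun x => ⟪f x, g x⟫) μ := by
  have h := L2.integrable_inner (𝕜 := ℝ) (hf.toLp f) (hg.toLp g)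
  refine h.congr ?_
  filter_upwards [hf.coeFn_toLp, hg.coeFn_toLp] with x h1 h2
  rw [h1, h2]

theorem abs_integral_inner_le {f g : α → V} (hf : MemLp f 2 μ) (hg : MemLp g 2 μ) :
    |∫ x, ⟪f x, g x⟫ ∂μ| ≤ (eLpNorm f 2 μ).toReal * (eLpNorm g 2 μ).toReal := by
  rw [integral_inner_eq_inner_toLp hf hg, ← Lp.norm_toLp f hf, ← Lp.norm_toLp g hg]
  exact abs_real_inner_le_norm _ _

theorem integral_norm_sq_eq {f : α → V} (hf : MemLp f 2 μ) :
    ∫ x, ‖f x‖ ^ 2 ∂μ = (eLpNorm f 2 μ).toReal ^ 2 := by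
  rw [← Lp.norm_toLp f hf, ← real_inner_self_eq_norm_sq, ← integral_inner_eq_inner_toLp hf hf]
  simp only [real_inner_self_eq_norm_sq]

theorem tendsto_integral_inner_of_L2 {ι : Type*} {l : Filter ι} {f g₀ : α → V} {g : ι → α → V}
    (hf : MemLp f 2 μ) (hg : ∀ k, MemLp (g k) 2 μ) (hg₀ : MemLp g₀ 2 μ)
    (h : Tendsto (fun k => eLpNorm (fun x => g k x - g₀ x) 2 μ) l (𝓝 0)) :
    Tendsto (fun k => ∫ x, ⟪f x, g k x⟫ ∂μ) l (𝓝 (∫ x, ⟪f x, g₀ x⟫ ∂μ)) := by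
  simp only [fun k => integral_inner_eq_inner_toLp hf (hg k), integral_inner_eq_inner_toLp hf hg₀]
  refine tendsto_const_nhds.inner (tendsto_iff_edist_tendsto_0.2 ?_)
  refine h.congr fun k => ?_
  rw [Lp.edist_toLp_toLp]
  rfl

end Pairing

/-! ### Gradients of smooth maps -/

section GradField

variable {n N : ℕ}

/-- The gradient of a scalar function as a vector. -/
noncomputable def gradVec (η : RVec n → ℝ) (x : RVec n) : RVec n :=
  WithLp.toLp 2 fun i => fderiv ℝ η x (EuclideanSpace.single i 1)

/-- The gradient of a vector-valued map as a matrix. -/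
noncomputable def gradField (y : RVec n → RVec N) (x : RVec n) : RMat N n :=
  WithLp.toLp 2 fun c => fderiv ℝ y x (EuclideanSpace.single c.2 1) c.1

/-- The rank-one matrix `y ⊗ p`. -/
noncomputable def outer (y : RVec N) (p : RVec n) : RMat N n :=
  WithLp.toLp 2 fun c => y c.1 * p c.2

theorem gradField_apply (y : RVec n → RVec N) (x : RVec n) (c : Fin N × Fin n) :
    gradField y x c = fderiv ℝ y x (EuclideanSpace.single c.2 1) c.1 := rfl

theorem norm_outer (y : RVec N) (p : RVec n) : ‖outer y p‖ = ‖y‖ * ‖p‖ := by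
  have h : ‖outer y p‖ ^ 2 = (‖y‖ * ‖p‖) ^ 2 := by
    rw [mul_pow, EuclideanSpace.norm_sq_eq, EuclideanSpace.norm_sq_eq, EuclideanSpace.norm_sq_eq,
      Fintype.sum_prod_type, Finset.sum_mul_sum]
    simp [outer, mul_pow]
  exact (sq_eq_sq₀ (norm_nonneg _) (by positivity)).1 h

theorem continuous_gradVec {η : RVec n → ℝ} (h : ContDiff ℝ ∞ η) : Continuous (gradVec η) :=
  (PiLp.continuous_toLp 2 _).comp (continuous_pi fun _ =>
    (h.continuous_fderiv (by simp)).clm_apply continuous_const)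

theorem continuous_gradField {y : RVec n → RVec N} (h : ContDiff ℝ ∞ y) :
    Continuous (gradField y) :=
  (PiLp.continuous_toLp 2 _).comp (continuous_pi fun c =>
    (EuclideanSpace.proj c.1).continuous.comp
      ((h.continuous_fderiv (by simp)).clm_apply continuous_const))

theorem continuous_outer : Continuous fun z : RVec N × RVec n => outer z.1 z.2 :=
  (PiLp.continuous_toLp 2 _).comp (by fun_prop)

theorem gradVec_eq_zero {η : RVec n → ℝ} {x : RVec n} (hx : x ∉ tsupport η) : gradVec η x = 0 := by
  ext i
  simp [gradVec, image_eq_zero_of_notMem_tsupport fun h => hx (tsupport_fderiv_subset ℝ h)]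

theorem gradField_eq_zero {y : RVec n → RVec N} {x : RVec n} (hx : x ∉ tsupport y) :
    gradField y x = 0 := by
  ext c
  simp [gradField, image_eq_zero_of_notMem_tsupport fun h => hx (tsupport_fderiv_subset ℝ h)]

theorem gradField_smul {η : RVec n → ℝ} {y : RVec n → RVec N} {x : RVec n}
    (hη : DifferentiableAt ℝ η x) (hy : DifferentiableAt ℝ y x) :
    gradField (fun x => η x • y x) x = η x • gradField y x + outer (y x) (gradVec η x) := by
  ext c
  simp only [gradField, outer, gradVec, PiLp.add_apply, PiLp.smul_apply, smul_eq_mul]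
  rw [fderiv_fun_smul hη hy]
  simp [mul_comm]

theorem gradField_sub {y z : RVec n → RVec N} {x : RVec n}
    (hy : DifferentiableAt ℝ y x) (hz : DifferentiableAt ℝ z x) :
    gradField (fun x => y x - z x) x = gradField y x - gradField z x := by
  ext c
  simp only [gradField, PiLp.sub_apply]
  rw [fderiv_fun_sub hy hz]
  simp

theorem gradField_comp_add (y : RVec n → RVec N) (v x : RVec n) :
    gradField (fun x => y (x + v)) x = gradField y (x + v) := by
  ext c
  simp only [gradField, fderiv_comp_add_right]

theorem gradVec_sq {η : RVec n → ℝ} {x : RVec n} (hη : DifferentiableAt ℝ η x) :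
    gradVec (fun x => η x ^ 2) x = (2 * η x) • gradVec η x := by
  ext i
  simp only [gradVec, PiLp.smul_apply, smul_eq_mul]
  have := (hη.hasFDerivAt.pow 2).fderiv
  rw [this]
  simp

theorem outer_smul_right (a : ℝ) (y : RVec N) (p : RVec n) : outer y (a • p) = a • outer y p := by
  ext c
  simp [outer]
  ring

theorem norm_fderiv_apply_le_gradField (y : RVec n → RVec N) (x v : RVec n) :
    ‖fderiv ℝ y x v‖ ≤ ‖v‖ * ‖gradField y x‖ := by
  have h : ‖fderiv ℝ y x v‖ ^ 2 ≤ (‖v‖ * ‖gradField y x‖) ^ 2 := by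
    rw [mul_pow, EuclideanSpace.norm_sq_eq, EuclideanSpace.norm_sq_eq (gradField y x),
      Fintype.sum_prod_type, Finset.mul_sum]
    refine Finset.sum_le_sum fun a _ => ?_
    have e : fderiv ℝ y x v a = ∑ i, v i * gradField y x (a, i) := by
      conv_lhs => rw [RVec.eq_sum_smul_single v]
      simp [gradField]
    rw [e, Real.norm_eq_abs, sq_abs, EuclideanSpace.norm_sq_eq]
    simp only [Real.norm_eq_abs, sq_abs]
    exact Finset.sum_mul_sq_le_sq_mul_sq _ _ _
  exact le_of_sq_le_sq h (by positivity)

/-- A smooth difference is the average of the derivative over the segment. -/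
theorem sub_eq_segmentAverage_fderiv {y : RVec n → RVec N} (hy : ContDiff ℝ ∞ y) (x v : RVec n) :
    y (x + v) - y x = segmentAverage v (fun z => fderiv ℝ y z v) x := by
  have hd : ∀ t ∈ Set.uIcc (0 : ℝ) 1, HasDerivAt (fun t : ℝ => y (x + t • v))
      (fderiv ℝ y (x + t • v) v) t := fun t _ => by
    have h1 : HasDerivAt (fun t : ℝ => x + t • v) v t := by
      simpa using ((hasDerivAt_id t).smul_const v).const_add x
    exact ((hy.differentiable (by simp) _).hasFDerivAt).comp_hasDerivAt t h1
  have hc : Continuous fun t : ℝ => fderiv ℝ y (x + t • v) v :=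
    ((hy.continuous_fderiv (by simp)).comp (by fun_prop)).clm_apply continuous_const
  have h := intervalIntegral.integral_eq_sub_of_hasDerivAt hd (hc.intervalIntegrable _ _)
  rw [segmentAverage_eq, ← intervalIntegral.integral_of_le zero_le_one, h]
  simp

/-- Both `w` and its translate by `v` are supported in Ω and hence admissible; a change of variables
moves the translation onto `A`. -/
theorem integral_inner_translate_sub_gradField_eq_zero {Ω : Set (RVec n)} {A : RVec n → RMat N n}
    (hA : MemLp A 2) (h : ∀ φ : RVec n → RVec N, ContDiff ℝ ∞ φ → HasCompactSupport φ →
      tsupport φ ⊆ Ω → ∫ x, ⟪A x, gradField φ x⟫ = 0)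
    {w : RVec n → RVec N} (hw : ContDiff ℝ ∞ w) (hwc : HasCompactSupport w) {v : RVec n}
    (hv : ∀ x ∈ tsupport w, x ∈ Ω ∧ x + v ∈ Ω) :
    ∫ x, ⟪A (x + v) - A x, gradField w x⟫ = 0 := by
  have hg : MemLp (gradField w) 2 := (continuous_gradField hw).memLp_of_hasCompactSupport
    (hwc.mono' fun x hx => by
      by_contra h
      exact hx (gradField_eq_zero h))
  have h1 := h w hw hwc fun x hx => (hv x hx).1
  have h2 := h (fun x => w (x + -v)) (hw.comp (contDiff_id.add contDiff_const))
    (hwc.comp_homeomorph (Homeomorph.addRight (-v))) fun x hx => by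
      have hx' : x + -v ∈ tsupport w :=
        tsupport_comp_subset_preimage w (Homeomorph.addRight (-v)).continuous hx
      simpa using (hv _ hx').2
  simp only [gradField_comp_add] at h2
  rw [← integral_add_right_eq_self _ v] at h2
  simp only [add_neg_cancel_right] at h2
  have hA' : MemLp (fun x => A (x + v)) 2 :=
    hA.comp_measurePreserving (measurePreserving_add_right_volume v)
  have e : ∫ x, (⟪A (x + v), gradField w x⟫ - ⟪A x, gradField w x⟫) =
      (∫ x, ⟪A (x + v), gradField w x⟫) - ∫ x, ⟪A x, gradField w x⟫ :=
    integral_sub (hA'.integrable_inner₂ hg) (hA.integrable_inner₂ hg)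
  simp only [inner_sub_left]
  rw [e, h1, h2, sub_zero]

end GradField

/-! ### Difference quotients -/

section DifferenceQuotients

variable {n N : ℕ}

theorem IsTestFunction.memLp_smul {V : Type*} [NormedAddCommGroup V] [NormedSpace ℝ V]
    {Ω : Set (RVec n)} {η : RVec n → ℝ} (hη : IsTestFunction Ω η) {q : ℝ≥0∞} {F : RVec n → V}
    (hF : MemLp F q) : MemLp (fun x => η x • F x) q := by
  obtain ⟨M, hM⟩ := hη.1.continuous.bounded_above_of_compact_support hη.2
  exact hF.of_le_mul (hη.1.continuous.aestronglyMeasurable.smul hF.1) (c := M)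
    (.of_forall fun x => by
      rw [norm_smul]
      exact mul_le_mul_of_nonneg_right (hM x) (norm_nonneg _))

theorem memLp_translate_sub {V : Type*} [NormedAddCommGroup V] {q : ℝ≥0∞} {F : RVec n → V}
    (hF : MemLp F q) (v : RVec n) : MemLp (fun x => F (x + v) - F x) q :=
  (hF.comp_measurePreserving (measurePreserving_add_right_volume v)).sub hF

/-- The differenced equation is tested with η²(u(· + v) − u). As `G` is only an L² limit of
gradients, `u` runs through the smooth approximations. The remaining commutator with ∇η contains u(·
+ v) − u, a segment average of derivatives, which yields the factor |v|. -/
theorem abs_integral_inner_difference_le {Ω : Set (RVec n)} (hΩ : IsOpen Ω)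
    {A G : RVec n → RMat N n} (hA : MemLp A 2) (hG : MemLp G 2)
    (h : ∀ φ : RVec n → RVec N, ContDiff ℝ ∞ φ → HasCompactSupport φ →
      tsupport φ ⊆ Ω → ∫ x, ⟪A x, gradField φ x⟫ = 0)
    {u : ℕ → RVec n → RVec N} (hu : ∀ k, ContDiff ℝ ∞ (u k))
    (hu2 : ∀ k, MemLp (gradField (u k)) 2 (volume.restrict Ω))
    (hlim : Tendsto (fun k => eLpNorm (fun x => gradField (u k) x - G x) 2 (volume.restrict Ω))
      atTop (𝓝 0))
    {η : RVec n → ℝ} (hη : IsTestFunction Ω η) {M : ℝ} (hM : ∀ x, ‖gradVec η x‖ ≤ M)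
    {v : RVec n} (hv : ∀ x ∈ tsupport η, ∀ t ∈ Set.Icc (0 : ℝ) 1, x + t • v ∈ Ω) :
    |∫ x, ⟪η x • (A (x + v) - A x), η x • (G (x + v) - G x)⟫| ≤
      (eLpNorm (fun x => η x • (A (x + v) - A x)) 2 volume).toReal *
        (2 * M * ‖v‖ * (eLpNorm G 2 (volume.restrict Ω)).toReal) := by
  have hΩm := hΩ.measurableSet
  have hM0 : 0 ≤ M := (norm_nonneg _).trans (hM 0)
  have hGΩ : MemLp G 2 (volume.restrict Ω) := hG.restrict Ω
  have hv0 : ∀ x ∈ tsupport η, x ∈ Ω := fun x hx => hη.3 hx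
  have hv1 : ∀ x ∈ tsupport η, x + v ∈ Ω := fun x hx => by simpa using hv x hx 1 (by simp)
  set f : RVec n → RMat N n := fun x => η x • (A (x + v) - A x) with hf
  have hf2 : MemLp f 2 := hη.memLp_smul (memLp_translate_sub hA v)
  obtain ⟨Mη, hMη⟩ := hη.1.continuous.bounded_above_of_compact_support hη.2
  have hMη0 : 0 ≤ Mη := (norm_nonneg _).trans (hMη 0)
  set D : ℕ → RVec n → RMat N n := fun k x =>
    η x • (gradField (u k) (x + v) - gradField (u k) x) with hD
  have hD2 : ∀ k, MemLp (D k) 2 := fun k => by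
    have hc := continuous_gradField (hu k)
    refine (hη.1.continuous.smul ((hc.comp (continuous_id.add continuous_const)).sub
      hc)).memLp_of_hasCompactSupport ?_
    exact hη.2.smul_right
  set E : ℕ → RVec n → RMat N n := fun k x =>
    (2 : ℝ) • outer (u k (x + v) - u k x) (gradVec η x) with hE
  have hEc : ∀ k, Continuous (E k) := fun k =>
    (continuous_outer.comp ((((hu k).continuous.comp (continuous_id.add continuous_const)).sub
      (hu k).continuous).prodMk (continuous_gradVec hη.1))).const_smul (2 : ℝ)
  have hE2 : ∀ k, MemLp (E k) 2 := fun k => by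
    refine (hEc k).memLp_of_hasCompactSupport (hη.2.mono' fun x hx => ?_)
    by_contra hx'
    refine hx ?_
    have : ‖E k x‖ = 0 := by
      rw [hE]; simp only; rw [norm_smul, norm_outer, gradVec_eq_zero hx']; simp
    exact norm_eq_zero.1 this
  have hI : ∀ k, ∫ x, ⟪f x, D k x⟫ = -∫ x, ⟪f x, E k x⟫ := by
    intro k
    have hw : ContDiff ℝ ∞ fun x => u k (x + v) - u k x :=
      ((hu k).comp (contDiff_id.add contDiff_const)).sub (hu k)
    have hts : tsupport (fun x => (η x ^ 2) • (u k (x + v) - u k x)) ⊆ tsupport η := by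
      refine (tsupport_smul_subset_left _ _).trans (closure_mono fun x hx => ?_)
      exact fun h0 => hx (by simp [h0])
    have h1 := integral_inner_translate_sub_gradField_eq_zero hA h (v := v)
      (w := fun x => (η x ^ 2) • (u k (x + v) - u k x)) ((hη.1.pow 2).smul hw)
      (hη.2.of_isClosed_subset (isClosed_tsupport _) hts)
      fun x hx => ⟨hv0 x (hts hx), hv1 x (hts hx)⟩
    have h2 : ∀ x, ⟪A (x + v) - A x, gradField (fun x => (η x ^ 2) • (u k (x + v) - u k x)) x⟫ =
        ⟪f x, D k x⟫ + ⟪f x, E k x⟫ := fun x => by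
      have h3 : DifferentiableAt ℝ (fun x => u k (x + v)) x :=
        ((hu k).comp (contDiff_id.add contDiff_const)).differentiable (by simp) x
      rw [gradField_smul ((hη.1.pow 2).differentiable (by simp) x) (hw.differentiable (by simp) x),
        gradField_sub h3 ((hu k).differentiable (by simp) x), gradField_comp_add,
        gradVec_sq (hη.1.differentiable (by simp) x), outer_smul_right]
      simp only [hf, hD, hE, inner_add_right, real_inner_smul_left, real_inner_smul_right]
      ring
    simp only [h2] at h1
    rw [integral_add (hf2.integrable_inner₂ (hD2 k)) (hf2.integrable_inner₂ (hE2 k))] at h1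
    linarith
  -- the commutator term
  have hEle : ∀ k, eLpNorm (E k) 2 volume ≤
      ENNReal.ofReal (2 * M * ‖v‖) * eLpNorm (gradField (u k)) 2 (volume.restrict Ω) := by
    intro k
    set P : RVec n → RVec N := Ω.indicator fun z => fderiv ℝ (u k) z v with hP
    have hPm : AEStronglyMeasurable P volume :=
      ((((hu k).continuous_fderiv (by simp)).clm_apply
        continuous_const).aestronglyMeasurable.indicator hΩm)
    have h1 : eLpNorm (E k) 2 volume ≤ ENNReal.ofReal (2 * M) * eLpNorm P 2 volume := by
      refine (eLpNorm_le_mul_eLpNorm_of_ae_le_mul (g := segmentAverage v P) (c := 2 * M)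
        (.of_forall fun x => ?_) 2).trans ?_
      · rw [hE]
        simp only
        rw [norm_smul, norm_outer, Real.norm_of_nonneg (by norm_num : (0 : ℝ) ≤ 2)]
        by_cases hx : x ∈ tsupport η
        · have h3 : u k (x + v) - u k x = segmentAverage v P x := by
            rw [sub_eq_segmentAverage_fderiv (hu k), segmentAverage_eq, segmentAverage_eq]
            refine setIntegral_congr_fun measurableSet_Ioc fun t ht => ?_
            simp only [hP, Set.indicator_of_mem (hv x hx t ⟨ht.1.le, ht.2⟩)]
          rw [h3]
          have := mul_le_mul_of_nonneg_left (hM x) (norm_nonneg (segmentAverage v P x))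
          linarith
        · rw [gradVec_eq_zero hx, norm_zero, mul_zero, mul_zero]
          positivity
      · gcongr
        exact eLpNorm_translateAverage_le one_le_two (by simp) hPm (measurable_smul_const_RVec v)
    have h2 : eLpNorm P 2 volume ≤
        ENNReal.ofReal ‖v‖ * eLpNorm (gradField (u k)) 2 (volume.restrict Ω) := by
      rw [hP, eLpNorm_indicator_eq_eLpNorm_restrict hΩm]
      exact eLpNorm_le_mul_eLpNorm_of_ae_le_mul
        (.of_forall fun x => norm_fderiv_apply_le_gradField _ _ _) 2
    refine h1.trans ((mul_le_mul_right h2 _).trans (le_of_eq ?_))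
    rw [← mul_assoc, ← ENNReal.ofReal_mul (by positivity)]
  -- passage to the limit
  set R : ℕ → RVec n → RMat N n := fun k => Ω.indicator fun x => gradField (u k) x - G x with hR
  have hRm : ∀ k, AEStronglyMeasurable (R k) volume := fun k =>
    ((continuous_gradField (hu k)).aestronglyMeasurable.sub hG.1).indicator hΩm
  have hR0 : Tendsto (fun k => eLpNorm (R k) 2 volume) atTop (𝓝 0) := by
    simpa only [hR, eLpNorm_indicator_eq_eLpNorm_restrict hΩm] using hlim
  have hDlim : Tendsto (fun k => eLpNorm (fun x => D k x - η x • (G (x + v) - G x)) 2 volume)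
      atTop (𝓝 0) := by
    have h1 : Tendsto (fun k => ENNReal.ofReal Mη * (eLpNorm (R k) 2 volume +
        eLpNorm (R k) 2 volume)) atTop (𝓝 0) := by
      have := ENNReal.Tendsto.const_mul (hR0.add hR0) (Or.inr (ENNReal.ofReal_ne_top (r := Mη)))
      simpa using this
    refine tendsto_of_tendsto_of_tendsto_of_le_of_le tendsto_const_nhds h1 (fun _ => zero_le)
      fun k => ?_
    calc eLpNorm (fun x => D k x - η x • (G (x + v) - G x)) 2 volume
        ≤ ENNReal.ofReal Mη * eLpNorm (fun x => R k (x + v) - R k x) 2 volume := by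
          refine eLpNorm_le_mul_eLpNorm_of_ae_le_mul (.of_forall fun x => ?_) 2
          by_cases hx : x ∈ tsupport η
          · simp only [hD, hR, Set.indicator_of_mem (hv0 x hx), Set.indicator_of_mem (hv1 x hx)]
            rw [← smul_sub, norm_smul, show gradField (u k) (x + v) - gradField (u k) x -
              (G (x + v) - G x) = gradField (u k) (x + v) - G (x + v) -
                (gradField (u k) x - G x) by abel]
            exact mul_le_mul_of_nonneg_right (hMη x) (norm_nonneg _)
          · simp only [hD, image_eq_zero_of_notMem_tsupport hx, zero_smul, sub_zero, norm_zero]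
            positivity
      _ ≤ ENNReal.ofReal Mη * (eLpNorm (R k) 2 volume + eLpNorm (R k) 2 volume) := by
          gcongr
          refine (eLpNorm_sub_le ((hRm k).comp_measurePreserving
            (measurePreserving_add_right_volume v)) (hRm k) one_le_two).trans ?_
          exact add_le_add_left (eLpNorm_translate (R k) (hRm k) v).le _
  have hG2 : MemLp (fun x => η x • (G (x + v) - G x)) 2 :=
    hη.memLp_smul (memLp_translate_sub hG v)
  have hleft := (tendsto_integral_inner_of_L2 hf2 hD2 hG2 hDlim).abs
  have hd2 : ∀ k, eLpNorm (fun x => gradField (u k) x - G x) 2 (volume.restrict Ω) ≠ ⊤ := fun k =>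
    ((hu2 k).sub hGΩ).2.ne
  have hd0 : Tendsto (fun k => (eLpNorm (fun x => gradField (u k) x - G x) 2
      (volume.restrict Ω)).toReal) atTop (𝓝 0) := by
    have := (ENNReal.tendsto_toReal ENNReal.zero_ne_top).comp hlim
    simpa [Function.comp_def] using this
  have hright : Tendsto (fun k => (eLpNorm f 2 volume).toReal * (2 * M * ‖v‖ *
      ((eLpNorm (fun x => gradField (u k) x - G x) 2 (volume.restrict Ω)).toReal +
        (eLpNorm G 2 (volume.restrict Ω)).toReal))) atTop
      (𝓝 ((eLpNorm f 2 volume).toReal * (2 * M * ‖v‖ *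
        (0 + (eLpNorm G 2 (volume.restrict Ω)).toReal)))) :=
    ((hd0.add_const _).const_mul _).const_mul _
  rw [zero_add] at hright
  refine le_of_tendsto_of_tendsto' hleft hright fun k => ?_
  rw [hI k, abs_neg]
  refine (abs_integral_inner_le hf2 (hE2 k)).trans ?_
  gcongr
  have h3 : eLpNorm (gradField (u k)) 2 (volume.restrict Ω) ≤
      eLpNorm (fun x => gradField (u k) x - G x) 2 (volume.restrict Ω) +
        eLpNorm G 2 (volume.restrict Ω) := by
    have := eLpNorm_add_le ((hu2 k).sub hGΩ).1 hGΩ.1 one_le_two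
    rw [sub_add_cancel] at this
    exact this
  have h4 : eLpNorm (E k) 2 volume ≤ ENNReal.ofReal (2 * M * ‖v‖) *
      (eLpNorm (fun x => gradField (u k) x - G x) 2 (volume.restrict Ω) +
        eLpNorm G 2 (volume.restrict Ω)) := (hEle k).trans (by gcongr)
  have h5 := ENNReal.toReal_mono (ENNReal.mul_ne_top ENNReal.ofReal_ne_top
    (ENNReal.add_ne_top.2 ⟨hd2 k, hGΩ.2.ne⟩)) h4
  rwa [ENNReal.toReal_mul, ENNReal.toReal_ofReal (by positivity),
    ENNReal.toReal_add (hd2 k) hGΩ.2.ne] at h5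

/-- Differences of functions with square integrable weak gradient are controlled in `L²`. -/
theorem eLpNorm_smul_difference_le_of_hasWeakPartial {Ω : Set (RVec n)} (hΩ : IsOpen Ω)
    {u : RVec n → ℝ} {g : Fin n → RVec n → ℝ} (hul : LocallyIntegrableOn u Ω)
    (hg : ∀ i, MemLp (g i) 2 (volume.restrict Ω))
    (hu : ∀ i, HasWeakPartial Ω i u (g i)) {η : RVec n → ℝ} {M : ℝ}
    (hM : ∀ x, ‖η x‖ ≤ M) {ρ : ℝ} (hρ : 0 < ρ)
    (hρΩ : ∀ x ∈ tsupport η, Metric.ball x ρ ⊆ Ω) {v : RVec n} (hv : ‖v‖ < ρ / 2) :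
    eLpNorm (fun x => η x * (u (x + v) - u x)) 2 volume ≤
      ENNReal.ofReal (M * ‖v‖) * ∑ i, eLpNorm (g i) 2 (volume.restrict Ω) := by
  have hΩm := hΩ.measurableSet
  have hM0 : 0 ≤ M := (norm_nonneg _).trans (hM 0)
  set V : Set (RVec n) := Metric.thickening (ρ / 2) (tsupport η) with hV
  have hVo : IsOpen V := Metric.isOpen_thickening
  have hVΩ : ∀ x ∈ V, ∀ t ∈ Set.Icc (0 : ℝ) 1, x + t • v ∈ Ω := fun x hx t ht => by
    obtain ⟨y, hy, hxy⟩ := Metric.mem_thickening_iff.1 hx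
    refine hρΩ y hy ?_
    rw [Metric.mem_ball, dist_eq_norm, add_sub_right_comm]
    rw [dist_eq_norm] at hxy
    have h1 : ‖t • v‖ ≤ ‖v‖ := by
      rw [norm_smul, Real.norm_of_nonneg ht.1]
      exact mul_le_of_le_one_left (norm_nonneg _) ht.2
    have := norm_add_le (x - y) (t • v)
    linarith
  set P : RVec n → ℝ := Ω.indicator fun x => ∑ i, v i * g i x with hP
  have hPm : AEStronglyMeasurable P volume := by
    rw [hP, aestronglyMeasurable_indicator_iff hΩm]
    exact Finset.aestronglyMeasurable_fun_sum _ fun i _ => (hg i).1.const_mul (v i)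
  have hftc := ae_sub_eq_segmentAverage hVo hVΩ hul
    (show LocallyIntegrableOn (fun x => ∑ i, v i * g i x) Ω by
      intro x hx
      obtain ⟨s, hs, hsi⟩ : ∃ s ∈ 𝓝[Ω] x, ∀ i, IntegrableOn (g i) s := by
        have h1 : ∀ i, ∃ s ∈ 𝓝[Ω] x, IntegrableOn (g i) s := fun i => (hu i).2.1 x hx
        choose s hs hsi using h1
        exact ⟨⋂ i, s i, (Filter.iInter_mem.2 hs), fun i => (hsi i).mono_set
          (Set.iInter_subset _ i)⟩
      exact ⟨s, hs, integrable_finsetSum _ fun i _ => (hsi i).const_mul (v i)⟩)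
    fun φ hφ => integral_mul_fderiv_of_hasWeakPartial hu hul hφ v
  have h1 : eLpNorm (fun x => η x * (u (x + v) - u x)) 2 volume ≤
      ENNReal.ofReal M * eLpNorm (segmentAverage v P) 2 volume := by
    refine eLpNorm_le_mul_eLpNorm_of_ae_le_mul ?_ 2
    rw [Filter.EventuallyEq, ae_restrict_iff' hVo.measurableSet] at hftc
    filter_upwards [hftc] with x hx
    rw [norm_mul]
    by_cases hxη : x ∈ tsupport η
    · have hxV : x ∈ V := Metric.self_subset_thickening (half_pos hρ) _ hxη
      have h2 : segmentAverage v P x = segmentAverage v (fun x => ∑ i, v i * g i x) x := by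
        rw [segmentAverage_eq, segmentAverage_eq]
        refine setIntegral_congr_fun measurableSet_Ioc fun t ht => ?_
        exact Set.indicator_of_mem (hVΩ x hxV t ⟨ht.1.le, ht.2⟩) _
      rw [hx hxV, h2]
      exact mul_le_mul_of_nonneg_right (hM x) (norm_nonneg _)
    · rw [image_eq_zero_of_notMem_tsupport hxη, norm_zero, zero_mul]
      positivity
  have h2 : eLpNorm P 2 volume ≤
      ENNReal.ofReal ‖v‖ * ∑ i, eLpNorm (g i) 2 (volume.restrict Ω) := by
    rw [hP, eLpNorm_indicator_eq_eLpNorm_restrict hΩm]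
    have e : (fun x => ∑ i, v i * g i x) = ∑ i, fun x => v i * g i x := by ext x; simp
    rw [e]
    refine (eLpNorm_sum_le (fun i _ => (hg i).1.const_mul (v i)) one_le_two).trans ?_
    · rw [Finset.mul_sum]
      refine Finset.sum_le_sum fun i _ => eLpNorm_le_mul_eLpNorm_of_ae_le_mul
        (.of_forall fun x => ?_) 2
      rw [norm_mul]
      exact mul_le_mul_of_nonneg_right (PiLp.norm_apply_le v i) (norm_nonneg _)
  refine h1.trans ((mul_le_mul_right ((eLpNorm_translateAverage_le one_le_two (by simp) hPm
    (measurable_smul_const_RVec v)).trans h2) _).trans (le_of_eq ?_))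
  rw [← mul_assoc, ← ENNReal.ofReal_mul hM0]

/-- If `a` exceeded the claimed bound, it would exceed `p` because of the summand 1; then p² ≤ pa
reduces the inequality to a linear one. -/
theorem le_mul_of_quadratic {ε a p P Q : ℝ} (hε : 0 < ε) (hp : 0 ≤ p) (hP : 0 ≤ P)
    (hQ : 0 ≤ Q) (h : ε * a ^ 2 ≤ P * p * a + Q * p ^ 2) : a ≤ ((P + Q) / ε + 1) * p := by
  by_contra! hlt
  have hq : 0 ≤ (P + Q) / ε * p := by positivity
  have hpa : p ≤ a := by linarith
  have ha1 : 0 < a := lt_of_le_of_lt (by positivity) hlt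
  have h1 : Q * p * p ≤ Q * p * a := mul_le_mul_of_nonneg_left hpa (by positivity)
  have h2 : ε * a ≤ (P + Q) * p := le_of_mul_le_mul_right (by linarith) ha1
  have h3 : ε * (((P + Q) / ε + 1) * p) < ε * a := mul_lt_mul_of_pos_left hlt hε
  have h4 : ε * (((P + Q) / ε + 1) * p) = (P + Q) * p + ε * p := by field_simp
  have h5 : 0 ≤ ε * p := by positivity
  linarith

/-- Local `L²` bound on the difference quotients of solutions of strongly monotone equations. -/
theorem exists_eLpNorm_difference_le {Ω : Set (RVec n)} (hΩ : IsOpen Ω)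
    {S : RMat N n → RMat N n} {ε : ℝ} {Λ : ℝ≥0} (hε : 0 < ε)
    (hSm : ∀ z w, ε * ‖w - z‖ ^ 2 ≤ ⟪S w - S z, w - z⟫) (hSL : LipschitzWith Λ S)
    {G T : RVec n → RMat N n} (hG : MemLp G 2) (hT : MemLp T 2) (hSG : MemLp (fun x => S (G x)) 2)
    (h : ∀ φ : RVec n → RVec N, ContDiff ℝ ∞ φ → HasCompactSupport φ →
      tsupport φ ⊆ Ω → ∫ x, ⟪S (G x) - T x, gradField φ x⟫ = 0)
    {u : ℕ → RVec n → RVec N} (hu : ∀ k, ContDiff ℝ ∞ (u k))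
    (hu2 : ∀ k, MemLp (gradField (u k)) 2 (volume.restrict Ω))
    (hlim : Tendsto (fun k => eLpNorm (fun x => gradField (u k) x - G x) 2 (volume.restrict Ω))
      atTop (𝓝 0))
    {η : RVec n → ℝ} (hη : IsTestFunction Ω η) {ρ : ℝ}
    (hρΩ : ∀ x ∈ tsupport η, Metric.ball x ρ ⊆ Ω) {CT : ℝ} (hCT : 0 ≤ CT)
    (hTd : ∀ v : RVec n, ‖v‖ < ρ → (eLpNorm (fun x => η x • (T (x + v) - T x)) 2 volume).toReal ≤
      CT * ‖v‖) :
    ∃ C, 0 ≤ C ∧ ∀ v : RVec n, ‖v‖ < ρ →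
      (eLpNorm (fun x => η x • (G (x + v) - G x)) 2 volume).toReal ≤ C * ‖v‖ := by
  obtain ⟨M, hM⟩ : ∃ M, ∀ x, ‖gradVec η x‖ ≤ M :=
    (continuous_gradVec hη.1).bounded_above_of_compact_support (hη.2.mono' fun x hx => by
      by_contra h'
      exact hx (gradVec_eq_zero h'))
  have hM0 : 0 ≤ M := (norm_nonneg _).trans (hM 0)
  set B : ℝ := 2 * M * (eLpNorm G 2 (volume.restrict Ω)).toReal with hB
  have hB0 : 0 ≤ B := by positivity
  have hΛ0 : (0 : ℝ) ≤ Λ := Λ.2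
  -- This constant degenerates with `ε`. The bound serves only to produce square integrable second
  -- derivatives; the uniform estimate comes later.
  refine ⟨((B * Λ + CT) + B * CT) / ε + 1, by positivity, fun v hv => ?_⟩
  have hA : MemLp (fun x => S (G x) - T x) 2 := hSG.sub hT
  have hseg : ∀ x ∈ tsupport η, ∀ t ∈ Set.Icc (0 : ℝ) 1, x + t • v ∈ Ω := fun x hx t ht => by
    refine hρΩ x hx ?_
    rw [Metric.mem_ball, dist_eq_norm, add_sub_cancel_left, norm_smul, Real.norm_of_nonneg ht.1]
    exact (mul_le_of_le_one_left (norm_nonneg _) ht.2).trans_lt hv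
  have h1 := abs_integral_inner_difference_le hΩ hA hG h hu hu2 hlim hη hM hseg
  set dG : RVec n → RMat N n := fun x => η x • (G (x + v) - G x) with hdG
  set dT : RVec n → RMat N n := fun x => η x • (T (x + v) - T x) with hdT
  set dS : RVec n → RMat N n := fun x => η x • (S (G (x + v)) - S (G x)) with hdS
  have hdG2 : MemLp dG 2 := hη.memLp_smul (memLp_translate_sub hG v)
  have hdT2 : MemLp dT 2 := hη.memLp_smul (memLp_translate_sub hT v)
  have hdS2 : MemLp dS 2 := hη.memLp_smul (memLp_translate_sub hSG v)
  set a : ℝ := (eLpNorm dG 2 volume).toReal with ha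
  set b : ℝ := (eLpNorm dT 2 volume).toReal with hb
  have ha0 : 0 ≤ a := ENNReal.toReal_nonneg
  have hb0 : 0 ≤ b := ENNReal.toReal_nonneg
  have hbT : b ≤ CT * ‖v‖ := hTd v hv
  have eA : ∀ x, η x • (S (G (x + v)) - T (x + v) - (S (G x) - T x)) = dS x - dT x := by
    intro x
    simp only [hdS, hdT]
    rw [← smul_sub]
    congr 1
    abel
  simp only [eA] at h1
  have hSle : (eLpNorm dS 2 volume).toReal ≤ Λ * a := by
    have h2 : eLpNorm dS 2 volume ≤ ENNReal.ofReal Λ * eLpNorm dG 2 volume := by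
      refine eLpNorm_le_mul_eLpNorm_of_ae_le_mul (.of_forall fun x => ?_) 2
      simp only [hdS, hdG, norm_smul]
      have := hSL.norm_sub_le (G (x + v)) (G x)
      nlinarith [mul_le_mul_of_nonneg_left this (norm_nonneg (η x))]
    have h3 := ENNReal.toReal_mono (ENNReal.mul_ne_top ENNReal.ofReal_ne_top hdG2.2.ne) h2
    rwa [ENNReal.toReal_mul, ENNReal.toReal_ofReal hΛ0] at h3
  have hAle : (eLpNorm (fun x => dS x - dT x) 2 volume).toReal ≤ Λ * a + b := by
    have h2 := ENNReal.toReal_mono (ENNReal.add_ne_top.2 ⟨hdS2.2.ne, hdT2.2.ne⟩)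
      (eLpNorm_sub_le hdS2.1 hdT2.1 one_le_two)
    rw [ENNReal.toReal_add hdS2.2.ne hdT2.2.ne] at h2
    exact h2.trans (by linarith)
  have hTG := (le_abs_self _).trans (abs_integral_inner_le hdT2 hdG2)
  have hmono : ε * a ^ 2 ≤ (∫ x, ⟪dS x - dT x, dG x⟫) + ∫ x, ⟪dT x, dG x⟫ := by
    have e1 : ∫ x, (⟪dS x - dT x, dG x⟫ + ⟪dT x, dG x⟫) =
        (∫ x, ⟪dS x - dT x, dG x⟫) + ∫ x, ⟪dT x, dG x⟫ :=
      integral_add ((hdS2.sub hdT2).integrable_inner₂ hdG2) (hdT2.integrable_inner₂ hdG2)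
    rw [← e1, ha, ← integral_norm_sq_eq hdG2, ← integral_const_mul]
    refine integral_mono ((hdG2.integrable_norm_pow (by norm_num)).const_mul ε)
      (((hdS2.sub hdT2).integrable_inner₂ hdG2).add (hdT2.integrable_inner₂ hdG2)) fun x => ?_
    simp only
    rw [← inner_add_left, sub_add_cancel]
    simp only [hdS, hdG, norm_smul, real_inner_smul_left, real_inner_smul_right, mul_pow]
    have := mul_le_mul_of_nonneg_left (hSm (G x) (G (x + v))) (sq_nonneg (η x))
    rw [Real.norm_eq_abs, sq_abs]
    linarith
  have h4 := le_abs_self (∫ x, ⟪dS x - dT x, dG x⟫)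
  have hkey : ε * a ^ 2 ≤ (Λ * a + CT * ‖v‖) * (B * ‖v‖) + CT * ‖v‖ * a := by
    have h5 : (eLpNorm (fun x => dS x - dT x) 2 volume).toReal *
        (2 * M * ‖v‖ * (eLpNorm G 2 (volume.restrict Ω)).toReal) ≤
          (Λ * a + CT * ‖v‖) * (B * ‖v‖) := by
      have e3 : 2 * M * ‖v‖ * (eLpNorm G 2 (volume.restrict Ω)).toReal = B * ‖v‖ := by
        rw [hB]; ring
      rw [e3]
      gcongr
      exact hAle.trans (by linarith)
    have h6 : b * a ≤ CT * ‖v‖ * a := mul_le_mul_of_nonneg_right hbT ha0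
    linarith
  refine le_mul_of_quadratic hε (norm_nonneg v) (by positivity) (by positivity) ?_
  linarith

end DifferenceQuotients

/-! ### Existence of weak derivatives and the chain rule -/

theorem Real.inner_eq_mul (x y : ℝ) : ⟪x, y⟫ = x * y := by simp [mul_comm]

theorem MeasureTheory.AEStronglyMeasurable.clm_apply_aestronglyMeasurable {α E F : Type*}
    [MeasurableSpace α] {μ : Measure α} [NormedAddCommGroup E] [NormedSpace ℝ E]
    [NormedAddCommGroup F] [NormedSpace ℝ F] {A : α → E →L[ℝ] F} {g : α → E}
    (hA : AEStronglyMeasurable A μ) (hg : AEStronglyMeasurable g μ) :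
    AEStronglyMeasurable (fun x => A x (g x)) μ :=
  isBoundedBilinearMap_apply.continuous.comp_aestronglyMeasurable (hA.prodMk hg)

/-- Bounded sequences in Hilbert spaces have weak limits along some filter. -/
theorem exists_weak_limit_of_bounded {H : Type*} [NormedAddCommGroup H] [InnerProductSpace ℝ H]
    [CompleteSpace H] {U : ℕ → H} {C : ℝ} (hU : ∀ k, ‖U k‖ ≤ C) :
    ∃ (X : H) (l : Filter ℕ), l.NeBot ∧ l ≤ atTop ∧
      ∀ y, Tendsto (fun k => ⟪U k, y⟫) l (𝓝 ⟪X, y⟫) := by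
  -- Convergence along an ultrafilter replaces a weakly convergent subsequence, so no separability
  -- is needed.
  let l : Ultrafilter ℕ := Ultrafilter.of atTop
  let Φ : ℕ → WeakDual ℝ H := fun k =>
    StrongDual.toWeakDual (InnerProductSpace.toDual ℝ H (U k))
  have hK := WeakDual.isCompact_closedBall (𝕜 := ℝ) (E := H) 0 C
  obtain ⟨Z, -, hZ⟩ := hK.ultrafilter_le_nhds (l.map Φ) (by
    rw [le_principal_iff, Ultrafilter.mem_coe, Ultrafilter.mem_map]
    refine Filter.mem_of_superset Filter.univ_mem fun k _ => ?_
    simp [Φ, hU k])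
  refine ⟨(InnerProductSpace.toDual ℝ H).symm (WeakDual.toStrongDual Z), l, inferInstance,
    Ultrafilter.of_le _, fun y => ?_⟩
  have h1 : Tendsto (fun k => Φ k y) l (𝓝 (Z y)) :=
    ((WeakDual.eval_continuous y).tendsto Z).comp (show Tendsto Φ l (𝓝 Z) from hZ)
  rw [InnerProductSpace.toDual_symm_apply]
  exact h1

section WeakDerivative

variable {n N : ℕ}

theorem memLp_apply {ι : Type*} [Fintype ι] {α : Type*} [MeasurableSpace α] {μ : Measure α}
    {q : ℝ≥0∞} {G : α → EuclideanSpace ℝ ι} (hG : MemLp G q μ) (c : ι) :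
    MemLp (fun x => G x c) q μ :=
  hG.of_le ((EuclideanSpace.proj c).continuous.comp_aestronglyMeasurable hG.1)
    (.of_forall fun x => PiLp.norm_apply_le (G x) c)

/-- Difference quotients bounded in L² have a weak limit, which is the weak derivative where η = 1:
discrete integration by parts moves the quotient to the test function, where it converges strongly.
-/
theorem exists_hasWeakPartial_of_difference_le {Ω V : Set (RVec n)}
    {G : RVec n → RMat N n} (hG : MemLp G 2) {η : RVec n → ℝ} (hη : IsTestFunction Ω η)
    (hηV : ∀ x ∈ V, η x = 1) {ρ C : ℝ} (hρ : 0 < ρ)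
    (hC : ∀ v : RVec n, ‖v‖ < ρ →
      (eLpNorm (fun x => η x • (G (x + v) - G x)) 2 volume).toReal ≤ C * ‖v‖) (s : Fin n) :
    ∃ X : RVec n → RMat N n, MemLp X 2 ∧
      ∀ c, HasWeakPartial V s (fun x => G x c) (fun x => X x c) := by
  let a : ℕ → ℝ := fun k => (ρ / 2) * (1 / ((k : ℝ) + 1))
  have ha : ∀ k, 0 < a k := fun k => by positivity
  have haρ : ∀ k, a k < ρ := fun k => by
    have h1 : 1 / ((k : ℝ) + 1) ≤ 1 := (div_le_one (by positivity)).2 (by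
      have := Nat.cast_nonneg (α := ℝ) k; linarith)
    have := mul_le_of_le_one_right (half_pos hρ).le h1
    simp only [a]; linarith
  have ha0 : Tendsto a atTop (𝓝 0) := by
    have := (tendsto_one_div_add_atTop_nhds_zero_nat (𝕜 := ℝ)).const_mul (ρ / 2)
    rwa [mul_zero] at this
  set e : RVec n := EuclideanSpace.single s 1 with he
  have he1 : ‖e‖ = 1 := by simp [he]
  have hnorm : ∀ k, ‖a k • e‖ = a k := fun k => by
    rw [norm_smul, he1, mul_one, Real.norm_of_nonneg (ha k).le]
  have hU : ∀ k, MemLp (fun x => (a k)⁻¹ • (η x • (G (x + a k • e) - G x))) 2 := fun k =>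
    (hη.memLp_smul (memLp_translate_sub hG _)).const_smul (a k)⁻¹
  have hUC : ∀ k, ‖(hU k).toLp _‖ ≤ C := fun k => by
    rw [Lp.norm_toLp]
    have h1 := hC (a k • e) ((hnorm k).trans_lt (haρ k))
    rw [hnorm k] at h1
    have h2 := eLpNorm_const_smul (a k)⁻¹ (fun x => η x • (G (x + a k • e) - G x)) 2
      (volume : Measure (RVec n))
    have h3 : eLpNorm (fun x => (a k)⁻¹ • (η x • (G (x + a k • e) - G x))) 2 volume =
        ‖(a k)⁻¹‖ₑ * eLpNorm (fun x => η x • (G (x + a k • e) - G x)) 2 volume := h2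
    rw [h3, ENNReal.toReal_mul, toReal_enorm, norm_inv, Real.norm_of_nonneg (ha k).le,
      inv_mul_le_iff₀ (ha k)]
    linarith
  obtain ⟨X, l, hl, hl2, hX⟩ := exists_weak_limit_of_bounded hUC
  have hX2 : MemLp X 2 := Lp.memLp X
  have hloc : ∀ {F : RVec n → RMat N n} (_ : MemLp F 2) c, LocallyIntegrableOn (fun x => F x c) V :=
    fun hF c => ((memLp_apply hF c).locallyIntegrable one_le_two).locallyIntegrableOn V
  refine ⟨X, hX2, fun c => hasWeakPartial_of_integral_eq (hloc hG c) (hloc hX2 c) fun φ hφ => ?_⟩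
  have hφ2 : ∀ {ψ : RVec n → ℝ}, IsTestFunction V ψ → MemLp ψ 2 := fun hψ =>
    hψ.1.continuous.memLp_of_hasCompactSupport hψ.2
  -- the test field
  have hY : MemLp (fun x => φ x • (EuclideanSpace.single c (1 : ℝ) : RMat N n)) 2 :=
    (hφ.1.continuous.smul continuous_const).memLp_of_hasCompactSupport hφ.2.smul_right
  have hlim1 : Tendsto (fun k => ∫ x, (a k)⁻¹ * (η x * (G (x + a k • e) c - G x c)) * φ x) l
      (𝓝 (∫ x, X x c * φ x)) := by
    have h1 := hX (hY.toLp _)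
    have h2 : ∫ x, X x c * φ x = ⟪X, hY.toLp _⟫ := by
      rw [L2.inner_def]
      refine integral_congr_ae ?_
      filter_upwards [hY.coeFn_toLp] with x hx
      rw [hx, real_inner_smul_right, EuclideanSpace.inner_single_right]
      simp [mul_comm]
    rw [h2]
    refine h1.congr fun k => ?_
    rw [← integral_inner_eq_inner_toLp]
    refine integral_congr_ae (.of_forall fun x => ?_)
    simp only
    rw [real_inner_smul_right, EuclideanSpace.inner_single_right]
    simp [mul_comm]
  -- the other form of the integrals
  have hφs := hφ.fderiv_apply e
  have hseg : ∀ k x, φ (x - a k • e) - φ x =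
      -(a k) * segmentAverage (-(a k • e)) (fun z => fderiv ℝ φ z e) x := fun k x => by
    have hd : ∀ t ∈ Set.uIcc (0 : ℝ) 1, HasDerivAt (fun t : ℝ => φ (x + t • -(a k • e)))
        (-(a k) * fderiv ℝ φ (x + t • -(a k • e)) e) t := fun t _ => by
      have h1 : HasDerivAt (fun t : ℝ => x + t • -(a k • e)) (-(a k • e)) t := by
        simpa using ((hasDerivAt_id t).smul_const (-(a k • e))).const_add x
      have h2 := ((hφ.1.differentiable (by simp) (x + t • -(a k • e))).hasFDerivAt).comp_hasDerivAt
        t h1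
      simpa [Function.comp_def] using h2
    have hc : Continuous fun t : ℝ => -(a k) * fderiv ℝ φ (x + t • -(a k • e)) e :=
      continuous_const.mul (hφs.1.continuous.comp (by fun_prop))
    have h := intervalIntegral.integral_eq_sub_of_hasDerivAt hd (hc.intervalIntegrable _ _)
    rw [segmentAverage_eq, ← intervalIntegral.integral_of_le zero_le_one,
      ← intervalIntegral.integral_const_mul, h]
    simp [sub_eq_add_neg]
  have hform : ∀ k, ∫ x, (a k)⁻¹ * (η x * (G (x + a k • e) c - G x c)) * φ x =
      -∫ x, G x c * segmentAverage (-(a k • e)) (fun z => fderiv ℝ φ z e) x := by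
    intro k
    have e1 : ∀ x, (a k)⁻¹ * (η x * (G (x + a k • e) c - G x c)) * φ x =
        (a k)⁻¹ * (G (x + a k • e) c * φ x - G x c * φ x) := fun x => by
      by_cases hx : x ∈ V
      · rw [hηV x hx]; ring
      · rw [image_eq_zero_of_notMem_tsupport fun h => hx (hφ.3 h)]; ring
    simp only [e1]
    have hi2 : Integrable fun x => G x c * φ x :=
      hφ.integrable_mul (hloc hG c)
    have hi3 : Integrable fun x => G x c * φ (x - a k • e) := by
      have h1 : Integrable fun x => G x c * φ (x + -(a k • e)) :=
        MemLp.integrable_mul (memLp_apply hG c) ((hφ2 hφ).comp_measurePreserving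
          (measurePreserving_add_right_volume (-(a k • e))))
      simpa only [sub_eq_add_neg] using h1
    have e2 : ∫ x, G (x + a k • e) c * φ x = ∫ x, G x c * φ (x - a k • e) := by
      rw [← integral_add_right_eq_self (fun x => G x c * φ (x - a k • e)) (a k • e)]
      simp
    have hi1 : Integrable fun x => G (x + a k • e) c * φ x := by
      have := hi3.comp_add_right (a k • e)
      simpa using this
    rw [integral_const_mul, integral_sub hi1 hi2, e2, ← integral_sub hi3 hi2, ← integral_const_mul,
      ← integral_neg]
    refine integral_congr_ae (.of_forall fun x => ?_)
    simp only
    rw [← mul_sub, hseg]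
    have := (ha k).ne'
    field_simp
  have hlim2 : Tendsto (fun k => -∫ x, G x c * segmentAverage (-(a k • e))
      (fun z => fderiv ℝ φ z e) x) l (𝓝 (-∫ x, G x c * fderiv ℝ φ x e)) := by
    have : Fact ((1 : ℝ≥0∞) ≤ 2) := ⟨one_le_two⟩
    have hv0 : Tendsto (fun k => -(a k • e)) l (𝓝 0) := by
      have := ((ha0.mono_left hl2).smul_const e).neg
      simpa using this
    have h1 := tendsto_integral_inner_of_L2 (memLp_apply hG c)
      (fun k => memLp_segmentAverage one_le_two (by simp) (hφ2 hφs) (-(a k • e))) (hφ2 hφs)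
      (tendsto_eLpNorm_segmentAverage_sub (by simp) hv0 (hφ2 hφs))
    simp only [Real.inner_eq_mul] at h1
    exact h1.neg
  simp only [hform] at hlim1
  have := tendsto_nhds_unique hlim2 hlim1
  linarith

theorem EuclideanSpace.norm_le_sum {ι : Type*} [Fintype ι] (z : EuclideanSpace ℝ ι) :
    ‖z‖ ≤ ∑ c, ‖z c‖ := by
  classical
  calc ‖z‖ = ‖∑ c, z c • EuclideanSpace.basisFun ι ℝ c‖ := by
        congr 1
        exact ((EuclideanSpace.basisFun ι ℝ).sum_repr z).symm
    _ ≤ ∑ c, ‖z c • EuclideanSpace.basisFun ι ℝ c‖ := norm_sum_le _ _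
    _ = ∑ c, ‖z c‖ := by
        refine Finset.sum_congr rfl fun c _ => ?_
        rw [norm_smul, (EuclideanSpace.basisFun ι ℝ).norm_eq_one, mul_one]

theorem eLpNorm_euclidean_le {ι α : Type*} [Fintype ι] [MeasurableSpace α] {μ : Measure α}
    {q : ℝ≥0∞} (hq : 1 ≤ q) {G : α → EuclideanSpace ℝ ι} (hG : AEStronglyMeasurable G μ) :
    eLpNorm G q μ ≤ ∑ c, eLpNorm (fun x => G x c) q μ := by
  have h1 : ∀ c, AEStronglyMeasurable (fun x => ‖G x c‖) μ := fun c =>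
    ((EuclideanSpace.proj (𝕜 := ℝ) c).continuous.comp_aestronglyMeasurable hG).norm
  calc eLpNorm G q μ ≤ eLpNorm (∑ c, fun x => ‖G x c‖) q μ := by
        refine eLpNorm_mono_real fun x => ?_
        rw [Finset.sum_apply]
        exact EuclideanSpace.norm_le_sum (G x)
    _ ≤ ∑ c, eLpNorm (fun x => ‖G x c‖) q μ := eLpNorm_sum_le (fun c _ => h1 c) hq
    _ = ∑ c, eLpNorm (fun x => G x c) q μ := by simp only [eLpNorm_norm]

theorem memLp_toLp {ι α : Type*} [Fintype ι] [MeasurableSpace α] {μ : Measure α}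
    {q : ℝ≥0∞} (hq : 1 ≤ q) {g : ι → α → ℝ} (hg : ∀ c, MemLp (g c) q μ) :
    MemLp (fun x => (WithLp.toLp 2 fun c => g c x : EuclideanSpace ℝ ι)) q μ := by
  have hm : AEStronglyMeasurable
      (fun x => (WithLp.toLp 2 fun c => g c x : EuclideanSpace ℝ ι)) μ :=
    (PiLp.continuous_toLp 2 _).comp_aestronglyMeasurable
      (aemeasurable_pi_lambda _ fun c => (hg c).1.aemeasurable).aestronglyMeasurable
  exact ⟨hm, (eLpNorm_euclidean_le hq hm).trans_lt (ENNReal.sum_lt_top.2 fun c _ => (hg c).2)⟩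

theorem tendsto_eLpNorm_toLp_sub {ι α : Type*} [Fintype ι] [MeasurableSpace α] {μ : Measure α}
    {q : ℝ≥0∞} (hq : 1 ≤ q) {f : ℕ → ι → α → ℝ} {g : ι → α → ℝ} (hf : ∀ k c, MemLp (f k c) q μ)
    (hg : ∀ c, MemLp (g c) q μ)
    (h : ∀ c, Tendsto (fun k => eLpNorm (fun x => f k c x - g c x) q μ) atTop (𝓝 0)) :
    Tendsto (fun k => eLpNorm (fun x => (WithLp.toLp 2 fun c => f k c x : EuclideanSpace ℝ ι) -
      WithLp.toLp 2 fun c => g c x) q μ) atTop (𝓝 0) := by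
  have h1 : Tendsto (fun k => ∑ c, eLpNorm (fun x => f k c x - g c x) q μ) atTop (𝓝 0) := by
    simpa using tendsto_finsetSum Finset.univ fun c _ => h c
  refine tendsto_of_tendsto_of_tendsto_of_le_of_le tendsto_const_nhds h1 (fun _ => zero_le)
    fun k => ?_
  exact eLpNorm_euclidean_le hq ((memLp_toLp hq (hf k)).1.sub (memLp_toLp hq hg).1)

/-- The chain rule for weak derivatives. -/
theorem HasWeakPartial.comp_contDiff {ι : Type*} [Fintype ι] {V : Set (RVec n)}
    (hV : IsOpen V) {s : Fin n} {G X : RVec n → EuclideanSpace ℝ ι}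
    (hG : LocallyIntegrableOn G V) (hX : LocallyIntegrableOn X V)
    (h : ∀ c, HasWeakPartial V s (fun x => G x c) fun x => X x c)
    {F : EuclideanSpace ℝ ι → ℝ} (hF : ContDiff ℝ 1 F) {M : ℝ≥0} (hM : ∀ z, ‖fderiv ℝ F z‖ ≤ M) :
    HasWeakPartial V s (fun x => F (G x)) fun x => fderiv ℝ F (G x) (X x) := by
  have hFL : LipschitzWith M F := lipschitzWith_of_nnnorm_fderiv_le
    (hF.differentiable (by simp)) fun z => by exact_mod_cast hM z
  have hDF : Continuous (fderiv ℝ F) := hF.continuous_fderiv (by simp)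
  have hM0 : (0 : ℝ) ≤ M := M.2
  -- local integrability
  have hl1 : LocallyIntegrableOn (fun x => F (G x)) V := by
    rw [locallyIntegrableOn_iff hV.isLocallyClosed] at hG ⊢
    intro K hKV hK
    have hi := hG K hKV hK
    have h1 : IntegrableOn (fun x => M * ‖G x‖ + ‖F 0‖) K :=
      (hi.norm.const_mul (M : ℝ)).add (integrableOn_const hK.measure_lt_top.ne)
    refine Integrable.mono' h1 (hFL.continuous.comp_aestronglyMeasurable hi.1)
      (.of_forall fun x => ?_)
    have h2 := hFL.norm_sub_le (G x) 0
    rw [sub_zero] at h2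
    have h3 := norm_sub_norm_le (F (G x)) (F 0)
    linarith
  have hl2 : LocallyIntegrableOn (fun x => fderiv ℝ F (G x) (X x)) V := by
    rw [locallyIntegrableOn_iff hV.isLocallyClosed] at hG hX ⊢
    intro K hKV hK
    refine Integrable.mono' ((hX K hKV hK).norm.const_mul (M : ℝ))
      (MeasureTheory.AEStronglyMeasurable.clm_apply_aestronglyMeasurable
        (hDF.comp_aestronglyMeasurable (hG K hKV hK).1) (hX K hKV hK).1)
      (.of_forall fun x => ((fderiv ℝ F (G x)).le_opNorm _).trans
        (mul_le_mul_of_nonneg_right (hM _) (norm_nonneg _)))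
  refine hasWeakPartial_of_integral_eq hl1 hl2 fun φ hφ => ?_
  set K := tsupport φ with hK
  obtain ⟨r, hr, hrV⟩ := hφ.2.exists_cthickening_subset_open hV hφ.3
  set K' := Metric.cthickening r K with hK'
  have hK'c : IsCompact K' := hφ.2.isCompact.cthickening
  have hKK' : K ⊆ K' := Metric.self_subset_cthickening _
  let U : ι → RVec n → ℝ := fun c => K'.indicator fun x => G x c
  let W : ι → RVec n → ℝ := fun c => K'.indicator fun x => X x c
  have hU : ∀ c, Integrable (U c) := fun c => (integrable_indicator_iff hK'c.measurableSet).2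
    ((h c).1.integrableOn_compact_subset hrV hK'c)
  have hW : ∀ c, Integrable (W c) := fun c => (integrable_indicator_iff hK'c.measurableSet).2
    ((h c).2.1.integrableOn_compact_subset hrV hK'c)
  let ρ : ℕ → ℝ := fun k => (r / 2) * (1 / ((k : ℝ) + 1))
  have hρ : ∀ k, 0 < ρ k := fun k => by positivity
  have hρr : ∀ k, ρ k < r := fun k => by
    have h1 : 1 / ((k : ℝ) + 1) ≤ 1 := (div_le_one (by positivity)).2 (by
      have := Nat.cast_nonneg (α := ℝ) k; linarith)
    have := mul_le_of_le_one_right (half_pos hr).le h1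
    simp only [ρ]; linarith
  have hρ0 : Tendsto ρ atTop (𝓝 0) := by
    have := (tendsto_one_div_add_atTop_nhds_zero_nat (𝕜 := ℝ)).const_mul (r / 2)
    rwa [mul_zero] at this
  let b : ℕ → ContDiffBump (0 : RVec n) := fun k => smallBump 0 (hρ k)
  have hb : Tendsto (fun k => ‖(0 : RVec n)‖ + (b k).rOut) atTop (𝓝 0) := by
    simpa [b, smallBump] using hρ0
  let γ : ℕ → RVec n → EuclideanSpace ℝ ι := fun k x =>
    WithLp.toLp 2 fun c => mollify (b k) (U c) x
  let Y : ℕ → RVec n → EuclideanSpace ℝ ι := fun k x =>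
    WithLp.toLp 2 fun c => mollify (b k) (W c) x
  let U' : RVec n → EuclideanSpace ℝ ι := fun x => WithLp.toLp 2 fun c => U c x
  let W' : RVec n → EuclideanSpace ℝ ι := fun x => WithLp.toLp 2 fun c => W c x
  have hU1 : ∀ c, MemLp (U c) 1 := fun c => memLp_one_iff_integrable.2 (hU c)
  have hW1 : ∀ c, MemLp (W c) 1 := fun c => memLp_one_iff_integrable.2 (hW c)
  have hγ1 : ∀ k c, MemLp (mollify (b k) (U c)) 1 := fun k c =>
    memLp_one_iff_integrable.2 (integrable_mollify _ (hU c))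
  have hY1 : ∀ k c, MemLp (mollify (b k) (W c)) 1 := fun k c =>
    memLp_one_iff_integrable.2 (integrable_mollify _ (hW c))
  have hγU : Tendsto (fun k => eLpNorm (fun x => γ k x - U' x) 1 volume) atTop (𝓝 0) :=
    tendsto_eLpNorm_toLp_sub le_rfl hγ1 hU1 fun c => tendsto_eLpNorm_mollify_sub b hb (hU c)
  have hYW : Tendsto (fun k => eLpNorm (fun x => Y k x - W' x) 1 volume) atTop (𝓝 0) :=
    tendsto_eLpNorm_toLp_sub le_rfl hY1 hW1 fun c => tendsto_eLpNorm_mollify_sub b hb (hW c)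
  have hγi : ∀ k, Integrable (γ k) := fun k => memLp_one_iff_integrable.1 (memLp_toLp le_rfl (hγ1 k))
  have hYi : ∀ k, Integrable (Y k) := fun k => memLp_one_iff_integrable.1 (memLp_toLp le_rfl (hY1 k))
  have hU'i : Integrable U' := memLp_one_iff_integrable.1 (memLp_toLp le_rfl hU1)
  have hW'i : Integrable W' := memLp_one_iff_integrable.1 (memLp_toLp le_rfl hW1)
  have hγc : ∀ k, ContDiff ℝ ∞ (γ k) := fun k => contDiff_euclidean.2 fun c =>
    contDiff_mollify _ (hU c)
  set e : RVec n := EuclideanSpace.single s 1 with he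
  have hγd : ∀ k, ∀ x ∈ K, fderiv ℝ (γ k) x e = Y k x := by
    intro k x hx
    have h1 : HasFDerivAt (γ k) (fderiv ℝ (γ k) x) x :=
      ((hγc k).differentiable (by simp) x).hasFDerivAt
    ext c
    have h2 := ((EuclideanSpace.proj c : EuclideanSpace ℝ ι →L[ℝ] ℝ).hasFDerivAt.comp x h1).fderiv
    have h3 : fderiv ℝ (mollify (b k) (U c)) x = (EuclideanSpace.proj c).comp
      (fderiv ℝ (γ k) x) := h2
    have h4 : fderiv ℝ (γ k) x e c = fderiv ℝ (mollify (b k) (U c)) x e := by rw [h3]; rfl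
    rw [h4]
    refine fderiv_mollify (b k) (hU c) (V := Metric.thickening r K) (G := W c) (fun ψ hψ => ?_)
      fun y hy => ?_
    · have hψK : tsupport ψ ⊆ K' := hψ.3.trans (Metric.thickening_subset_cthickening _ _)
      have h5 := (h c).integral_mul_fderiv (hψ.mono
        ((Metric.thickening_subset_cthickening _ _).trans hrV))
      have e1 : ∀ (P : RVec n → ℝ) (χ : RVec n → ℝ), tsupport χ ⊆ K' →
          ∫ x, K'.indicator P x * χ x = ∫ x, P x * χ x := fun P χ hχ => by
        refine integral_congr_ae (.of_forall fun x => ?_)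
        simp only
        by_cases hx : x ∈ K'
        · rw [Set.indicator_of_mem hx]
        · rw [image_eq_zero_of_notMem_tsupport fun h => hx (hχ h), mul_zero, mul_zero]
      simp only [U, W]
      rw [e1 _ _ hψK, e1 _ _ ((tsupport_fderiv_apply_subset ℝ e).trans hψK)]
      exact h5
    · refine Metric.mem_thickening_iff.2 ⟨x, hx, ?_⟩
      rw [mem_closedBall_zero_iff] at hy
      rw [dist_eq_norm, sub_sub_cancel_left, norm_neg]
      exact hy.trans_lt (hρr k)
  obtain ⟨C₀, hC₀⟩ := hφ.1.continuous.bounded_above_of_compact_support hφ.2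
  have hφs := hφ.fderiv_apply e
  obtain ⟨C₁, hC₁⟩ := hφs.1.continuous.bounded_above_of_compact_support hφs.2
  have hC₀0 : 0 ≤ C₀ := (norm_nonneg _).trans (hC₀ 0)
  have hC₁0 : 0 ≤ C₁ := (norm_nonneg _).trans (hC₁ 0)
  -- the smooth identity
  have hibp : ∀ k, ∫ x, F (γ k x) * fderiv ℝ φ x e =
      -∫ x, fderiv ℝ F (γ k x) (Y k x) * φ x := by
    intro k
    have hd : ∀ x, HasFDerivAt (fun x => F (γ k x)) ((fderiv ℝ F (γ k x)).comp (fderiv ℝ (γ k) x))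
        x := fun x => ((hF.differentiable (by simp) _).hasFDerivAt).comp x
      ((hγc k).differentiable (by simp) x).hasFDerivAt
    have hc1 : Continuous fun x => F (γ k x) := hF.continuous.comp (hγc k).continuous
    have hc2 : Continuous fun x => fderiv ℝ F (γ k x) (fderiv ℝ (γ k) x e) :=
      (hDF.comp (hγc k).continuous).clm_apply
        (((hγc k).continuous_fderiv (by simp)).clm_apply continuous_const)
    have e1 : ∀ x, fderiv ℝ (fun x => F (γ k x)) x e = fderiv ℝ F (γ k x) (fderiv ℝ (γ k) x e) :=
      fun x => by rw [(hd x).fderiv]; rfl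
    have e2 : ∫ x, fderiv ℝ F (γ k x) (Y k x) * φ x =
        ∫ x, fderiv ℝ (fun x => F (γ k x)) x e * φ x := by
      refine integral_congr_ae (.of_forall fun x => ?_)
      simp only
      by_cases hx : x ∈ K
      · rw [e1, hγd k x hx]
      · rw [image_eq_zero_of_notMem_tsupport hx, mul_zero, mul_zero]
    rw [e2]
    refine integral_mul_fderiv_eq_neg_fderiv_mul_of_integrable ?_ ?_ ?_
      (fun x _ => (hd x).differentiableAt) (fun x _ => hφ.1.differentiable (by simp) x)
    · simp only [e1]
      exact (hc2.mul hφ.1.continuous).integrable_of_hasCompactSupport hφ.2.mul_left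
    · exact (hc1.mul hφs.1.continuous).integrable_of_hasCompactSupport hφs.2.mul_left
    · exact (hc1.mul hφ.1.continuous).integrable_of_hasCompactSupport hφ.2.mul_left
  have hγU' : Tendsto (fun k => ∫ x, ‖γ k x - U' x‖) atTop (𝓝 0) := by
    have h1 := (ENNReal.tendsto_toReal ENNReal.zero_ne_top).comp hγU
    refine h1.congr fun k => ?_
    rw [Function.comp_apply, eLpNorm_one_eq_lintegral_enorm]
    exact (integral_norm_eq_lintegral_enorm ((hγi k).sub hU'i).1).symm
  have hYW' : Tendsto (fun k => ∫ x, ‖Y k x - W' x‖) atTop (𝓝 0) := by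
    have h1 := (ENNReal.tendsto_toReal ENNReal.zero_ne_top).comp hYW
    refine h1.congr fun k => ?_
    rw [Function.comp_apply, eLpNorm_one_eq_lintegral_enorm]
    exact (integral_norm_eq_lintegral_enorm ((hYi k).sub hW'i).1).symm
  -- limits of both sides
  have hFi : ∀ {Z : RVec n → EuclideanSpace ℝ ι}, Integrable Z →
      Integrable fun x => F (Z x) * fderiv ℝ φ x e := fun {Z} hZ => by
    have h1 : Integrable fun x => (F (Z x) - F 0) * fderiv ℝ φ x e := by
      refine Integrable.mul_bdd (c := C₁) (Integrable.mono' (hZ.norm.const_mul (M : ℝ))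
        ((hFL.continuous.comp_aestronglyMeasurable hZ.1).sub aestronglyMeasurable_const)
        (.of_forall fun x => ?_)) hφs.1.continuous.aestronglyMeasurable (.of_forall hC₁)
      have h2 := hFL.norm_sub_le (Z x) 0
      rwa [sub_zero] at h2
    have h3 : Integrable fun x => F 0 * fderiv ℝ φ x e :=
      (hφs.1.continuous.integrable_of_hasCompactSupport hφs.2).const_mul _
    refine (h1.add h3).congr (.of_forall fun x => ?_)
    simp only [Pi.add_apply]; ring
  have hleft : Tendsto (fun k => ∫ x, F (γ k x) * fderiv ℝ φ x e) atTop
      (𝓝 (∫ x, F (U' x) * fderiv ℝ φ x e)) := by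
    rw [tendsto_iff_norm_sub_tendsto_zero]
    have h1 : Tendsto (fun k => M * C₁ * ∫ x, ‖γ k x - U' x‖) atTop (𝓝 0) := by
      simpa using hγU'.const_mul (M * C₁ : ℝ)
    refine squeeze_zero (fun _ => norm_nonneg _) (fun k => ?_) h1
    rw [← integral_sub (hFi (hγi k)) (hFi hU'i), ← integral_const_mul]
    refine norm_integral_le_of_norm_le (((hγi k).sub hU'i).norm.const_mul _)
      (.of_forall fun x => ?_)
    rw [← sub_mul, norm_mul]
    calc ‖F (γ k x) - F (U' x)‖ * ‖fderiv ℝ φ x e‖ ≤ (M * ‖γ k x - U' x‖) * C₁ :=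
          mul_le_mul (hFL.norm_sub_le _ _) (hC₁ x) (norm_nonneg _) (by positivity)
      _ = M * C₁ * ‖(γ k - U') x‖ := by rw [Pi.sub_apply]; ring
  obtain ⟨σ, hσ, hσae⟩ := (tendstoInMeasure_of_tendsto_eLpNorm one_ne_zero
    (fun k => (hγi k).1) hU'i.1 hγU).exists_seq_tendsto_ae
  have hDi : ∀ {Z P : RVec n → EuclideanSpace ℝ ι}, Integrable Z → Integrable P →
      Integrable fun x => fderiv ℝ F (Z x) (P x) * φ x := fun {Z P} hZ hP =>
    Integrable.mul_bdd (c := C₀) (Integrable.mono' (hP.norm.const_mul (M : ℝ))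
      (MeasureTheory.AEStronglyMeasurable.clm_apply_aestronglyMeasurable
        (hDF.comp_aestronglyMeasurable hZ.1) hP.1)
      (.of_forall fun x => ((fderiv ℝ F (Z x)).le_opNorm _).trans
        (mul_le_mul_of_nonneg_right (hM _) (norm_nonneg _))))
      hφ.1.continuous.aestronglyMeasurable (.of_forall hC₀)
  -- The product is split. The error in the derivative field is small in L¹ against a bounded
  -- factor; with the derivative field fixed, dominated convergence applies along an almost
  -- everywhere convergent subsequence.
  have hr1 : Tendsto (fun k => ∫ x, fderiv ℝ F (γ k x) (Y k x - W' x) * φ x) atTop (𝓝 0) := by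
    have h1 : Tendsto (fun k => M * C₀ * ∫ x, ‖Y k x - W' x‖) atTop (𝓝 0) := by
      simpa using hYW'.const_mul (M * C₀ : ℝ)
    refine squeeze_zero_norm (fun k => ?_) h1
    rw [← integral_const_mul]
    refine norm_integral_le_of_norm_le (((hYi k).sub hW'i).norm.const_mul _)
      (.of_forall fun x => ?_)
    rw [norm_mul]
    calc ‖fderiv ℝ F (γ k x) (Y k x - W' x)‖ * ‖φ x‖ ≤ (M * ‖Y k x - W' x‖) * C₀ :=
          mul_le_mul (((fderiv ℝ F (γ k x)).le_opNorm _).trans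
            (mul_le_mul_of_nonneg_right (hM _) (norm_nonneg _))) (hC₀ x) (norm_nonneg _)
            (by positivity)
      _ = M * C₀ * ‖(Y k - W') x‖ := by rw [Pi.sub_apply]; ring
  have hr2 : Tendsto (fun j => ∫ x, fderiv ℝ F (γ (σ j) x) (W' x) * φ x) atTop
      (𝓝 (∫ x, fderiv ℝ F (U' x) (W' x) * φ x)) := by
    refine tendsto_integral_of_dominated_convergence (fun x => M * C₀ * ‖W' x‖)
      (fun j => (hDi (hγi _) hW'i).1) (hW'i.norm.const_mul _)
      (fun j => .of_forall fun x => ?_) ?_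
    · rw [norm_mul]
      calc ‖fderiv ℝ F (γ (σ j) x) (W' x)‖ * ‖φ x‖ ≤ (M * ‖W' x‖) * C₀ :=
            mul_le_mul (((fderiv ℝ F (γ (σ j) x)).le_opNorm _).trans
              (mul_le_mul_of_nonneg_right (hM _) (norm_nonneg _))) (hC₀ x) (norm_nonneg _)
              (by positivity)
        _ = M * C₀ * ‖W' x‖ := by ring
    · filter_upwards [hσae] with x hx
      have h1 : Tendsto (fun j => fderiv ℝ F (γ (σ j) x)) atTop (𝓝 (fderiv ℝ F (U' x))) :=
        (hDF.tendsto _).comp hx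
      exact (((ContinuousLinearMap.apply ℝ ℝ (W' x)).continuous.tendsto _).comp h1).mul_const _
  have hright : Tendsto (fun j => -∫ x, fderiv ℝ F (γ (σ j) x) (Y (σ j) x) * φ x) atTop
      (𝓝 (-∫ x, fderiv ℝ F (U' x) (W' x) * φ x)) := by
    have h1 := ((hr1.comp hσ.tendsto_atTop).add hr2).neg
    rw [zero_add] at h1
    refine h1.congr fun j => ?_
    simp only [Function.comp_apply]
    congr 1
    have e1 : ∫ x, (fderiv ℝ F (γ (σ j) x) (Y (σ j) x - W' x) * φ x +
        fderiv ℝ F (γ (σ j) x) (W' x) * φ x) = _ :=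
      integral_add (hDi (hγi _) ((hYi _).sub hW'i)) (hDi (hγi _) hW'i)
    refine e1.symm.trans ?_
    refine integral_congr_ae (.of_forall fun x => ?_)
    simp only [map_sub]
    ring
  simp only [← hibp] at hright
  have hfin := tendsto_nhds_unique (hleft.comp hσ.tendsto_atTop) hright
  have hUG : ∀ x ∈ K, U' x = G x := fun x hx => by
    ext c; exact Set.indicator_of_mem (hKK' hx) fun x => G x c
  have hWX : ∀ x ∈ K, W' x = X x := fun x hx => by
    ext c; exact Set.indicator_of_mem (hKK' hx) fun x => X x c
  have e1 : ∫ x, F (G x) * fderiv ℝ φ x e = ∫ x, F (U' x) * fderiv ℝ φ x e := by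
    refine integral_congr_ae (.of_forall fun x => ?_)
    simp only
    by_cases hx : x ∈ K
    · rw [hUG x hx]
    · have : fderiv ℝ φ x e = 0 := by
        rw [image_eq_zero_of_notMem_tsupport fun h => hx (tsupport_fderiv_subset ℝ h)]; rfl
      rw [this, mul_zero, mul_zero]
  have e2 : ∫ x, fderiv ℝ F (G x) (X x) * φ x = ∫ x, fderiv ℝ F (U' x) (W' x) * φ x := by
    refine integral_congr_ae (.of_forall fun x => ?_)
    simp only
    by_cases hx : x ∈ K
    · rw [hUG x hx, hWX x hx]
    · rw [image_eq_zero_of_notMem_tsupport hx, mul_zero, mul_zero]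
  rw [e1, e2, hfin]

end WeakDerivative

/-! ### Testing differentiated equations with localised derivatives -/

section SecondOrder

variable {n N : ℕ}

theorem tendsto_eLpNorm_mollify_sub_two {c : ℕ → RVec n} (b : ∀ k, ContDiffBump (c k))
    (hb : Tendsto (fun k => ‖c k‖ + (b k).rOut) atTop (𝓝 0)) {U : RVec n → ℝ} (hU : MemLp U 2) :
    Tendsto (fun k => eLpNorm (fun x => mollify (b k) U x - U x) 2 volume) atTop (𝓝 0) := by
  have : Fact ((1 : ℝ≥0∞) ≤ 2) := ⟨one_le_two⟩
  simp only [mollify_eq_translateAverage]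
  exact tendsto_eLpNorm_translateAverage_sub (by simp) (fun _ => measurable_neg) hb
    (fun k => ae_bumpMeasure (b k)) hU

theorem memLp_mollify {c : RVec n} (b : ContDiffBump c) {U : RVec n → ℝ} (hU : MemLp U 2) :
    MemLp (mollify b U) 2 := by
  rw [mollify_eq_translateAverage]
  exact memLp_translateAverage one_le_two (by simp) hU measurable_neg

theorem tsupport_mollify_subset {r : ℝ} (b : ContDiffBump (0 : RVec n)) (hb : b.rOut ≤ r)
    {U : RVec n → ℝ} {K : Set (RVec n)} (hU : ∀ x ∉ K, U x = 0) :
    tsupport (mollify b U) ⊆ Metric.cthickening r K := by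
  refine closure_minimal (fun x hx => ?_) Metric.isClosed_cthickening
  by_contra hxK
  refine hx ?_
  rw [mollify_apply]
  refine integral_eq_zero_of_ae (.of_forall fun t => ?_)
  simp only [Pi.zero_apply, mul_eq_zero]
  by_cases ht : t ∈ Metric.ball (0 : RVec n) b.rOut
  · refine Or.inr (hU _ fun hxt => hxK ?_)
    refine Metric.mem_cthickening_of_dist_le x (x - t) r K hxt ?_
    rw [dist_eq_norm, sub_sub_cancel]
    exact (mem_ball_zero_iff.1 ht).le.trans hb
  · left
    have : t ∉ Function.support (b.normed volume) := by rwa [b.support_normed_eq]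
    simpa using this

/-- An equation in divergence form may be tested with `ζ u`, where `u` is weakly differentiable and
`ζ` is a cutoff function. -/
theorem sum_integral_mul_cutoff_eq {V : Set (RVec n)} (hV : IsOpen V) {P : Fin n → RVec n → ℝ}
    {q : RVec n → ℝ} (hP : ∀ j, MemLp (P j) 2) (hq : MemLp q 2)
    (h : ∀ ψ, IsTestFunction V ψ →
      ∑ j, ∫ x, P j x * fderiv ℝ ψ x (EuclideanSpace.single j 1) = ∫ x, q x * ψ x)
    {u : RVec n → ℝ} {g : Fin n → RVec n → ℝ} (hu : MemLp u 2) (hg : ∀ j, MemLp (g j) 2)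
    (hug : ∀ j, HasWeakPartial V j u (g j)) {ζ : RVec n → ℝ} (hζ : IsTestFunction V ζ) :
    ∑ j, ∫ x, P j x * (ζ x * g j x + fderiv ℝ ζ x (EuclideanSpace.single j 1) * u x) =
      ∫ x, q x * (ζ x * u x) := by
  set K := tsupport ζ with hK
  obtain ⟨r, hr, hrV⟩ := hζ.2.exists_cthickening_subset_open hV hζ.3
  set w : RVec n → ℝ := fun x => ζ x * u x with hw
  set H : Fin n → RVec n → ℝ := fun j x =>
    ζ x * g j x + fderiv ℝ ζ x (EuclideanSpace.single j 1) * u x with hH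
  have hw2 : MemLp w 2 := hζ.memLp_smul hu
  have hH2 : ∀ j, MemLp (H j) 2 := fun j =>
    (hζ.memLp_smul (hg j)).add ((hζ.fderiv_apply _).memLp_smul hu)
  have hwi : Integrable w :=
    (hζ.integrable_mul ((hu.locallyIntegrable one_le_two).locallyIntegrableOn V)).congr
      (.of_forall fun x => mul_comm _ _)
  -- The cutoff makes ζu weakly differentiable on all of space, so its mollifications are test
  -- functions whose derivatives converge in L².
  have hwH : ∀ j, HasWeakPartial Set.univ j w (H j) := fun j =>
    (hug j).smooth_mul_of_test hζ.1 isOpen_univ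
      ((hu.locallyIntegrable one_le_two).locallyIntegrableOn _)
      (((hg j).locallyIntegrable one_le_two).locallyIntegrableOn _)
      fun φ hφ => (hζ.mul hφ).mono Set.inter_subset_left
  let ρ : ℕ → ℝ := fun k => r * (1 / ((k : ℝ) + 1))
  have hρ : ∀ k, 0 < ρ k := fun k => by positivity
  have hρr : ∀ k, ρ k ≤ r := fun k => by
    have h1 : 1 / ((k : ℝ) + 1) ≤ 1 := (div_le_one (by positivity)).2 (by
      have := Nat.cast_nonneg (α := ℝ) k; linarith)
    exact mul_le_of_le_one_right hr.le h1
  have hρ0 : Tendsto ρ atTop (𝓝 0) := by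
    have := (tendsto_one_div_add_atTop_nhds_zero_nat (𝕜 := ℝ)).const_mul r
    rwa [mul_zero] at this
  let b : ℕ → ContDiffBump (0 : RVec n) := fun k => smallBump 0 (hρ k)
  have hb : Tendsto (fun k => ‖(0 : RVec n)‖ + (b k).rOut) atTop (𝓝 0) := by
    simpa [b, smallBump] using hρ0
  have hψ : ∀ k, IsTestFunction V (mollify (b k) w) := fun k => by
    have h1 : tsupport (mollify (b k) w) ⊆ Metric.cthickening r K :=
      tsupport_mollify_subset (b k) (hρr k) fun x hx => by
        simp only [hw, image_eq_zero_of_notMem_tsupport hx, zero_mul]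
    exact ⟨contDiff_mollify _ hwi, hζ.2.isCompact.cthickening.of_isClosed_subset
      (isClosed_tsupport _) h1, h1.trans hrV⟩
  have hd : ∀ k j x, fderiv ℝ (mollify (b k) w) x (EuclideanSpace.single j 1) =
      mollify (b k) (H j) x := fun k j x =>
    fderiv_mollify (b k) hwi (V := Set.univ) (fun φ hφ => (hwH j).integral_mul_fderiv hφ)
      fun _ _ => Set.mem_univ _
  have hmain := fun k => h _ (hψ k)
  simp only [hd] at hmain
  have hl1 : Tendsto (fun k => ∑ j, ∫ x, P j x * mollify (b k) (H j) x) atTop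
      (𝓝 (∑ j, ∫ x, P j x * H j x)) := by
    refine tendsto_finsetSum _ fun j _ => ?_
    have := tendsto_integral_inner_of_L2 (hP j) (fun k => memLp_mollify (b k) (hH2 j)) (hH2 j)
      (tendsto_eLpNorm_mollify_sub_two b hb (hH2 j))
    simpa only [Real.inner_eq_mul] using this
  have hl2 : Tendsto (fun k => ∫ x, q x * mollify (b k) w x) atTop (𝓝 (∫ x, q x * w x)) := by
    have := tendsto_integral_inner_of_L2 hq (fun k => memLp_mollify (b k) hw2) hw2
      (tendsto_eLpNorm_mollify_sub_two b hb hw2)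
    simpa only [Real.inner_eq_mul] using this
  simp only [hmain] at hl1
  exact tendsto_nhds_unique hl1 hl2

/-- The `s`-th column of a matrix. -/
noncomputable def matColumn (s : Fin n) (z : RMat N n) : RVec N := WithLp.toLp 2 fun a => z (a, s)

theorem norm_matColumn_le (s : Fin n) (z : RMat N n) : ‖matColumn s z‖ ≤ ‖z‖ := by
  have h : ‖matColumn s z‖ ^ 2 ≤ ‖z‖ ^ 2 := by
    rw [EuclideanSpace.norm_sq_eq, EuclideanSpace.norm_sq_eq, Fintype.sum_prod_type]
    refine Finset.sum_le_sum fun a _ => ?_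
    exact Finset.single_le_sum (f := fun i => ‖z (a, i)‖ ^ 2) (fun i _ => sq_nonneg _)
      (Finset.mem_univ s)
  exact le_of_sq_le_sq h (norm_nonneg _)

theorem fderiv_fderiv_apply_comm {ψ : RVec n → ℝ} (hψ : ContDiff ℝ ∞ ψ) (x v w : RVec n) :
    fderiv ℝ (fun y => fderiv ℝ ψ y v) x w = fderiv ℝ (fun y => fderiv ℝ ψ y w) x v := by
  have hd : DifferentiableAt ℝ (fderiv ℝ ψ) x :=
    (hψ.fderiv_right (m := ∞) (by simp)).differentiable (by simp) x
  have e : ∀ a b, fderiv ℝ (fun y => fderiv ℝ ψ y a) x b = fderiv ℝ (fderiv ℝ ψ) x b a := by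
    intro a b
    have := (hd.hasFDerivAt.clm_apply (hasFDerivAt_const a x)).fderiv
    rw [this]
    simp
  rw [e, e]
  exact ((contDiff_infty.1 hψ 2).contDiffAt.isSymmSndFDerivAt (by simp)).eq w v

/-- The differentiated equation, tested with `ζ ∂ₛu`. -/
theorem integral_inner_differentiated_eq {V : Set (RVec n)} (hV : IsOpen V)
    {S : RMat N n → RMat N n} {S' : RMat N n → RMat N n →L[ℝ] RMat N n} {Λ : ℝ≥0}
    (hS : ∀ z, HasFDerivAt S (S' z) z) (hS'c : Continuous S') (hS'Λ : ∀ z ξ, ‖S' z ξ‖ ≤ Λ * ‖ξ‖)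
    {G X T : RVec n → RMat N n} (hG : MemLp G 2) (hX : MemLp X 2) {s : Fin n}
    (hGX : ∀ c, HasWeakPartial V s (fun x => G x c) fun x => X x c)
    (hcurl : ∀ a, IsWeaklyCurlFree V fun i x => G x (a, i))
    (heq : ∀ φ : RVec n → RVec N, ContDiff ℝ ∞ φ → HasCompactSupport φ →
      tsupport φ ⊆ V → ∫ x, ⟪S (G x) - T x, gradField φ x⟫ = 0)
    {T₁ T₂ : Fin N × Fin n → RVec n → ℝ}
    (hT₁ : ∀ c, HasWeakPartial V s (fun x => T x c) (T₁ c))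
    (hT₂ : ∀ c, HasWeakPartial V c.2 (T₁ c) (T₂ c)) (hT₂2 : ∀ c, MemLp (T₂ c) 2)
    {ζ : RVec n → ℝ} (hζ : IsTestFunction V ζ) :
    ∫ x, ⟪S' (G x) (X x), ζ x • X x + outer (matColumn s (G x)) (gradVec ζ x)⟫ =
      -∑ c, ∫ x, T₂ c x * (ζ x * G x (c.1, s)) := by
  have hGl : LocallyIntegrableOn G V := (hG.locallyIntegrable one_le_two).locallyIntegrableOn V
  have hXl : LocallyIntegrableOn X V := (hX.locallyIntegrable one_le_two).locallyIntegrableOn V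
  set e : Fin n → RVec n := fun j => EuclideanSpace.single j 1 with he
  -- the derivative of the nonlinear term
  have hSX2 : MemLp (fun x => S' (G x) (X x)) 2 := hX.of_le_mul
    (MeasureTheory.AEStronglyMeasurable.clm_apply_aestronglyMeasurable
      (hS'c.comp_aestronglyMeasurable hG.1) hX.1) (.of_forall fun x => hS'Λ _ _)
  have hSG : ∀ c, HasWeakPartial V s (fun x => S (G x) c) fun x => S' (G x) (X x) c := by
    intro c
    have hFd : ∀ z, HasFDerivAt (fun z => S z c)
        ((EuclideanSpace.proj c : RMat N n →L[ℝ] ℝ).comp (S' z)) z := fun z =>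
      (EuclideanSpace.proj c : RMat N n →L[ℝ] ℝ).hasFDerivAt.comp z (hS z)
    have hFd' : ∀ z, fderiv ℝ (fun z => S z c) z =
        (EuclideanSpace.proj c : RMat N n →L[ℝ] ℝ).comp (S' z) := fun z => (hFd z).fderiv
    have hF1 : ContDiff ℝ 1 fun z => S z c := by
      rw [contDiff_one_iff_fderiv]
      refine ⟨fun z => (hFd z).differentiableAt, ?_⟩
      rw [show (fderiv ℝ fun z => S z c) = fun z =>
        (EuclideanSpace.proj c : RMat N n →L[ℝ] ℝ).comp (S' z) from funext hFd']
      exact (continuous_const (y := (EuclideanSpace.proj c : RMat N n →L[ℝ] ℝ))).clm_comp hS'c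
    have h1 := HasWeakPartial.comp_contDiff hV hGl hXl hGX hF1 (M := Λ) fun z => by
      rw [hFd']
      refine ContinuousLinearMap.opNorm_le_bound _ Λ.2 fun ξ => ?_
      exact (PiLp.norm_apply_le (S' z ξ) c).trans (hS'Λ z ξ)
    simp only [hFd'] at h1
    exact h1
  -- the scalar equations
  have hscalar : ∀ (a : Fin N) (ψ : RVec n → ℝ), IsTestFunction V ψ →
      ∑ j, ∫ x, S' (G x) (X x) (a, j) * fderiv ℝ ψ x (e j) =
        ∫ x, (-∑ j, T₂ (a, j) x) * ψ x := by
    intro a ψ hψ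
    have hψs := hψ.fderiv_apply (e s)
    -- The test map is ∂ₛψ in the single component `a`; since second derivatives of ψ commute, ∂ₛ
    -- can be moved onto the stress and onto `T`.
    have h1 := heq (fun x => fderiv ℝ ψ x (e s) • EuclideanSpace.single a (1 : ℝ))
      (hψs.1.smul contDiff_const) hψs.2.smul_right
      ((tsupport_smul_subset_left _ _).trans hψs.3)
    have hgrad : ∀ x c, gradField (fun x => fderiv ℝ ψ x (e s) •
        (EuclideanSpace.single a (1 : ℝ) : RVec N)) x c =
        if c.1 = a then fderiv ℝ (fun y => fderiv ℝ ψ y (e c.2)) x (e s) else 0 := by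
      intro x c
      rw [gradField_apply, fderiv_smul_const (hψs.1.differentiable (by simp) x),
        fderiv_fderiv_apply_comm hψ.1 x (e c.2) (e s)]
      simp only [ContinuousLinearMap.smulRight_apply, PiLp.smul_apply, smul_eq_mul,
        PiLp.single_apply]
      split_ifs <;> simp [e]
    have h2 : ∀ x, ⟪S (G x) - T x, gradField (fun x => fderiv ℝ ψ x (e s) •
        (EuclideanSpace.single a (1 : ℝ) : RVec N)) x⟫ =
        ∑ j, (S (G x) (a, j) * fderiv ℝ (fun y => fderiv ℝ ψ y (e j)) x (e s) -
          T x (a, j) * fderiv ℝ (fun y => fderiv ℝ ψ y (e j)) x (e s)) := by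
      intro x
      rw [PiLp.inner_apply, Fintype.sum_prod_type]
      simp only [hgrad, Real.inner_eq_mul, mul_ite, mul_zero, PiLp.sub_apply]
      rw [Finset.sum_eq_single a (fun b _ hb => by simp [hb]) (by simp)]
      simp [sub_mul]
    simp only [h2] at h1
    have hψj : ∀ j, IsTestFunction V fun y => fderiv ℝ ψ y (e j) := fun j => hψ.fderiv_apply (e j)
    have hi1 : ∀ j, Integrable fun x => S (G x) (a, j) *
        fderiv ℝ (fun y => fderiv ℝ ψ y (e j)) x (e s) := fun j =>
      ((hψj j).fderiv_apply (e s)).integrable_mul (hSG (a, j)).1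
    have hi2 : ∀ j, Integrable fun x => T x (a, j) *
        fderiv ℝ (fun y => fderiv ℝ ψ y (e j)) x (e s) := fun j =>
      ((hψj j).fderiv_apply (e s)).integrable_mul (hT₁ (a, j)).1
    have hi3 : ∀ j, Integrable fun x => S (G x) (a, j) *
        fderiv ℝ (fun y => fderiv ℝ ψ y (e j)) x (e s) - T x (a, j) *
        fderiv ℝ (fun y => fderiv ℝ ψ y (e j)) x (e s) := fun j => (hi1 j).sub (hi2 j)
    rw [integral_finsetSum _ fun j _ => hi3 j] at h1
    have h3 : ∀ j, ∫ x, (S (G x) (a, j) * fderiv ℝ (fun y => fderiv ℝ ψ y (e j)) x (e s) -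
        T x (a, j) * fderiv ℝ (fun y => fderiv ℝ ψ y (e j)) x (e s)) =
        -(∫ x, S' (G x) (X x) (a, j) * fderiv ℝ ψ x (e j)) - ∫ x, T₂ (a, j) x * ψ x := by
      intro j
      have h4 := (hSG (a, j)).integral_mul_fderiv (hψj j)
      have h5 := (hT₁ (a, j)).integral_mul_fderiv (hψj j)
      have h6 := (hT₂ (a, j)).integral_mul_fderiv hψ
      rw [integral_sub (hi1 j) (hi2 j), h4, h5, h6]
      ring
    simp only [h3, Finset.sum_sub_distrib, Finset.sum_neg_distrib] at h1
    have h7 : ∫ x, (-∑ j, T₂ (a, j) x) * ψ x = -∑ j, ∫ x, T₂ (a, j) x * ψ x := by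
      rw [← integral_finsetSum _ fun j _ => hψ.integrable_mul (hT₂ (a, j)).2.1, ← integral_neg]
      refine integral_congr_ae (.of_forall fun x => ?_)
      simp only
      rw [← Finset.sum_mul, neg_mul]
    rw [h7]
    linarith
  -- As `G` is curl-free, ∂ⱼG_{as} = ∂ₛG_{aj}. Thus column `s` has the weak gradient `X` and may be
  -- used, cut off, as a test map.
  have hcol : ∀ a j, HasWeakPartial V j (fun x => G x (a, s)) fun x => X x (a, j) := fun a j =>
    hasWeakPartial_of_integral_eq (hGX (a, s)).1 (hGX (a, j)).2.1 fun ψ hψ => by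
      rw [hcurl a j s ψ hψ]
      exact (hGX (a, j)).integral_mul_fderiv hψ
  have hq : ∀ a, MemLp (fun x => -∑ j, T₂ (a, j) x) 2 := fun a =>
    (memLp_finsetSum _ fun j _ => hT₂2 (a, j)).neg
  have hsum : ∀ a, ∑ j, ∫ x, S' (G x) (X x) (a, j) *
      (ζ x * X x (a, j) + fderiv ℝ ζ x (e j) * G x (a, s)) =
        ∫ x, (-∑ j, T₂ (a, j) x) * (ζ x * G x (a, s)) := fun a =>
    sum_integral_mul_cutoff_eq hV (fun j => memLp_apply hSX2 (a, j)) (hq a) (hscalar a)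
      (memLp_apply hG (a, s)) (fun j => memLp_apply hX (a, j)) (hcol a) hζ
  have hW2 : ∀ c : Fin N × Fin n, MemLp (fun x => ζ x * X x c +
      fderiv ℝ ζ x (e c.2) * G x (c.1, s)) 2 := fun c =>
    (hζ.memLp_smul (memLp_apply hX c)).add
      ((hζ.fderiv_apply _).memLp_smul (memLp_apply hG (c.1, s)))
  have hexp : ∀ x, ⟪S' (G x) (X x), ζ x • X x + outer (matColumn s (G x)) (gradVec ζ x)⟫ =
      ∑ c : Fin N × Fin n, S' (G x) (X x) c *
        (ζ x * X x c + fderiv ℝ ζ x (e c.2) * G x (c.1, s)) := fun x => by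
    rw [PiLp.inner_apply]
    refine Finset.sum_congr rfl fun c _ => ?_
    simp only [Real.inner_eq_mul, PiLp.add_apply, PiLp.smul_apply, smul_eq_mul, outer, matColumn,
      gradVec]
    rw [mul_comm (G x (c.1, s))]
  simp only [hexp]
  have hi : ∀ c : Fin N × Fin n, Integrable fun x => S' (G x) (X x) c *
      (ζ x * X x c + fderiv ℝ ζ x (e c.2) * G x (c.1, s)) := fun c =>
    MemLp.integrable_mul (memLp_apply hSX2 c) (hW2 c)
  rw [integral_finsetSum _ fun c _ => hi c,
    Fintype.sum_prod_type, Fintype.sum_prod_type, ← Finset.sum_neg_distrib]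
  refine Finset.sum_congr rfl fun a _ => ?_
  have hi' : ∀ j, Integrable fun x => T₂ (a, j) x * (ζ x * G x (a, s)) := fun j =>
    MemLp.integrable_mul (hT₂2 (a, j)) (hζ.memLp_smul (memLp_apply hG (a, s)))
  rw [hsum a, ← integral_finsetSum _ fun j _ => hi' j, ← integral_neg]
  refine integral_congr_ae (.of_forall fun x => ?_)
  simp only
  rw [← Finset.sum_mul, neg_mul]

end SecondOrder

/-! ### A weighted estimate for second derivatives -/

section WeightedEstimate

variable {n N : ℕ} {f : ℝ → ℝ} {L : ℝ}

/-- The derivative of `z ↦ stress f z + ε z`. -/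
noncomputable def regularisedStressDeriv (f : ℝ → ℝ) (ε : ℝ) (z : RMat N n) :
    RMat N n →L[ℝ] RMat N n :=
  stressDeriv f z + ε • ContinuousLinearMap.id ℝ (RMat N n)

theorem regularisedStressDeriv_apply (ε : ℝ) (z ξ : RMat N n) :
    regularisedStressDeriv f ε z ξ = stressDeriv f z ξ + ε • ξ := by
  simp [regularisedStressDeriv]

namespace IsLinearGrowthDensity

theorem hasFDerivAt_regularisedStress (hf : IsLinearGrowthDensity f L) (ε : ℝ) (z : RMat N n) :
    HasFDerivAt (fun z => stress f z + ε • z) (regularisedStressDeriv f ε z) z :=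
  (hf.hasFDerivAt_stress z).add ((hasFDerivAt_id z).const_smul ε)

theorem continuous_regularisedStressDeriv (hf : IsLinearGrowthDensity f L) (ε : ℝ) :
    Continuous (regularisedStressDeriv (N := N) (n := n) f ε) :=
  hf.continuous_stressDeriv.add continuous_const

theorem norm_regularisedStressDeriv_apply_le (hf : IsLinearGrowthDensity f L) {ε : ℝ} (hε : 0 ≤ ε)
    (z ξ : RMat N n) : ‖regularisedStressDeriv f ε z ξ‖ ≤ (L + ε) * ‖ξ‖ := by
  rw [regularisedStressDeriv_apply, add_mul]
  refine (norm_add_le _ _).trans (add_le_add (hf.norm_stressDeriv_apply_le z ξ) ?_)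
  rw [norm_smul, Real.norm_of_nonneg hε]

/-- Young's inequality for the Caccioppoli argument: the difference of the two sides is the
quadratic form of the stress derivative at tX + 2Y plus ε(|tX + 2Y|² + t²|X|²). -/
theorem mul_inner_stressDeriv_le (hf : IsLinearGrowthDensity f L) {ε : ℝ} (hε : 0 ≤ ε) (t : ℝ)
    (z X Y : RMat N n) :
    t ^ 2 * ⟪stressDeriv f z X, X⟫ ≤
      2 * ⟪regularisedStressDeriv f ε z X, t ^ 2 • X + (2 * t) • Y⟫ +
        4 * ⟪regularisedStressDeriv f ε z Y, Y⟫ := by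
  have h1 := hf.inner_stressDeriv_nonneg z (t • X + (2 : ℝ) • Y)
  have h2 : 0 ≤ ε * ‖t • X + (2 : ℝ) • Y‖ ^ 2 := by positivity
  have h3 : 0 ≤ ε * (t ^ 2 * ‖X‖ ^ 2) := by positivity
  have hs : ⟪stressDeriv f z Y, X⟫ = ⟪stressDeriv f z X, Y⟫ := by
    rw [inner_stressDeriv_comm, real_inner_comm]
  rw [← real_inner_self_eq_norm_sq] at h2 h3
  simp only [map_add, map_smul, inner_add_left, inner_add_right, real_inner_smul_left,
    real_inner_smul_right, regularisedStressDeriv_apply, hs, real_inner_comm X Y] at h1 h2 h3 ⊢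
  linarith

/-- The decay (1 + |z|)⁻¹ of the stress derivative turns the quadratic cutoff term into one linear
in |z|, apart from the ε part; the integrals of both are bounded uniformly for the regularised
solutions. -/
theorem inner_regularisedStressDeriv_le (hf : IsLinearGrowthDensity f L) {ε M : ℝ} (hε : 0 ≤ ε)
    {z Y : RMat N n} (hY : ‖Y‖ ≤ M * ‖z‖) :
    ⟪regularisedStressDeriv f ε z Y, Y⟫ ≤ M ^ 2 * (2 * L * ‖z‖ + ε * ‖z‖ ^ 2) := by
  have hL := hf.pos
  have h1 := hf.inner_stressDeriv_le z Y
  have hY2 : ‖Y‖ ^ 2 ≤ M ^ 2 * ‖z‖ ^ 2 := by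
    rw [← mul_pow]; exact pow_le_pow_left₀ (norm_nonneg _) hY 2
  have h2 : 2 * L * (1 + ‖z‖)⁻¹ * ‖Y‖ ^ 2 ≤ M ^ 2 * (2 * L * ‖z‖) := by
    calc 2 * L * (1 + ‖z‖)⁻¹ * ‖Y‖ ^ 2 ≤ 2 * L * (1 + ‖z‖)⁻¹ * (M ^ 2 * ‖z‖ ^ 2) := by gcongr
      _ = M ^ 2 * (2 * L) * (‖z‖ ^ 2 * (1 + ‖z‖)⁻¹) := by ring
      _ ≤ M ^ 2 * (2 * L) * ‖z‖ := by
        gcongr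
        rw [← div_eq_mul_inv]
        apply div_le_of_le_mul₀ (by positivity) (by positivity)
        nlinarith [norm_nonneg z]
      _ = _ := by ring
  have h3 : ε * ‖Y‖ ^ 2 ≤ M ^ 2 * (ε * ‖z‖ ^ 2) := by
    calc ε * ‖Y‖ ^ 2 ≤ ε * (M ^ 2 * ‖z‖ ^ 2) := by gcongr
      _ = _ := by ring
  rw [regularisedStressDeriv_apply, inner_add_left, real_inner_smul_left,
    real_inner_self_eq_norm_sq]
  linarith

theorem integrable_mul_inner_stressDeriv (hf : IsLinearGrowthDensity f L) {V : Set (RVec n)}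
    {G X : RVec n → RMat N n} (hG : AEStronglyMeasurable G volume) (hX : MemLp X 2)
    {η : RVec n → ℝ} (hη : IsTestFunction V η) :
    Integrable fun x => η x ^ 2 * ⟪stressDeriv f (G x) (X x), X x⟫ := by
  have hSX2 : MemLp (fun x => stressDeriv f (G x) (η x • X x)) 2 :=
    (hη.memLp_smul hX).of_le_mul
      (MeasureTheory.AEStronglyMeasurable.clm_apply_aestronglyMeasurable
        (hf.continuous_stressDeriv.comp_aestronglyMeasurable hG)
        (hη.memLp_smul hX).1) (.of_forall fun x => hf.norm_stressDeriv_apply_le _ _)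
  refine (MemLp.integrable_inner₂ hSX2 (hη.memLp_smul hX)).congr (.of_forall fun x => ?_)
  simp only [map_smul, real_inner_smul_left, real_inner_smul_right]
  ring

/-- The second derivatives of solutions of the regularised equation are bounded, in a weighted `L²`
space, in terms of the `L¹` norm of the gradient. -/
theorem integral_mul_inner_stressDeriv_le (hf : IsLinearGrowthDensity f L) {V : Set (RVec n)}
    (hV : IsOpen V) {ε : ℝ} (hε : 0 ≤ ε)
    {G X T : RVec n → RMat N n} (hG : MemLp G 2) (hGi : Integrable G) (hX : MemLp X 2) {s : Fin n}
    (hGX : ∀ c, HasWeakPartial V s (fun x => G x c) fun x => X x c)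
    (hcurl : ∀ a, IsWeaklyCurlFree V fun i x => G x (a, i))
    (heq : ∀ φ : RVec n → RVec N, ContDiff ℝ ∞ φ → HasCompactSupport φ →
      tsupport φ ⊆ V → ∫ x, ⟪stress f (G x) + ε • G x - T x, gradField φ x⟫ = 0)
    {T₁ T₂ : Fin N × Fin n → RVec n → ℝ}
    (hT₁ : ∀ c, HasWeakPartial V s (fun x => T x c) (T₁ c))
    (hT₂ : ∀ c, HasWeakPartial V c.2 (T₁ c) (T₂ c)) (hT₂2 : ∀ c, MemLp (T₂ c) 2)
    {B : ℝ} (hB : ∀ c, ∀ᵐ x, ‖T₂ c x‖ ≤ B)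
    {η : RVec n → ℝ} (hη : IsTestFunction V η) {M M' : ℝ} (hM : ∀ x, ‖η x‖ ≤ M)
    (hM' : ∀ x, ‖gradVec η x‖ ≤ M') :
    ∫ x, η x ^ 2 * ⟪stressDeriv f (G x) (X x), X x⟫ ≤
      2 * ((Fintype.card (Fin N × Fin n) : ℝ) * (B * (M ^ 2 * ∫ x, ‖G x‖))) +
        4 * (M' ^ 2 * (2 * L * (∫ x, ‖G x‖) + ε * ∫ x, ‖G x‖ ^ 2)) := by
  set S' := regularisedStressDeriv (N := N) (n := n) f ε with hS'
  have hL := hf.pos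
  have hM0 : 0 ≤ M := (norm_nonneg _).trans (hM 0)
  have hM'0 : 0 ≤ M' := (norm_nonneg _).trans (hM' 0)
  have hη2 : IsTestFunction V fun x => η x ^ 2 := by
    simpa only [sq, Set.inter_self] using hη.mul hη
  have key := integral_inner_differentiated_eq hV (Λ := (L + ε).toNNReal)
    (hf.hasFDerivAt_regularisedStress ε) (hf.continuous_regularisedStressDeriv ε)
    (fun z ξ => by
      rw [Real.coe_toNNReal _ (by positivity)]
      exact hf.norm_regularisedStressDeriv_apply_le hε z ξ)
    hG hX hGX hcurl heq hT₁ hT₂ hT₂2 hη2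
  set Y : RVec n → RMat N n := fun x => outer (matColumn s (G x)) (gradVec η x) with hY
  have hYle : ∀ x, ‖Y x‖ ≤ M' * ‖G x‖ := fun x => by
    rw [hY, norm_outer, mul_comm]
    exact mul_le_mul (hM' x) (norm_matColumn_le _ _) (norm_nonneg _) hM'0
  have hYm : AEStronglyMeasurable Y volume := by
    have hc : Continuous (matColumn (N := N) s) :=
      (PiLp.continuous_toLp 2 _).comp (by fun_prop)
    exact continuous_outer.comp_aestronglyMeasurable
      ((hc.comp_aestronglyMeasurable hG.1).prodMk
        (continuous_gradVec hη.1).aestronglyMeasurable)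
  have hY2 : MemLp Y 2 := hG.of_le_mul hYm (.of_forall hYle)
  have hout : ∀ x, η x ^ 2 • X x + outer (matColumn s (G x)) (gradVec (fun x => η x ^ 2) x) =
      η x ^ 2 • X x + (2 * η x) • Y x := fun x => by
    rw [gradVec_sq (hη.1.differentiable (by simp) x), outer_smul_right]
  simp only [hout] at key
  have hop : ∀ {Z : RVec n → RMat N n}, MemLp Z 2 → MemLp (fun x => S' (G x) (Z x)) 2 := fun hZ =>
    hZ.of_le_mul (MeasureTheory.AEStronglyMeasurable.clm_apply_aestronglyMeasurable
      ((hf.continuous_regularisedStressDeriv ε).comp_aestronglyMeasurable hG.1) hZ.1)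
      (.of_forall fun x => hf.norm_regularisedStressDeriv_apply_le hε _ _)
  have hi1 : Integrable fun x => ⟪S' (G x) (X x), η x ^ 2 • X x + (2 * η x) • Y x⟫ := by
    refine MemLp.integrable_inner₂ (hop hX) (MemLp.add (hη2.memLp_smul hX) ?_)
    simp only [mul_smul]
    exact (hη.memLp_smul hY2).const_smul (2 : ℝ)
  have hi2 : Integrable fun x => ⟪S' (G x) (Y x), Y x⟫ := MemLp.integrable_inner₂ (hop hY2) hY2
  have hi3 : Integrable fun x => η x ^ 2 * ⟪stressDeriv f (G x) (X x), X x⟫ :=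
    hf.integrable_mul_inner_stressDeriv hG.1 hX hη
  have hi4 : Integrable fun x => ‖G x‖ ^ 2 := hG.integrable_norm_pow (by simp)
  have e1 : ∫ x, (2 * ⟪S' (G x) (X x), η x ^ 2 • X x + (2 * η x) • Y x⟫ +
      4 * ⟪S' (G x) (Y x), Y x⟫) =
      2 * (∫ x, ⟪S' (G x) (X x), η x ^ 2 • X x + (2 * η x) • Y x⟫) +
        4 * ∫ x, ⟪S' (G x) (Y x), Y x⟫ := by
    rw [← integral_const_mul, ← integral_const_mul]
    exact integral_add (hi1.const_mul 2) (hi2.const_mul 4)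
  have e2 : ∫ x, ⟪S' (G x) (Y x), Y x⟫ ≤
      M' ^ 2 * (2 * L * (∫ x, ‖G x‖) + ε * ∫ x, ‖G x‖ ^ 2) := by
    have e3 : ∫ x, M' ^ 2 * (2 * L * ‖G x‖ + ε * ‖G x‖ ^ 2) =
        M' ^ 2 * (2 * L * (∫ x, ‖G x‖) + ε * ∫ x, ‖G x‖ ^ 2) := by
      rw [integral_const_mul, ← integral_const_mul (2 * L), ← integral_const_mul ε]
      congr 1
      exact integral_add (hGi.norm.const_mul _) (hi4.const_mul _)
    rw [← e3]
    exact integral_mono hi2 (((hGi.norm.const_mul _).add (hi4.const_mul _)).const_mul _)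
      fun x => hf.inner_regularisedStressDeriv_le hε (hYle x)
  -- The second derivatives of the datum are bounded, so this term costs only the L¹ norm of `G`.
  have e4 : -∑ c : Fin N × Fin n, ∫ x, T₂ c x * (η x ^ 2 * G x (c.1, s)) ≤
      (Fintype.card (Fin N × Fin n) : ℝ) * (B * (M ^ 2 * ∫ x, ‖G x‖)) := by
    rw [← Finset.sum_neg_distrib, ← nsmul_eq_mul, ← Finset.card_univ, ← Finset.sum_const]
    refine Finset.sum_le_sum fun c _ => ?_
    refine (neg_le_abs _).trans ?_
    rw [← Real.norm_eq_abs, ← integral_const_mul, ← integral_const_mul]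
    refine norm_integral_le_of_norm_le ((hGi.norm.const_mul _).const_mul _) ?_
    filter_upwards [hB c] with x hx
    rw [norm_mul, norm_mul, norm_pow]
    have hB0 : 0 ≤ B := (norm_nonneg _).trans hx
    exact mul_le_mul hx (mul_le_mul (pow_le_pow_left₀ (norm_nonneg _) (hM x) 2)
      (PiLp.norm_apply_le (G x) _) (norm_nonneg _) (by positivity)) (by positivity) hB0
  calc ∫ x, η x ^ 2 * ⟪stressDeriv f (G x) (X x), X x⟫
      ≤ ∫ x, (2 * ⟪S' (G x) (X x), η x ^ 2 • X x + (2 * η x) • Y x⟫ +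
        4 * ⟪S' (G x) (Y x), Y x⟫) :=
        integral_mono hi3 ((hi1.const_mul 2).add (hi2.const_mul 4)) fun x =>
          hf.mul_inner_stressDeriv_le hε (η x) (G x) (X x) (Y x)
    _ ≤ _ := by
      rw [e1, key]
      linarith

end IsLinearGrowthDensity

end WeightedEstimate

/-! ### Truncated gradients are nearly curl-free -/

section Truncation

variable {n N : ℕ} {f : ℝ → ℝ} {L : ℝ}

/-- `χ` is a smooth function with `χ = 1` on `(-∞, 1]`, `χ = 0` on `[2, ∞)`, `|χ| ≤ 1` and
`|χ'| ≤ K`. -/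
structure IsCutoffProfile (χ : ℝ → ℝ) (K : ℝ) : Prop where
  contDiff : ContDiff ℝ ∞ χ
  eq_one : ∀ t ≤ 1, χ t = 1
  eq_zero : ∀ t, 2 ≤ t → χ t = 0
  abs_le : ∀ t, |χ t| ≤ 1
  abs_deriv_le : ∀ t, |deriv χ t| ≤ K

theorem exists_isCutoffProfile : ∃ χ K, IsCutoffProfile χ K := by
  let χ : ℝ → ℝ := fun t => Real.smoothTransition (2 - t)
  have hχ : ContDiff ℝ ∞ χ := Real.smoothTransition.contDiff.comp (contDiff_const.sub contDiff_id)
  have h1 : ∀ t ≤ 1, χ t = 1 := fun t ht => Real.smoothTransition.one_of_one_le (by linarith)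
  have h2 : ∀ t, 2 ≤ t → χ t = 0 := fun t ht => Real.smoothTransition.zero_of_nonpos (by linarith)
  have hc : HasCompactSupport (deriv χ) := by
    refine HasCompactSupport.intro (isCompact_Icc (a := (1 : ℝ)) (b := 2)) fun t ht => ?_
    rw [Set.mem_Icc, not_and_or, not_le, not_le] at ht
    rcases ht with ht | ht
    · have : χ =ᶠ[𝓝 t] fun _ => 1 := by
        filter_upwards [Iio_mem_nhds ht] with y hy using h1 y (le_of_lt hy)
      rw [this.deriv_eq, deriv_const]
    · have : χ =ᶠ[𝓝 t] fun _ => 0 := by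
        filter_upwards [Ioi_mem_nhds ht] with y hy using h2 y (le_of_lt hy)
      rw [this.deriv_eq, deriv_const]
  obtain ⟨K, hK⟩ := (hχ.continuous_deriv (by simp)).bounded_above_of_compact_support hc
  refine ⟨χ, K, hχ, h1, h2, fun t => ?_, hK⟩
  rw [abs_of_nonneg (Real.smoothTransition.nonneg _)]
  exact Real.smoothTransition.le_one _

/-- The component `c` of `z`, cut off where `δ log (1 + |z|²)` exceeds `2`. -/
noncomputable def truncate (χ : ℝ → ℝ) (δ : ℝ) (c : Fin N × Fin n) (z : RMat N n) : ℝ :=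
  χ (δ * Real.log (1 + ‖z‖ ^ 2)) * z c

namespace IsCutoffProfile

variable {χ : ℝ → ℝ} {K : ℝ}

theorem contDiff_truncate (hχ : IsCutoffProfile χ K) (δ : ℝ) (c : Fin N × Fin n) :
    ContDiff ℝ ∞ (truncate χ δ c) := by
  refine (hχ.contDiff.comp (contDiff_const.mul (ContDiff.log (contDiff_const.add (contDiff_norm_sq ℝ)) fun z => ?_))).mul
    (EuclideanSpace.proj c : RMat N n →L[ℝ] ℝ).contDiff
  positivity

theorem fderiv_truncate_apply (hχ : IsCutoffProfile χ K) (δ : ℝ) (c : Fin N × Fin n)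
    (z ξ : RMat N n) : fderiv ℝ (truncate χ δ c) z ξ = χ (δ * Real.log (1 + ‖z‖ ^ 2)) * ξ c +
      deriv χ (δ * Real.log (1 + ‖z‖ ^ 2)) * (δ * (2 * ⟪z, ξ⟫ / (1 + ‖z‖ ^ 2))) * z c := by
  have hp : (0 : ℝ) < 1 + ‖z‖ ^ 2 := by positivity
  have h1 : HasFDerivAt (fun z : RMat N n => 1 + ‖z‖ ^ 2) (2 • innerSL ℝ z) z :=
    (hasStrictFDerivAt_norm_sq z).hasFDerivAt.const_add 1
  have h2 := (h1.log hp.ne').const_mul δ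
  have h3 : HasDerivAt χ (deriv χ (δ * Real.log (1 + ‖z‖ ^ 2))) (δ * Real.log (1 + ‖z‖ ^ 2)) :=
    (hχ.contDiff.differentiable (by simp) _).hasDerivAt
  have h4 := (h3.comp_hasFDerivAt z h2).mul (EuclideanSpace.proj c : RMat N n →L[ℝ] ℝ).hasFDerivAt
  have h5 : fderiv ℝ (truncate χ δ c) z = _ := h4.fderiv
  rw [h5]
  have h6 : ∀ w : RMat N n, (EuclideanSpace.proj c : RMat N n →L[ℝ] ℝ) w = w c := fun _ => rfl
  simp only [add_apply, smul_apply, Function.comp, h6, innerSL_apply_apply, smul_eq_mul,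
    nsmul_eq_mul]
  push_cast
  field_simp

/-- The argument δ log(1 + |z|²) has a gradient of size at most 2δ|z|/(1 + |z|²), which compensates
the factor `z c`. Hence the truncation is globally Lipschitz and the chain rule applies. -/
theorem norm_fderiv_truncate_le (hχ : IsCutoffProfile χ K) {δ : ℝ} (hδ : 0 ≤ δ)
    (c : Fin N × Fin n) (z : RMat N n) : ‖fderiv ℝ (truncate χ δ c) z‖ ≤ 1 + K * (δ * 2) := by
  have hK : 0 ≤ K := (abs_nonneg _).trans (hχ.abs_deriv_le 0)
  refine ContinuousLinearMap.opNorm_le_bound _ (by positivity) fun ξ => ?_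
  have hp : (0 : ℝ) < 1 + ‖z‖ ^ 2 := by positivity
  rw [hχ.fderiv_truncate_apply, add_mul, one_mul]
  refine (norm_add_le _ _).trans (add_le_add ?_ ?_)
  · rw [norm_mul]
    exact (mul_le_of_le_one_left (norm_nonneg _) (hχ.abs_le _)).trans (PiLp.norm_apply_le ξ c)
  · have h1 : ‖2 * ⟪z, ξ⟫ / (1 + ‖z‖ ^ 2)‖ * ‖z c‖ ≤ 2 * ‖ξ‖ := by
      rw [norm_div, norm_mul, Real.norm_of_nonneg hp.le, div_mul_eq_mul_div, div_le_iff₀ hp]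
      have h2 := norm_inner_le_norm (𝕜 := ℝ) z ξ
      have h3 := PiLp.norm_apply_le z c
      have h4 : ‖⟪z, ξ⟫‖ * ‖z c‖ ≤ ‖z‖ * ‖ξ‖ * ‖z‖ := by gcongr
      have h5 := norm_nonneg ξ
      rw [Real.norm_ofNat]
      nlinarith
    calc _ = |deriv χ (δ * Real.log (1 + ‖z‖ ^ 2))| *
          (δ * (‖2 * ⟪z, ξ⟫ / (1 + ‖z‖ ^ 2)‖ * ‖z c‖)) := by
            rw [norm_mul, norm_mul, norm_mul, Real.norm_of_nonneg hδ, Real.norm_eq_abs (deriv χ _)]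
            ring
      _ ≤ K * (δ * (2 * ‖ξ‖)) := by
        gcongr
        exact hχ.abs_deriv_le _
      _ = _ := by ring

theorem abs_truncate_le (hχ : IsCutoffProfile χ K) (δ : ℝ) (c : Fin N × Fin n) (z : RMat N n) :
    |truncate χ δ c z| ≤ ‖z‖ := by
  rw [truncate, abs_mul]
  exact (mul_le_of_le_one_left (abs_nonneg _) (hχ.abs_le _)).trans (PiLp.norm_apply_le z c)

theorem abs_truncate_le_exp (hχ : IsCutoffProfile χ K) {δ : ℝ} (hδ : 0 < δ) (c : Fin N × Fin n)
    (z : RMat N n) : |truncate χ δ c z| ≤ Real.exp (2 / δ) := by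
  by_cases h : 2 ≤ δ * Real.log (1 + ‖z‖ ^ 2)
  · rw [truncate, hχ.eq_zero _ h, zero_mul, abs_zero]
    positivity
  · refine (hχ.abs_truncate_le δ c z).trans ?_
    have h1 : Real.log (1 + ‖z‖ ^ 2) ≤ 2 / δ := by
      rw [le_div_iff₀ hδ]; linarith
    have h2 := (Real.log_le_iff_le_exp (by positivity)).1 h1
    nlinarith [norm_nonneg z]

theorem tendsto_truncate (hχ : IsCutoffProfile χ K) {δ : ℕ → ℝ} (hδ : Tendsto δ atTop (𝓝 0))
    (c : Fin N × Fin n) (z : RMat N n) :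
    Tendsto (fun k => truncate χ (δ k) c z) atTop (𝓝 (z c)) := by
  have h1 := hδ.mul_const (Real.log (1 + ‖z‖ ^ 2))
  have h2 := ((hχ.contDiff.continuous.tendsto _).comp h1).mul_const (z c)
  rwa [zero_mul, hχ.eq_one 0 zero_le_one, one_mul] at h2

/-- The pointwise cancellation in the curl of the truncated gradient. -/
theorem abs_fderiv_truncate_sub_le (hχ : IsCutoffProfile χ K) (hf : IsLinearGrowthDensity f L)
    {δ : ℝ} (hδ : 0 ≤ δ) (hδ1 : δ ≤ 1) {a b : Fin N × Fin n} {z X Y : RMat N n} (h : X a = Y b) :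
    |fderiv ℝ (truncate χ δ a) z X - fderiv ℝ (truncate χ δ b) z Y| ≤
      δ * (K * (2 * (derivHalfLine f 1)⁻¹ * ‖z‖ + ⟪stressDeriv f z X, X⟫ +
        ⟪stressDeriv f z Y, Y⟫)) := by
  have hK : 0 ≤ K := (abs_nonneg _).trans (hχ.abs_deriv_le 0)
  have hc : 0 < derivHalfLine f 1 := hf.deriv_pos one_pos
  have hX := hf.inner_stressDeriv_nonneg z X
  have hY := hf.inner_stressDeriv_nonneg z Y
  have hp : (0 : ℝ) < 1 + ‖z‖ ^ 2 := by positivity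
  -- The terms in which χ is not differentiated cancel because `X a = Y b`; in the application this
  -- is the vanishing of the curl.
  have e1 : fderiv ℝ (truncate χ δ a) z X - fderiv ℝ (truncate χ δ b) z Y =
      deriv χ (δ * Real.log (1 + ‖z‖ ^ 2)) *
        (δ * (2 / (1 + ‖z‖ ^ 2) * (⟪z, X⟫ * z a - ⟪z, Y⟫ * z b))) := by
    rw [hχ.fderiv_truncate_apply, hχ.fderiv_truncate_apply, h]
    ring
  rw [e1]
  -- For |z| < 1 the argument of χ is below log 2 < 1, where χ is locally constant.
  by_cases hz : ‖z‖ < 1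
  · have h0 : deriv χ (δ * Real.log (1 + ‖z‖ ^ 2)) = 0 := by
      have hlog : Real.log (1 + ‖z‖ ^ 2) < 1 := by
        have h2 : Real.log (1 + ‖z‖ ^ 2) ≤ Real.log 2 :=
          Real.log_le_log hp (by nlinarith [norm_nonneg z])
        linarith [Real.log_two_lt_d9]
      have hlog0 : 0 ≤ Real.log (1 + ‖z‖ ^ 2) := Real.log_nonneg (by nlinarith [norm_nonneg z])
      have ht : δ * Real.log (1 + ‖z‖ ^ 2) < 1 :=
        (mul_le_of_le_one_left hlog0 hδ1).trans_lt hlog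
      have : χ =ᶠ[𝓝 (δ * Real.log (1 + ‖z‖ ^ 2))] fun _ => 1 := by
        filter_upwards [Iio_mem_nhds ht] with y hy using hχ.eq_one y (le_of_lt hy)
      rw [this.deriv_eq, deriv_const]
    rw [h0, zero_mul, abs_zero]
    positivity
  rw [not_lt] at hz
  have hz0 : 0 < ‖z‖ := one_pos.trans_le hz
  -- the component orthogonal to `z`
  have horth : ∀ W : RMat N n, ‖W - (⟪z, W⟫ / ‖z‖ ^ 2) • z‖ ≤
      2⁻¹ * ((derivHalfLine f 1)⁻¹ * ‖z‖ + ⟪stressDeriv f z W, W⟫) := by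
    intro W
    set p := W - (⟪z, W⟫ / ‖z‖ ^ 2) • z with hpdef
    have hpn : ‖p‖ ^ 2 = ‖W‖ ^ 2 - ⟪z, W⟫ ^ 2 / ‖z‖ ^ 2 := by
      rw [hpdef, norm_sub_sq_real, real_inner_smul_right, norm_smul, mul_pow, Real.norm_eq_abs,
        sq_abs, real_inner_comm z W]
      field_simp
      ring
    -- For |z| ≥ 1 monotonicity of f' bounds the tangential ellipticity below by f'(1)/|z|.
    have hcoef : derivHalfLine f 1 * ‖z‖⁻¹ ≤ secantCoeff f ‖z‖ := by
      rw [secantCoeff, if_neg hz0.ne', div_eq_mul_inv]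
      gcongr
      exact hf.strictMonoOn.monotoneOn (Set.mem_Ici.2 zero_le_one) (Set.mem_Ici.2 hz0.le) hz
    have h2 := hf.secantCoeff_mul_le_inner z W
    rw [← hpn] at h2
    have h3 : derivHalfLine f 1 * ‖z‖⁻¹ * ‖p‖ ^ 2 ≤ ⟪stressDeriv f z W, W⟫ :=
      (mul_le_mul_of_nonneg_right hcoef (sq_nonneg _)).trans h2
    -- Weighted arithmetic-geometric mean: the weights are chosen so that one term is linear in |z|
    -- and the other is bounded by the quadratic form.
    have h4 : 2 * ‖p‖ ≤ (derivHalfLine f 1)⁻¹ * ‖z‖ + derivHalfLine f 1 * ‖z‖⁻¹ * ‖p‖ ^ 2 := by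
      have h5 := sq_nonneg (‖z‖ - derivHalfLine f 1 * ‖p‖)
      have h6 : 0 ≤ (derivHalfLine f 1)⁻¹ * ‖z‖⁻¹ * (‖z‖ - derivHalfLine f 1 * ‖p‖) ^ 2 := by
        positivity
      have h7 : (derivHalfLine f 1)⁻¹ * ‖z‖⁻¹ * (‖z‖ - derivHalfLine f 1 * ‖p‖) ^ 2 =
          (derivHalfLine f 1)⁻¹ * ‖z‖ + derivHalfLine f 1 * ‖z‖⁻¹ * ‖p‖ ^ 2 - 2 * ‖p‖ := by
        field_simp
        ring
      linarith
    linarith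
  -- Each radial product ⟨z, X⟩ z_a / |z|² is `X a` minus the tangential part of that entry. The
  -- common entry drops out, so only tangential parts remain, which are all that can be controlled.
  have e2 : 2 / (1 + ‖z‖ ^ 2) * (⟪z, X⟫ * z a - ⟪z, Y⟫ * z b) = 2 * (‖z‖ ^ 2 / (1 + ‖z‖ ^ 2)) *
      ((Y - (⟪z, Y⟫ / ‖z‖ ^ 2) • z) b - (X - (⟪z, X⟫ / ‖z‖ ^ 2) • z) a) := by
    simp only [PiLp.sub_apply, PiLp.smul_apply, smul_eq_mul, h]
    field_simp
    ring
  have h8 : |(Y - (⟪z, Y⟫ / ‖z‖ ^ 2) • z) b - (X - (⟪z, X⟫ / ‖z‖ ^ 2) • z) a| ≤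
      2⁻¹ * (2 * (derivHalfLine f 1)⁻¹ * ‖z‖ + ⟪stressDeriv f z X, X⟫ +
        ⟪stressDeriv f z Y, Y⟫) := by
    refine (abs_sub _ _).trans ?_
    have h9 := (PiLp.norm_apply_le (Y - (⟪z, Y⟫ / ‖z‖ ^ 2) • z) b).trans (horth Y)
    have h10 := (PiLp.norm_apply_le (X - (⟪z, X⟫ / ‖z‖ ^ 2) • z) a).trans (horth X)
    rw [Real.norm_eq_abs] at h9 h10
    linarith
  have h11 : |2 / (1 + ‖z‖ ^ 2) * (⟪z, X⟫ * z a - ⟪z, Y⟫ * z b)| ≤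
      2 * (derivHalfLine f 1)⁻¹ * ‖z‖ + ⟪stressDeriv f z X, X⟫ + ⟪stressDeriv f z Y, Y⟫ := by
    rw [e2, abs_mul, abs_of_nonneg (by positivity : (0 : ℝ) ≤ 2 * (‖z‖ ^ 2 / (1 + ‖z‖ ^ 2)))]
    have h12 : ‖z‖ ^ 2 / (1 + ‖z‖ ^ 2) ≤ 1 := (div_le_one hp).2 (by linarith)
    calc _ ≤ 2 * 1 * _ := mul_le_mul (by gcongr) h8 (abs_nonneg _) (by norm_num)
      _ = _ := by ring
  rw [abs_mul, abs_mul, abs_of_nonneg hδ, mul_left_comm]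
  gcongr
  exact hχ.abs_deriv_le _

/-- The pointwise cancellation is integrated against φ; as η = 1 on the support of φ, the quadratic
forms may carry the weight η² of the second derivative estimate. -/
theorem abs_integral_truncate_curl_le (hχ : IsCutoffProfile χ K) (hf : IsLinearGrowthDensity f L)
    {δ : ℝ} (hδ : 0 ≤ δ) (hδ1 : δ ≤ 1) {V : Set (RVec n)} (hV : IsOpen V)
    {G : RVec n → RMat N n} {X : Fin n → RVec n → RMat N n} (hG : MemLp G 2) (hGi : Integrable G)
    (hX : ∀ s, MemLp (X s) 2)
    (hGX : ∀ s c, HasWeakPartial V s (fun x => G x c) fun x => X s x c)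
    (hcurl : ∀ a, IsWeaklyCurlFree V fun i x => G x (a, i))
    {η : RVec n → ℝ} (hη : IsTestFunction V η) {φ : RVec n → ℝ} (hφ : IsTestFunction V φ)
    (hηφ : ∀ x ∈ tsupport φ, η x = 1) {M : ℝ} (hM : ∀ x, ‖φ x‖ ≤ M) (a : Fin N) (i j : Fin n) :
    |(∫ x, truncate χ δ (a, j) (G x) * fderiv ℝ φ x (EuclideanSpace.single i 1)) -
        ∫ x, truncate χ δ (a, i) (G x) * fderiv ℝ φ x (EuclideanSpace.single j 1)| ≤
      δ * (K * (2 * (derivHalfLine f 1)⁻¹ * (∫ x, ‖G x‖) +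
        (∫ x, η x ^ 2 * ⟪stressDeriv f (G x) (X i x), X i x⟫) +
        ∫ x, η x ^ 2 * ⟪stressDeriv f (G x) (X j x), X j x⟫)) * M := by
  have hK : 0 ≤ K := (abs_nonneg _).trans (hχ.abs_deriv_le 0)
  have hGl : LocallyIntegrableOn G V := (hG.locallyIntegrable one_le_two).locallyIntegrableOn V
  have hXl : ∀ s, LocallyIntegrableOn (X s) V := fun s =>
    ((hX s).locallyIntegrable one_le_two).locallyIntegrableOn V
  have hM0 : 0 ≤ M := (norm_nonneg _).trans (hM 0)
  have hc : 0 < derivHalfLine f 1 := hf.deriv_pos one_pos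
  have hw : ∀ s c, HasWeakPartial V s (fun x => truncate χ δ c (G x))
      fun x => fderiv ℝ (truncate χ δ c) (G x) (X s x) := fun s c =>
    HasWeakPartial.comp_contDiff hV hGl (hXl s) (hGX s)
      (contDiff_infty.1 (hχ.contDiff_truncate δ c) 1) (M := (1 + K * (δ * 2)).toNNReal) fun z => by
        rw [Real.coe_toNNReal _ (by positivity)]
        exact hχ.norm_fderiv_truncate_le hδ c z
  rw [(hw i (a, j)).integral_mul_fderiv hφ, (hw j (a, i)).integral_mul_fderiv hφ]
  -- The weak curl condition for `G`, expressed through its weak derivatives.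
  have hsymm : ∀ᵐ x, x ∈ V → X i x (a, j) = X j x (a, i) := by
    refine (ae_restrict_iff' hV.measurableSet).1 ?_
    refine ae_eq_of_forall_integral_test_eq hV (hGX i (a, j)).2.1 (hGX j (a, i)).2.1
      fun ψ hψ => ?_
    have h1 := (hGX i (a, j)).integral_mul_fderiv hψ
    have h2 := (hGX j (a, i)).integral_mul_fderiv hψ
    have h3 := hcurl a i j ψ hψ
    linarith
  have hD : ∀ s, Integrable fun x => η x ^ 2 * ⟪stressDeriv f (G x) (X s x), X s x⟫ := fun s =>
    hf.integrable_mul_inner_stressDeriv hG.1 (hX s) hη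
  have hi : ∀ s c, Integrable fun x => fderiv ℝ (truncate χ δ c) (G x) (X s x) * φ x := fun s c =>
    hφ.integrable_mul (hw s c).2.1
  have e1 : -(∫ x, fderiv ℝ (truncate χ δ (a, j)) (G x) (X i x) * φ x) -
      -∫ x, fderiv ℝ (truncate χ δ (a, i)) (G x) (X j x) * φ x =
      -∫ x, (fderiv ℝ (truncate χ δ (a, j)) (G x) (X i x) * φ x -
        fderiv ℝ (truncate χ δ (a, i)) (G x) (X j x) * φ x) := by
    rw [integral_sub (hi i (a, j)) (hi j (a, i))]
    ring
  have hg1 : Integrable fun x => 2 * (derivHalfLine f 1)⁻¹ * ‖G x‖ := hGi.norm.const_mul _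
  have hg2 : Integrable fun x => 2 * (derivHalfLine f 1)⁻¹ * ‖G x‖ +
      η x ^ 2 * ⟪stressDeriv f (G x) (X i x), X i x⟫ := hg1.add (hD i)
  have hg3 : Integrable fun x => 2 * (derivHalfLine f 1)⁻¹ * ‖G x‖ +
      η x ^ 2 * ⟪stressDeriv f (G x) (X i x), X i x⟫ +
      η x ^ 2 * ⟪stressDeriv f (G x) (X j x), X j x⟫ := hg2.add (hD j)
  have e2 : δ * (K * (2 * (derivHalfLine f 1)⁻¹ * (∫ x, ‖G x‖) +
        (∫ x, η x ^ 2 * ⟪stressDeriv f (G x) (X i x), X i x⟫) +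
        ∫ x, η x ^ 2 * ⟪stressDeriv f (G x) (X j x), X j x⟫)) * M =
      ∫ x, δ * (K * (2 * (derivHalfLine f 1)⁻¹ * ‖G x‖ +
        η x ^ 2 * ⟪stressDeriv f (G x) (X i x), X i x⟫ +
        η x ^ 2 * ⟪stressDeriv f (G x) (X j x), X j x⟫)) * M := by
    rw [integral_mul_const, integral_const_mul, integral_const_mul, integral_add hg2 (hD j),
      integral_add hg1 (hD i), integral_const_mul]
  rw [e1, e2, abs_neg, ← Real.norm_eq_abs]
  refine norm_integral_le_of_norm_le (((hg3.const_mul K).const_mul δ).mul_const M) ?_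
  filter_upwards [hsymm] with x hx
  have hX1 := hf.inner_stressDeriv_nonneg (G x) (X i x)
  have hX2 := hf.inner_stressDeriv_nonneg (G x) (X j x)
  by_cases hxφ : x ∈ tsupport φ
  · rw [hηφ x hxφ, one_pow, one_mul, one_mul, ← sub_mul, norm_mul]
    refine mul_le_mul ?_ (hM x) (norm_nonneg _) (by positivity)
    exact hχ.abs_fderiv_truncate_sub_le hf hδ hδ1 (hx (hφ.3 hxφ))
  · rw [image_eq_zero_of_notMem_tsupport hxφ, mul_zero, mul_zero, sub_zero, norm_zero]
    positivity

end IsCutoffProfile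

end Truncation

/-! ### Curl bounds for truncated gradients of regularised solutions -/

section CurlBound

variable {n N : ℕ} {f : ℝ → ℝ} {L : ℝ}

theorem exists_isTestFunction_eq_one {Ω K : Set (RVec n)} (hΩ : IsOpen Ω) (hK : IsCompact K)
    (hKΩ : K ⊆ Ω) : ∃ η, IsTestFunction Ω η ∧ ∀ x ∈ K, η x = 1 := by
  have hr : ∀ x : RVec n, ∃ r > 0, x ∈ K → Metric.ball x r ⊆ Ω := fun x => by
    by_cases hx : x ∈ K
    · obtain ⟨r, hr, h⟩ := Metric.isOpen_iff.1 hΩ x (hKΩ hx)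
      exact ⟨r, hr, fun _ => h⟩
    · exact ⟨1, one_pos, fun h => absurd h hx⟩
  choose r hr hrΩ using hr
  obtain ⟨t, ζ, htK, hζ, hsum⟩ := exists_smooth_partition hK fun x _ => hr x
  have hζΩ : ∀ x : t, IsTestFunction Ω (ζ x) := fun x => (hζ x).mono (hrΩ x (htK x x.2))
  have hs : ∀ y, y ∉ ⋃ x : t, tsupport (ζ x) → ∑ x, ζ x y = 0 := fun y hy =>
    Finset.sum_eq_zero fun x _ => image_eq_zero_of_notMem_tsupport fun h =>
      hy (Set.mem_iUnion.2 ⟨x, h⟩)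
  have hc : IsCompact (⋃ x : t, tsupport (ζ x)) := isCompact_iUnion fun x => (hζΩ x).2
  refine ⟨fun y => ∑ x, ζ x y, ⟨ContDiff.sum fun x _ => (hζ x).1, HasCompactSupport.intro hc hs, ?_⟩,
    hsum⟩
  refine (closure_minimal (fun y hy => ?_) hc.isClosed).trans
    (Set.iUnion_subset fun x => (hζΩ x).3)
  by_contra h
  exact hy (hs y h)

theorem isWeaklyCurlFree_gradField {u : RVec n → RVec N} (hu : ContDiff ℝ ∞ u) (Ω : Set (RVec n))
    (a : Fin N) : IsWeaklyCurlFree Ω fun i x => gradField u x (a, i) := by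
  intro i j φ hφ
  have hua : ContDiff ℝ ∞ fun x => u x a := (EuclideanSpace.proj a : RVec N →L[ℝ] ℝ).contDiff.comp hu
  have hd : ∀ k x, gradField u x (a, k) =
      fderiv ℝ (fun x => u x a) x (EuclideanSpace.single k 1) := fun k x => by
    have h1 := ((EuclideanSpace.proj a : RVec N →L[ℝ] ℝ).hasFDerivAt.comp x
      (hu.differentiable (by simp) x).hasFDerivAt).fderiv
    have h2 : fderiv ℝ (fun x => u x a) x = _ := h1
    rw [h2]
    rfl
  simp only [hd]
  have hw : ∀ k, HasWeakPartial Ω k (fun x => u x a) _ := fun k =>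
    (contDiff_infty.1 hua 1).hasWeakPartial Ω k
  have h1 := (hw j).integral_mul_fderiv (hφ.fderiv_apply (EuclideanSpace.single i 1))
  have h2 := (hw i).integral_mul_fderiv (hφ.fderiv_apply (EuclideanSpace.single j 1))
  simp only [fderiv_fderiv_apply_comm hφ.1 _ (EuclideanSpace.single i 1)
    (EuclideanSpace.single j 1)] at h1
  linarith

/-- An `L²` limit of gradients is weakly curl-free. -/
theorem isWeaklyCurlFree_of_tendsto {Ω : Set (RVec n)} {G : RVec n → RMat N n}
    (hG : MemLp G 2 (volume.restrict Ω)) {u : ℕ → RVec n → RVec N} (hu : ∀ k, ContDiff ℝ ∞ (u k))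
    (hu2 : ∀ k, MemLp (gradField (u k)) 2 (volume.restrict Ω))
    (hlim : Tendsto (fun k => eLpNorm (fun x => gradField (u k) x - G x) 2 (volume.restrict Ω))
      atTop (𝓝 0)) (a : Fin N) : IsWeaklyCurlFree Ω fun i x => G x (a, i) := by
  have hl : ∀ (c : Fin N × Fin n) (v : RVec n) (φ : RVec n → ℝ), IsTestFunction Ω φ →
      Tendsto (fun k => ∫ x, gradField (u k) x c * fderiv ℝ φ x v) atTop
        (𝓝 (∫ x, G x c * fderiv ℝ φ x v)) := by
    intro c v φ hφ
    have hv := hφ.fderiv_apply v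
    have h0 : Tendsto (fun k => eLpNorm (fun x => gradField (u k) x c - G x c) 2
        (volume.restrict Ω)) atTop (𝓝 0) := by
      refine tendsto_of_tendsto_of_tendsto_of_le_of_le tendsto_const_nhds hlim (fun _ => zero_le)
        fun k => eLpNorm_mono fun x => ?_
      exact PiLp.norm_apply_le (gradField (u k) x - G x) c
    have h1 := tendsto_integral_inner_of_L2 (f := fun x => fderiv ℝ φ x v)
      ((hv.1.continuous.memLp_of_hasCompactSupport hv.2).restrict Ω)
      (fun k => memLp_apply (hu2 k) c) (memLp_apply hG c) h0
    simp only [Real.inner_eq_mul, mul_comm (fderiv ℝ φ _ v)] at h1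
    simpa only [setIntegral_mul_eq_integral hv.3] using h1
  intro i j φ hφ
  have h1 := hl (a, j) (EuclideanSpace.single i 1) φ hφ
  simp only [fun k => isWeaklyCurlFree_gradField (hu k) Ω a i j φ hφ] at h1
  exact tendsto_nhds_unique h1 (hl (a, i) (EuclideanSpace.single j 1) φ hφ)

theorem exists_eLpNorm_field_difference_le {Ω : Set (RVec n)} (hΩ : IsOpen Ω)
    {T : RVec n → RMat N n} (hT : MemLp T 2) {T₁ : Fin n → Fin N × Fin n → RVec n → ℝ}
    (hT₁ : ∀ s c, HasWeakPartial Ω s (fun x => T x c) (T₁ s c)) (hT₁2 : ∀ s c, MemLp (T₁ s c) 2)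
    {η : RVec n → ℝ} (hη : IsTestFunction Ω η) {ρ : ℝ} (hρ : 0 < ρ)
    (hρΩ : ∀ x ∈ tsupport η, Metric.ball x ρ ⊆ Ω) :
    ∃ C, 0 ≤ C ∧ ∀ v : RVec n, ‖v‖ < ρ / 2 →
      (eLpNorm (fun x => η x • (T (x + v) - T x)) 2 volume).toReal ≤ C * ‖v‖ := by
  obtain ⟨M, hM⟩ := hη.1.continuous.bounded_above_of_compact_support hη.2
  have hM0 : 0 ≤ M := (norm_nonneg _).trans (hM 0)
  set D : ℝ≥0∞ := ∑ c : Fin N × Fin n, ∑ i, eLpNorm (T₁ i c) 2 (volume.restrict Ω) with hD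
  have hDt : D ≠ ⊤ := (ENNReal.sum_lt_top.2 fun c _ => ENNReal.sum_lt_top.2 fun i _ =>
    ((hT₁2 i c).restrict Ω).2).ne
  refine ⟨M * D.toReal, by positivity, fun v hv => ?_⟩
  have h1 : eLpNorm (fun x => η x • (T (x + v) - T x)) 2 volume ≤
      ENNReal.ofReal (M * ‖v‖) * D := by
    refine (eLpNorm_euclidean_le one_le_two (hη.memLp_smul (memLp_translate_sub hT v)).1).trans ?_
    rw [hD, Finset.mul_sum]
    refine Finset.sum_le_sum fun c _ => ?_
    exact eLpNorm_smul_difference_le_of_hasWeakPartial hΩ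
      (((memLp_apply hT c).locallyIntegrable one_le_two).locallyIntegrableOn Ω)
      (fun i => (hT₁2 i c).restrict Ω) (fun i => hT₁ i c) hM hρ hρΩ hv
  have h2 := ENNReal.toReal_mono (ENNReal.mul_ne_top ENNReal.ofReal_ne_top hDt) h1
  rw [ENNReal.toReal_mul, ENNReal.toReal_ofReal (by positivity)] at h2
  linarith

namespace IsLinearGrowthDensity

theorem memLp_regularisedStress {α : Type*} [MeasurableSpace α] {μ : Measure α}
    (hf : IsLinearGrowthDensity f L) {ε : ℝ} (hε : 0 ≤ ε) {q : ℝ≥0∞} {G : α → RMat N n}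
    (hG : MemLp G q μ) : MemLp (fun x => stress f (G x) + ε • G x) q μ := by
  refine hG.of_le_mul (c := L + ε) ((hf.continuous_stress.comp_aestronglyMeasurable hG.1).add
    (hG.1.const_smul ε)) (.of_forall fun x => ?_)
  rw [add_mul]
  refine (norm_add_le _ _).trans (add_le_add ?_ ?_)
  · have := hf.lipschitzWith_stress.norm_sub_le (G x) 0
    rwa [stress_zero, sub_zero, sub_zero, Real.coe_toNNReal _ hf.pos.le] at this
  · rw [norm_smul, Real.norm_of_nonneg hε]

/-- For solutions of the regularised equation, the curl of the truncated gradient is small,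
uniformly in the regularisation. -/
theorem exists_abs_integral_truncate_curl_le (hf : IsLinearGrowthDensity f L) {χ : ℝ → ℝ} {K : ℝ}
    (hχ : IsCutoffProfile χ K) {Ω : Set (RVec n)} (hΩ : IsOpen Ω)
    {T : RVec n → RMat N n} (hT : MemLp T 2) {T₁ T₂ : Fin n → Fin N × Fin n → RVec n → ℝ}
    (hT₁ : ∀ s c, HasWeakPartial Ω s (fun x => T x c) (T₁ s c)) (hT₁2 : ∀ s c, MemLp (T₁ s c) 2)
    (hT₂ : ∀ s c, HasWeakPartial Ω c.2 (T₁ s c) (T₂ s c)) (hT₂2 : ∀ s c, MemLp (T₂ s c) 2)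
    {B : ℝ} (hB : ∀ s c, ∀ᵐ x, ‖T₂ s c x‖ ≤ B) {φ : RVec n → ℝ} (hφ : IsTestFunction Ω φ)
    (a : Fin N) (i j : Fin n) (C₀ : ℝ) :
    ∃ C, ∀ (ε : ℝ) (G : RVec n → RMat N n), 0 < ε → MemLp G 2 → Integrable G →
      ∫ x, ‖G x‖ ≤ C₀ → ε * ∫ x, ‖G x‖ ^ 2 ≤ C₀ →
      (∀ ψ : RVec n → RVec N, ContDiff ℝ ∞ ψ → HasCompactSupport ψ → tsupport ψ ⊆ Ω →
        ∫ x, ⟪stress f (G x) + ε • G x - T x, gradField ψ x⟫ = 0) →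
      ∀ u : ℕ → RVec n → RVec N, (∀ k, ContDiff ℝ ∞ (u k)) →
      (∀ k, MemLp (gradField (u k)) 2 (volume.restrict Ω)) →
      Tendsto (fun k => eLpNorm (fun x => gradField (u k) x - G x) 2 (volume.restrict Ω))
        atTop (𝓝 0) →
      ∀ δ : ℝ, 0 ≤ δ → δ ≤ 1 →
      |(∫ x, truncate χ δ (a, j) (G x) * fderiv ℝ φ x (EuclideanSpace.single i 1)) -
        ∫ x, truncate χ δ (a, i) (G x) * fderiv ℝ φ x (EuclideanSpace.single j 1)| ≤ δ * C := by
  have hK0 : 0 ≤ K := (abs_nonneg _).trans (hχ.abs_deriv_le 0)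
  have hL := hf.pos
  have hc1 : 0 < derivHalfLine f 1 := hf.deriv_pos one_pos
  obtain ⟨r, hr, hrΩ⟩ := hφ.2.exists_cthickening_subset_open hΩ hφ.3
  -- Two nested cutoffs are used: `η₁` is 1 on `V` and provides second derivatives there, while `η`
  -- lives in `V`, is 1 on the support of φ and localises the weighted estimate.
  obtain ⟨η₁, hη₁, hη₁1⟩ := exists_isTestFunction_eq_one hΩ hφ.2.isCompact.cthickening hrΩ
  set V := Metric.thickening r (tsupport φ) with hVdef
  have hV : IsOpen V := Metric.isOpen_thickening
  have hVΩ : V ⊆ Ω := (Metric.thickening_subset_cthickening _ _).trans hrΩ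
  have hφV : IsTestFunction V φ := ⟨hφ.1, hφ.2, Metric.self_subset_thickening hr _⟩
  obtain ⟨η, hη, hη1⟩ := exists_isTestFunction_eq_one hV hφ.2 hφV.3
  obtain ⟨ρ, hρ, hρΩ⟩ := hη₁.2.exists_thickening_subset_open hΩ hη₁.3
  have hρΩ' : ∀ x ∈ tsupport η₁, Metric.ball x ρ ⊆ Ω := fun x hx y hy =>
    hρΩ (Metric.mem_thickening_iff.2 ⟨x, hx, hy⟩)
  obtain ⟨CT, hCT, hTd⟩ := exists_eLpNorm_field_difference_le hΩ hT hT₁ hT₁2 hη₁ hρ hρΩ'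
  obtain ⟨M, hM⟩ := hη.1.continuous.bounded_above_of_compact_support hη.2
  obtain ⟨M', hM'⟩ := (continuous_gradVec hη.1).bounded_above_of_compact_support
    (hη.2.mono' fun x hx => by
      by_contra h'
      exact hx (gradVec_eq_zero h'))
  obtain ⟨Mφ, hMφ⟩ := hφ.1.continuous.bounded_above_of_compact_support hφ.2
  have hMφ0 : 0 ≤ Mφ := (norm_nonneg _).trans (hMφ 0)
  have hB0 : 0 ≤ B := by
    obtain ⟨x, hx⟩ := (hB i (a, i)).exists
    exact (norm_nonneg _).trans hx
  -- The bound of the weighted second derivative integrals; it depends on `C₀`, the datum and the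
  -- cutoffs, not on `ε` or `G`.
  set D : ℝ := 2 * ((Fintype.card (Fin N × Fin n) : ℝ) * (B * (M ^ 2 * C₀))) +
    4 * (M' ^ 2 * (2 * L * C₀ + C₀)) with hD
  refine ⟨K * (2 * (derivHalfLine f 1)⁻¹ * C₀ + D + D) * Mφ, fun ε G hε hG hGi hC₁ hC₂ heq u hu hu2
    hlim δ hδ hδ1 => ?_⟩
  have hΛ : LipschitzWith (L.toNNReal + ‖ε‖₊) fun z : RMat N n => stress f z + ε • z :=
    hf.lipschitzWith_stress.add (lipschitzWith_smul ε)
  obtain ⟨CG, -, hGd⟩ := exists_eLpNorm_difference_le hΩ hε (S := fun z => stress f z + ε • z)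
    (fun z w => by
      have h1 := hf.inner_stress_sub_nonneg z w
      have e : stress f w + ε • w - (stress f z + ε • z) =
          (stress f w - stress f z) + ε • (w - z) := by
        rw [smul_sub]; abel
      rw [e, inner_add_left, real_inner_smul_left, real_inner_self_eq_norm_sq]
      linarith) hΛ hG hT (hf.memLp_regularisedStress hε.le hG) heq hu hu2 hlim hη₁ (ρ := ρ / 2)
    (fun x hx => (Metric.ball_subset_ball (by linarith)).trans (hρΩ' x hx)) hCT hTd
  -- Only the existence of `X` is retained from the bound `CG`, which is not uniform in `ε`.
  choose X hX hGX using exists_hasWeakPartial_of_difference_le (V := V) hG hη₁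
    (fun x hx => hη₁1 x (Metric.thickening_subset_cthickening _ _ hx)) (half_pos hρ) hGd
  have hcurl : ∀ a, IsWeaklyCurlFree V fun i x => G x (a, i) := fun a i j ψ hψ =>
    isWeaklyCurlFree_of_tendsto (hG.restrict Ω) hu hu2 hlim a i j ψ (hψ.mono hVΩ)
  have hDs : ∀ s, ∫ x, η x ^ 2 * ⟪stressDeriv f (G x) (X s x), X s x⟫ ≤ D := by
    intro s
    refine (hf.integral_mul_inner_stressDeriv_le hV hε.le hG hGi (hX s) (hGX s) hcurl
      (fun ψ h1 h2 h3 => heq ψ h1 h2 (h3.trans hVΩ)) (fun c => (hT₁ s c).mono hVΩ)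
      (fun c => (hT₂ s c).mono hVΩ) (hT₂2 s) (hB s) hη hM hM').trans ?_
    rw [hD]
    gcongr
  refine (hχ.abs_integral_truncate_curl_le hf hδ hδ1 hV hG hGi hX hGX hcurl hη hφV hη1 hMφ a i
    j).trans ?_
  rw [mul_assoc δ]
  gcongr
  · exact hDs i
  · exact hDs j

end IsLinearGrowthDensity

end CurlBound

/-! ### A curl-free solution of the limit equation -/

section CurlFreeSolution

variable {n N : ℕ} {f : ℝ → ℝ} {L : ℝ}

theorem gradField_add {y z : RVec n → RVec N} {x : RVec n}
    (hy : DifferentiableAt ℝ y x) (hz : DifferentiableAt ℝ z x) :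
    gradField (fun x => y x + z x) x = gradField y x + gradField z x := by
  ext c
  simp only [gradField, PiLp.add_apply]
  rw [fderiv_fun_add hy hz]
  simp

theorem gradField_const_smul {y : RVec n → RVec N} {x : RVec n}
    (hy : DifferentiableAt ℝ y x) (a : ℝ) :
    gradField (fun x => a • y x) x = a • gradField y x := by
  ext c
  simp only [gradField, PiLp.smul_apply]
  rw [fderiv_fun_const_smul hy]
  simp

theorem memLp_gradField {φ : RVec n → RVec N} (hφ : ContDiff ℝ ∞ φ) (hφc : HasCompactSupport φ)
    {q : ℝ≥0∞} : MemLp (gradField φ) q :=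
  (continuous_gradField hφ).memLp_of_hasCompactSupport (hφc.mono' fun x hx => by
    by_contra h
    exact hx (gradField_eq_zero h))

/-- The gradients of smooth compactly supported maps, as elements of `L²(Ω)`. -/
noncomputable def testGradients (N : ℕ) (Ω : Set (RVec n)) :
    Submodule ℝ (Lp (RMat N n) 2 (volume.restrict Ω)) where
  carrier := {Φ | ∃ φ : RVec n → RVec N, ContDiff ℝ ∞ φ ∧ HasCompactSupport φ ∧
    Φ =ᵐ[volume.restrict Ω] gradField φ}
  zero_mem' := ⟨0, contDiff_const, HasCompactSupport.zero, by
    filter_upwards [Lp.coeFn_zero (RMat N n) 2 (volume.restrict Ω)] with x hx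
    rw [hx]
    ext c
    simp [gradField]⟩
  add_mem' := by
    rintro Φ Ψ ⟨φ, h1, h2, h3⟩ ⟨ψ, h4, h5, h6⟩
    refine ⟨fun x => φ x + ψ x, h1.add h4, h2.add h5, ?_⟩
    filter_upwards [Lp.coeFn_add Φ Ψ, h3, h6] with x hx hx3 hx6
    rw [hx, Pi.add_apply, hx3, hx6, gradField_add (h1.differentiable (by simp) x)
      (h4.differentiable (by simp) x)]
  smul_mem' := by
    rintro a Φ ⟨φ, h1, h2, h3⟩
    refine ⟨fun x => a • φ x, h1.const_smul a, h2.smul_left (f := fun _ => a), ?_⟩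
    filter_upwards [Lp.coeFn_smul a Φ, h3] with x hx hx3
    rw [hx, Pi.smul_apply, hx3, gradField_const_smul (h1.differentiable (by simp) x)]

theorem toLp_gradField_mem_testGradients {φ : RVec n → RVec N} (hφ : ContDiff ℝ ∞ φ)
    (hφc : HasCompactSupport φ) (Ω : Set (RVec n)) :
    ((memLp_gradField hφ hφc).restrict Ω).toLp (gradField φ) ∈ testGradients N Ω :=
  ⟨φ, hφ, hφc, MemLp.coeFn_toLp _⟩

theorem exists_tendsto_gradField_of_mem_closure {Ω : Set (RVec n)}
    {G : Lp (RMat N n) 2 (volume.restrict Ω)} (hG : G ∈ (testGradients N Ω).topologicalClosure) :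
    ∃ u : ℕ → RVec n → RVec N, (∀ k, ContDiff ℝ ∞ (u k)) ∧
      (∀ k, MemLp (gradField (u k)) 2 (volume.restrict Ω)) ∧
      Tendsto (fun k => eLpNorm (fun x => gradField (u k) x - G x) 2 (volume.restrict Ω))
        atTop (𝓝 0) := by
  obtain ⟨Φ, hΦ, hlim⟩ := mem_closure_iff_seq_limit.1 hG
  choose u hu huc hΦu using hΦ
  refine ⟨u, hu, fun k => (memLp_gradField (hu k) (huc k)).restrict Ω, ?_⟩
  refine ((Lp.tendsto_Lp_iff_tendsto_eLpNorm' Φ G).1 hlim).congr fun k => eLpNorm_congr_ae ?_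
  filter_upwards [hΦu k] with x hx
  rw [Pi.sub_apply, hx]

theorem ae_indicator_norm_le {Ω : Set (RVec n)} (hΩ : MeasurableSet Ω) {u : RVec n → ℝ}
    (hu : MemLp u ⊤ (volume.restrict Ω)) :
    ∀ᵐ x, ‖Ω.indicator u x‖ ≤ (eLpNorm u ⊤ (volume.restrict Ω)).toReal := by
  have h1 : ∀ᵐ x ∂volume.restrict Ω, ‖u x‖ ≤ (eLpNorm u ⊤ (volume.restrict Ω)).toReal := by
    filter_upwards [ae_le_eLpNormEssSup (f := u) (μ := volume.restrict Ω)] with x hx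
    rw [eLpNorm_exponent_top, ← toReal_enorm]
    exact ENNReal.toReal_mono (by simpa using hu.2.ne) hx
  filter_upwards [(ae_restrict_iff' hΩ).1 h1] with x hx
  by_cases hxΩ : x ∈ Ω
  · rw [Set.indicator_of_mem hxΩ]
    exact hx hxΩ
  · rw [Set.indicator_of_notMem hxΩ, norm_zero]
    positivity

/-- The datum and its derivatives are extended by zero. The derivative relations are claimed in Ω
only, so jumps at the boundary are harmless. -/
theorem MemSobolev.exists_derivatives {Ω : Set (RVec n)} (hΩ : IsOpen Ω)
    (hΩf : volume Ω ≠ ⊤) {T₀ : RVec n → RMat N n} (hT₀ : MemSobolev Ω 2 ⊤ T₀) :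
    MemLp (Ω.indicator T₀) 2 ∧ ∃ (T₁ T₂ : Fin n → Fin N × Fin n → RVec n → ℝ) (B : ℝ),
      (∀ s c, HasWeakPartial Ω s (fun x => Ω.indicator T₀ x c) (T₁ s c)) ∧
      (∀ s c, MemLp (T₁ s c) 2) ∧ (∀ s c, HasWeakPartial Ω c.2 (T₁ s c) (T₂ s c)) ∧
      (∀ s c, MemLp (T₂ s c) 2) ∧ ∀ s c, ∀ᵐ x, ‖T₂ s c x‖ ≤ B := by
  have : IsFiniteMeasure (volume.restrict Ω) := isFiniteMeasure_restrict.2 hΩf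
  have hΩm := hΩ.measurableSet
  choose g hg hg1 using fun s c => (hT₀ c).2 s
  choose g2 hg2 hg3 using fun s (c : Fin N × Fin n) => (hg1 s c).2 c.2
  have hg2m : ∀ s c, MemLp (g2 s c) ⊤ (volume.restrict Ω) := hg3
  have hind : ∀ {u : RVec n → ℝ}, MemLp u ⊤ (volume.restrict Ω) → MemLp (Ω.indicator u) 2 :=
    fun hu => (memLp_indicator_iff_restrict hΩm).2 (hu.mono_exponent le_top)
  have hT : MemLp T₀ 2 (volume.restrict Ω) :=
    memLp_toLp one_le_two fun c => (hT₀ c).1.mono_exponent le_top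
  refine ⟨(memLp_indicator_iff_restrict hΩm).2 hT, fun s c => Ω.indicator (g s c),
    fun s c => Ω.indicator (g2 s c),
    ∑ s, ∑ c, (eLpNorm (g2 s c) ⊤ (volume.restrict Ω)).toReal, fun s c => ?_,
    fun s c => hind (hg1 s c).1, fun s c => ?_, fun s c => hind (hg2m s c), fun s c => ?_⟩
  · refine (hg s c).congr_ae ?_ (indicator_ae_eq_restrict hΩm).symm
    filter_upwards [indicator_ae_eq_restrict (f := T₀) hΩm] with x hx
    rw [hx]
  · exact (hg2 s c).congr_ae (indicator_ae_eq_restrict hΩm).symm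
      (indicator_ae_eq_restrict hΩm).symm
  · filter_upwards [ae_indicator_norm_le hΩm (hg2m s c)] with x hx
    refine hx.trans ?_
    refine (Finset.single_le_sum (f := fun c => (eLpNorm (g2 s c) ⊤ (volume.restrict Ω)).toReal)
      (fun _ _ => ENNReal.toReal_nonneg) (Finset.mem_univ c)).trans ?_
    exact Finset.single_le_sum
      (f := fun s => ∑ c, (eLpNorm (g2 s c) ⊤ (volume.restrict Ω)).toReal)
      (fun _ _ => Finset.sum_nonneg fun _ _ => ENNReal.toReal_nonneg) (Finset.mem_univ s)

/-- A pointwise limit of fields whose truncations have a uniformly small curl is curl-free. -/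
theorem isWeaklyCurlFree_of_truncate {χ : ℝ → ℝ} {K : ℝ} (hχ : IsCutoffProfile χ K)
    {Ω : Set (RVec n)} {G : ℕ → RVec n → RMat N n} {g : RVec n → RMat N n}
    (hG : ∀ k, AEStronglyMeasurable (G k) (volume.restrict Ω))
    (hg : IntegrableOn g Ω)
    (hlim : ∀ᵐ x ∂volume.restrict Ω, Tendsto (fun k => G k x) atTop (𝓝 (g x))) {a : Fin N}
    (h : ∀ i j φ, IsTestFunction Ω φ → ∃ C, ∀ k, ∀ δ : ℝ, 0 ≤ δ → δ ≤ 1 →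
      |(∫ x, truncate χ δ (a, j) (G k x) * fderiv ℝ φ x (EuclideanSpace.single i 1)) -
        ∫ x, truncate χ δ (a, i) (G k x) * fderiv ℝ φ x (EuclideanSpace.single j 1)| ≤ δ * C) :
    IsWeaklyCurlFree Ω fun i x => g x (a, i) := by
  intro i j φ hφ
  obtain ⟨C, hC⟩ := h i j φ hφ
  -- For fixed `δ` the truncations are bounded by exp(2/δ), so dominated convergence needs no
  -- equi-integrability of the sequence.
  have hlim1 : ∀ (δ : ℝ) (c : Fin N × Fin n) (v : RVec n), 0 < δ →
      Tendsto (fun k => ∫ x, truncate χ δ c (G k x) * fderiv ℝ φ x v) atTop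
        (𝓝 (∫ x, truncate χ δ c (g x) * fderiv ℝ φ x v)) := by
    intro δ c v hδ
    have hv := hφ.fderiv_apply v
    have hc := (hχ.contDiff_truncate δ c).continuous
    have hvi : Integrable (fun x => fderiv ℝ φ x v) (volume.restrict Ω) :=
      (hv.1.continuous.integrable_of_hasCompactSupport hv.2).restrict
    simp only [← setIntegral_mul_eq_integral hv.3]
    refine tendsto_integral_of_dominated_convergence
      (fun x => Real.exp (2 / δ) * ‖fderiv ℝ φ x v‖)
      (fun k => (hc.comp_aestronglyMeasurable (hG k)).mul hvi.1)
      (hvi.norm.const_mul _) (fun k => .of_forall fun x => ?_) ?_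
    · rw [norm_mul]
      exact mul_le_mul_of_nonneg_right (hχ.abs_truncate_le_exp hδ c _) (norm_nonneg _)
    · filter_upwards [hlim] with x hx
      exact ((hc.tendsto _).comp hx).mul_const _
  have hbound : ∀ δ : ℝ, 0 < δ → δ ≤ 1 →
      |(∫ x, truncate χ δ (a, j) (g x) * fderiv ℝ φ x (EuclideanSpace.single i 1)) -
        ∫ x, truncate χ δ (a, i) (g x) * fderiv ℝ φ x (EuclideanSpace.single j 1)| ≤ δ * C :=
    fun δ hδ hδ1 => le_of_tendsto ((hlim1 δ _ _ hδ).sub (hlim1 δ _ _ hδ)).abs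
      (.of_forall fun k => hC k δ hδ.le hδ1)
  let d : ℕ → ℝ := fun m => 1 / ((m : ℝ) + 1)
  have hd0 : ∀ m, 0 < d m := fun m => by positivity
  have hd1 : ∀ m, d m ≤ 1 := fun m => (div_le_one (by positivity)).2 (by
    have := Nat.cast_nonneg (α := ℝ) m; linarith)
  have hd : Tendsto d atTop (𝓝 0) := tendsto_one_div_add_atTop_nhds_zero_nat
  -- The truncation is removed on the limit field alone, with |g| in L¹ as the dominating function.
  have hlim2 : ∀ (c : Fin N × Fin n) (v : RVec n),
      Tendsto (fun m => ∫ x, truncate χ (d m) c (g x) * fderiv ℝ φ x v) atTop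
        (𝓝 (∫ x, g x c * fderiv ℝ φ x v)) := by
    intro c v
    have hv := hφ.fderiv_apply v
    obtain ⟨M, hM⟩ := hv.1.continuous.bounded_above_of_compact_support hv.2
    simp only [← setIntegral_mul_eq_integral hv.3]
    refine tendsto_integral_of_dominated_convergence (fun x => ‖g x‖ * M)
      (fun m => ((hχ.contDiff_truncate (d m) c).continuous.comp_aestronglyMeasurable hg.1).mul
        hv.1.continuous.aestronglyMeasurable)
      (hg.norm.mul_const M) (fun m => .of_forall fun x => ?_) (.of_forall fun x => ?_)
    · rw [norm_mul]
      exact mul_le_mul (hχ.abs_truncate_le (d m) c (g x)) (hM x) (norm_nonneg _) (norm_nonneg _)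
    · exact (hχ.tendsto_truncate hd c (g x)).mul_const _
  have h0 : Tendsto (fun m => d m * C) atTop (𝓝 0) := by simpa using hd.mul_const C
  have h1 := le_of_tendsto_of_tendsto' ((hlim2 (a, j) (EuclideanSpace.single i 1)).sub
    (hlim2 (a, i) (EuclideanSpace.single j 1))).abs h0 fun m => hbound (d m) (hd0 m) (hd1 m)
  exact sub_eq_zero.1 (abs_nonpos_iff.1 h1)

/-- The regularised problems are posed in the closure of gradients of functions that need not vanish
on the boundary of Ω; this encodes the Neumann condition. The fields are extended by zero for the
interior estimates, which take place inside Ω. -/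
theorem IsLinearGrowthDensity.exists_curlFree_solution (hf : IsLinearGrowthDensity f L)
    (hf0 : f 0 = 0) {Ω : Set (RVec n)} (hΩ : IsOpen Ω) (hΩf : volume Ω ≠ ⊤)
    {T₀ : RVec n → RMat N n} (hT₀ : MemSobolev Ω 2 ⊤ T₀) {τ : ℝ}
    (hτ : ∀ᵐ x ∂volume.restrict Ω, ‖T₀ x‖ ≤ τ) (hτf : τ < recessionSlope f) :
    ∃ g : RVec n → RMat N n, IntegrableOn g Ω ∧
      (∀ a, IsWeaklyCurlFree Ω fun i x => g x (a, i)) ∧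
      ∀ φ : RVec n → RVec N, ContDiff ℝ ∞ φ → HasCompactSupport φ →
        ∫ x in Ω, (⟪stress f (g x), gradField φ x⟫ - ⟪T₀ x, gradField φ x⟫) = 0 := by
  have : IsFiniteMeasure (volume.restrict Ω) := isFiniteMeasure_restrict.2 hΩf
  have hΩm := hΩ.measurableSet
  obtain ⟨hT, T₁, T₂, B, hT₁, hT₁2, hT₂, hT₂2, hB⟩ := hT₀.exists_derivatives hΩ hΩf
  set H := (testGradients N Ω).topologicalClosure with hH
  have hHc : IsClosed (H : Set (Lp (RMat N n) 2 (volume.restrict Ω))) :=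
    Submodule.isClosed_topologicalClosure _
  have : CompleteSpace H := hHc.completeSpace_coe
  have hmem : ∀ {φ : RVec n → RVec N} (h1 : ContDiff ℝ ∞ φ) (h2 : HasCompactSupport φ),
      ((memLp_gradField h1 h2).restrict Ω).toLp (gradField φ) ∈ H := fun h1 h2 =>
    Submodule.le_topologicalClosure _ (toLp_gradField_mem_testGradients h1 h2 Ω)
  obtain ⟨ε, G, C₀, g, hε, hGH, heq, hC₁, hC₂, hg, hlim, hgeq⟩ :=
    exists_limit_of_regularised_solutions hf hf0
      ((memLp_indicator_iff_restrict hΩm).1 hT).1 hτ hτf H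
  refine ⟨g, hg, fun a => ?_, fun φ h1 h2 => ?_⟩
  · obtain ⟨χ, K, hχ⟩ := exists_isCutoffProfile
    set Ge : ℕ → RVec n → RMat N n := fun k => Ω.indicator (G k) with hGe
    have hGe_eq : ∀ k, ∀ x ∈ Ω, Ge k x = G k x := fun k x hx => Set.indicator_of_mem hx _
    have hGe_zero : ∀ k, ∀ x ∉ Ω, Ge k x = 0 := fun k x hx => Set.indicator_of_notMem hx _
    have hGe2 : ∀ k, MemLp (Ge k) 2 := fun k =>
      (memLp_indicator_iff_restrict hΩm).2 (Lp.memLp (G k))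
    have hGei : ∀ k, Integrable (Ge k) := fun k =>
      (integrable_indicator_iff hΩm).2 ((Lp.memLp (G k)).integrable one_le_two)
    have hint : ∀ (k : ℕ) (p : ℕ), p ≠ 0 → ∫ x, ‖Ge k x‖ ^ p = ∫ x in Ω, ‖G k x‖ ^ p := by
      intro k p hp
      rw [← setIntegral_eq_integral_of_forall_compl_eq_zero (s := Ω) fun x hx => by
        rw [hGe_zero k x hx, norm_zero, zero_pow hp]]
      exact setIntegral_congr_fun hΩm fun x hx => by simp only [hGe_eq k x hx]
    refine isWeaklyCurlFree_of_truncate hχ (G := Ge) (fun k => (hGe2 k).1.restrict) hg ?_ ?_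
    · filter_upwards [hlim, ae_restrict_mem hΩm] with x hx hxΩ
      simpa only [hGe_eq _ x hxΩ] using hx
    · intro i j φ hφ
      obtain ⟨C, hC⟩ := hf.exists_abs_integral_truncate_curl_le hχ hΩ hT hT₁ hT₁2 hT₂ hT₂2 hB hφ
        a i j C₀
      refine ⟨C, fun k => ?_⟩
      obtain ⟨u, hu, hu2, hulim⟩ := exists_tendsto_gradField_of_mem_closure (hGH k)
      refine hC (ε k) (Ge k) (hε k).1 (hGe2 k) (hGei k) ?_ ?_ (fun ψ h1 h2 _ => ?_) u hu hu2 ?_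
      · have := hint k 1 one_ne_zero
        simp only [pow_one] at this
        rw [this]
        exact hC₁ k
      · rw [hint k 2 two_ne_zero]
        exact hC₂ k
      · have h3 := heq k _ (hmem h1 h2)
        rw [← h3, ← setIntegral_eq_integral_of_forall_compl_eq_zero (s := Ω) fun x hx => by
          rw [hGe_zero k x hx, Set.indicator_of_notMem hx, stress_zero, smul_zero, add_zero,
            sub_zero, inner_zero_left]]
        refine integral_congr_ae ?_
        filter_upwards [((memLp_gradField h1 h2).restrict Ω).coeFn_toLp, ae_restrict_mem hΩm]
          with x hx hxΩ
        rw [hx, hGe_eq k x hxΩ, Set.indicator_of_mem hxΩ]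
      · refine hulim.congr fun k' => eLpNorm_congr_ae ?_
        filter_upwards [ae_restrict_mem hΩm] with x hxΩ
        rw [hGe_eq k x hxΩ]
  · rw [← hgeq _ (hmem h1 h2)]
    refine integral_congr_ae ?_
    filter_upwards [((memLp_gradField h1 h2).restrict Ω).coeFn_toLp] with x hx
    rw [hx]

end CurlFreeSolution

/-! ### Sobolev maps and weak gradients -/

section Sobolev

variable {n N : ℕ} {f : ℝ → ℝ} {L : ℝ} {Ω : Set (RVec n)}

theorem HasWeakGrad.ae_eq (hΩ : IsOpen Ω) {u : RVec n → RVec N} {G G' : RVec n → RMat N n}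
    (h : HasWeakGrad Ω u G) (h' : HasWeakGrad Ω u G') : G =ᵐ[volume.restrict Ω] G' := by
  have h1 : ∀ᵐ x ∂volume.restrict Ω, ∀ c : Fin N × Fin n, G x c = G' x c :=
    ae_all_iff.2 fun c => (h c.1 c.2).ae_eq hΩ (h' c.1 c.2)
  filter_upwards [h1] with x hx
  ext c
  exact hx c

theorem HasWeakGrad.memSobolev {u : RVec n → RVec N} {G : RVec n → RMat N n}
    (h : HasWeakGrad Ω u G) (hu : IntegrableOn u Ω) (hG : IntegrableOn G Ω) :
    MemSobolev Ω 1 1 u := fun a =>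
  ⟨memLp_apply (memLp_one_iff_integrable.2 hu) a, fun i =>
    ⟨_, h a i, memLp_apply (memLp_one_iff_integrable.2 hG) (a, i)⟩⟩

theorem HasWeakGrad.add {u v : RVec n → RVec N} {G H : RVec n → RMat N n}
    (hu : HasWeakGrad Ω u G) (hv : HasWeakGrad Ω v H) :
    HasWeakGrad Ω (fun x => u x + v x) fun x => G x + H x := fun a i =>
  (hu a i).add (hv a i)

theorem HasWeakGrad.const_smul {u : RVec n → RVec N} {G : RVec n → RMat N n}
    (hu : HasWeakGrad Ω u G) (s : ℝ) : HasWeakGrad Ω (fun x => s • u x) fun x => s • G x :=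
  fun a i => (hu a i).const_mul s

theorem HasWeakGrad.weakGrad_ae_eq (hΩ : IsOpen Ω) {u : RVec n → RVec N} {G : RVec n → RMat N n}
    (h : HasWeakGrad Ω u G) : weakGrad Ω u =ᵐ[volume.restrict Ω] G := by
  have h1 : ∃ G, HasWeakGrad Ω u G := ⟨G, h⟩
  refine HasWeakGrad.ae_eq hΩ (u := u) ?_ h
  rw [weakGrad, dif_pos h1]
  exact h1.choose_spec

theorem MemSobolev.integrableOn {u : RVec n → RVec N} (hu : MemSobolev Ω 1 1 u) :
    IntegrableOn u Ω :=
  memLp_one_iff_integrable.1 (memLp_toLp le_rfl fun a => (hu a).1)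

theorem MemSobolev.integrableOn_weakGrad (hΩ : IsOpen Ω) {u : RVec n → RVec N}
    (hu : MemSobolev Ω 1 1 u) : IntegrableOn (weakGrad Ω u) Ω := by
  have h1 : ∀ c : Fin N × Fin n, MemLp (fun x => weakGrad Ω u x c) 1 (volume.restrict Ω) := by
    intro c
    obtain ⟨g, hg, hgi⟩ := (hu c.1).2 c.2
    have hgi' : MemLp g 1 (volume.restrict Ω) := hgi
    exact hgi'.ae_eq (hg.ae_eq hΩ (hu.hasWeakGrad c.1 c.2))
  exact memLp_one_iff_integrable.1 (memLp_toLp le_rfl h1)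

theorem MemSobolev.add_smul (hΩ : IsOpen Ω) {u v : RVec n → RVec N}
    (hu : MemSobolev Ω 1 1 u) (hv : MemSobolev Ω 1 1 v) (s : ℝ) :
    MemSobolev Ω 1 1 (fun x => u x + s • v x) ∧
      weakGrad Ω (fun x => u x + s • v x) =ᵐ[volume.restrict Ω]
        fun x => weakGrad Ω u x + s • weakGrad Ω v x := by
  have h := hu.hasWeakGrad.add (hv.hasWeakGrad.const_smul s)
  exact ⟨h.memSobolev (hu.integrableOn.add (hv.integrableOn.smul s))
    ((hu.integrableOn_weakGrad hΩ).add ((hv.integrableOn_weakGrad hΩ).smul s)),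
    h.weakGrad_ae_eq hΩ⟩

end Sobolev

/-! ### Weak solutions and minimisers -/

section WeakSolution

variable {n N : ℕ} {f : ℝ → ℝ} {L τ : ℝ} {Ω : Set (RVec n)} {T₀ : RVec n → RMat N n}

theorem IsWeakSolution.integral_sub_eq_zero (hf : IsLinearGrowthDensity f L) (hΩ : IsOpen Ω)
    (hT₀ : AEStronglyMeasurable T₀ (volume.restrict Ω))
    (hτ : ∀ᵐ x ∂volume.restrict Ω, ‖T₀ x‖ ≤ τ) {u v : RVec n → RVec N}
    (hu : IsWeakSolution Ω f T₀ u) (hv : MemSobolev Ω 1 1 v) :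
    ∫ x in Ω, (⟪stress f (weakGrad Ω u x), weakGrad Ω v x - weakGrad Ω u x⟫ -
      ⟪T₀ x, weakGrad Ω v x - weakGrad Ω u x⟫) = 0 := by
  obtain ⟨h1, h2⟩ := hv.add_smul hΩ hu.1 (-1)
  have h3 := hu.2 _ h1
  have h4 := h1.integrableOn_weakGrad hΩ
  have h5 : ∫ x in Ω, (⟪stress f (weakGrad Ω u x), weakGrad Ω (fun x => v x + (-1 : ℝ) • u x) x⟫ -
      ⟪T₀ x, weakGrad Ω (fun x => v x + (-1 : ℝ) • u x) x⟫) = 0 := by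
    rw [integral_sub (hf.integrable_inner_stress (hu.1.integrableOn_weakGrad hΩ).1 h4)
      (integrable_inner_of_ae_norm_le hT₀ hτ h4), sub_eq_zero]
    exact h3
  rw [← h5]
  refine integral_congr_ae ?_
  filter_upwards [h2] with x hx
  rw [hx, neg_one_smul, ← sub_eq_add_neg]

theorem IsWeakSolution.isEnergyMinimiser (hf : IsLinearGrowthDensity f L) (hf0 : f 0 = 0)
    (hΩ : IsOpen Ω) (hT₀ : AEStronglyMeasurable T₀ (volume.restrict Ω))
    (hτ : ∀ᵐ x ∂volume.restrict Ω, ‖T₀ x‖ ≤ τ) {u : RVec n → RVec N}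
    (hu : IsWeakSolution Ω f T₀ u) : IsEnergyMinimiser Ω f T₀ u := by
  refine ⟨hu.1, fun w hw => ?_⟩
  have h1 := le_fieldEnergy_sub hf hf0 hT₀ hτ (hu.1.integrableOn_weakGrad hΩ)
    (hw.integrableOn_weakGrad hΩ)
  rw [hu.integral_sub_eq_zero hf hΩ hT₀ hτ hw] at h1
  exact sub_nonneg.1 h1

/-- Convexity at u + sφ and minimality of `u` make the first variation at u + sφ in direction φ
nonnegative for s > 0. As s → 0 the stresses stay bounded by `L`, so dominated convergence applies.
Replacing φ by −φ gives the opposite inequality. -/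
theorem IsEnergyMinimiser.integral_inner_le (hf : IsLinearGrowthDensity f L) (hf0 : f 0 = 0)
    (hΩ : IsOpen Ω) (hT₀ : AEStronglyMeasurable T₀ (volume.restrict Ω))
    (hτ : ∀ᵐ x ∂volume.restrict Ω, ‖T₀ x‖ ≤ τ) {u : RVec n → RVec N}
    (hu : IsEnergyMinimiser Ω f T₀ u) {φ : RVec n → RVec N} (hφ : MemSobolev Ω 1 1 φ) :
    ∫ x in Ω, ⟪T₀ x, weakGrad Ω φ x⟫ ≤
      ∫ x in Ω, ⟪stress f (weakGrad Ω u x), weakGrad Ω φ x⟫ := by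
  have hui := hu.1.integrableOn_weakGrad hΩ
  have hφi := hφ.integrableOn_weakGrad hΩ
  have hs : ∀ s : ℝ, 0 < s → ∫ x in Ω, ⟪T₀ x, weakGrad Ω φ x⟫ ≤
      ∫ x in Ω, ⟪stress f (weakGrad Ω u x + s • weakGrad Ω φ x), weakGrad Ω φ x⟫ := by
    intro s hs
    obtain ⟨h1, h2⟩ := hu.1.add_smul hΩ hφ s
    have hwi : IntegrableOn (fun x => weakGrad Ω u x + s • weakGrad Ω φ x) Ω :=
      hui.add (hφi.smul s)
    have h3 := hu.2 _ h1
    have h4 : energy Ω f T₀ (fun x => u x + s • φ x) = fieldEnergy (volume.restrict Ω) f T₀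
        fun x => weakGrad Ω u x + s • weakGrad Ω φ x := by
      refine integral_congr_ae ?_
      filter_upwards [h2] with x hx
      rw [hx]
    have h5 := le_fieldEnergy_sub hf hf0 hT₀ hτ hwi hui
    have hi1 := hf.integrable_inner_stress hwi.1 hφi
    have hi2 := integrable_inner_of_ae_norm_le hT₀ hτ hφi
    have h6 : ∫ x in Ω, (⟪stress f (weakGrad Ω u x + s • weakGrad Ω φ x),
        weakGrad Ω u x - (weakGrad Ω u x + s • weakGrad Ω φ x)⟫ -
        ⟪T₀ x, weakGrad Ω u x - (weakGrad Ω u x + s • weakGrad Ω φ x)⟫) =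
        -s * ((∫ x in Ω, ⟪stress f (weakGrad Ω u x + s • weakGrad Ω φ x), weakGrad Ω φ x⟫) -
          ∫ x in Ω, ⟪T₀ x, weakGrad Ω φ x⟫) := by
      rw [← integral_sub hi1 hi2, ← integral_const_mul]
      refine integral_congr_ae (.of_forall fun x => ?_)
      simp only [sub_add_cancel_left, inner_neg_right, real_inner_smul_right]
      ring
    rw [h6] at h5
    have h7 : fieldEnergy (volume.restrict Ω) f T₀ (fun x => weakGrad Ω u x) ≤
        energy Ω f T₀ (fun x => u x + s • φ x) := h3
    rw [h4] at h7
    have h8 : 0 ≤ s * ((∫ x in Ω, ⟪stress f (weakGrad Ω u x + s • weakGrad Ω φ x),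
        weakGrad Ω φ x⟫) - ∫ x in Ω, ⟪T₀ x, weakGrad Ω φ x⟫) := by linarith
    exact sub_nonneg.1 (nonneg_of_mul_nonneg_right h8 hs)
  let d : ℕ → ℝ := fun m => 1 / ((m : ℝ) + 1)
  have hd0 : ∀ m, 0 < d m := fun m => by positivity
  have hd : Tendsto d atTop (𝓝 0) := tendsto_one_div_add_atTop_nhds_zero_nat
  refine ge_of_tendsto' (f := fun m => ∫ x in Ω, ⟪stress f (weakGrad Ω u x + d m • weakGrad Ω φ x),
    weakGrad Ω φ x⟫) (x := atTop) ?_ fun m => hs (d m) (hd0 m)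
  refine tendsto_integral_of_dominated_convergence (fun x => L * ‖weakGrad Ω φ x‖)
    (fun m => (hf.integrable_inner_stress (hui.1.add (hφi.1.const_smul (d m))) hφi).1)
    (hφi.norm.const_mul L) (fun m => .of_forall fun x => ?_) (.of_forall fun x => ?_)
  · exact (norm_inner_le_norm _ _).trans
      (mul_le_mul_of_nonneg_right (hf.norm_stress_le _) (norm_nonneg _))
  · have h1 := (hd.smul_const (weakGrad Ω φ x)).const_add (weakGrad Ω u x)
    rw [zero_smul, add_zero] at h1
    exact ((hf.continuous_stress.tendsto _).comp h1).inner tendsto_const_nhds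

theorem IsEnergyMinimiser.isWeakSolution (hf : IsLinearGrowthDensity f L) (hf0 : f 0 = 0)
    (hΩ : IsOpen Ω) (hT₀ : AEStronglyMeasurable T₀ (volume.restrict Ω))
    (hτ : ∀ᵐ x ∂volume.restrict Ω, ‖T₀ x‖ ≤ τ) {u : RVec n → RVec N}
    (hu : IsEnergyMinimiser Ω f T₀ u) : IsWeakSolution Ω f T₀ u := by
  refine ⟨hu.1, fun φ hφ => le_antisymm ?_ (hu.integral_inner_le hf hf0 hΩ hT₀ hτ hφ)⟩
  have hg := hφ.hasWeakGrad.const_smul (-1)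
  have h1 := hu.integral_inner_le hf hf0 hΩ hT₀ hτ (hg.memSobolev (hφ.integrableOn.smul (-1 : ℝ))
    ((hφ.integrableOn_weakGrad hΩ).smul (-1 : ℝ)))
  have h2 : ∀ F : RVec n → RMat N n, ∫ x in Ω, ⟪F x, weakGrad Ω (fun x => (-1 : ℝ) • φ x) x⟫ =
      -∫ x in Ω, ⟪F x, weakGrad Ω φ x⟫ := fun F => by
    rw [← integral_neg]
    refine integral_congr_ae ?_
    filter_upwards [hg.weakGrad_ae_eq hΩ] with x hx
    rw [hx, neg_one_smul, inner_neg_right]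
  rw [h2, h2 fun x => stress f (weakGrad Ω u x)] at h1
  exact neg_le_neg_iff.1 h1

/-- Testing each equation with the difference of the solutions shows that the integral of the
monotonicity expression is zero. Its integrand bounds the squared difference of the stresses, and
the stress is injective. -/
theorem IsWeakSolution.weakGrad_ae_eq (hf : IsLinearGrowthDensity f L)
    (hΩ : IsOpen Ω) (hT₀ : AEStronglyMeasurable T₀ (volume.restrict Ω))
    (hτ : ∀ᵐ x ∂volume.restrict Ω, ‖T₀ x‖ ≤ τ) {u v : RVec n → RVec N}
    (hu : IsWeakSolution Ω f T₀ u) (hv : IsWeakSolution Ω f T₀ v) :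
    weakGrad Ω v =ᵐ[volume.restrict Ω] weakGrad Ω u := by
  have hui := hu.1.integrableOn_weakGrad hΩ
  have hvi := hv.1.integrableOn_weakGrad hΩ
  have h1 := hu.integral_sub_eq_zero hf hΩ hT₀ hτ hv.1
  have h2 := hv.integral_sub_eq_zero hf hΩ hT₀ hτ hu.1
  have hi : ∀ {G H : RVec n → RMat N n}, IntegrableOn G Ω → IntegrableOn H Ω → Integrable
      (fun x => ⟪stress f (G x), H x - G x⟫ - ⟪T₀ x, H x - G x⟫) (volume.restrict Ω) :=
    fun hG hH => Integrable.sub (hf.integrable_inner_stress hG.1 (hH.sub hG))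
      (integrable_inner_of_ae_norm_le hT₀ hτ (hH.sub hG))
  have e : ∀ x, ⟪stress f (weakGrad Ω v x) - stress f (weakGrad Ω u x),
      weakGrad Ω v x - weakGrad Ω u x⟫ =
      -((⟪stress f (weakGrad Ω u x), weakGrad Ω v x - weakGrad Ω u x⟫ -
        ⟪T₀ x, weakGrad Ω v x - weakGrad Ω u x⟫) +
        (⟪stress f (weakGrad Ω v x), weakGrad Ω u x - weakGrad Ω v x⟫ -
        ⟪T₀ x, weakGrad Ω u x - weakGrad Ω v x⟫)) := fun x => by
    simp only [inner_sub_left, inner_sub_right]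
    ring
  have h3 : ∫ x in Ω, ⟪stress f (weakGrad Ω v x) - stress f (weakGrad Ω u x),
      weakGrad Ω v x - weakGrad Ω u x⟫ = 0 := by
    simp only [e]
    rw [integral_neg, integral_add (hi hui hvi) (hi hvi hui), h1, h2, add_zero, neg_zero]
  have h4 : Integrable (fun x => ⟪stress f (weakGrad Ω v x) - stress f (weakGrad Ω u x),
      weakGrad Ω v x - weakGrad Ω u x⟫) (volume.restrict Ω) := by
    simp only [e]
    exact ((hi hui hvi).add (hi hvi hui)).neg
  have h5 := (integral_eq_zero_iff_of_nonneg
    (fun x => hf.inner_stress_sub_nonneg (weakGrad Ω u x) (weakGrad Ω v x)) h4).1 h3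
  filter_upwards [h5] with x hx
  have h6 := hf.norm_stress_sub_sq_le_inner (weakGrad Ω u x) (weakGrad Ω v x)
  rw [Pi.zero_apply] at hx
  rw [hx, mul_zero] at h6
  refine hf.stress_injective (sub_eq_zero.1 (norm_eq_zero.1 ?_))
  exact pow_eq_zero_iff two_ne_zero |>.1 (le_antisymm h6 (sq_nonneg _))

theorem integral_eq_zero_of_setAverage_eq_zero (hΩ0 : volume Ω ≠ 0) (hΩf : volume Ω ≠ ⊤)
    {u : RVec n → RVec N} (h : (⨍ x in Ω, u x) = 0) : ∫ x in Ω, u x = 0 := by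
  rw [setAverage_eq] at h
  exact (smul_eq_zero.1 h).resolve_left (inv_ne_zero (ENNReal.toReal_ne_zero.2 ⟨hΩ0, hΩf⟩))

/-- Weak solutions with the same mean agree. -/
theorem IsWeakSolution.ae_eq (hf : IsLinearGrowthDensity f L)
    (hΩ : IsOpen Ω) (hΩc : IsPreconnected Ω) (hΩ0 : volume Ω ≠ 0) (hΩf : volume Ω ≠ ⊤)
    (hT₀ : AEStronglyMeasurable T₀ (volume.restrict Ω))
    (hτ : ∀ᵐ x ∂volume.restrict Ω, ‖T₀ x‖ ≤ τ) {u v : RVec n → RVec N}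
    (hu : IsWeakSolution Ω f T₀ u) (hv : IsWeakSolution Ω f T₀ v)
    (hu0 : (⨍ x in Ω, u x) = 0) (hv0 : (⨍ x in Ω, v x) = 0) :
    v =ᵐ[volume.restrict Ω] u := by
  have hgrad := hu.weakGrad_ae_eq hf hΩ hT₀ hτ hv
  have hw := hv.1.hasWeakGrad.add (hu.1.hasWeakGrad.const_smul (-1))
  have hconst : ∀ a : Fin N, ∃ b : ℝ, (fun x => (v x + (-1 : ℝ) • u x) a) =ᵐ[volume.restrict Ω]
      fun _ => b := fun a =>
    exists_ae_eq_const_of_hasWeakPartial_zero hΩ hΩc fun i =>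
      (hw a i).congr_ae ae_eq_rfl (by
        filter_upwards [hgrad] with x hx
        simp [hx])
  choose b hb using hconst
  have hvu : v =ᵐ[volume.restrict Ω] fun x => u x + WithLp.toLp 2 b := by
    filter_upwards [ae_all_iff.2 hb] with x hx
    ext a
    have := hx a
    simp only [PiLp.add_apply, PiLp.smul_apply, smul_eq_mul] at this ⊢
    linarith
  have h1 := integral_congr_ae hvu
  have : IsFiniteMeasure (volume.restrict Ω) := isFiniteMeasure_restrict.2 hΩf
  rw [integral_add hu.1.integrableOn (integrable_const _), integral_const,
    integral_eq_zero_of_setAverage_eq_zero hΩ0 hΩf hu0,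
    integral_eq_zero_of_setAverage_eq_zero hΩ0 hΩf hv0, zero_add] at h1
  have h2 : (WithLp.toLp 2 b : RVec N) = 0 := by
    refine (smul_eq_zero.1 h1.symm).resolve_left ?_
    rw [measureReal_restrict_apply_univ]
    exact ENNReal.toReal_ne_zero.2 ⟨hΩ0, hΩf⟩
  simpa [h2] using hvu

end WeakSolution

/-! ### Existence of weak solutions -/

section Existence

variable {n N : ℕ} {f : ℝ → ℝ} {L τ : ℝ} {Ω : Set (RVec n)} {T₀ : RVec n → RMat N n}

/-- Each row of the curl-free limit field has a potential. Since stress minus datum is bounded, the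
equation extends row by row from smooth test functions to all W^{1,1} test maps. -/
theorem IsLinearGrowthDensity.exists_hasWeakGrad_solution (hf : IsLinearGrowthDensity f L)
    (hf0 : f 0 = 0) (hn : 1 ≤ n) (hΩ : IsBoundedLipschitzDomain Ω) (hΩsc : IsSimplyConnected Ω)
    (hT₀ : MemSobolev Ω 2 ⊤ T₀) (hτ : ∀ᵐ x ∂volume.restrict Ω, ‖T₀ x‖ ≤ τ)
    (hτf : τ < recessionSlope f) :
    ∃ (u : RVec n → RVec N) (g : RVec n → RMat N n), IntegrableOn u Ω ∧ IntegrableOn g Ω ∧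
      HasWeakGrad Ω u g ∧ ∀ φ : RVec n → RVec N, MemSobolev Ω 1 1 φ →
        ∫ x in Ω, ⟪stress f (g x), weakGrad Ω φ x⟫ = ∫ x in Ω, ⟪T₀ x, weakGrad Ω φ x⟫ := by
  have hΩf : volume Ω ≠ ⊤ := hΩ.isBounded.measure_lt_top.ne
  have hT₀m : AEStronglyMeasurable T₀ (volume.restrict Ω) :=
    (memLp_toLp le_top fun c => (hT₀ c).1).1
  obtain ⟨g, hg, hcurl, heq⟩ := hf.exists_curlFree_solution hf0 hΩ.isOpen hΩf hT₀ hτ hτf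
  have hgc : ∀ c, IntegrableOn (fun x => g x c) Ω := fun c =>
    memLp_one_iff_integrable.1 (memLp_apply (memLp_one_iff_integrable.2 hg) c)
  choose w hw using fun a => exists_potential hΩ.isOpen hΩsc
    (fun i => (hgc (a, i)).locallyIntegrableOn) (hcurl a)
  -- Since n ≥ 1, some weak derivative exists, and its definition includes the local integrability
  -- of `w a`.
  have hwi : ∀ a, IntegrableOn (w a) Ω := fun a =>
    hΩ.integrableOn_of_hasWeakPartial (fun i => hgc (a, i)) (hw a) (hw a ⟨0, hn⟩).1
  refine ⟨fun x => WithLp.toLp 2 fun a => w a x, g,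
    memLp_one_iff_integrable.1 (memLp_toLp le_rfl fun a => memLp_one_iff_integrable.2 (hwi a)), hg,
    fun a i => hw a i, fun φ hφ => ?_⟩
  have hφi := hφ.integrableOn_weakGrad hΩ.isOpen
  have hφc : ∀ c, IntegrableOn (fun x => weakGrad Ω φ x c) Ω := fun c =>
    memLp_one_iff_integrable.1 (memLp_apply (memLp_one_iff_integrable.2 hφi) c)
  set S : Fin N × Fin n → RVec n → ℝ := fun c x => (stress f (g x) - T₀ x) c with hS
  have hSm : ∀ c, AEStronglyMeasurable (S c) (volume.restrict Ω) := fun c =>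
    (EuclideanSpace.proj (𝕜 := ℝ) c).continuous.comp_aestronglyMeasurable
      ((hf.continuous_stress.comp_aestronglyMeasurable hg.1).sub hT₀m)
  have hSb : ∀ c, ∀ᵐ x ∂volume.restrict Ω, ‖S c x‖ ≤ L + τ := fun c => by
    filter_upwards [hτ] with x hx
    exact (PiLp.norm_apply_le _ c).trans ((norm_sub_le _ _).trans
      (add_le_add (hf.norm_stress_le _) hx))
  have hSi : ∀ c {h : RVec n → ℝ}, IntegrableOn h Ω →
      Integrable (fun x => S c x * h x) (volume.restrict Ω) := fun c h hh =>
    hh.bdd_mul (hSm c) (hSb c)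
  have htest : ∀ (a : Fin N) (ψ : RVec n → ℝ), ContDiff ℝ ∞ ψ → HasCompactSupport ψ →
      ∑ i, ∫ x in Ω, S (a, i) x * fderiv ℝ ψ x (EuclideanSpace.single i 1) = 0 := by
    intro a ψ h1 h2
    have h3 := heq (fun x => ψ x • EuclideanSpace.single a (1 : ℝ)) (h1.smul contDiff_const)
      h2.smul_right
    have hψi : ∀ i, IntegrableOn (fun x => fderiv ℝ ψ x (EuclideanSpace.single i 1)) Ω := fun i =>
      (((h1.continuous_fderiv (by simp)).clm_apply
        continuous_const).integrable_of_hasCompactSupport (h2.fderiv_apply (𝕜 := ℝ) _)).integrableOn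
    rw [← integral_finsetSum _ fun i _ => hSi (a, i) (hψi i), ← h3]
    refine integral_congr_ae (.of_forall fun x => ?_)
    have hgrad : ∀ c, gradField (fun x => ψ x • (EuclideanSpace.single a (1 : ℝ) : RVec N)) x c =
        if c.1 = a then fderiv ℝ ψ x (EuclideanSpace.single c.2 1) else 0 := by
      intro c
      rw [gradField_apply, fderiv_smul_const (h1.differentiable (by simp) x)]
      simp only [ContinuousLinearMap.smulRight_apply, PiLp.smul_apply, smul_eq_mul,
        PiLp.single_apply]
      split_ifs <;> simp
    simp only
    rw [← inner_sub_left, PiLp.inner_apply, Fintype.sum_prod_type,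
      Finset.sum_eq_single a (fun b _ hb => by simp [hgrad, hb]) (by simp)]
    simp only [hgrad, if_true, Real.inner_eq_mul, hS]
  have hrow : ∀ a, ∑ i, ∫ x in Ω, S (a, i) x * weakGrad Ω φ x (a, i) = 0 := fun a =>
    hΩ.sum_integral_mul_weak_partial_eq_zero (fun i => hSm (a, i)) (fun i => hSb (a, i)) (htest a)
      (memLp_one_iff_integrable.1 (hφ a).1) (fun i => hφc (a, i)) fun i => hφ.hasWeakGrad a i
  rw [← sub_eq_zero, ← integral_sub (hf.integrable_inner_stress hg.1 hφi)
    (integrable_inner_of_ae_norm_le hT₀m hτ hφi)]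
  have e : ∀ x, ⟪stress f (g x), weakGrad Ω φ x⟫ - ⟪T₀ x, weakGrad Ω φ x⟫ =
      ∑ c, S c x * weakGrad Ω φ x c := fun x => by
    rw [← inner_sub_left, PiLp.inner_apply]
    simp only [Real.inner_eq_mul, hS]
  simp only [e]
  rw [integral_finsetSum _ fun c _ => hSi c (hφc c), Fintype.sum_prod_type]
  exact Finset.sum_eq_zero fun a _ => hrow a

theorem IsLinearGrowthDensity.exists_isWeakSolution (hf : IsLinearGrowthDensity f L)
    (hf0 : f 0 = 0) (hn : 1 ≤ n) (hΩ : IsBoundedLipschitzDomain Ω) (hΩsc : IsSimplyConnected Ω)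
    (hT₀ : MemSobolev Ω 2 ⊤ T₀) (hτ : ∀ᵐ x ∂volume.restrict Ω, ‖T₀ x‖ ≤ τ)
    (hτf : τ < recessionSlope f) :
    ∃ u : RVec n → RVec N, IsWeakSolution Ω f T₀ u ∧ (⨍ x in Ω, u x) = 0 := by
  have hΩf : volume Ω ≠ ⊤ := hΩ.isBounded.measure_lt_top.ne
  have hΩ0 : volume Ω ≠ 0 := hΩ.isOpen.measure_ne_zero volume hΩ.isConnected.nonempty
  have : IsFiniteMeasure (volume.restrict Ω) := isFiniteMeasure_restrict.2 hΩf
  obtain ⟨u, g, hu, hg, hug, heq⟩ :=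
    hf.exists_hasWeakGrad_solution hf0 hn hΩ hΩsc hT₀ hτ hτf
  set m : RVec N := ⨍ x in Ω, u x with hm
  have hum : HasWeakGrad Ω (fun x => u x + (-m)) g := fun a i => by
    have := (hug a i).add (hasWeakPartial_const Ω i ((-m) a))
    simp only [add_zero] at this
    exact this
  refine ⟨fun x => u x + (-m), ⟨hum.memSobolev (hu.add (integrable_const _)) hg, fun φ hφ => ?_⟩, ?_⟩
  · rw [← heq φ hφ]
    refine integral_congr_ae ?_
    filter_upwards [hum.weakGrad_ae_eq hΩ.isOpen] with x hx
    rw [hx]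
    rfl
  · have h1 : (volume.real Ω) ≠ 0 := ENNReal.toReal_ne_zero.2 ⟨hΩ0, hΩf⟩
    rw [setAverage_eq, integral_add hu (integrable_const _), smul_add, ← setAverage_eq, ← hm,
      integral_const, measureReal_restrict_apply_univ, smul_smul, inv_mul_cancel₀ h1, one_smul,
      add_neg_cancel]

end Existence

/-! ### The main theorem -/

theorem theorem1p5 {n N : ℕ} (hn : 1 ≤ n) (hN : 1 ≤ N)
    (Ω : Set (RVec n)) (hΩ : IsBoundedLipschitzDomain Ω) (hΩsc : IsSimplyConnected Ω)
    (f : ℝ → ℝ) (hfC2 : ContDiffOn ℝ 2 f (Set.Ici 0)) (hfconv : StrictConvexOn ℝ (Set.Ici 0) f)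
    (hf0 : f 0 = 0) (hf'0 : derivHalfLine f 0 = 0)
    (ν L : ℝ) (hν : 0 < ν) (hνL : ν ≤ L)
    (hgrowth : ∀ t : ℝ, 0 ≤ t → ν * t - L ≤ f t ∧ f t ≤ L * (t + 1))
    (hf'' : ∀ t : ℝ, 0 ≤ t → derivHalfLine₂ f t ≤ L * (1 + t)⁻¹)
    (T₀ : RVec n → RMat N n) (hT₀ : MemSobolev Ω 2 ∞ T₀)
    (hcoer : eLpNorm T₀ ∞ (volume.restrict Ω) < ENNReal.ofReal (recessionSlope f)) :
    (∀ u : RVec n → RVec N, IsWeakSolution Ω f T₀ u ↔ IsEnergyMinimiser Ω f T₀ u) ∧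
    ∃ u : RVec n → RVec N, IsWeakSolution Ω f T₀ u ∧ (⨍ x in Ω, u x) = 0 ∧
      ∀ v : RVec n → RVec N, IsWeakSolution Ω f T₀ v → (⨍ x in Ω, v x) = 0 →
        v =ᵐ[volume.restrict Ω] u := by
  have hf := isLinearGrowthDensity hfC2 hfconv hf'0 hν hνL hgrowth hf''
  have hΩo := hΩ.isOpen
  have hΩf : volume Ω ≠ ⊤ := hΩ.isBounded.measure_lt_top.ne
  have hΩ0 : volume Ω ≠ 0 := hΩo.measure_ne_zero volume hΩ.isConnected.nonempty
  have hT₀m : AEStronglyMeasurable T₀ (volume.restrict Ω) :=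
    (memLp_toLp le_top fun c => (hT₀ c).1).1
  have hτ : ∀ᵐ x ∂volume.restrict Ω, ‖T₀ x‖ ≤ (eLpNorm T₀ ⊤ (volume.restrict Ω)).toReal := by
    filter_upwards [ae_le_eLpNormEssSup (f := T₀) (μ := volume.restrict Ω)] with x hx
    rw [eLpNorm_exponent_top, ← toReal_enorm]
    exact ENNReal.toReal_mono (by simpa using (hcoer.trans ENNReal.ofReal_lt_top).ne) hx
  have hτf := ENNReal.toReal_lt_of_lt_ofReal hcoer
  obtain ⟨u, hu, hu0⟩ := hf.exists_isWeakSolution hf0 hn hΩ hΩsc hT₀ hτ hτf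
  exact ⟨fun u => ⟨fun h => h.isEnergyMinimiser hf hf0 hΩo hT₀m hτ,
    fun h => h.isWeakSolution hf hf0 hΩo hT₀m hτ⟩, u, hu, hu0, fun v hv hv0 =>
    hu.ae_eq hf hΩo hΩ.isConnected.isPreconnected hΩ0 hΩf hT₀m hτ hv hu0 hv0⟩
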